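/- Let $m\geqslant 3$ be an integer. There are real constants $a_0,a_1$ and $\kappa\neq 0$, depending only on $m$, such that the following holds for every $x_+>1$. For $c\in\mathbb R$ and $\mathrm{Re}\,\varepsilon\geqslant 0$ put $$r(\varepsilon)=1+c\,\varepsilon+a_1\varepsilon^{m-2}\ln\varepsilon+a_0\varepsilon^{2m-4}(\ln\varepsilon)^2,\qquad r(0)=1,$$ with the principal branch of the logarithm, and $$\Phi_1(x)=(m-2)^{\frac1{m-2}}\,\Gamma\!\left(\tfrac{m-1}{m-2}\right)\sqrt{x}\,I_{\frac{1}{m-2}}\!\left(\tfrac{2x^{1-m/2}}{m-2}\right),\qquad \Phi_2(x)=\frac{(m-2)^{-\frac1{m-2}}}{\Gamma\!\left(\frac{1}{m-2}\right)}\sqrt{x}\,K_{\frac{1}{m-2}}\!\left(\tfrac{2x^{1-m/2}}{m-2}\right),$$ where $I_\nu,K_\nu$ are the modified Bessel functions. Then there is $c\in\mathbb R$ for which $r$ has no zero in $\{\mathrm{Re}\,\varepsilon\geqslant 0,\ |\varepsilon|\leqslant 1/x_+\}$, and for every such $c$ (in particular for $c=0$, if that $r$ has no zero there) the following is true. There is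 a linear combination $B_1$ of $\Phi_1,\Phi_2$ with real coefficients and $B_1(x)\sim\kappa x$ as $x\to\infty$, such that, whenever $V:\mathbb R\to\mathbb R$ satisfies $V(x)=x^{-m}$ for $x\geqslant x_+$ and $y_+(\cdot\,;\varepsilon)$, $\mathrm{Re}\,\varepsilon>0$, is the solution of $y''=(V+\varepsilon^2)y$ on $[x_+,\infty)$ with $y_+(x;\varepsilon)=e^{-\varepsilon x}(1+o(1))$ as $x\to\infty$, then $$y_+(x;\varepsilon)=r(\varepsilon)\Bigl(\Phi_1(x)+B_1(x)\,\varepsilon^{m-1}\ln\varepsilon+\hat f_a(x;\varepsilon)\Bigr)\qquad (x\geqslant x_+,\ \mathrm{Re}\,\varepsilon>0,\ r(\varepsilon)\neq0),$$ in particular for all $x\geqslant x_+$, $\mathrm{Re}\,\varepsilon>0$, $|\varepsilon|\leqslant 1/x$. Here $\hat f_a$ is $m+1$ times differentiable in $\varepsilon$ at all $(x,\varepsilon)$ in the region $x\geqslant x_+$, $\mathrm{Re}\,\varepsilon>0$, $|\varepsilon|\leqslant 1/x$, and, with suprema over this region, $|\hat f_a(x;\varepsilon)|\leqslant C|\varepsilon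 x|$ and $$\sup_{1\leqslant k\leqslant m-1}\left|x^{-k}\frac{\partial^k\hat f_a(x;\varepsilon)}{\partial\varepsilon^k}\right|<\infty,\qquad \sup_{m\leqslant k\leqslant m+1}|\varepsilon|^{k-m+\delta}x^{-m}\left|\frac{\partial^k\hat f_a(x;\varepsilon)}{\partial\varepsilon^k}\right|<\infty\quad\text{for every }\delta>0.$$ Furthermore the expansion is differentiable in $x$: $\partial_x\hat f_a$ exists in this region (one-sided at $x=x_+$), and $x\,\partial_x\hat f_a(x;\varepsilon)$ is also $m+1$ times differentiable in $\varepsilon$ there and satisfies both supremum bounds. -/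

import Mathlib

open Filter Topology Asymptotics Set

noncomputable section

/-- The modified Bessel function of the first kind `I_ν(z)`, for real `z > 0`. -/
def besselI (ν z : ℝ) : ℝ :=
  ∑' k : ℕ, (z / 2) ^ (2 * (k : ℝ) + ν) / ((k.factorial : ℝ) * Real.Gamma ((k : ℝ) + ν + 1))

/-- The modified Bessel function of the second kind `K_ν(z)`, for real `z > 0`, by its integral
representation (valid for every real order, integers included). -/
def besselK (ν z : ℝ) : ℝ :=
  ∫ t in Ioi (0 : ℝ), Real.exp (-z * Real.cosh t) * Real.cosh (ν * t)

/-- `Φ₁(x) = (m-2)^{1/(m-2)} Γ((m-1)/(m-2)) √x I_{1/(m-2)}(2 x^{1-m/2}/(m-2))`. -/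
def Phi1 (m : ℕ) (x : ℝ) : ℝ :=
  ((m : ℝ) - 2) ^ (1 / ((m : ℝ) - 2)) * Real.Gamma (((m : ℝ) - 1) / ((m : ℝ) - 2)) * √x *
    besselI (1 / ((m : ℝ) - 2)) (2 * x ^ (1 - (m : ℝ) / 2) / ((m : ℝ) - 2))

/-- `Φ₂(x) = (m-2)^{-1/(m-2)} Γ(1/(m-2))⁻¹ √x K_{1/(m-2)}(2 x^{1-m/2}/(m-2))`. -/
def Phi2 (m : ℕ) (x : ℝ) : ℝ :=
  ((m : ℝ) - 2) ^ (-(1 / ((m : ℝ) - 2))) / Real.Gamma (1 / ((m : ℝ) - 2)) * √x *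
    besselK (1 / ((m : ℝ) - 2)) (2 * x ^ (1 - (m : ℝ) / 2) / ((m : ℝ) - 2))

/-- `y` solves `y'' = (V + ε²) y` on `[x₀, ∞)` (one-sided derivatives at `x₀`) and
`y(x) = e^{-εx}(1 + o(1))` as `x → ∞`. -/
def IsDecayingSolution (V : ℝ → ℝ) (x₀ : ℝ) (ε : ℂ) (y : ℝ → ℂ) : Prop :=
  (∃ y' : ℝ → ℂ, ∀ x ∈ Ici x₀,
    HasDerivWithinAt y (y' x) (Ici x₀) x ∧
    HasDerivWithinAt y' (((V x : ℂ) + ε ^ 2) * y x) (Ici x₀) x) ∧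
  Tendsto (fun x : ℝ => Complex.exp (ε * x) * y x) atTop (𝓝 1)

/-- `r(ε) = 1 + c ε + a₁ ε^{m-2} ln ε + a₀ ε^{2m-4} (ln ε)²`, with the principal logarithm. -/
def rFactor (m : ℕ) (a₀ a₁ c : ℝ) (ε : ℂ) : ℂ :=
  1 + c * ε + a₁ * ε ^ (m - 2) * Complex.log ε + a₀ * ε ^ (2 * m - 4) * Complex.log ε ^ 2

/-- `r` has no zero in the closed half disc `Re ε ≥ 0`, `|ε| ≤ 1/x₀`. -/
def NoZeroHalfDisc (r : ℂ → ℂ) (x₀ : ℝ) : Prop :=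
  ∀ ε : ℂ, 0 ≤ ε.re → ‖ε‖ ≤ 1 / x₀ → r ε ≠ 0

/-- On the region `x ≥ x₀`, `Re ε > 0`, `|ε| ≤ 1/x`, the function `g(x, ε)` is `m + 1` times
differentiable in `ε`, and, uniformly there, `|∂_ε^k g| ≲ x^k` for `1 ≤ k ≤ m - 1`, and for every
`δ > 0` also `|∂_ε^k g| ≲_δ |ε|^{m-k-δ} x^m` for `m ≤ k ≤ m + 1`. -/
def EpsDerivBounds (m : ℕ) (x₀ : ℝ) (g : ℝ → ℂ → ℂ) : Prop :=
  (∀ x : ℝ, x₀ ≤ x → ∀ ε : ℂ, 0 < ε.re → ‖ε‖ ≤ 1 / x → ContDiffAt ℂ (m + 1) (g x) ε) ∧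
  (∃ C : ℝ, ∀ k : ℕ, 1 ≤ k → k ≤ m - 1 →
    ∀ x : ℝ, x₀ ≤ x → ∀ ε : ℂ, 0 < ε.re → ‖ε‖ ≤ 1 / x →
      ‖iteratedDeriv k (g x) ε‖ ≤ C * x ^ k) ∧
  (∀ δ : ℝ, 0 < δ → ∃ C : ℝ, ∀ k : ℕ, m ≤ k → k ≤ m + 1 →
    ∀ x : ℝ, x₀ ≤ x → ∀ ε : ℂ, 0 < ε.re → ‖ε‖ ≤ 1 / x →
      ‖iteratedDeriv k (g x) ε‖ ≤ C * ‖ε‖ ^ ((m : ℝ) - (k : ℝ) - δ) * x ^ m)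

end

/-!
Write `m = M + 2`. The zero-energy solutions `Phi1` and `Psi2` (the multiple of `Phi2` whose
Wronskian with `Phi1` is `1`) continue to solutions `pert` of `y'' = (x⁻ᵐ + ε²) y` with the same
Cauchy data at `x = 1`. These are entire in `ε²`, and on `|ε| ≤ 2 / x` they differ from their
values at `ε = 0` by a relative error of order `(εx)²` (`norm_pert_sub_le`). The non-analyticity in
`ε` of the decaying solution is therefore that of its two coefficients in this basis
(`jost_eq_coef`), which are Wronskians, called `coef`.

To locate this non-analyticity, the decaying solution is obtained from the Volterra equation at
infinity, with the integral taken along a rotated ray (`rot`, `cone`). This gives a solution `jost`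
which is holomorphic in `ε` well beyond the half plane `Re ε > 0`, up to and past the negative axis
from above; complex conjugation gives the continuation from below. In the coordinate `w = ln ε`,
the functions `coef` are holomorphic for `|Im w| < 13π/12` and bounded for `Re w ≤ 0`. The
continuations from above and below to `ε = -t` both solve the equation with energy `t²`, so they
differ by a multiple of the decaying solution at `ε = t`: the jump of `coef` across the negative
axis is a Stokes factor times its own value on the positive axis (`coef_jump`). By scaling, the
Stokes factor expands in powers of `t^{m-2}` (`stokes_expansion`). Its leading coefficient is, up
to nonzero factors, the coefficient of `z^{m-1}` in `e^{-2z}`, and so it does not vanish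
(`stokes₁_ne_zero`).

A holomorphic function on the slit disc whose jump across the slit is `O(t^{N-δ})` for every
`δ > 0` is, up to an error of the same order, a polynomial in `ε`; this is Cauchy's formula
(`LogHolomorphic.exists_polynomial`). The jump relation determines the jump of `coef` to an order
`m - 2` higher than `coef` itself is known, and subtracting functions with the same leading jump,
namely multiples of `ε^{m-2} ln ε`, `ε^{m-1} ln ε`, `ε^{2m-4} ln ε` and `ε^{2m-4} (ln ε)²`, one
arrives at an expansion of `coef` to order `m`, in which all logarithmic terms are determined by
the first two Taylor coefficients (`LogHolomorphic.exists_stokesExpansion`). These are found by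
matching `jost` and `pert` at `x = ε^{-2/3}` (`tendsto_coef_Psi2`, `tendsto_coef_Phi1`). Since the
factor `r` carries the logarithmic terms that belong to the constant term of `coef`, the quotient
by `r` is a polynomial plus a single multiple of `ε^{m-1} ln ε` (`stokesExpansion_eq_rLog_mul`). In
the coefficient of `Psi2` this multiple is `2 a₁`, because there the Taylor expansion starts with
`-ε`; this is the constant `κ`.

What remains after removing `Phi1` and the logarithmic term is an entire function of `ε` of size
`O(|ε| x)` and a function of size `O(|ε|^{m-δ} x²)` that is holomorphic near the half disc
`Re ε > 0`, `|ε| ≤ 1 / x`, where `r` is bounded below by compactness. Cauchy's estimate, on discs of radius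
`1 / x` for the first and proportional to `|ε|` for the second, bounds all the derivatives
(`epsDerivBounds_of_split`). The same argument applies to `x` times the derivative in `x`, with the
derivatives of the basis in place of the basis.
-/



/-! ### The zero-energy equation `y'' = x⁻ᵐ y` -/

/-- Coefficients of the solution `∑ dₖ x^{-(m-2)k}` of `y'' = x⁻ᵐ y` that tends to `1` at infinity;
here and below `M = m - 2`. -/
noncomputable def zeroCoeff (M : ℕ) : ℕ → ℝ
  | 0 => 1
  | k + 1 => zeroCoeff M k / ((M * (k + 1)) * (M * (k + 1) + 1))

theorem zeroCoeff_pos {M : ℕ} (hM : 1 ≤ M) (k : ℕ) : 0 < zeroCoeff M k := by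
  have : (0 : ℝ) < M := by exact_mod_cast hM
  induction k with
  | zero => simp [zeroCoeff]
  | succ k ih => simp only [zeroCoeff]; positivity

theorem zeroCoeff_le {M : ℕ} (hM : 1 ≤ M) (k : ℕ) : zeroCoeff M k ≤ 1 / k.factorial := by
  have h1 : (1 : ℝ) ≤ M := by exact_mod_cast hM
  induction k with
  | zero => simp [zeroCoeff]
  | succ k ih =>
    simp only [zeroCoeff, Nat.factorial_succ, Nat.cast_mul, Nat.cast_add, Nat.cast_one]
    rw [mul_comm ((k : ℝ) + 1), ← div_div (1 : ℝ)]
    have h2 : (k : ℝ) + 1 ≤ M * (k + 1) * (M * (k + 1) + 1) := by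
      have : (k : ℝ) + 1 ≤ M * (k + 1) := by nlinarith
      nlinarith [mul_nonneg (le_trans (by positivity : (0:ℝ) ≤ (k:ℝ)+1) this)
        (le_trans (by positivity : (0:ℝ) ≤ (k:ℝ)+1) this)]
    exact div_le_div₀ (by positivity) ih (by positivity) h2

theorem zeroCoeff_eq {M : ℕ} (hM : 1 ≤ M) (k : ℕ) :
    zeroCoeff M k = Real.Gamma (1 / (M : ℝ) + 1) /
      ((M : ℝ) ^ (2 * k) * k.factorial * Real.Gamma ((k : ℝ) + 1 / (M : ℝ) + 1)) := by
  have h1 : (0 : ℝ) < M := by exact_mod_cast hM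
  induction k with
  | zero =>
    have : Real.Gamma (1 / (M : ℝ) + 1) ≠ 0 := (Real.Gamma_pos_of_pos (by positivity)).ne'
    simp only [zeroCoeff, mul_zero, pow_zero, Nat.factorial_zero, Nat.cast_one, Nat.cast_zero,
      zero_add, one_mul]
    rw [div_self this]
  | succ k ih =>
    have hG : Real.Gamma ((k : ℝ) + 1 / (M : ℝ) + 1) ≠ 0 :=
      (Real.Gamma_pos_of_pos (by positivity)).ne'
    have hG' : Real.Gamma (((k + 1 : ℕ) : ℝ) + 1 / (M : ℝ) + 1) =
        ((k : ℝ) + 1 / (M : ℝ) + 1) * Real.Gamma ((k : ℝ) + 1 / (M : ℝ) + 1) := by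
      rw [← Real.Gamma_add_one (by positivity)]
      congr 1; push_cast; ring
    have hpos : (k : ℝ) + 1 / (M : ℝ) + 1 ≠ 0 := by positivity
    have hk : (k.factorial : ℝ) ≠ 0 := by positivity
    rw [zeroCoeff, ih, hG', Nat.factorial_succ]
    have e : (k : ℝ) + 1 / (M : ℝ) + 1 = (M * (k + 1) + 1) / M := by field_simp; ring
    rw [div_div]
    congr 1
    rw [show Real.Gamma ((k : ℝ) + 1 / (M : ℝ) + 1) = Real.Gamma ((k : ℝ) + 1 / (M : ℝ) + 1) from rfl]
    generalize Real.Gamma ((k : ℝ) + 1 / (M : ℝ) + 1) = G at *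
    rw [e]
    push_cast
    field_simp
    ring

theorem Phi1_eq_tsum {M : ℕ} (hM : 1 ≤ M) {x : ℝ} (hx : 0 < x) :
    Phi1 (M + 2) x = ∑' k : ℕ, zeroCoeff M k * (x⁻¹) ^ (M * k) := by
  have h1 : (0 : ℝ) < M := by exact_mod_cast hM
  have e1 : ((M + 2 : ℕ) : ℝ) - 2 = M := by push_cast; ring
  have e2 : (((M + 2 : ℕ) : ℝ) - 1) / M = 1 / (M : ℝ) + 1 := by
    push_cast; field_simp; ring
  unfold Phi1 besselI
  rw [e1, e2, ← tsum_mul_left]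
  refine tsum_congr fun k => ?_
  have hz : 2 * x ^ (1 - ((M + 2 : ℕ) : ℝ) / 2) / (M : ℝ) / 2 = x ^ (-(M : ℝ) / 2) / M := by
    have : 1 - ((M + 2 : ℕ) : ℝ) / 2 = -(M : ℝ) / 2 := by push_cast; ring
    rw [this]; ring
  rw [hz, zeroCoeff_eq hM, Real.div_rpow (by positivity) (by positivity), ← Real.rpow_mul hx.le]
  have e3 : -(M : ℝ) / 2 * (2 * (k : ℝ) + 1 / (M : ℝ)) = -((M * k : ℕ) : ℝ) + -(1 / 2) := by
    push_cast; field_simp; ring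
  have e4 : (2 * (k : ℝ) + 1 / (M : ℝ)) = ((2 * k : ℕ) : ℝ) + 1 / (M : ℝ) := by push_cast; ring
  rw [e3, e4, Real.rpow_add hx, Real.rpow_add h1, Real.rpow_neg hx.le, Real.rpow_neg hx.le,
    Real.rpow_natCast, Real.rpow_natCast, ← Real.sqrt_eq_rpow]
  have hs : √x ≠ 0 := (Real.sqrt_pos.2 hx).ne'
  have hr : (M : ℝ) ^ (1 / (M : ℝ)) ≠ 0 := (Real.rpow_pos_of_pos h1 _).ne'
  have hG : Real.Gamma ((k : ℝ) + 1 / (M : ℝ) + 1) ≠ 0 :=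
    (Real.Gamma_pos_of_pos (by positivity)).ne'
  have hk : (k.factorial : ℝ) ≠ 0 := by positivity
  rw [inv_pow]
  generalize Real.Gamma ((k : ℝ) + 1 / (M : ℝ) + 1) = G at *
  generalize Real.Gamma (1 / (M : ℝ) + 1) = G' at *
  generalize (M : ℝ) ^ (1 / (M : ℝ)) = R at *
  field_simp

/-- The termwise derivative of the series for `Phi1`. -/
noncomputable def dPhi1 (M : ℕ) (x : ℝ) : ℝ :=
  ∑' k : ℕ, -(zeroCoeff M k * (M * k : ℕ) * (x⁻¹) ^ (M * k + 1))

theorem hasDerivAt_inv_pow (n : ℕ) {x : ℝ} (hx : 0 < x) :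
    HasDerivAt (fun y : ℝ => (y⁻¹) ^ n) (-(n * (x⁻¹) ^ (n + 1))) x := by
  have h := ((hasDerivAt_inv hx.ne').pow n)
  refine h.congr_deriv ?_
  rcases n with _ | n
  · simp
  · simp only [Nat.add_sub_cancel]
    rw [pow_succ' (x⁻¹) (n + 1), pow_succ' (x⁻¹) n]; field_simp

theorem sq_le_four_pow (k : ℕ) : ((k : ℝ)) ^ 2 ≤ 4 ^ k := by
  have h : (k : ℝ) ≤ 2 ^ k := by exact_mod_cast Nat.lt_two_pow_self.le
  calc ((k : ℝ)) ^ 2 ≤ (2 ^ k) ^ 2 := by gcongr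
    _ = 4 ^ k := by rw [← pow_mul, mul_comm, pow_mul]; norm_num

theorem zeroCoeff_mul_le {M : ℕ} (hM : 1 ≤ M) (k : ℕ) :
    zeroCoeff M k * ((M * k : ℕ) * (M * k + 1 : ℕ)) ≤ 2 * M ^ 2 * (4 ^ k / k.factorial) := by
  have h1 : (1 : ℝ) ≤ M := by exact_mod_cast hM
  have h2 : ((M * k : ℕ) * (M * k + 1 : ℕ) : ℝ) ≤ 2 * M ^ 2 * 4 ^ k := by
    have := sq_le_four_pow k
    have h3 : (k : ℝ) ≤ k ^ 2 := by
      rcases Nat.eq_zero_or_pos k with h | h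
      · simp [h]
      · have : (1 : ℝ) ≤ k := by exact_mod_cast h
        nlinarith
    push_cast
    have h5 : (M : ℝ) * k ≤ M ^ 2 * k ^ 2 := by
      have : (M : ℝ) ≤ M ^ 2 := by nlinarith
      exact mul_le_mul this h3 (by positivity) (by positivity)
    nlinarith [mul_le_mul_of_nonneg_left this (by positivity : (0 : ℝ) ≤ M ^ 2)]
  calc _ ≤ 1 / (k.factorial : ℝ) * (2 * M ^ 2 * 4 ^ k) := by
        gcongr; exact zeroCoeff_le hM k
    _ = _ := by ring

theorem summable_zero_majorant (c R : ℝ) :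
    Summable fun k : ℕ => c * (4 ^ k / (k.factorial : ℝ)) * R ^ k := by
  have := (Real.summable_pow_div_factorial (4 * R)).mul_left c
  refine this.congr fun k => ?_
  rw [mul_pow]; ring

theorem zeroCoeff_mul_le' {M : ℕ} (hM : 1 ≤ M) (k : ℕ) :
    zeroCoeff M k * (M * k : ℕ) ≤ 2 * M ^ 2 * (4 ^ k / k.factorial) := by
  refine le_trans ?_ (zeroCoeff_mul_le hM k)
  have := zeroCoeff_pos hM k
  gcongr
  have h0 : (0 : ℝ) ≤ (M * k : ℕ) := by positivity
  have : (1 : ℝ) ≤ (M * k + 1 : ℕ) := by exact_mod_cast Nat.le_add_left _ _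
  nlinarith

theorem zeroCoeff_le' {M : ℕ} (hM : 1 ≤ M) (k : ℕ) :
    zeroCoeff M k ≤ 1 * (4 ^ k / k.factorial) := by
  refine (zeroCoeff_le hM k).trans ?_
  rw [one_mul]
  gcongr
  exact one_le_pow₀ (by norm_num)

theorem inv_pow_mul_le {M k j : ℕ} {a x : ℝ} (ha : 0 < a) (hx : a ≤ x) :
    (x⁻¹) ^ (M * k + j) ≤ (a⁻¹) ^ j * ((a⁻¹) ^ M) ^ k := by
  rw [← pow_mul, ← pow_add, add_comm j]
  have : x⁻¹ ≤ a⁻¹ := inv_anti₀ ha hx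
  have : 0 < x := ha.trans_le hx
  gcongr

theorem summable_Phi1 {M : ℕ} (hM : 1 ≤ M) {x : ℝ} (hx : 0 < x) :
    Summable fun k : ℕ => zeroCoeff M k * (x⁻¹) ^ (M * k) := by
  refine Summable.of_nonneg_of_le (fun k => by have := zeroCoeff_pos hM k; positivity) (fun k => ?_)
    (summable_zero_majorant 1 ((x⁻¹) ^ M))
  rw [← pow_mul]
  gcongr
  exact zeroCoeff_le' hM k

theorem summable_dPhi1 {M : ℕ} (hM : 1 ≤ M) {x : ℝ} (hx : 0 < x) :
    Summable fun k : ℕ => zeroCoeff M k * (M * k : ℕ) * (x⁻¹) ^ (M * k + 1) := by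
  refine Summable.of_nonneg_of_le (fun k => by have := zeroCoeff_pos hM k; positivity) (fun k => ?_)
    ((summable_zero_majorant (2 * M ^ 2) ((x⁻¹) ^ M)).mul_left (x⁻¹))
  calc _ ≤ (2 * M ^ 2 * (4 ^ k / k.factorial)) * ((x⁻¹) ^ 1 * ((x⁻¹) ^ M) ^ k) := by
        have := zeroCoeff_pos hM k
        exact mul_le_mul (zeroCoeff_mul_le' hM k) (inv_pow_mul_le hx le_rfl)
              (by positivity) (by positivity)
    _ = _ := by ring

theorem hasDerivAt_Phi1 {M : ℕ} (hM : 1 ≤ M) {x : ℝ} (hx : 0 < x) :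
    HasDerivAt (Phi1 (M + 2)) (dPhi1 M x) x := by
  have hmem : x ∈ Ioi (x / 2) := by simp; linarith
  have h : HasDerivAt (fun z => ∑' k : ℕ, zeroCoeff M k * (z⁻¹) ^ (M * k)) (dPhi1 M x) x := by
    refine hasDerivAt_tsum_of_isPreconnected
      (u := fun k => ((x / 2)⁻¹) * ((2 * M ^ 2) * (4 ^ k / (k.factorial : ℝ)) * (((x / 2)⁻¹) ^ M) ^ k))
      ((summable_zero_majorant _ _).mul_left _) isOpen_Ioi isPreconnected_Ioi
      (g' := fun k y => -(zeroCoeff M k * (M * k : ℕ) * (y⁻¹) ^ (M * k + 1)))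
      (fun k y hy => ?_) (fun k y hy => ?_) hmem (summable_Phi1 hM hx) hmem
    · have hy0 : 0 < y := (by positivity : 0 < x / 2).trans hy
      exact ((hasDerivAt_inv_pow (M * k) hy0).const_mul (zeroCoeff M k)).congr_deriv (by ring)
    · have hy0 : 0 < y := (by positivity : 0 < x / 2).trans hy
      have hp := zeroCoeff_pos hM k
      rw [norm_neg, Real.norm_of_nonneg (by positivity)]
      calc _ ≤ (2 * M ^ 2 * (4 ^ k / k.factorial)) * (((x / 2)⁻¹) ^ 1 * (((x / 2)⁻¹) ^ M) ^ k) := by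
            exact mul_le_mul (zeroCoeff_mul_le' hM k) (inv_pow_mul_le (by positivity) (le_of_lt hy))
              (by positivity) (by positivity)
        _ = _ := by ring
  refine h.congr_of_eventuallyEq ?_
  filter_upwards [lt_mem_nhds hx] with y hy using Phi1_eq_tsum hM hy

theorem hasDerivAt_dPhi1 {M : ℕ} (hM : 1 ≤ M) {x : ℝ} (hx : 0 < x) :
    HasDerivAt (dPhi1 M) (1 / x ^ (M + 2) * Phi1 (M + 2) x) x := by
  have hmem : x ∈ Ioi (x / 2) := by simp; linarith
  have h : HasDerivAt (dPhi1 M)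
      (∑' k : ℕ, zeroCoeff M k * ((M * k : ℕ) * (M * k + 1 : ℕ)) * (x⁻¹) ^ (M * k + 2)) x := by
    refine hasDerivAt_tsum_of_isPreconnected
      (u := fun k => ((x / 2)⁻¹) ^ 2 *
        ((2 * M ^ 2) * (4 ^ k / (k.factorial : ℝ)) * (((x / 2)⁻¹) ^ M) ^ k))
      ((summable_zero_majorant _ _).mul_left _) isOpen_Ioi isPreconnected_Ioi
      (g' := fun k y => zeroCoeff M k * ((M * k : ℕ) * (M * k + 1 : ℕ)) * (y⁻¹) ^ (M * k + 2))
      (fun k y hy => ?_) (fun k y hy => ?_) hmem (summable_dPhi1 hM hx).neg hmem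
    · have hy0 : 0 < y := (by positivity : 0 < x / 2).trans hy
      exact (((hasDerivAt_inv_pow (M * k + 1) hy0).const_mul
        (zeroCoeff M k * (M * k : ℕ))).neg).congr_deriv (by ring)
    · have hy0 : 0 < y := (by positivity : 0 < x / 2).trans hy
      have hp := zeroCoeff_pos hM k
      rw [Real.norm_of_nonneg (by positivity)]
      calc _ ≤ (2 * M ^ 2 * (4 ^ k / k.factorial)) * (((x / 2)⁻¹) ^ 2 * (((x / 2)⁻¹) ^ M) ^ k) := by
            exact mul_le_mul (zeroCoeff_mul_le hM k) (inv_pow_mul_le (by positivity) (le_of_lt hy))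
              (by positivity) (by positivity)
        _ = _ := by ring
  refine h.congr_deriv ?_
  have hs : Summable fun k : ℕ =>
      zeroCoeff M k * ((M * k : ℕ) * (M * k + 1 : ℕ)) * (x⁻¹) ^ (M * k + 2) := by
    refine Summable.of_nonneg_of_le (fun k => by have := zeroCoeff_pos hM k; positivity)
      (fun k => ?_) ((summable_zero_majorant (2 * M ^ 2) ((x⁻¹) ^ M)).mul_left ((x⁻¹) ^ 2))
    calc _ ≤ (2 * M ^ 2 * (4 ^ k / k.factorial)) * ((x⁻¹) ^ 2 * ((x⁻¹) ^ M) ^ k) := by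
          exact mul_le_mul (zeroCoeff_mul_le hM k) (inv_pow_mul_le hx le_rfl)
              (by positivity) (by positivity)
      _ = _ := by ring
  rw [hs.tsum_eq_zero_add, Phi1_eq_tsum hM hx, ← tsum_mul_left]
  simp only [mul_zero, Nat.cast_zero, zero_mul, zero_add]
  refine tsum_congr fun k => ?_
  have h1 : (0 : ℝ) < M := by exact_mod_cast hM
  rw [zeroCoeff]
  push_cast
  have e : (x⁻¹) ^ (M * (k + 1) + 2) = (x⁻¹) ^ (M * k) * (1 / x ^ (M + 2)) := by
    rw [one_div, ← inv_pow, ← pow_add]; ring_nf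
  rw [e]
  field_simp

theorem one_le_Phi1 {M : ℕ} (hM : 1 ≤ M) {x : ℝ} (hx : 0 < x) : 1 ≤ Phi1 (M + 2) x := by
  rw [Phi1_eq_tsum hM hx]
  have := (summable_Phi1 hM hx).le_tsum 0
    (fun k _ => by have := zeroCoeff_pos hM k; positivity)
  simpa [zeroCoeff] using this

theorem Phi1_sub_one_le {M : ℕ} (hM : 1 ≤ M) :
    ∃ K : ℝ, 1 ≤ K ∧ ∀ x : ℝ, 1 ≤ x → |Phi1 (M + 2) x - 1| ≤ K * x⁻¹ ∧
      |dPhi1 M x| ≤ K * (x⁻¹) ^ 2 := by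
  have s1 := summable_zero_majorant (2 * M ^ 2) 1
  simp only [one_pow, mul_one] at s1
  have s0 := summable_zero_majorant 1 1
  simp only [one_pow, mul_one] at s0
  refine ⟨max 1 (max (∑' k : ℕ, 1 * (4 ^ k / (k.factorial : ℝ)))
    (∑' k : ℕ, 2 * (M : ℝ) ^ 2 * (4 ^ k / (k.factorial : ℝ)))), le_max_left _ _, fun x hx => ?_⟩
  have hx0 : 0 < x := by linarith
  have hinv : x⁻¹ ≤ 1 := inv_le_one_of_one_le₀ hx
  constructor
  · have e := (summable_Phi1 hM hx0).tsum_eq_zero_add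
    have hs1 := (summable_nat_add_iff 1).2 (summable_Phi1 hM hx0)
    rw [Phi1_eq_tsum hM hx0, e]
    simp only [zeroCoeff, mul_zero, pow_zero, mul_one, add_sub_cancel_left]
    rw [abs_of_nonneg (tsum_nonneg fun k => by
      have := zeroCoeff_pos hM (k + 1); rw [zeroCoeff] at this; positivity)]
    refine le_trans ?_ (mul_le_mul_of_nonneg_right ((le_max_left _ _).trans (le_max_right _ _))
      (by positivity))
    rw [← tsum_mul_right]
    have s0' := (summable_nat_add_iff 1).2 (s0.mul_right x⁻¹)
    refine le_trans (Summable.tsum_le_tsum (fun k => ?_) hs1 s0') ?_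
    · have := zeroCoeff_pos hM (k + 1)
      have hp : (x⁻¹) ^ (M * (k + 1)) ≤ x⁻¹ := by
        refine pow_le_of_le_one (by positivity) hinv ?_
        have := Nat.mul_pos hM (Nat.succ_pos k); exact this.ne'
      gcongr
      exact zeroCoeff_le' hM (k + 1)
    · rw [(s0.mul_right x⁻¹).tsum_eq_zero_add]
      have : 0 ≤ 1 * ((4 : ℝ) ^ 0 / (Nat.factorial 0 : ℝ)) * x⁻¹ := by positivity
      linarith
  · rw [dPhi1, tsum_neg, abs_neg, abs_of_nonneg (tsum_nonneg fun k => by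
      have := zeroCoeff_pos hM k; positivity)]
    refine le_trans ?_ (mul_le_mul_of_nonneg_right ((le_max_right _ _).trans (le_max_right _ _))
      (by positivity))
    rw [← tsum_mul_right]
    refine Summable.tsum_le_tsum (fun k => ?_) (summable_dPhi1 hM hx0) (s1.mul_right _)
    have := zeroCoeff_pos hM k
    rcases Nat.eq_zero_or_pos k with rfl | hk
    · simp only [mul_zero, Nat.cast_zero, zero_mul]; positivity
    have hp : (x⁻¹) ^ (M * k + 1) ≤ (x⁻¹) ^ 2 := by
      refine pow_le_pow_of_le_one (by positivity) hinv ?_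
      have := Nat.mul_pos hM hk; omega
    exact mul_le_mul (zeroCoeff_mul_le' hM k) hp (by positivity) (by positivity)

/-! ### The second solution: the Bessel function `K` -/

/-- The integrals `∫₀^∞ coshᵏ t e^{-z cosh t} cosh νt dt`, which are, up to sign, the derivatives
of `K_ν`. -/
noncomputable def besselKMoment (ν : ℝ) (k : ℕ) (z : ℝ) : ℝ :=
  ∫ t in Ioi (0 : ℝ), Real.cosh t ^ k * Real.exp (-z * Real.cosh t) * Real.cosh (ν * t)

theorem besselK_integrand_le {ν : ℝ} (hν : 0 ≤ ν) (hν1 : ν ≤ 1) (k : ℕ) {a z t : ℝ} (ha : 0 < a)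
    (hz : a ≤ z) (ht : 0 ≤ t) :
    Real.cosh t ^ k * Real.exp (-z * Real.cosh t) * Real.cosh (ν * t) ≤
      (k + 2).factorial * (2 / a) ^ (k + 2) * Real.exp (-1 * t) := by
  have hc : Real.cosh t ≤ Real.exp t := by
    rw [Real.cosh_eq]
    have : Real.exp (-t) ≤ Real.exp t := Real.exp_le_exp.2 (by linarith)
    linarith
  have hcν : Real.cosh (ν * t) ≤ Real.exp t := by
    refine le_trans (Real.cosh_le_cosh.2 ?_) hc
    rw [abs_of_nonneg (by positivity), abs_of_nonneg ht]
    nlinarith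
  have hc2 : Real.exp t / 2 ≤ Real.cosh t := by
    rw [Real.cosh_eq]
    have : 0 < Real.exp (-t) := Real.exp_pos _
    linarith
  set s := a * Real.exp t / 2 with hs
  have hs0 : 0 < s := by positivity
  have h1 : Real.exp (-z * Real.cosh t) ≤ Real.exp (-s) := by
    apply Real.exp_le_exp.2
    have : a * (Real.exp t / 2) ≤ z * Real.cosh t := by
      apply mul_le_mul hz hc2 (by positivity) (by linarith)
    rw [hs]; linarith
  have h2 : s ^ (k + 2) * Real.exp (-s) ≤ (k + 2).factorial := by
    have := Real.pow_div_factorial_le_exp s hs0.le (k + 2)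
    rw [Real.exp_neg]
    rw [div_le_iff₀ (by positivity)] at this
    rw [← div_eq_mul_inv, div_le_iff₀ (Real.exp_pos _)]
    linarith
  have h3 : Real.exp (-s) ≤ (k + 2).factorial * (2 / a) ^ (k + 2) * (Real.exp (-1 * t)) ^ (k + 2) := by
    have e : (2 / a) ^ (k + 2) * (Real.exp (-1 * t)) ^ (k + 2) = (s ^ (k + 2))⁻¹ := by
      rw [← mul_pow, ← inv_pow]
      congr 1
      rw [hs, neg_one_mul, Real.exp_neg]; field_simp
    rw [mul_assoc, e, ← div_eq_mul_inv, le_div_iff₀ (by positivity)]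
    linarith
  have hc0 := Real.cosh_pos t
  have hcn := Real.cosh_pos (ν * t)
  calc _ ≤ Real.exp t ^ k * ((k + 2).factorial * (2 / a) ^ (k + 2) * (Real.exp (-1 * t)) ^ (k + 2))
        * Real.exp t := by
        gcongr
        exact h1.trans h3
    _ = _ := by
        have e : Real.exp t * Real.exp (-1 * t) = 1 := by rw [← Real.exp_add]; simp
        calc _ = (k + 2).factorial * (2 / a) ^ (k + 2) *
              ((Real.exp t * Real.exp (-1 * t)) ^ (k + 1) * Real.exp (-1 * t)) := by ring
          _ = _ := by rw [e]; ring

theorem continuous_besselK_integrand (ν : ℝ) (k : ℕ) (z : ℝ) : Continuous fun t : ℝ =>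
    Real.cosh t ^ k * Real.exp (-z * Real.cosh t) * Real.cosh (ν * t) := by
  fun_prop

theorem integrableOn_const_mul_exp_neg (C : ℝ) :
    MeasureTheory.IntegrableOn (fun t : ℝ => C * Real.exp (-1 * t)) (Ioi 0) :=
  (exp_neg_integrableOn_Ioi 0 one_pos).const_mul C

theorem integrableOn_besselK {ν : ℝ} (hν : 0 ≤ ν) (hν1 : ν ≤ 1) (k : ℕ) {z : ℝ} (hz : 0 < z) :
    MeasureTheory.IntegrableOn (fun t : ℝ =>
      Real.cosh t ^ k * Real.exp (-z * Real.cosh t) * Real.cosh (ν * t)) (Ioi 0) := by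
  refine MeasureTheory.Integrable.mono' (integrableOn_const_mul_exp_neg
    ((k + 2).factorial * (2 / z) ^ (k + 2)))
    (continuous_besselK_integrand ν k z).aestronglyMeasurable ?_
  filter_upwards [MeasureTheory.ae_restrict_mem measurableSet_Ioi] with t ht
  have := Real.cosh_pos t
  have := Real.cosh_pos (ν * t)
  rw [Real.norm_of_nonneg (by positivity)]
  exact besselK_integrand_le hν hν1 k hz le_rfl (le_of_lt ht)

theorem hasDerivAt_besselKMoment {ν : ℝ} (hν : 0 ≤ ν) (hν1 : ν ≤ 1) (k : ℕ) {z : ℝ} (hz : 0 < z) :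
    HasDerivAt (besselKMoment ν k) (-besselKMoment ν (k + 1) z) z := by
  have h := (hasDerivAt_integral_of_dominated_loc_of_deriv_le
    (μ := MeasureTheory.volume.restrict (Ioi (0 : ℝ))) (x₀ := z) (s := Ioi (z / 2))
    (F := fun z t => Real.cosh t ^ k * Real.exp (-z * Real.cosh t) * Real.cosh (ν * t))
    (F' := fun z t => -(Real.cosh t ^ (k + 1) * Real.exp (-z * Real.cosh t) * Real.cosh (ν * t)))
    (bound := fun t => ((k + 1) + 2).factorial * (2 / (z / 2)) ^ ((k + 1) + 2) * Real.exp (-1 * t))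
    (Ioi_mem_nhds (by linarith)) ?_ (integrableOn_besselK hν hν1 k hz) ?_ ?_
    (integrableOn_const_mul_exp_neg _) ?_).2
  · rw [MeasureTheory.integral_neg] at h
    exact h
  · exact Eventually.of_forall fun y => (continuous_besselK_integrand ν k y).aestronglyMeasurable
  · exact (continuous_besselK_integrand ν (k + 1) z).neg.aestronglyMeasurable
  · filter_upwards [MeasureTheory.ae_restrict_mem measurableSet_Ioi] with t ht y hy
    have := Real.cosh_pos t
    have := Real.cosh_pos (ν * t)
    rw [norm_neg, Real.norm_of_nonneg (by positivity)]
    exact besselK_integrand_le hν hν1 (k + 1) (by positivity) (le_of_lt hy) (le_of_lt ht)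
  · refine Eventually.of_forall fun t y _ => ?_
    have h1 : HasDerivAt (fun y : ℝ => Real.exp (-y * Real.cosh t))
        (Real.exp (-y * Real.cosh t) * (-1 * Real.cosh t)) y :=
      ((hasDerivAt_id y).neg.mul_const (Real.cosh t)).exp
    exact ((h1.const_mul (Real.cosh t ^ k)).mul_const (Real.cosh (ν * t))).congr_deriv (by ring)

/-- The modified Bessel equation, integrated: its left side is the integral of a total
`t`-derivative. -/
theorem besselKMoment_eq {ν : ℝ} (hν : 0 ≤ ν) (hν1 : ν ≤ 1) {z : ℝ} (hz : 0 < z) :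
    z ^ 2 * besselKMoment ν 2 z - z * besselKMoment ν 1 z - (z ^ 2 + ν ^ 2) * besselKMoment ν 0 z
      = 0 := by
  set A : ℝ → ℝ := fun t => -(z * Real.sinh t * Real.exp (-z * Real.cosh t) * Real.cosh (ν * t))
    - ν * Real.exp (-z * Real.cosh t) * Real.sinh (ν * t) with hA
  set A' : ℝ → ℝ := fun t =>
    z ^ 2 * (Real.cosh t ^ 2 * Real.exp (-z * Real.cosh t) * Real.cosh (ν * t))
    - z * (Real.cosh t ^ 1 * Real.exp (-z * Real.cosh t) * Real.cosh (ν * t))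
    - (z ^ 2 + ν ^ 2) * (Real.cosh t ^ 0 * Real.exp (-z * Real.cosh t) * Real.cosh (ν * t)) with hA'
  have i2 := (integrableOn_besselK hν hν1 2 hz).const_mul (z ^ 2)
  have i1 := (integrableOn_besselK hν hν1 1 hz).const_mul z
  have i0 := (integrableOn_besselK hν hν1 0 hz).const_mul (z ^ 2 + ν ^ 2)
  have hder : ∀ t, HasDerivAt A (A' t) t := by
    intro t
    have he : HasDerivAt (fun t : ℝ => Real.exp (-z * Real.cosh t))
        (Real.exp (-z * Real.cosh t) * (-z * Real.sinh t)) t :=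
      ((Real.hasDerivAt_cosh t).const_mul (-z)).exp
    have hν' : HasDerivAt (fun t : ℝ => ν * t) ν t := by simpa using (hasDerivAt_id t).const_mul ν
    have h1 := ((((Real.hasDerivAt_sinh t).const_mul z).mul he).mul hν'.cosh).neg
    have h2 := (he.const_mul ν).mul hν'.sinh
    refine (h1.sub h2).congr_deriv ?_
    simp only [hA', Pi.mul_apply]
    rw [Real.cosh_sq t]; ring
  have hlim : Tendsto A atTop (𝓝 0) := by
    have hb := (Real.tendsto_exp_neg_atTop_nhds_zero.const_mul
      ((z + ν) * ((1 + 2).factorial * (2 / z) ^ (1 + 2))))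
    rw [mul_zero] at hb
    refine squeeze_zero_norm' ?_ hb
    filter_upwards [eventually_ge_atTop 0] with t ht
    have hk := besselK_integrand_le hν hν1 1 hz le_rfl ht
    have c1 := Real.one_le_cosh t
    have s1 : |Real.sinh t| ≤ Real.cosh t := by
      rw [abs_of_nonneg (Real.sinh_nonneg_iff.2 ht)]; exact (Real.sinh_lt_cosh t).le
    have s2 : |Real.sinh (ν * t)| ≤ Real.cosh (ν * t) := by
      rw [abs_of_nonneg (Real.sinh_nonneg_iff.2 (by positivity))]; exact (Real.sinh_lt_cosh _).le
    have cν := Real.cosh_pos (ν * t)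
    have hE := Real.exp_pos (-z * Real.cosh t)
    rw [Real.norm_eq_abs]
    calc |A t| ≤ z * |Real.sinh t| * Real.exp (-z * Real.cosh t) * Real.cosh (ν * t)
          + ν * Real.exp (-z * Real.cosh t) * |Real.sinh (ν * t)| := by
          simp only [hA]
          refine (abs_sub _ _).trans ?_
          rw [abs_neg, abs_mul, abs_mul, abs_mul, abs_mul, abs_mul, abs_of_pos hz, abs_of_pos hE,
            abs_of_pos cν, abs_of_nonneg hν]
      _ ≤ z * Real.cosh t * Real.exp (-z * Real.cosh t) * Real.cosh (ν * t)
          + ν * Real.exp (-z * Real.cosh t) * Real.cosh (ν * t) * Real.cosh t := by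
          refine add_le_add (by gcongr) ?_
          rw [mul_assoc _ (Real.cosh (ν * t))]
          exact mul_le_mul_of_nonneg_left (s2.trans (le_mul_of_one_le_right cν.le c1))
            (by positivity)
      _ = (z + ν) * (Real.cosh t ^ 1 * Real.exp (-z * Real.cosh t) * Real.cosh (ν * t)) := by ring
      _ ≤ (z + ν) * ((1 + 2).factorial * (2 / z) ^ (1 + 2) * Real.exp (-1 * t)) := by gcongr
      _ = _ := by rw [neg_one_mul]; ring
  have hint := MeasureTheory.integral_Ioi_of_hasDerivAt_of_tendsto'
    (fun t _ => hder t) ((i2.sub i1).sub i0) hlim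
  have e : ∫ t in Ioi (0 : ℝ), A' t = z ^ 2 * besselKMoment ν 2 z - z * besselKMoment ν 1 z -
      (z ^ 2 + ν ^ 2) * besselKMoment ν 0 z := by
    simp only [hA']
    have e2 := MeasureTheory.integral_sub (i2.sub i1) i0
    have e1 := MeasureTheory.integral_sub i2 i1
    simp only [Pi.sub_apply] at e2
    rw [e2, e1, MeasureTheory.integral_const_mul, MeasureTheory.integral_const_mul,
      MeasureTheory.integral_const_mul]
    rfl
  rw [← e, hint]
  simp [hA]

theorem besselKMoment_zero (ν z : ℝ) : besselKMoment ν 0 z = besselK ν z := by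
  simp [besselKMoment, besselK]

theorem besselK_pos {ν : ℝ} (hν : 0 ≤ ν) (hν1 : ν ≤ 1) {z : ℝ} (hz : 0 < z) : 0 < besselK ν z := by
  rw [← besselKMoment_zero]
  rw [besselKMoment, MeasureTheory.setIntegral_pos_iff_support_of_nonneg_ae]
  · have : (Function.support fun t : ℝ =>
        Real.cosh t ^ 0 * Real.exp (-z * Real.cosh t) * Real.cosh (ν * t)) = univ := by
      ext t
      have := Real.cosh_pos t
      have := Real.cosh_pos (ν * t)
      simp only [Function.mem_support, mem_univ, iff_true]
      positivity
    rw [this]; simp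
  · refine Eventually.of_forall fun t => ?_
    have := Real.cosh_pos t
    have := Real.cosh_pos (ν * t)
    simp only [Pi.zero_apply]; positivity
  · exact integrableOn_besselK hν hν1 0 hz

theorem besselK_anti {ν : ℝ} (hν : 0 ≤ ν) (hν1 : ν ≤ 1) {z z' : ℝ} (hz : 0 < z) (hzz : z ≤ z') :
    besselK ν z' ≤ besselK ν z := by
  rw [← besselKMoment_zero, ← besselKMoment_zero]
  refine MeasureTheory.integral_mono (integrableOn_besselK hν hν1 0 (hz.trans_le hzz))
    (integrableOn_besselK hν hν1 0 hz) fun t => ?_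
  have := Real.cosh_pos t
  have := Real.cosh_pos (ν * t)
  simp only
  gcongr

/-- The derivative of `Phi2`, in terms of `K_ν` and `K_ν' = -besselKMoment ν 1`. -/
noncomputable def dPhi2 (M : ℕ) (x : ℝ) : ℝ :=
  (M : ℝ) ^ (-(1 / (M : ℝ))) / Real.Gamma (1 / (M : ℝ)) * ((√x)⁻¹ *
    (besselKMoment (1 / M) 0 (2 * x ^ (-(M : ℝ) / 2) / M) / 2 +
      x ^ (-(M : ℝ) / 2) * besselKMoment (1 / M) 1 (2 * x ^ (-(M : ℝ) / 2) / M)))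

theorem Phi2_eq (M : ℕ) (x : ℝ) :
    Phi2 (M + 2) x = (M : ℝ) ^ (-(1 / (M : ℝ))) / Real.Gamma (1 / (M : ℝ)) *
      (√x * besselKMoment (1 / M) 0 (2 * x ^ (-(M : ℝ) / 2) / M)) := by
  have e1 : ((M + 2 : ℕ) : ℝ) - 2 = M := by push_cast; ring
  have e2 : 1 - ((M + 2 : ℕ) : ℝ) / 2 = -(M : ℝ) / 2 := by push_cast; ring
  rw [Phi2, e1, e2, besselKMoment_zero, mul_assoc]

theorem hasDerivAt_besselK_arg {M : ℕ} (hM : 1 ≤ M) (k : ℕ) {x : ℝ} (hx : 0 < x) :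
    HasDerivAt (fun x : ℝ => besselKMoment (1 / M) k (2 * x ^ (-(M : ℝ) / 2) / M))
      (besselKMoment (1 / M) (k + 1) (2 * x ^ (-(M : ℝ) / 2) / M) * (x ^ (-(M : ℝ) / 2) / x)) x := by
  have h1 : (1 : ℝ) ≤ M := by exact_mod_cast hM
  have h0 : (0 : ℝ) < M := by linarith
  have hp : HasDerivAt (fun x : ℝ => 2 * x ^ (-(M : ℝ) / 2) / M)
      (2 * ((-(M : ℝ) / 2) * x ^ (-(M : ℝ) / 2 - 1)) / M) x :=
    ((Real.hasDerivAt_rpow_const (Or.inl hx.ne')).const_mul 2).div_const _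
  have hK := hasDerivAt_besselKMoment (ν := 1 / M) (by positivity)
    (by rw [div_le_one h0]; exact h1) k (z := 2 * x ^ (-(M : ℝ) / 2) / M) (by positivity)
  refine (hK.comp x hp).congr_deriv ?_
  rw [Real.rpow_sub_one hx.ne']
  field_simp

theorem hasDerivAt_Phi2 {M : ℕ} (hM : 1 ≤ M) {x : ℝ} (hx : 0 < x) :
    HasDerivAt (Phi2 (M + 2)) (dPhi2 M x) x := by
  have hs := Real.hasDerivAt_sqrt hx.ne'
  have h := (hs.mul (hasDerivAt_besselK_arg hM 0 hx)).const_mul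
    ((M : ℝ) ^ (-(1 / (M : ℝ))) / Real.Gamma (1 / (M : ℝ)))
  rw [show Phi2 (M + 2) = _ from funext fun x => Phi2_eq M x]
  refine h.congr_deriv ?_
  rw [dPhi2]
  congr 1
  have hs0 : √x ≠ 0 := (Real.sqrt_pos.2 hx).ne'
  have hsq : x = √x * √x := (Real.mul_self_sqrt hx.le).symm
  generalize x ^ (-(M : ℝ) / 2) = X
  generalize besselKMoment (1 / M) 0 (2 * X / M) = K0
  generalize besselKMoment (1 / M) (0 + 1) (2 * X / M) = K1
  generalize √x = r at *
  subst hsq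
  field_simp

theorem hasDerivAt_dPhi2 {M : ℕ} (hM : 1 ≤ M) {x : ℝ} (hx : 0 < x) :
    HasDerivAt (dPhi2 M) (1 / x ^ (M + 2) * Phi2 (M + 2) x) x := by
  have h1 : (1 : ℝ) ≤ M := by exact_mod_cast hM
  have h0 : (0 : ℝ) < M := by linarith
  have hs := (Real.hasDerivAt_sqrt hx.ne').inv (Real.sqrt_pos.2 hx).ne'
  have hp : HasDerivAt (fun x : ℝ => x ^ (-(M : ℝ) / 2))
      ((-(M : ℝ) / 2) * x ^ (-(M : ℝ) / 2 - 1)) x := Real.hasDerivAt_rpow_const (Or.inl hx.ne')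
  have h := (hs.mul (((hasDerivAt_besselK_arg hM 0 hx).div_const 2).add
    (hp.mul (hasDerivAt_besselK_arg hM 1 hx)))).const_mul
    ((M : ℝ) ^ (-(1 / (M : ℝ))) / Real.Gamma (1 / (M : ℝ)))
  refine h.congr_deriv ?_
  have hode := besselKMoment_eq (ν := 1 / M) (by positivity)
    (by rw [div_le_one h0]; exact h1) (z := 2 * x ^ (-(M : ℝ) / 2) / M) (by positivity)
  rw [Phi2_eq, mul_left_comm (1 / x ^ (M + 2))]
  simp only [Pi.mul_apply, Pi.add_apply, Pi.inv_apply]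
  congr 1
  have hs0 : √x ≠ 0 := (Real.sqrt_pos.2 hx).ne'
  have hsq : x = √x * √x := (Real.mul_self_sqrt hx.le).symm
  have hX2 : x ^ (-(M : ℝ) / 2) * x ^ (-(M : ℝ) / 2) = (x ^ M)⁻¹ := by
    rw [← Real.rpow_add hx, ← Real.rpow_natCast, ← Real.rpow_neg hx.le]; congr 1; ring
  have hpow : 1 / x ^ (M + 2) = (x ^ M)⁻¹ * (x * x)⁻¹ := by rw [pow_add, one_div, mul_inv, sq]
  rw [Real.rpow_sub_one hx.ne', hpow, ← hX2]
  have hX0 : 0 < x ^ (-(M : ℝ) / 2) := by positivity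
  clear hX2 hpow h hp hs
  simp only [zero_add, Nat.reduceAdd] at *
  generalize x ^ (-(M : ℝ) / 2) = X at *
  generalize besselKMoment (1 / M) 0 (2 * X / M) = K0 at *
  generalize besselKMoment (1 / M) 1 (2 * X / M) = K1 at *
  generalize besselKMoment (1 / M) 2 (2 * X / M) = K2 at *
  generalize √x = r at *
  subst hsq
  field_simp at hode ⊢
  linear_combination hode

theorem besselK_const_pos {M : ℕ} (hM : 1 ≤ M) :
    0 < (M : ℝ) ^ (-(1 / (M : ℝ))) / Real.Gamma (1 / (M : ℝ)) := by
  have h0 : (0 : ℝ) < M := by exact_mod_cast hM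
  exact div_pos (Real.rpow_pos_of_pos h0 _) (Real.Gamma_pos_of_pos (by positivity))

theorem Phi2_pos {M : ℕ} (hM : 1 ≤ M) {x : ℝ} (hx : 0 < x) : 0 < Phi2 (M + 2) x := by
  have h1 : (1 : ℝ) ≤ M := by exact_mod_cast hM
  have h0 : (0 : ℝ) < M := by linarith
  rw [Phi2_eq, besselKMoment_zero]
  refine mul_pos (besselK_const_pos hM) (mul_pos (Real.sqrt_pos.2 hx)
    (besselK_pos (by positivity) (by rw [div_le_one h0]; exact h1) (by positivity)))

theorem tendsto_Phi2_zero {M : ℕ} (hM : 1 ≤ M) :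
    Tendsto (Phi2 (M + 2)) (𝓝[>] 0) (𝓝 0) := by
  have h1 : (1 : ℝ) ≤ M := by exact_mod_cast hM
  have h0 : (0 : ℝ) < M := by linarith
  set c := (M : ℝ) ^ (-(1 / (M : ℝ))) / Real.Gamma (1 / (M : ℝ)) with hc
  have hcp : 0 < c := besselK_const_pos hM
  have hlim : Tendsto (fun x : ℝ => c * (√x * besselK (1 / M) (2 / M))) (𝓝[>] 0) (𝓝 0) := by
    have : Tendsto (fun x : ℝ => c * (√x * besselK (1 / M) (2 / M))) (𝓝 0)
        (𝓝 (c * (√0 * besselK (1 / M) (2 / M)))) :=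
      ((Real.continuous_sqrt.mul continuous_const).const_mul c).tendsto 0
    simp only [Real.sqrt_zero, zero_mul, mul_zero] at this
    exact this.mono_left nhdsWithin_le_nhds
  refine squeeze_zero' ?_ ?_ hlim
  · filter_upwards [self_mem_nhdsWithin] with x hx using (Phi2_pos hM hx).le
  · filter_upwards [Ioo_mem_nhdsGT (zero_lt_one' ℝ)] with x hx
    rw [Phi2_eq, besselKMoment_zero]
    have : 1 ≤ x ^ (-(M : ℝ) / 2) :=
      Real.one_le_rpow_of_pos_of_le_one_of_nonpos hx.1 hx.2.le (by linarith)
    gcongr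
    refine besselK_anti (by positivity) (by rw [div_le_one h0]; exact h1) (by positivity) ?_
    gcongr
    linarith

/-- A function with zero derivative on `(a, ∞)` is constant there. -/
theorem eq_of_hasDerivAt_zero {E : Type*} [NormedAddCommGroup E] [NormedSpace ℝ E] {f : ℝ → E}
    {a : ℝ} (h : ∀ x, a < x → HasDerivAt f 0 x) {x y : ℝ} (hx : a < x) (hy : a < y) :
    f x = f y := by
  refine isOpen_Ioi.is_const_of_deriv_eq_zero isPreconnected_Ioi
    (fun z hz => (h z hz).differentiableAt.differentiableWithinAt) (fun z hz => (h z hz).deriv) hx hy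

/-- The Wronskian of `Phi1` and `Phi2`. -/
noncomputable def wronskianPhi (M : ℕ) : ℝ :=
  Phi1 (M + 2) 1 * dPhi2 M 1 - dPhi1 M 1 * Phi2 (M + 2) 1

theorem wronskianPhi_eq {M : ℕ} (hM : 1 ≤ M) {x : ℝ} (hx : 0 < x) :
    Phi1 (M + 2) x * dPhi2 M x - dPhi1 M x * Phi2 (M + 2) x = wronskianPhi M := by
  refine eq_of_hasDerivAt_zero (a := 0)
    (f := fun x => Phi1 (M + 2) x * dPhi2 M x - dPhi1 M x * Phi2 (M + 2) x) (fun y hy => ?_) hx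
    one_pos
  refine (((hasDerivAt_Phi1 hM hy).mul (hasDerivAt_dPhi2 hM hy)).sub
    ((hasDerivAt_dPhi1 hM hy).mul (hasDerivAt_Phi2 hM hy))).congr_deriv ?_
  ring

/-- `Phi1` and `Phi2` are independent: at `0⁺` the second tends to `0` while the first stays
above `1`. -/
theorem wronskianPhi_ne_zero {M : ℕ} (hM : 1 ≤ M) : wronskianPhi M ≠ 0 := by
  intro h0
  have hconst : ∀ x : ℝ, 0 < x →
      Phi2 (M + 2) x / Phi1 (M + 2) x = Phi2 (M + 2) 1 / Phi1 (M + 2) 1 := fun x hx => by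
    refine eq_of_hasDerivAt_zero (a := 0) (f := fun x => Phi2 (M + 2) x / Phi1 (M + 2) x)
      (fun y hy => ?_) hx one_pos
    have hne : Phi1 (M + 2) y ≠ 0 := (zero_lt_one.trans_le (one_le_Phi1 hM hy)).ne'
    refine ((hasDerivAt_Phi2 hM hy).div (hasDerivAt_Phi1 hM hy) hne).congr_deriv ?_
    have := wronskianPhi_eq hM hy
    rw [h0] at this
    rw [div_eq_zero_iff]; left; linarith
  set c := Phi2 (M + 2) 1 / Phi1 (M + 2) 1 with hc
  have hcp : 0 < c := div_pos (Phi2_pos hM one_pos)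
    (zero_lt_one.trans_le (one_le_Phi1 hM one_pos))
  have hge : ∀ᶠ x in 𝓝[>] (0 : ℝ), c ≤ Phi2 (M + 2) x := by
    filter_upwards [self_mem_nhdsWithin] with x hx
    have h1 := one_le_Phi1 hM hx
    have := hconst x hx
    rw [div_eq_iff (by linarith)] at this
    rw [this]
    nlinarith
  have := ge_of_tendsto (tendsto_Phi2_zero hM) hge
  linarith

/-- The multiple of `Phi2` whose Wronskian with `Phi1` is `1`. -/
noncomputable def Psi2 (M : ℕ) (x : ℝ) : ℝ := Phi2 (M + 2) x / wronskianPhi M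

/-- The derivative of `Psi2`. -/
noncomputable def dPsi2 (M : ℕ) (x : ℝ) : ℝ := dPhi2 M x / wronskianPhi M

theorem hasDerivAt_Psi2 {M : ℕ} (hM : 1 ≤ M) {x : ℝ} (hx : 0 < x) :
    HasDerivAt (Psi2 M) (dPsi2 M x) x := (hasDerivAt_Phi2 hM hx).div_const _

theorem hasDerivAt_dPsi2 {M : ℕ} (hM : 1 ≤ M) {x : ℝ} (hx : 0 < x) :
    HasDerivAt (dPsi2 M) (1 / x ^ (M + 2) * Psi2 M x) x :=
  ((hasDerivAt_dPhi2 hM hx).div_const _).congr_deriv (by rw [Psi2]; ring)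

theorem wronskian_Phi1_Psi2 {M : ℕ} (hM : 1 ≤ M) {x : ℝ} (hx : 0 < x) :
    Phi1 (M + 2) x * dPsi2 M x - dPhi1 M x * Psi2 M x = 1 := by
  rw [dPsi2, Psi2, mul_div_assoc', mul_div_assoc', ← sub_div, wronskianPhi_eq hM hx,
    div_self (wronskianPhi_ne_zero hM)]

theorem hasDerivAt_Psi2_div_Phi1 {M : ℕ} (hM : 1 ≤ M) {x : ℝ} (hx : 0 < x) :
    HasDerivAt (fun x => Psi2 M x / Phi1 (M + 2) x) (1 / Phi1 (M + 2) x ^ 2) x := by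
  have hne : Phi1 (M + 2) x ≠ 0 := (zero_lt_one.trans_le (one_le_Phi1 hM hx)).ne'
  refine ((hasDerivAt_Psi2 hM hx).div (hasDerivAt_Phi1 hM hx) hne).congr_deriv ?_
  congr 1
  linarith [wronskian_Phi1_Psi2 hM hx]

theorem tendsto_Phi1_atTop {M : ℕ} (hM : 1 ≤ M) :
    Tendsto (Phi1 (M + 2)) atTop (𝓝 1) := by
  obtain ⟨K, hK, hb⟩ := Phi1_sub_one_le hM
  rw [tendsto_iff_norm_sub_tendsto_zero]
  have : Tendsto (fun x : ℝ => K * x⁻¹) atTop (𝓝 0) := by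
    simpa using tendsto_inv_atTop_zero.const_mul K
  refine squeeze_zero' (Eventually.of_forall fun _ => norm_nonneg _) ?_ this
  filter_upwards [eventually_ge_atTop 1] with x hx using (hb x hx).1

/-- The quotient `Psi2 / Phi1` has derivative `1 / Phi1²`, which is at most `1` and differs from `1`
by `O(1/x)`. -/
theorem Psi2_div_Phi1_bounds {M : ℕ} (hM : 1 ≤ M) :
    ∃ K D : ℝ, 1 ≤ K ∧ 1 ≤ D ∧ ∀ x : ℝ, 1 ≤ x →
      Psi2 M x / Phi1 (M + 2) x ≤ x + D ∧
      x - K * Real.log x - D ≤ Psi2 M x / Phi1 (M + 2) x := by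
  obtain ⟨K, hK, hb⟩ := Phi1_sub_one_le hM
  set u : ℝ → ℝ := fun x => Psi2 M x / Phi1 (M + 2) x with hu
  refine ⟨2 * K, 1 + |u 1|, by linarith, by linarith [abs_nonneg (u 1)], fun x hx => ⟨?_, ?_⟩⟩
  · have hanti : AntitoneOn (fun x => u x - x) (Ici 1) := by
      refine antitoneOn_of_deriv_nonpos (convex_Ici 1) ?_ ?_ ?_
      · intro y hy
        exact ((hasDerivAt_Psi2_div_Phi1 hM (zero_lt_one.trans_le hy)).sub
          (hasDerivAt_id y)).continuousAt.continuousWithinAt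
      · intro y hy
        rw [interior_Ici] at hy
        exact ((hasDerivAt_Psi2_div_Phi1 hM (zero_lt_one.trans hy)).sub
          (hasDerivAt_id y)).differentiableAt.differentiableWithinAt
      · intro y hy
        rw [interior_Ici] at hy
        have hy0 : 0 < y := zero_lt_one.trans hy
        have := ((hasDerivAt_Psi2_div_Phi1 hM hy0).sub (hasDerivAt_id y)).deriv
        erw [this]
        have h1 := one_le_Phi1 hM hy0
        have : 1 / Phi1 (M + 2) y ^ 2 ≤ 1 := by
          rw [div_le_one (by positivity)]; nlinarith
        linarith
    have := hanti (mem_Ici.2 le_rfl) (mem_Ici.2 hx) hx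
    simp only at this
    linarith [le_abs_self (u 1)]
  · have hmono : MonotoneOn (fun x => u x - (x - 2 * K * Real.log x)) (Ici 1) := by
      have hd : ∀ y : ℝ, 0 < y → HasDerivAt (fun x => u x - (x - 2 * K * Real.log x))
          (1 / Phi1 (M + 2) y ^ 2 - (1 - 2 * K * y⁻¹)) y := fun y hy =>
        (hasDerivAt_Psi2_div_Phi1 hM hy).sub
          ((hasDerivAt_id y).sub ((Real.hasDerivAt_log hy.ne').const_mul (2 * K)))
      refine monotoneOn_of_deriv_nonneg (convex_Ici 1) ?_ ?_ ?_
      · intro y hy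
        exact (hd y (zero_lt_one.trans_le hy)).continuousAt.continuousWithinAt
      · intro y hy
        rw [interior_Ici] at hy
        exact (hd y (zero_lt_one.trans hy)).differentiableAt.differentiableWithinAt
      · intro y hy
        rw [interior_Ici] at hy
        have hy0 : 0 < y := zero_lt_one.trans hy
        rw [(hd y hy0).deriv]
        have h1 := one_le_Phi1 hM hy0
        have h2 := (abs_le.1 (hb y (le_of_lt hy)).1).2
        have h3 : 0 < K * y⁻¹ := by positivity
        have h4 : 1 - 2 * (K * y⁻¹) ≤ 1 / Phi1 (M + 2) y ^ 2 := by
          rw [le_div_iff₀ (by positivity)]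
          have : Phi1 (M + 2) y ^ 2 ≤ (1 + K * y⁻¹) ^ 2 := by
            apply pow_le_pow_left₀ (by linarith); linarith
          by_cases hneg : 1 - 2 * (K * y⁻¹) ≤ 0
          · nlinarith [sq_nonneg (Phi1 (M + 2) y)]
          · push Not at hneg
            nlinarith [mul_le_mul_of_nonneg_left this hneg.le, mul_pos h3 h3,
              mul_pos h3 (mul_pos h3 h3)]
        linarith
    have := hmono (mem_Ici.2 le_rfl) (mem_Ici.2 hx) hx
    simp only [Real.log_one] at this
    linarith [neg_abs_le (u 1)]

theorem Psi2_isEquivalent {M : ℕ} (hM : 1 ≤ M) :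
    Tendsto (fun x => Psi2 M x / x) atTop (𝓝 1) := by
  obtain ⟨K, D, hK, hD, hb⟩ := Psi2_div_Phi1_bounds hM
  have hinv : Tendsto (fun x : ℝ => D * x⁻¹) atTop (𝓝 0) := by
    simpa using tendsto_inv_atTop_zero.const_mul D
  have hlog : Tendsto (fun x : ℝ => K * (Real.log x / x)) atTop (𝓝 0) := by
    have := Real.tendsto_pow_log_div_mul_add_atTop 1 0 1 one_ne_zero
    simpa using this.const_mul K
  have hu : Tendsto (fun x => Psi2 M x / Phi1 (M + 2) x / x) atTop (𝓝 1) := by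
    refine tendsto_of_tendsto_of_tendsto_of_le_of_le'
      (g := fun x : ℝ => 1 - K * (Real.log x / x) - D * x⁻¹) (h := fun x : ℝ => 1 + D * x⁻¹) ?_ ?_ ?_ ?_
    · simpa using (tendsto_const_nhds.sub hlog).sub hinv
    · simpa using tendsto_const_nhds.add hinv
    · filter_upwards [eventually_ge_atTop 1] with x hx
      have hx0 : 0 < x := by linarith
      rw [le_div_iff₀ hx0]
      refine le_trans (le_of_eq ?_) (hb x hx).2
      field_simp
    · filter_upwards [eventually_ge_atTop 1] with x hx
      have hx0 : 0 < x := by linarith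
      rw [div_le_iff₀ hx0]
      refine (hb x hx).1.trans (le_of_eq ?_)
      field_simp
  have := hu.mul (tendsto_Phi1_atTop hM)
  rw [mul_one] at this
  refine this.congr' ?_
  filter_upwards [eventually_gt_atTop 0] with x hx
  have : Phi1 (M + 2) x ≠ 0 := (zero_lt_one.trans_le (one_le_Phi1 hM hx)).ne'
  field_simp

/-- Size of the zero-energy solutions and their derivatives on `[1, ∞)`. -/
theorem zero_energy_bounds {M : ℕ} (hM : 1 ≤ M) :
    ∃ K : ℝ, 1 ≤ K ∧ ∀ x : ℝ, 1 ≤ x → |Phi1 (M + 2) x| ≤ K ∧ |dPhi1 M x| ≤ K * (x⁻¹) ^ 2 ∧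
      |Psi2 M x| ≤ K * x ∧ |dPsi2 M x| ≤ K ∧ |Phi1 (M + 2) x - 1| ≤ K * x⁻¹ ∧
      |dPsi2 M x - 1| ≤ K * x⁻¹ := by
  obtain ⟨K, hK, hb⟩ := Phi1_sub_one_le hM
  obtain ⟨K', D, hK', hD, hb'⟩ := Psi2_div_Phi1_bounds hM
  set L := 1 + K' + D with hL
  have hu : ∀ x : ℝ, 1 ≤ x → |Psi2 M x / Phi1 (M + 2) x| ≤ L * x := by
    intro x hx
    obtain ⟨h1, h2⟩ := hb' x hx
    have hlog : Real.log x ≤ x := (Real.log_le_sub_one_of_pos (by linarith)).trans (by linarith)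
    have hlog0 : 0 ≤ Real.log x := Real.log_nonneg hx
    rw [abs_le]
    constructor
    · nlinarith
    · nlinarith
  have hL1 : 1 ≤ L := by linarith
  have key : ∀ x : ℝ, 1 ≤ x → |Phi1 (M + 2) x| ≤ 2 * K ∧ |Psi2 M x| ≤ 2 * K * L * x ∧
      |dPsi2 M x - 1| ≤ 2 * K * L * x⁻¹ := by
    intro x hx
    have hx0 : 0 < x := by linarith
    have hi : x⁻¹ ≤ 1 := inv_le_one_of_one_le₀ hx
    have hi0 : 0 < x⁻¹ := by positivity
    have h1 := one_le_Phi1 hM hx0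
    obtain ⟨h2, h3⟩ := hb x hx
    have h2' := (abs_le.1 h2).2
    have hP : |Phi1 (M + 2) x| ≤ 2 * K := by
      rw [abs_of_nonneg (by linarith)]; nlinarith
    refine ⟨hP, ?_, ?_⟩
    · have e : Psi2 M x = Phi1 (M + 2) x * (Psi2 M x / Phi1 (M + 2) x) := by
        field_simp
      rw [e, abs_mul]
      calc _ ≤ 2 * K * (L * x) := by gcongr; exact hu x hx
        _ = _ := by ring
    · have e : dPsi2 M x - 1 = dPhi1 M x * (Psi2 M x / Phi1 (M + 2) x)
          - (Phi1 (M + 2) x - 1) / Phi1 (M + 2) x := by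
        have := wronskian_Phi1_Psi2 hM hx0
        field_simp
        linarith
      rw [e]
      refine (abs_sub _ _).trans ?_
      rw [abs_mul, abs_div (Phi1 (M + 2) x - 1)]
      have : |Phi1 (M + 2) x - 1| / |Phi1 (M + 2) x| ≤ K * x⁻¹ := by
        refine (div_le_self (abs_nonneg _) ?_).trans h2
        rwa [abs_of_nonneg (by linarith)]
      have h4 : |dPhi1 M x| * |Psi2 M x / Phi1 (M + 2) x| ≤ K * (x⁻¹) ^ 2 * (L * x) := by
        gcongr; exact hu x hx
      have h5 : K * (x⁻¹) ^ 2 * (L * x) = K * L * x⁻¹ := by field_simp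
      rw [h5] at h4
      have : K * x⁻¹ ≤ K * L * x⁻¹ := by
        gcongr; nlinarith
      linarith
  refine ⟨1 + 2 * K * L, by nlinarith, fun x hx => ?_⟩
  have hx0 : 0 < x := by linarith
  have hi : x⁻¹ ≤ 1 := inv_le_one_of_one_le₀ hx
  have hi0 : 0 < x⁻¹ := by positivity
  obtain ⟨k1, k2, k3⟩ := key x hx
  obtain ⟨h2, h3⟩ := hb x hx
  have hKL : K ≤ K * L := by nlinarith
  refine ⟨by nlinarith, h3.trans ?_, k2.trans ?_, ?_, h2.trans ?_, k3.trans ?_⟩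
  · gcongr; nlinarith
  · gcongr; linarith
  · have : |dPsi2 M x| ≤ |dPsi2 M x - 1| + 1 := by
      have := abs_add_le (dPsi2 M x - 1) 1
      simpa using this
    nlinarith [mul_pos (by linarith : 0 < K) (by linarith : 0 < L)]
  · gcongr; nlinarith
  · gcongr; linarith

/-! ### Series with exponential majorant -/

theorem hasSum_pow_div_factorial (q : ℝ) :
    HasSum (fun j : ℕ => q ^ j / (j.factorial : ℝ)) (Real.exp q) := by
  rw [Real.exp_eq_exp_ℝ]
  exact NormedSpace.expSeries_div_hasSum_exp q

theorem summable_of_exp_majorant {E : Type*} [NormedAddCommGroup E] [CompleteSpace E] {a : ℕ → E}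
    {C q : ℝ} (h : ∀ j, ‖a j‖ ≤ C * (q ^ j / j.factorial)) : Summable a :=
  Summable.of_norm_bounded ((hasSum_pow_div_factorial q).summable.mul_left C) h

theorem norm_tsum_sub_le_of_exp_majorant {E : Type*} [NormedAddCommGroup E] [CompleteSpace E]
    {a : ℕ → E} {C q : ℝ} (hC : 0 ≤ C) (hq : 0 ≤ q) (N : ℕ)
    (h : ∀ j, ‖a j‖ ≤ C * (q ^ j / j.factorial)) :
    ‖∑' j, a j - ∑ j ∈ Finset.range N, a j‖ ≤ C * q ^ N * Real.exp q := by
  have hs := summable_of_exp_majorant h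
  rw [← hs.sum_add_tsum_nat_add N, add_sub_cancel_left]
  refine tsum_of_norm_bounded ((hasSum_pow_div_factorial q).mul_left (C * q ^ N)) fun j => ?_
  refine (h (j + N)).trans ?_
  rw [mul_assoc C, mul_div_assoc' (q ^ N), ← pow_add, add_comm N j]
  gcongr
  omega

theorem norm_tsum_le_of_exp_majorant {E : Type*} [NormedAddCommGroup E] [CompleteSpace E]
    {a : ℕ → E} {C q : ℝ} (h : ∀ j, ‖a j‖ ≤ C * (q ^ j / j.factorial)) :
    ‖∑' j, a j‖ ≤ C * Real.exp q :=
  tsum_of_norm_bounded ((hasSum_pow_div_factorial q).mul_left C) h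

/-! ### Solutions at small energy, analytic in `ε²` -/

/-- `K` dominates the zero-energy solutions and their derivatives on `[1, ∞)`. -/
structure ZeroEnergyBound (M : ℕ) (K : ℝ) : Prop where
  one_le : 1 ≤ K
  Phi1_le : ∀ x : ℝ, 1 ≤ x → |Phi1 (M + 2) x| ≤ K
  dPhi1_le : ∀ x : ℝ, 1 ≤ x → |dPhi1 M x| ≤ K * (x⁻¹) ^ 2
  Psi2_le : ∀ x : ℝ, 1 ≤ x → |Psi2 M x| ≤ K * x
  dPsi2_le : ∀ x : ℝ, 1 ≤ x → |dPsi2 M x| ≤ K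

/-- `Ψ` solves the zero-energy equation on `(0, ∞)` with derivative `dΨ`, and is `O(xⁱ)` together
with `x dΨ`. -/
structure ZeroEnergySolution (M i : ℕ) (K : ℝ) (Ψ dΨ : ℝ → ℝ) : Prop where
  deriv : ∀ x : ℝ, 0 < x → HasDerivAt Ψ (dΨ x) x
  deriv2 : ∀ x : ℝ, 0 < x → HasDerivAt dΨ (1 / x ^ (M + 2) * Ψ x) x
  le : ∀ x : ℝ, 1 ≤ x → |Ψ x| ≤ K * x ^ i
  dle : ∀ x : ℝ, 1 ≤ x → x * |dΨ x| ≤ K * x ^ i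

theorem zeroEnergySolution_Phi1 {M : ℕ} (hM : 1 ≤ M) {K : ℝ} (hK : ZeroEnergyBound M K) :
    ZeroEnergySolution M 0 K (Phi1 (M + 2)) (dPhi1 M) where
  deriv _ hx := hasDerivAt_Phi1 hM hx
  deriv2 _ hx := hasDerivAt_dPhi1 hM hx
  le x hx := by simpa using hK.Phi1_le x hx
  dle x hx := by
    have hx0 : 0 < x := by linarith
    have := mul_le_mul_of_nonneg_left (hK.dPhi1_le x hx) hx0.le
    have e : x * (K * (x⁻¹) ^ 2) = K * x⁻¹ := by field_simp
    rw [e] at this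
    have hi : x⁻¹ ≤ 1 := inv_le_one_of_one_le₀ hx
    have := hK.one_le
    rw [pow_zero]; nlinarith

theorem zeroEnergySolution_Psi2 {M : ℕ} (hM : 1 ≤ M) {K : ℝ} (hK : ZeroEnergyBound M K) :
    ZeroEnergySolution M 1 K (Psi2 M) (dPsi2 M) where
  deriv _ hx := hasDerivAt_Psi2 hM hx
  deriv2 _ hx := hasDerivAt_dPsi2 hM hx
  le x hx := by simpa using hK.Psi2_le x hx
  dle x hx := by
    have hx0 : 0 < x := by linarith
    have := mul_le_mul_of_nonneg_left (hK.dPsi2_le x hx) hx0.le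
    rw [pow_one]; linarith

/-- Coefficients in powers of `ε²` of the solution of `y'' = (x⁻ᵐ + ε²) y` with the same Cauchy
data at `x = 1` as `Ψ`. -/
noncomputable def pertCoeff (M : ℕ) (Ψ : ℝ → ℝ) : ℕ → ℝ → ℝ
  | 0 => Ψ
  | j + 1 => fun x => Psi2 M x * (∫ t in (1 : ℝ)..x, Phi1 (M + 2) t * pertCoeff M Ψ j t) -
      Phi1 (M + 2) x * ∫ t in (1 : ℝ)..x, Psi2 M t * pertCoeff M Ψ j t

/-- The `x`-derivatives of `pertCoeff`. -/
noncomputable def dpertCoeff (M : ℕ) (Ψ dΨ : ℝ → ℝ) : ℕ → ℝ → ℝ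
  | 0 => dΨ
  | j + 1 => fun x => dPsi2 M x * (∫ t in (1 : ℝ)..x, Phi1 (M + 2) t * pertCoeff M Ψ j t) -
      dPhi1 M x * ∫ t in (1 : ℝ)..x, Psi2 M t * pertCoeff M Ψ j t

section
variable {M i : ℕ} {K : ℝ} {Ψ dΨ : ℝ → ℝ}

theorem continuousOn_of_hasDerivAt_pos {f f' : ℝ → ℝ} (h : ∀ x : ℝ, 0 < x → HasDerivAt f (f' x) x) :
    ContinuousOn f (Ioi 0) := fun x hx => (h x hx).continuousAt.continuousWithinAt

theorem hasDerivAt_integral_of_continuousOn_Ioi {f : ℝ → ℝ} (hf : ContinuousOn f (Ioi 0)) {x : ℝ}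
    (hx : 0 < x) : HasDerivAt (fun x => ∫ t in (1 : ℝ)..x, f t) (f x) x := by
  refine intervalIntegral.integral_hasDerivAt_right ?_ ?_ (hf.continuousAt (Ioi_mem_nhds hx))
  · refine (hf.mono ?_).intervalIntegrable
    intro t ht
    exact (lt_min one_pos hx).trans_le ht.1
  · exact hf.stronglyMeasurableAtFilter isOpen_Ioi x hx

theorem hasDerivAt_pertCoeff (hM : 1 ≤ M) (hΨ : ZeroEnergySolution M i K Ψ dΨ) (j : ℕ) :
    ∀ x : ℝ, 0 < x → HasDerivAt (pertCoeff M Ψ j) (dpertCoeff M Ψ dΨ j x) x := by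
  induction j with
  | zero => exact hΨ.deriv
  | succ j ih =>
    intro x hx
    have c0 := continuousOn_of_hasDerivAt_pos ih
    have c1 := continuousOn_of_hasDerivAt_pos fun x hx => hasDerivAt_Phi1 hM hx
    have c2 := continuousOn_of_hasDerivAt_pos fun x hx => hasDerivAt_Psi2 hM hx
    have h := ((hasDerivAt_Psi2 hM hx).mul
      (hasDerivAt_integral_of_continuousOn_Ioi (c1.mul c0) hx)).sub
      ((hasDerivAt_Phi1 hM hx).mul (hasDerivAt_integral_of_continuousOn_Ioi (c2.mul c0) hx))
    refine h.congr_deriv ?_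
    simp only [dpertCoeff, Pi.mul_apply]
    ring

/-- The coefficient preceding the `j`-th one, with `0` before the first. -/
noncomputable def prevCoeff (M : ℕ) (Ψ : ℝ → ℝ) : ℕ → ℝ → ℝ
  | 0 => 0
  | j + 1 => pertCoeff M Ψ j

theorem hasDerivAt_dpertCoeff (hM : 1 ≤ M) (hΨ : ZeroEnergySolution M i K Ψ dΨ) (j : ℕ) (x : ℝ)
    (hx : 0 < x) : HasDerivAt (dpertCoeff M Ψ dΨ j)
      (1 / x ^ (M + 2) * pertCoeff M Ψ j x + prevCoeff M Ψ j x) x := by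
  cases j with
  | zero => simpa [prevCoeff, pertCoeff, dpertCoeff] using hΨ.deriv2 x hx
  | succ j =>
    have c0 := continuousOn_of_hasDerivAt_pos (hasDerivAt_pertCoeff hM hΨ j)
    have c1 := continuousOn_of_hasDerivAt_pos fun x hx => hasDerivAt_Phi1 hM hx
    have c2 := continuousOn_of_hasDerivAt_pos fun x hx => hasDerivAt_Psi2 hM hx
    have h := ((hasDerivAt_dPsi2 hM hx).mul
      (hasDerivAt_integral_of_continuousOn_Ioi (c1.mul c0) hx)).sub
      ((hasDerivAt_dPhi1 hM hx).mul (hasDerivAt_integral_of_continuousOn_Ioi (c2.mul c0) hx))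
    refine h.congr_deriv ?_
    simp only [pertCoeff, prevCoeff, Pi.mul_apply]
    linear_combination pertCoeff M Ψ j x * wronskian_Phi1_Psi2 hM hx

theorem abs_integral_le_of_le_pow {f : ℝ → ℝ} {b x : ℝ} {n : ℕ} (hx : 1 ≤ x) (hb : 0 ≤ b)
    (h : ∀ t : ℝ, 1 ≤ t → |f t| ≤ b * t ^ n) :
    |∫ t in (1 : ℝ)..x, f t| ≤ b * (x ^ (n + 1) / (n + 1)) := by
  have h1 : ‖∫ t in (1 : ℝ)..x, f t‖ ≤ ∫ t in (1 : ℝ)..x, b * t ^ n := by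
    refine intervalIntegral.norm_integral_le_of_norm_le hx ?_ ?_
    · exact Eventually.of_forall fun t ht => h t ht.1.le
    · exact (continuous_const.mul (continuous_pow n)).intervalIntegrable _ _
  refine h1.trans ?_
  rw [intervalIntegral.integral_const_mul, integral_pow]
  gcongr
  simp

/-- Passing to the next coefficient gains the factor `x²/(j+1)`, from `Psi2` and the integration of
a power of at least `2j`: hence the factorial decay. -/
theorem pertCoeff_le (hK : ZeroEnergyBound M K) (hΨ : ZeroEnergySolution M i K Ψ dΨ) (j : ℕ) :
    ∀ x : ℝ, 1 ≤ x →
      |pertCoeff M Ψ j x| ≤ K * x ^ i * ((2 * K ^ 2 * x ^ 2) ^ j / j.factorial) ∧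
      x * |dpertCoeff M Ψ dΨ j x| ≤ K * x ^ i * ((2 * K ^ 2 * x ^ 2) ^ j / j.factorial) := by
  have hK0 : 0 < K := by linarith [hK.one_le]
  induction j with
  | zero =>
    intro x hx
    simpa [pertCoeff, dpertCoeff] using ⟨hΨ.le x hx, hΨ.dle x hx⟩
  | succ j ih =>
    intro x hx
    have hx0 : 0 < x := by linarith
    set b := K * (2 * K ^ 2) ^ j / j.factorial with hb
    have hb0 : 0 < b := by positivity
    have hbt : ∀ t : ℝ, 1 ≤ t → |pertCoeff M Ψ j t| ≤ b * t ^ (2 * j + i) := by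
      intro t ht
      refine ((ih t ht).1).trans (le_of_eq ?_)
      rw [hb, mul_pow (2 * K ^ 2), ← pow_mul, pow_add]; ring
    have I1 : |∫ t in (1 : ℝ)..x, Phi1 (M + 2) t * pertCoeff M Ψ j t| ≤
        K * b * (x ^ (2 * j + i + 1) / (j + 1)) := by
      refine (abs_integral_le_of_le_pow (n := 2 * j + i) (b := K * b) hx (by positivity)
        fun t ht => ?_).trans ?_
      · rw [abs_mul, mul_assoc]
        exact mul_le_mul (hK.Phi1_le t ht) (hbt t ht) (abs_nonneg _) hK0.le
      · gcongr
        linarith [(Nat.cast_nonneg j : (0 : ℝ) ≤ j), (Nat.cast_nonneg i : (0 : ℝ) ≤ i)]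
    have I2 : |∫ t in (1 : ℝ)..x, Psi2 M t * pertCoeff M Ψ j t| ≤
        K * b * (x ^ (2 * j + i + 1 + 1) / (j + 1)) := by
      refine (abs_integral_le_of_le_pow (n := 2 * j + i + 1) (b := K * b) hx (by positivity)
        fun t ht => ?_).trans ?_
      · rw [abs_mul]
        calc _ ≤ (K * t) * (b * t ^ (2 * j + i)) :=
              mul_le_mul (hK.Psi2_le t ht) (hbt t ht) (abs_nonneg _) (by positivity)
          _ = _ := by ring
      · gcongr
        linarith [(Nat.cast_nonneg j : (0 : ℝ) ≤ j), (Nat.cast_nonneg i : (0 : ℝ) ≤ i)]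
    have efin : K * x ^ i * ((2 * K ^ 2 * x ^ 2) ^ (j + 1) / (j + 1).factorial) =
        2 * K ^ 2 * b * (x ^ (2 * j + i + 2) / (j + 1)) := by
      rw [hb, Nat.factorial_succ, mul_pow _ (x ^ 2), ← pow_mul]
      push_cast
      field_simp
      ring
    rw [efin]
    constructor
    · simp only [pertCoeff]
      refine (abs_sub _ _).trans ?_
      rw [abs_mul, abs_mul]
      calc _ ≤ (K * x) * (K * b * (x ^ (2 * j + i + 1) / (j + 1))) +
            K * (K * b * (x ^ (2 * j + i + 1 + 1) / (j + 1))) := by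
            gcongr
            · exact hK.Psi2_le x hx
            · exact hK.Phi1_le x hx
        _ = _ := by ring
    · simp only [dpertCoeff]
      have h1 : x * |dPhi1 M x| ≤ K * x⁻¹ := by
        have := mul_le_mul_of_nonneg_left (hK.dPhi1_le x hx) hx0.le
        have e : x * (K * (x⁻¹) ^ 2) = K * x⁻¹ := by field_simp
        rwa [e] at this
      calc _ ≤ x * (|dPsi2 M x| * |∫ t in (1 : ℝ)..x, Phi1 (M + 2) t * pertCoeff M Ψ j t| +
            |dPhi1 M x| * |∫ t in (1 : ℝ)..x, Psi2 M t * pertCoeff M Ψ j t|) := by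
            gcongr
            refine (abs_sub _ _).trans ?_
            rw [abs_mul, abs_mul]
        _ = x * |dPsi2 M x| * |∫ t in (1 : ℝ)..x, Phi1 (M + 2) t * pertCoeff M Ψ j t| +
            (x * |dPhi1 M x|) * |∫ t in (1 : ℝ)..x, Psi2 M t * pertCoeff M Ψ j t| := by ring
        _ ≤ x * K * (K * b * (x ^ (2 * j + i + 1) / (j + 1))) +
            (K * x⁻¹) * (K * b * (x ^ (2 * j + i + 1 + 1) / (j + 1))) := by
            gcongr
            exact hK.dPsi2_le x hx
        _ ≤ x * K * (K * b * (x ^ (2 * j + i + 1) / (j + 1))) +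
            (K * x) * (K * b * (x ^ (2 * j + i + 1) / (j + 1))) := by
            gcongr 1
            have e : (K * x⁻¹) * (K * b * (x ^ (2 * j + i + 1 + 1) / (j + 1))) =
              (K * 1) * (K * b * (x ^ (2 * j + i + 1) / (j + 1))) := by
              rw [pow_succ x (2 * j + i + 1)]; field_simp
            rw [e]
            gcongr
        _ = _ := by ring

/-- The solution of `y'' = (x⁻ᵐ + ε²) y` with the same Cauchy data at `x = 1` as `Ψ`. -/
noncomputable def pert (M : ℕ) (Ψ : ℝ → ℝ) (x : ℝ) (ε : ℂ) : ℂ :=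
  ∑' j : ℕ, (pertCoeff M Ψ j x : ℂ) * ε ^ (2 * j)

/-- The `x`-derivative of `pert`. -/
noncomputable def dpert (M : ℕ) (Ψ dΨ : ℝ → ℝ) (x : ℝ) (ε : ℂ) : ℂ :=
  ∑' j : ℕ, (dpertCoeff M Ψ dΨ j x : ℂ) * ε ^ (2 * j)

theorem pert_term_le (hK : ZeroEnergyBound M K) (hΨ : ZeroEnergySolution M i K Ψ dΨ) {x : ℝ}
    (hx : 1 ≤ x) (ε : ℂ) (j : ℕ) :
    ‖(pertCoeff M Ψ j x : ℂ) * ε ^ (2 * j)‖ ≤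
      K * x ^ i * ((2 * K ^ 2 * x ^ 2 * ‖ε‖ ^ 2) ^ j / j.factorial) := by
  rw [norm_mul, norm_pow, Complex.norm_real, Real.norm_eq_abs, mul_pow _ (‖ε‖ ^ 2), ← pow_mul]
  refine (mul_le_mul_of_nonneg_right (pertCoeff_le hK hΨ j x hx).1 (by positivity)).trans
    (le_of_eq (by ring))

theorem dpert_term_le (hK : ZeroEnergyBound M K) (hΨ : ZeroEnergySolution M i K Ψ dΨ) {x : ℝ}
    (hx : 1 ≤ x) (ε : ℂ) (j : ℕ) :
    ‖(x : ℂ) * ((dpertCoeff M Ψ dΨ j x : ℂ) * ε ^ (2 * j))‖ ≤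
      K * x ^ i * ((2 * K ^ 2 * x ^ 2 * ‖ε‖ ^ 2) ^ j / j.factorial) := by
  rw [norm_mul, norm_mul, norm_pow, Complex.norm_real, Complex.norm_real, Real.norm_eq_abs,
    Real.norm_eq_abs, mul_pow _ (‖ε‖ ^ 2), ← pow_mul, abs_of_nonneg (by linarith : 0 ≤ x),
    ← mul_assoc]
  refine (mul_le_mul_of_nonneg_right (pertCoeff_le hK hΨ j x hx).2 (by positivity)).trans
    (le_of_eq (by ring))

theorem dpert_term_le' (hK : ZeroEnergyBound M K) (hΨ : ZeroEnergySolution M i K Ψ dΨ) {x : ℝ}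
    (hx : 1 ≤ x) (ε : ℂ) (j : ℕ) :
    ‖(dpertCoeff M Ψ dΨ j x : ℂ) * ε ^ (2 * j)‖ ≤
      K * x ^ i * ((2 * K ^ 2 * x ^ 2 * ‖ε‖ ^ 2) ^ j / j.factorial) := by
  refine le_trans ?_ (dpert_term_le hK hΨ hx ε j)
  rw [norm_mul (x : ℂ), Complex.norm_real, Real.norm_eq_abs, abs_of_nonneg (by linarith : 0 ≤ x)]
  exact le_mul_of_one_le_left (norm_nonneg _) hx

theorem norm_pert_le (hK : ZeroEnergyBound M K) (hΨ : ZeroEnergySolution M i K Ψ dΨ) {x : ℝ}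
    (hx : 1 ≤ x) (ε : ℂ) :
    ‖pert M Ψ x ε‖ ≤ K * x ^ i * Real.exp (2 * K ^ 2 * x ^ 2 * ‖ε‖ ^ 2) :=
  norm_tsum_le_of_exp_majorant (pert_term_le hK hΨ hx ε)

theorem norm_pert_sub_le (hK : ZeroEnergyBound M K) (hΨ : ZeroEnergySolution M i K Ψ dΨ) {x : ℝ}
    (hx : 1 ≤ x) (ε : ℂ) :
    ‖pert M Ψ x ε - Ψ x‖ ≤ K * x ^ i * (2 * K ^ 2 * x ^ 2 * ‖ε‖ ^ 2) *
      Real.exp (2 * K ^ 2 * x ^ 2 * ‖ε‖ ^ 2) := by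
  have hK0 : 0 < K := by linarith [hK.one_le]
  have := norm_tsum_sub_le_of_exp_majorant (by positivity) (by positivity) 1
    (pert_term_le hK hΨ hx ε)
  simpa [pert, pertCoeff] using this

theorem mul_dpert_eq (x : ℝ) (ε : ℂ) : (x : ℂ) * dpert M Ψ dΨ x ε =
    ∑' j : ℕ, (x : ℂ) * ((dpertCoeff M Ψ dΨ j x : ℂ) * ε ^ (2 * j)) := tsum_mul_left.symm

theorem norm_mul_dpert_le (hK : ZeroEnergyBound M K) (hΨ : ZeroEnergySolution M i K Ψ dΨ) {x : ℝ}
    (hx : 1 ≤ x) (ε : ℂ) :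
    ‖(x : ℂ) * dpert M Ψ dΨ x ε‖ ≤ K * x ^ i * Real.exp (2 * K ^ 2 * x ^ 2 * ‖ε‖ ^ 2) := by
  rw [mul_dpert_eq]
  exact norm_tsum_le_of_exp_majorant (dpert_term_le hK hΨ hx ε)

theorem norm_mul_dpert_sub_le (hK : ZeroEnergyBound M K) (hΨ : ZeroEnergySolution M i K Ψ dΨ)
    {x : ℝ} (hx : 1 ≤ x) (ε : ℂ) :
    ‖(x : ℂ) * dpert M Ψ dΨ x ε - (x : ℂ) * dΨ x‖ ≤ K * x ^ i * (2 * K ^ 2 * x ^ 2 * ‖ε‖ ^ 2) *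
      Real.exp (2 * K ^ 2 * x ^ 2 * ‖ε‖ ^ 2) := by
  have hK0 : 0 < K := by linarith [hK.one_le]
  have := norm_tsum_sub_le_of_exp_majorant (by positivity) (by positivity) 1
    (dpert_term_le hK hΨ hx ε)
  rw [mul_dpert_eq]
  simpa [dpertCoeff] using this

theorem hasDerivAt_pert (hM : 1 ≤ M) (hK : ZeroEnergyBound M K)
    (hΨ : ZeroEnergySolution M i K Ψ dΨ) {x : ℝ} (hx : 1 < x) (ε : ℂ) :
    HasDerivAt (fun x => pert M Ψ x ε) (dpert M Ψ dΨ x ε) x := by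
  have hK0 : 0 < K := by linarith [hK.one_le]
  have hmem : x ∈ Ioo 1 (2 * x) := ⟨hx, by linarith⟩
  refine hasDerivAt_tsum_of_isPreconnected
    (u := fun j => K * (2 * x) ^ i * ((2 * K ^ 2 * (2 * x) ^ 2 * ‖ε‖ ^ 2) ^ j / j.factorial))
    ((hasSum_pow_div_factorial _).summable.mul_left _) isOpen_Ioo isPreconnected_Ioo
    (g' := fun j y => (dpertCoeff M Ψ dΨ j y : ℂ) * ε ^ (2 * j))
    (fun j y hy => ?_) (fun j y hy => ?_) hmem
    (summable_of_exp_majorant (pert_term_le hK hΨ hx.le ε)) hmem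
  · exact ((hasDerivAt_pertCoeff hM hΨ j y (by linarith [hy.1])).ofReal_comp).mul_const _
  · refine (dpert_term_le' hK hΨ hy.1.le ε j).trans ?_
    have := hy.1; have := hy.2
    gcongr

theorem hasDerivAt_dpert (hM : 1 ≤ M) (hK : ZeroEnergyBound M K)
    (hΨ : ZeroEnergySolution M i K Ψ dΨ) {x : ℝ} (hx : 1 < x) (ε : ℂ) :
    HasDerivAt (fun x => dpert M Ψ dΨ x ε)
      (((1 / x ^ (M + 2) : ℝ) + ε ^ 2) * pert M Ψ x ε) x := by
  have hK0 : 0 < K := by linarith [hK.one_le]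
  have hmem : x ∈ Ioo 1 (2 * x) := ⟨hx, by linarith⟩
  have hprev : ∀ y : ℝ, 1 ≤ y → ∀ j, ‖(prevCoeff M Ψ j y : ℂ) * ε ^ (2 * j)‖ ≤
      ‖ε‖ ^ 2 * (K * y ^ i * (((2 * K ^ 2 * y ^ 2 * ‖ε‖ ^ 2) ^ (j - 1) / (j - 1).factorial))) := by
    intro y hy j
    cases j with
    | zero => simp [prevCoeff]; positivity
    | succ j =>
      have := pert_term_le hK hΨ hy ε j
      simp only [prevCoeff, Nat.add_sub_cancel]
      rw [mul_add, pow_add, ← mul_assoc, norm_mul, mul_comm, norm_pow, mul_one]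
      gcongr
  set u : ℕ → ℝ := fun j =>
    1 * (K * (2 * x) ^ i * ((2 * K ^ 2 * (2 * x) ^ 2 * ‖ε‖ ^ 2) ^ j / j.factorial)) +
    ‖ε‖ ^ 2 * (K * (2 * x) ^ i *
      (((2 * K ^ 2 * (2 * x) ^ 2 * ‖ε‖ ^ 2) ^ (j - 1) / (j - 1).factorial))) with hu
  have hs0 := (hasSum_pow_div_factorial (2 * K ^ 2 * (2 * x) ^ 2 * ‖ε‖ ^ 2)).summable
  have hs1 : Summable fun j : ℕ =>
      (2 * K ^ 2 * (2 * x) ^ 2 * ‖ε‖ ^ 2) ^ (j - 1) / ((j - 1).factorial : ℝ) :=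
    (summable_nat_add_iff 1).1 (by simpa using hs0)
  have husum : Summable u :=
    ((hs0.mul_left _).mul_left _).add ((hs1.mul_left _).mul_left _)
  have h := hasDerivAt_tsum_of_isPreconnected (u := u) husum isOpen_Ioo isPreconnected_Ioo
    (g := fun j y => (dpertCoeff M Ψ dΨ j y : ℂ) * ε ^ (2 * j))
    (g' := fun j y =>
      ((1 / y ^ (M + 2) * pertCoeff M Ψ j y + prevCoeff M Ψ j y : ℝ) : ℂ) * ε ^ (2 * j))
    (fun j y hy => ?_) (fun j y hy => ?_) hmem
    (summable_of_exp_majorant (dpert_term_le' hK hΨ hx.le ε)) hmem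
  · refine h.congr_deriv ?_
    have s1 := summable_of_exp_majorant (pert_term_le hK hΨ hx.le ε)
    have s2 : Summable fun j : ℕ => (prevCoeff M Ψ j x : ℂ) * ε ^ (2 * j) :=
      (summable_nat_add_iff 1).1 (by
        simp only [prevCoeff]
        refine (s1.mul_left (ε ^ 2)).congr fun j => by ring)
    have e : ∀ j : ℕ, ((1 / x ^ (M + 2) * pertCoeff M Ψ j x + prevCoeff M Ψ j x : ℝ) : ℂ) *
        ε ^ (2 * j) = ((1 / x ^ (M + 2) : ℝ) : ℂ) * ((pertCoeff M Ψ j x : ℂ) * ε ^ (2 * j)) +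
          (prevCoeff M Ψ j x : ℂ) * ε ^ (2 * j) := fun j => by push_cast; ring
    rw [tsum_congr e, (s1.mul_left _).tsum_add s2, tsum_mul_left, s2.tsum_eq_zero_add]
    simp only [prevCoeff, Pi.zero_apply, Complex.ofReal_zero, zero_mul, zero_add]
    have e2 : ∀ j : ℕ, (pertCoeff M Ψ j x : ℂ) * ε ^ (2 * (j + 1)) =
        ε ^ 2 * ((pertCoeff M Ψ j x : ℂ) * ε ^ (2 * j)) := fun j => by ring
    rw [tsum_congr e2, tsum_mul_left, pert]
    ring
  · exact ((hasDerivAt_dpertCoeff hM hΨ j y (by linarith [hy.1])).ofReal_comp).mul_const _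
  · have hy1 := hy.1; have hy2 := hy.2
    have e : ((1 / y ^ (M + 2) * pertCoeff M Ψ j y + prevCoeff M Ψ j y : ℝ) : ℂ) * ε ^ (2 * j) =
        ((1 / y ^ (M + 2) : ℝ) : ℂ) * ((pertCoeff M Ψ j y : ℂ) * ε ^ (2 * j)) +
          (prevCoeff M Ψ j y : ℂ) * ε ^ (2 * j) := by push_cast; ring
    rw [e]
    refine (norm_add_le _ _).trans (add_le_add ?_ ((hprev y hy1.le j).trans ?_))
    · rw [norm_mul]
      refine mul_le_mul ?_ ((pert_term_le hK hΨ hy1.le ε j).trans ?_) (norm_nonneg _) zero_le_one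
      · rw [Complex.norm_real, Real.norm_of_nonneg (by positivity)]
        rw [div_le_one (by positivity)]
        exact one_le_pow₀ hy1.le
      · gcongr
    · gcongr

theorem differentiable_of_exp_majorant {a : ℕ → ℂ} {C q : ℝ}
    (h : ∀ (ε : ℂ) (j : ℕ), ‖a j * ε ^ (2 * j)‖ ≤ C * ((q * ‖ε‖ ^ 2) ^ j / j.factorial))
    (hC : 0 ≤ C) (hq : 0 ≤ q) :
    Differentiable ℂ fun ε : ℂ => ∑' j : ℕ, a j * ε ^ (2 * j) := by
  intro ε
  have hball : DifferentiableOn ℂ (fun ε : ℂ => ∑' j : ℕ, a j * ε ^ (2 * j))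
      (Metric.ball 0 (‖ε‖ + 1)) := by
    refine Complex.differentiableOn_tsum_of_summable_norm
      (u := fun j => C * ((q * (‖ε‖ + 1) ^ 2) ^ j / j.factorial))
      ((hasSum_pow_div_factorial _).summable.mul_left _) (fun j => by fun_prop) Metric.isOpen_ball
      fun j z hz => ?_
    refine (h z j).trans ?_
    have : ‖z‖ ≤ ‖ε‖ + 1 := by simpa using (mem_ball_zero_iff.1 hz).le
    gcongr
  exact hball.differentiableAt (Metric.isOpen_ball.mem_nhds (by simp))

theorem differentiable_pert (hK : ZeroEnergyBound M K) (hΨ : ZeroEnergySolution M i K Ψ dΨ) {x : ℝ}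
    (hx : 1 ≤ x) : Differentiable ℂ (pert M Ψ x) := by
  have hK0 : 0 < K := by linarith [hK.one_le]
  exact differentiable_of_exp_majorant (fun ε j => pert_term_le hK hΨ hx ε j) (by positivity)
    (by positivity)

theorem differentiable_dpert (hK : ZeroEnergyBound M K) (hΨ : ZeroEnergySolution M i K Ψ dΨ) {x : ℝ}
    (hx : 1 ≤ x) : Differentiable ℂ (dpert M Ψ dΨ x) := by
  have hK0 : 0 < K := by linarith [hK.one_le]
  exact differentiable_of_exp_majorant (fun ε j => dpert_term_le' hK hΨ hx ε j) (by positivity)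
    (by positivity)

theorem pert_neg (x : ℝ) (ε : ℂ) : pert M Ψ x (-ε) = pert M Ψ x ε := by
  simp only [pert, pow_mul, neg_sq]

theorem dpert_neg (x : ℝ) (ε : ℂ) : dpert M Ψ dΨ x (-ε) = dpert M Ψ dΨ x ε := by
  simp only [dpert, pow_mul, neg_sq]

theorem conj_pert (x : ℝ) (ε : ℂ) :
    (starRingEnd ℂ) (pert M Ψ x ε) = pert M Ψ x ((starRingEnd ℂ) ε) := by
  rw [pert, Complex.conj_tsum]
  simp [pert]

theorem conj_dpert (x : ℝ) (ε : ℂ) :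
    (starRingEnd ℂ) (dpert M Ψ dΨ x ε) = dpert M Ψ dΨ x ((starRingEnd ℂ) ε) := by
  rw [dpert, Complex.conj_tsum]
  simp [dpert]

theorem continuousOn_pert (hM : 1 ≤ M) (hK : ZeroEnergyBound M K)
    (hΨ : ZeroEnergySolution M i K Ψ dΨ) (ε : ℂ) (b : ℝ) :
    ContinuousOn (fun x => pert M Ψ x ε) (Icc 1 b) := by
  have hK0 : 0 < K := by linarith [hK.one_le]
  unfold pert
  refine continuousOn_tsum (f := fun (j : ℕ) (x : ℝ) => (pertCoeff M Ψ j x : ℂ) * ε ^ (2 * j))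
    (u := fun j => K * b ^ i * ((2 * K ^ 2 * b ^ 2 * ‖ε‖ ^ 2) ^ j / j.factorial))
    (fun j => ?_) ((hasSum_pow_div_factorial _).summable.mul_left _) fun j y hy => ?_
  · intro y hy
    have hy0 : 0 < y := by linarith [hy.1]
    exact (((hasDerivAt_pertCoeff hM hΨ j y hy0).ofReal_comp).mul_const
      _).continuousAt.continuousWithinAt
  · refine (pert_term_le hK hΨ hy.1 ε j).trans ?_
    have := hy.1; have := hy.2
    have hb : 0 < b := by linarith
    gcongr

theorem continuousOn_dpert (hM : 1 ≤ M) (hK : ZeroEnergyBound M K)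
    (hΨ : ZeroEnergySolution M i K Ψ dΨ) (ε : ℂ) (b : ℝ) :
    ContinuousOn (fun x => dpert M Ψ dΨ x ε) (Icc 1 b) := by
  have hK0 : 0 < K := by linarith [hK.one_le]
  unfold dpert
  refine continuousOn_tsum (f := fun (j : ℕ) (x : ℝ) => (dpertCoeff M Ψ dΨ j x : ℂ) * ε ^ (2 * j))
    (u := fun j => K * b ^ i * ((2 * K ^ 2 * b ^ 2 * ‖ε‖ ^ 2) ^ j / j.factorial))
    (fun j => ?_) ((hasSum_pow_div_factorial _).summable.mul_left _) fun j y hy => ?_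
  · intro y hy
    have hy0 : 0 < y := by linarith [hy.1]
    exact (((hasDerivAt_dpertCoeff hM hΨ j y hy0).ofReal_comp).mul_const
      _).continuousAt.continuousWithinAt
  · refine (dpert_term_le' hK hΨ hy.1 ε j).trans ?_
    have := hy.1; have := hy.2
    have hb : 0 < b := by linarith
    gcongr

theorem pert_one (ε : ℂ) : pert M Ψ 1 ε = Ψ 1 := by
  rw [pert, tsum_eq_single 0]
  · simp [pertCoeff]
  · intro j hj
    obtain ⟨k, rfl⟩ := Nat.exists_eq_succ_of_ne_zero hj
    simp [pertCoeff]

theorem dpert_one (ε : ℂ) : dpert M Ψ dΨ 1 ε = dΨ 1 := by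
  rw [dpert, tsum_eq_single 0]
  · simp [dpertCoeff]
  · intro j hj
    obtain ⟨k, rfl⟩ := Nat.exists_eq_succ_of_ne_zero hj
    simp [dpertCoeff]

end

/-- The solutions of `y'' = (x⁻ᵐ + ε²) y` continuing `Phi1` and `Psi2` have Wronskian `1`. -/
theorem wronskian_pert {M : ℕ} {K : ℝ} (hM : 1 ≤ M) (hK : ZeroEnergyBound M K) {x : ℝ} (hx : 1 < x)
    (ε : ℂ) : pert M (Phi1 (M + 2)) x ε * dpert M (Psi2 M) (dPsi2 M) x ε -
      dpert M (Phi1 (M + 2)) (dPhi1 M) x ε * pert M (Psi2 M) x ε = 1 := by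
  have h1 := zeroEnergySolution_Phi1 hM hK
  have h2 := zeroEnergySolution_Psi2 hM hK
  set W : ℝ → ℂ := fun x => pert M (Phi1 (M + 2)) x ε * dpert M (Psi2 M) (dPsi2 M) x ε -
      dpert M (Phi1 (M + 2)) (dPhi1 M) x ε * pert M (Psi2 M) x ε with hW
  have hconst : ∀ y : ℝ, 1 < y → W y = W x := fun y hy => by
    refine eq_of_hasDerivAt_zero (a := 1) (f := W) (fun z hz => ?_) hy hx
    refine (((hasDerivAt_pert hM hK h1 hz ε).mul (hasDerivAt_dpert hM hK h2 hz ε)).sub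
      ((hasDerivAt_dpert hM hK h1 hz ε).mul (hasDerivAt_pert hM hK h2 hz ε))).congr_deriv ?_
    ring
  have hcont : ContinuousWithinAt W (Icc 1 2) 1 :=
    (((continuousOn_pert hM hK h1 ε 2).mul (continuousOn_dpert hM hK h2 ε 2)).sub
      ((continuousOn_dpert hM hK h1 ε 2).mul (continuousOn_pert hM hK h2 ε 2))) 1
      ⟨le_rfl, by norm_num⟩
  have hW1 : W 1 = 1 := by
    simp only [hW, pert_one, dpert_one]
    exact_mod_cast wronskian_Phi1_Psi2 hM one_pos
  have t1 : Tendsto W (𝓝[>] 1) (𝓝 (W 1)) :=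
    hcont.tendsto.mono_left (nhdsWithin_le_of_mem (Icc_mem_nhdsGT (by norm_num)))
  have t2 : Tendsto W (𝓝[>] 1) (𝓝 (W x)) := by
    refine tendsto_const_nhds.congr' ?_
    filter_upwards [self_mem_nhdsWithin] with y hy using (hconst y hy).symm
  rw [← hW1]
  exact tendsto_nhds_unique t2 t1

/-! ### Tail integrals in a cone around the positive axis -/

/-- `|ξ| + Re ξ`, which grows at a definite rate along horizontal rays to the right. -/
noncomputable def coneGauge (ξ : ℂ) : ℝ := ‖ξ‖ + ξ.re

/-- A cone around the positive real axis of half-angle larger than `5π/6`. -/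
def cone : Set ℂ := {ξ | ‖ξ‖ < 8 * coneGauge ξ}

theorem continuous_coneGauge : Continuous coneGauge := continuous_norm.add Complex.continuous_re

theorem isOpen_cone : IsOpen cone :=
  isOpen_lt continuous_norm (continuous_const.mul continuous_coneGauge)

theorem coneGauge_pos {ξ : ℂ} (h : ξ ∈ cone) : 0 < coneGauge ξ := by
  have h1 : ‖ξ‖ < 8 * coneGauge ξ := h
  have := norm_nonneg ξ
  linarith

theorem ne_zero_of_mem_cone {ξ : ℂ} (h : ξ ∈ cone) : ξ ≠ 0 := by
  rintro rfl
  have := coneGauge_pos h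
  simp [coneGauge] at this

theorem coneGauge_le (ξ : ℂ) : coneGauge ξ ≤ 2 * ‖ξ‖ := by
  have := Complex.re_le_norm ξ
  rw [coneGauge]; linarith

/-- The gauge grows at least at rate `1/8` along the horizontal ray from a point of the cone; this
is what the constant `8` in the definition of `cone` is for. -/
theorem coneGauge_add_le {ξ : ℂ} (h : ξ ∈ cone) {τ : ℝ} (hτ : 0 ≤ τ) :
    coneGauge ξ + τ / 8 ≤ coneGauge (ξ + τ) := by
  have hpos : 0 < ‖ξ‖ := norm_pos_iff.2 (ne_zero_of_mem_cone h)
  have h1 : ‖ξ‖ ^ 2 + τ * ξ.re ≤ ‖ξ‖ * ‖ξ + τ‖ := by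
    have e : ((starRingEnd ℂ) ξ * (ξ + τ)).re = ‖ξ‖ ^ 2 + τ * ξ.re := by
      rw [← Complex.normSq_eq_norm_sq, Complex.normSq_apply]
      simp; ring
    rw [← e]
    refine (Complex.re_le_norm _).trans ?_
    rw [norm_mul, Complex.norm_conj]
  have h2 : ‖ξ‖ < 8 * (‖ξ‖ + ξ.re) := h
  have h3 : ‖ξ‖ * (‖ξ‖ + τ / 8 - τ) ≤ ‖ξ‖ * ‖ξ + τ‖ := by nlinarith
  have h4 := le_of_mul_le_mul_left h3 hpos
  simp only [coneGauge, Complex.add_re, Complex.ofReal_re]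
  linarith

theorem add_mem_cone {ξ : ℂ} (h : ξ ∈ cone) {τ : ℝ} (hτ : 0 ≤ τ) : ξ + τ ∈ cone := by
  have h1 := coneGauge_add_le h hτ
  have h2 : ‖ξ‖ < 8 * coneGauge ξ := h
  have h3 := norm_add_le ξ τ
  rw [Complex.norm_of_nonneg hτ] at h3
  change ‖ξ + τ‖ < 8 * coneGauge (ξ + τ)
  linarith

theorem smul_mem_cone {η : ℂ} (h : η ∈ cone) {x : ℝ} (hx : 0 < x) : (x : ℂ) * η ∈ cone := by
  have h2 : ‖η‖ < 8 * (‖η‖ + η.re) := h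
  change ‖(x : ℂ) * η‖ < 8 * (‖(x : ℂ) * η‖ + ((x : ℂ) * η).re)
  rw [norm_mul, Complex.norm_of_nonneg hx.le, Complex.re_ofReal_mul]
  nlinarith

theorem coneGauge_smul (η : ℂ) {x : ℝ} (hx : 0 < x) : coneGauge ((x : ℂ) * η) = x * coneGauge η := by
  rw [coneGauge, norm_mul, Complex.norm_of_nonneg hx.le, Complex.re_ofReal_mul, coneGauge]; ring

theorem hasDerivAt_shifted_inv_pow {n : ℝ} (hn : 0 < n) {k : ℕ} (hk : 1 ≤ k) {τ : ℝ} (hτ : 0 ≤ τ) :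
    HasDerivAt (fun τ : ℝ => -(8 / k * ((n + τ / 8)⁻¹) ^ k)) (((n + τ / 8)⁻¹) ^ (k + 1)) τ := by
  have h1 : HasDerivAt (fun τ : ℝ => n + τ / 8) (1 / 8) τ :=
    ((hasDerivAt_id τ).div_const 8).const_add n
  have h2 := (((hasDerivAt_inv_pow k (x := n + τ / 8) (by positivity)).comp τ h1).const_mul
    (8 / (k : ℝ))).neg
  refine h2.congr_deriv ?_
  have : (k : ℝ) ≠ 0 := by positivity
  field_simp

theorem tendsto_shifted_inv_pow (n : ℝ) {k : ℕ} (hk : 1 ≤ k) :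
    Tendsto (fun τ : ℝ => ((n + τ / 8)⁻¹) ^ k) atTop (𝓝 0) := by
  have h1 : Tendsto (fun τ : ℝ => n + τ / 8) atTop atTop :=
    tendsto_atTop_add_const_left _ _ (tendsto_id.atTop_div_const (by norm_num))
  have := (tendsto_inv_atTop_zero.comp h1).pow k
  simpa [zero_pow (by omega : k ≠ 0)] using this

theorem integrableOn_shifted_inv_pow {n : ℝ} (hn : 0 < n) {k : ℕ} (hk : 1 ≤ k) :
    MeasureTheory.IntegrableOn (fun τ : ℝ => ((n + τ / 8)⁻¹) ^ (k + 1)) (Ioi 0) := by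
  refine MeasureTheory.integrableOn_Ioi_deriv_of_nonneg' (l := -(8 / k * 0))
    (fun τ hτ => hasDerivAt_shifted_inv_pow hn hk hτ) (fun τ hτ => ?_)
    ((tendsto_shifted_inv_pow n hk).const_mul _).neg
  have : 0 < τ := hτ
  positivity

theorem integral_shifted_inv_pow {n : ℝ} (hn : 0 < n) {k : ℕ} (hk : 1 ≤ k) :
    ∫ τ in Ioi (0 : ℝ), ((n + τ / 8)⁻¹) ^ (k + 1) = 8 / k * (n⁻¹) ^ k := by
  rw [MeasureTheory.integral_Ioi_of_hasDerivAt_of_nonneg' (l := -(8 / k * 0))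
    (fun τ hτ => hasDerivAt_shifted_inv_pow hn hk hτ) (fun τ hτ => ?_)
    ((tendsto_shifted_inv_pow n hk).const_mul _).neg]
  · simp
  · have : 0 < τ := hτ
    positivity

/-- The tail integral `∫₀^∞ e^{-qτ} g(ξ + τ) dτ`. -/
noncomputable def tailIntegral (q : ℂ) (g : ℂ → ℂ) (ξ : ℂ) : ℂ :=
  ∫ τ in Ioi (0 : ℝ), Complex.exp (-q * τ) * g (ξ + τ)

/-- `g` is holomorphic in the cone and decays like `coneGauge^{-(k+1)}`. -/
structure ConeDecay (A : ℝ) (k : ℕ) (g : ℂ → ℂ) : Prop where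
  diff : DifferentiableOn ℂ g cone
  le : ∀ ξ ∈ cone, ‖g ξ‖ ≤ A * ((coneGauge ξ)⁻¹) ^ (k + 1)

theorem norm_exp_neg_mul_le {q : ℂ} (hq : 0 ≤ q.re) {τ : ℝ} (hτ : 0 ≤ τ) :
    ‖Complex.exp (-q * τ)‖ ≤ 1 := by
  rw [Complex.norm_exp]
  apply Real.exp_le_one_iff.2
  simp only [Complex.re_mul_ofReal, Complex.neg_re]
  nlinarith

section
variable {A : ℝ} {k : ℕ} {g : ℂ → ℂ} {q : ℂ}

theorem ConeDecay.nonneg (hg : ConeDecay A k g) : 0 ≤ A := by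
  have h1 : (1 : ℂ) ∈ cone := by simp [cone, coneGauge]; norm_num
  have := (norm_nonneg _).trans (hg.le 1 h1)
  have hp := pow_pos (inv_pos.2 (coneGauge_pos h1)) (k + 1)
  by_contra h
  push Not at h
  nlinarith

theorem ConeDecay.le_shift (hg : ConeDecay A k g) {ξ : ℂ} (hξ : ξ ∈ cone) {n : ℝ} (hn : 0 < n)
    (hnξ : n ≤ coneGauge ξ) {τ : ℝ} (hτ : 0 ≤ τ) :
    ‖g (ξ + τ)‖ ≤ A * ((n + τ / 8)⁻¹) ^ (k + 1) := by
  refine (hg.le _ (add_mem_cone hξ hτ)).trans ?_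
  have := coneGauge_add_le hξ hτ
  have := hg.nonneg
  have := coneGauge_pos (add_mem_cone hξ hτ)
  gcongr
  linarith

theorem ConeDecay.continuousOn_shift (hg : ConeDecay A k g) {ξ : ℂ} (hξ : ξ ∈ cone) :
    ContinuousOn (fun τ : ℝ => g (ξ + τ)) (Ioi 0) := by
  refine hg.diff.continuousOn.comp (by fun_prop) fun τ hτ => add_mem_cone hξ (le_of_lt hτ)

theorem ConeDecay.aestronglyMeasurable (hg : ConeDecay A k g) {ξ : ℂ} (hξ : ξ ∈ cone) (f : ℝ → ℂ)
    (hf : Continuous f) : MeasureTheory.AEStronglyMeasurable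
      (fun τ : ℝ => f τ * g (ξ + τ)) (MeasureTheory.volume.restrict (Ioi 0)) :=
  (hf.continuousOn.mul (hg.continuousOn_shift hξ)).aestronglyMeasurable measurableSet_Ioi

theorem ConeDecay.integrable (hg : ConeDecay A k g) (hk : 1 ≤ k) (hq : 0 ≤ q.re) {ξ : ℂ}
    (hξ : ξ ∈ cone) :
    MeasureTheory.IntegrableOn (fun τ : ℝ => Complex.exp (-q * τ) * g (ξ + τ)) (Ioi 0) := by
  refine MeasureTheory.Integrable.mono'
    ((integrableOn_shifted_inv_pow (coneGauge_pos hξ) hk).const_mul A)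
    (hg.aestronglyMeasurable hξ _ (by fun_prop)) ?_
  filter_upwards [MeasureTheory.ae_restrict_mem measurableSet_Ioi] with τ hτ
  have hτ0 : 0 ≤ τ := le_of_lt hτ
  rw [norm_mul]
  refine (mul_le_of_le_one_left (norm_nonneg _) (norm_exp_neg_mul_le hq hτ0)).trans ?_
  exact hg.le_shift hξ (coneGauge_pos hξ) le_rfl hτ0

theorem ConeDecay.norm_tailIntegral_le (hg : ConeDecay A k g) (hk : 1 ≤ k) (hq : 0 ≤ q.re) {ξ : ℂ}
    (hξ : ξ ∈ cone) : ‖tailIntegral q g ξ‖ ≤ A * (8 / k * ((coneGauge ξ)⁻¹) ^ k) := by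
  rw [← integral_shifted_inv_pow (coneGauge_pos hξ) hk, ← MeasureTheory.integral_const_mul]
  refine MeasureTheory.norm_integral_le_of_norm_le
    ((integrableOn_shifted_inv_pow (coneGauge_pos hξ) hk).const_mul A) ?_
  filter_upwards [MeasureTheory.ae_restrict_mem measurableSet_Ioi] with τ hτ
  have hτ0 : 0 ≤ τ := le_of_lt hτ
  rw [norm_mul]
  refine (mul_le_of_le_one_left (norm_nonneg _) (norm_exp_neg_mul_le hq hτ0)).trans ?_
  exact hg.le_shift hξ (coneGauge_pos hξ) le_rfl hτ0

/-- A tail integral satisfies `E' = qE - g`: differentiate under the integral, then integrate by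
parts. -/
theorem ConeDecay.hasDerivAt_tailIntegral (hg : ConeDecay A k g) (hk : 1 ≤ k) (hq : 0 ≤ q.re)
    {ξ₀ : ℂ} (hξ₀ : ξ₀ ∈ cone) :
    HasDerivAt (tailIntegral q g) (q * tailIntegral q g ξ₀ - g ξ₀) ξ₀ := by
  set n := coneGauge ξ₀ / 2 with hn
  have hn0 : 0 < n := by have := coneGauge_pos hξ₀; positivity
  have hA := hg.nonneg
  have hnhds : cone ∩ {ξ | n < coneGauge ξ} ∈ 𝓝 ξ₀ := by
    refine (isOpen_cone.inter (isOpen_lt continuous_const continuous_coneGauge)).mem_nhds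
      ⟨hξ₀, ?_⟩
    have := coneGauge_pos hξ₀
    change n < coneGauge ξ₀
    rw [hn]; linarith
  obtain ⟨R, hR, hball⟩ := Metric.mem_nhds_iff.1 hnhds
  set r := R / 2 with hr
  have hr0 : 0 < r := by positivity
  have hdiffAt : ∀ ξ ∈ cone, DifferentiableAt ℂ g ξ := fun ξ hξ =>
    hg.diff.differentiableAt (isOpen_cone.mem_nhds hξ)
  -- a majorant for the derivative, uniform near `ξ₀`, from Cauchy's estimate
  have hderivle : ∀ ξ ∈ Metric.ball ξ₀ r, ∀ τ : ℝ, 0 ≤ τ →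
      ‖deriv g (ξ + τ)‖ ≤ A * ((n + τ / 8)⁻¹) ^ (k + 1) / r := by
    intro ξ hξ τ hτ
    have hsub : ∀ z ∈ Metric.closedBall (ξ + τ) r, z - τ ∈ Metric.ball ξ₀ R := by
      intro z hz
      rw [Metric.mem_closedBall, dist_eq_norm] at hz
      rw [Metric.mem_ball, dist_eq_norm] at hξ ⊢
      have e : z - τ - ξ₀ = (z - (ξ + τ)) + (ξ - ξ₀) := by ring
      rw [e]
      refine (norm_add_le _ _).trans_lt ?_
      linarith
    have hmem : ∀ z ∈ Metric.closedBall (ξ + τ) r, z ∈ cone := by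
      intro z hz
      have := add_mem_cone (hball (hsub z hz)).1 hτ
      simpa using this
    refine Complex.norm_deriv_le_of_forall_mem_sphere_norm_le hr0 ?_ ?_
    · refine DifferentiableOn.diffContOnCl ?_
      exact hg.diff.mono fun z hz => hmem z (Metric.closure_ball_subset_closedBall hz)
    · intro z hz
      have h1 := hball (hsub z (Metric.sphere_subset_closedBall hz))
      have := hg.le_shift h1.1 hn0 (le_of_lt h1.2) hτ
      simpa using this
  have hd := (hasDerivAt_integral_of_dominated_loc_of_deriv_le
    (μ := MeasureTheory.volume.restrict (Ioi (0 : ℝ))) (x₀ := ξ₀) (s := Metric.ball ξ₀ r)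
    (F := fun ξ τ => Complex.exp (-q * (τ : ℝ)) * g (ξ + (τ : ℝ)))
    (F' := fun ξ τ => Complex.exp (-q * (τ : ℝ)) * deriv g (ξ + (τ : ℝ)))
    (bound := fun τ => A / r * ((n + τ / 8)⁻¹) ^ (k + 1))
    (Metric.ball_mem_nhds _ hr0) ?_ (hg.integrable hk hq hξ₀) ?_ ?_
    ((integrableOn_shifted_inv_pow hn0 hk).const_mul _) ?_)
  · refine hd.2.congr_deriv ?_
    have hi1 : MeasureTheory.IntegrableOn
        (fun τ : ℝ => Complex.exp (-q * τ) * deriv g (ξ₀ + τ)) (Ioi 0) := hd.1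
    have hi2 := (hg.integrable hk hq hξ₀).const_mul q
    have hder : ∀ τ ∈ Ici (0 : ℝ), HasDerivAt (fun τ : ℝ => Complex.exp (-q * τ) * g (ξ₀ + τ))
        (Complex.exp (-q * τ) * deriv g (ξ₀ + τ) - q * (Complex.exp (-q * τ) * g (ξ₀ + τ))) τ := by
      intro τ hτ
      have h1 : HasDerivAt (fun z : ℂ => Complex.exp (-q * z) * g (ξ₀ + z))
          (Complex.exp (-q * τ) * deriv g (ξ₀ + τ) - q * (Complex.exp (-q * τ) * g (ξ₀ + τ)))
          (τ : ℂ) := by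
        have a1 : HasDerivAt (fun z : ℂ => Complex.exp (-q * z))
            (Complex.exp (-q * τ) * (-q)) (τ : ℂ) := by
          simpa using ((hasDerivAt_id (τ : ℂ)).const_mul (-q)).cexp
        have a2 : HasDerivAt (fun z : ℂ => g (ξ₀ + z)) (deriv g (ξ₀ + τ)) (τ : ℂ) :=
          HasDerivAt.comp_const_add ξ₀ (τ : ℂ) (hdiffAt _ (add_mem_cone hξ₀ hτ)).hasDerivAt
        exact (a1.mul a2).congr_deriv (by ring)
      exact h1.comp_ofReal
    have hlim : Tendsto (fun τ : ℝ => Complex.exp (-q * τ) * g (ξ₀ + τ)) atTop (𝓝 0) := by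
      have hb := (tendsto_shifted_inv_pow (coneGauge ξ₀) (k := k + 1) (by omega)).const_mul A
      rw [mul_zero] at hb
      refine squeeze_zero_norm' ?_ hb
      filter_upwards [eventually_ge_atTop 0] with τ hτ
      rw [norm_mul]
      refine (mul_le_of_le_one_left (norm_nonneg _) (norm_exp_neg_mul_le hq hτ)).trans ?_
      exact hg.le_shift hξ₀ (coneGauge_pos hξ₀) le_rfl hτ
    have hint := MeasureTheory.integral_Ioi_of_hasDerivAt_of_tendsto' hder (hi1.sub hi2) hlim
    rw [MeasureTheory.integral_sub hi1 hi2, MeasureTheory.integral_const_mul] at hint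
    simp only [Complex.ofReal_zero, mul_zero, Complex.exp_zero, add_zero, one_mul, zero_sub] at hint
    rw [tailIntegral]
    linear_combination hint
  · filter_upwards [isOpen_cone.mem_nhds hξ₀] with ξ hξ
    exact hg.aestronglyMeasurable hξ _ (by fun_prop)
  · have hc : ContinuousOn (deriv g) cone :=
      (hg.diff.deriv isOpen_cone).continuousOn
    refine ContinuousOn.aestronglyMeasurable ?_ measurableSet_Ioi
    refine ContinuousOn.mul (by fun_prop) (hc.comp (by fun_prop) fun τ hτ =>
      add_mem_cone hξ₀ (le_of_lt hτ))
  · filter_upwards [MeasureTheory.ae_restrict_mem measurableSet_Ioi] with τ hτ ξ hξ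
    have hτ0 : 0 ≤ τ := le_of_lt hτ
    rw [norm_mul]
    refine (mul_le_of_le_one_left (norm_nonneg _) (norm_exp_neg_mul_le hq hτ0)).trans ?_
    refine (hderivle ξ hξ τ hτ0).trans (le_of_eq (by ring))
  · filter_upwards [MeasureTheory.ae_restrict_mem measurableSet_Ioi] with τ hτ ξ hξ
    have hξc : ξ ∈ cone := (hball (Metric.ball_subset_ball (by rw [hr]; linarith) hξ)).1
    have a2 : HasDerivAt (fun z : ℂ => g (z + τ)) (deriv g (ξ + τ)) ξ :=
      HasDerivAt.comp_add_const ξ (τ : ℂ) (hdiffAt _ (add_mem_cone hξc (le_of_lt hτ))).hasDerivAt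
    exact a2.const_mul _

theorem norm_one_sub_exp_le {z : ℂ} (hz : 0 ≤ z.re) : ‖1 - Complex.exp (-z)‖ ≤ ‖z‖ := by
  have h := (convex_halfSpace_re_ge 0).norm_image_sub_le_of_norm_hasDerivWithin_le
    (f := fun z => Complex.exp (-z)) (f' := fun z => Complex.exp (-z) * (-1)) (C := 1)
    (fun w _ => (hasDerivAt_neg w).cexp.hasDerivWithinAt) (fun w hw => ?_) (x := z) (y := 0)
    hz (by simp)
  · simpa using h
  · have hw' : 0 ≤ w.re := hw
    simpa [Complex.norm_exp] using hw'

/-- The kernel `(1 - e^{-2pτ})/(2p)` is bounded by `τ`, which gains a power. -/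
theorem ConeDecay.norm_volterra_le (hg : ConeDecay A (k + 1) g) (hk : 1 ≤ k) {p : ℂ}
    (hp : 0 < p.re) {ξ : ℂ} (hξ : ξ ∈ cone) :
    ‖(tailIntegral 0 g ξ - tailIntegral (2 * p) g ξ) / (2 * p)‖ ≤
      A * (64 / k * ((coneGauge ξ)⁻¹) ^ k) := by
  have hA := hg.nonneg
  have hp0 : p ≠ 0 := by rintro rfl; simp at hp
  have h2p : 0 ≤ (2 * p).re := by simp; linarith
  have i0 := hg.integrable (q := 0) (by omega) (by simp) hξ
  have i1 := hg.integrable (q := 2 * p) (by omega) h2p hξ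
  have hn := coneGauge_pos hξ
  rw [tailIntegral, tailIntegral, ← MeasureTheory.integral_sub i0 i1, ← MeasureTheory.integral_div]
  have e : A * (64 / k * ((coneGauge ξ)⁻¹) ^ k) =
      ∫ τ in Ioi (0 : ℝ), 8 * A * ((coneGauge ξ + τ / 8)⁻¹) ^ (k + 1) := by
    rw [MeasureTheory.integral_const_mul, integral_shifted_inv_pow hn hk]; ring
  rw [e]
  refine MeasureTheory.norm_integral_le_of_norm_le
    ((integrableOn_shifted_inv_pow hn hk).const_mul _) ?_
  filter_upwards [MeasureTheory.ae_restrict_mem measurableSet_Ioi] with τ hτ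
  have hτ0 : 0 ≤ τ := le_of_lt hτ
  have h1 := hg.le_shift hξ hn le_rfl hτ0
  have h2 : ‖1 - Complex.exp (-(2 * p * τ))‖ ≤ ‖2 * p‖ * τ := by
    have h3 : 0 ≤ (2 * p * (τ : ℂ)).re := by
      rw [Complex.re_mul_ofReal]; positivity
    refine (norm_one_sub_exp_le h3).trans (le_of_eq ?_)
    rw [norm_mul, Complex.norm_of_nonneg hτ0]
  have e2 : (Complex.exp (-0 * τ) * g (ξ + τ) - Complex.exp (-(2 * p) * τ) * g (ξ + τ)) / (2 * p) =
      (1 - Complex.exp (-(2 * p * τ))) / (2 * p) * g (ξ + τ) := by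
    rw [neg_zero, zero_mul, Complex.exp_zero, neg_mul]; ring
  rw [e2, norm_mul, norm_div]
  have hpn : 0 < ‖2 * p‖ := norm_pos_iff.2 (mul_ne_zero two_ne_zero hp0)
  have h4 : ‖1 - Complex.exp (-(2 * p * τ))‖ / ‖2 * p‖ ≤ τ := by
    rw [div_le_iff₀ hpn]; linarith
  calc _ ≤ τ * (A * ((coneGauge ξ + τ / 8)⁻¹) ^ (k + 1 + 1)) := by gcongr
    _ ≤ (8 * (coneGauge ξ + τ / 8)) * (A * ((coneGauge ξ + τ / 8)⁻¹) ^ (k + 1 + 1)) := by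
        gcongr; linarith
    _ = _ := by
        have : coneGauge ξ + τ / 8 ≠ 0 := by positivity
        rw [pow_succ _ (k + 1)]; field_simp

end

/-! ### The Jost solution in a rotated half plane -/

/-- The direction `e^{iπ/4}`. Writing `ε = rot * η` with `η` in the cone covers the arguments of `ε`
from `-π/2` to `π`. -/
noncomputable def rot : ℂ := Complex.exp (Real.pi / 4 * Complex.I)

theorem rot_re_pos : 0 < rot.re := by
  rw [rot, Complex.exp_re]
  have : (Real.pi / 4 * Complex.I : ℂ).im = Real.pi / 4 := by simp
  rw [this]
  refine mul_pos (Real.exp_pos _) (Real.cos_pos_of_mem_Ioo ⟨?_, ?_⟩) <;> linarith [Real.pi_pos]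

theorem norm_rot : ‖rot‖ = 1 := by
  rw [rot, Complex.norm_exp]; simp

theorem rot_ne_zero : rot ≠ 0 := Complex.exp_ne_zero _

/-- The iterates of the Volterra equation
`u(ξ) = 1 + ∫₀^∞ (1 - e^{-2pτ})/(2p) (ξ+τ)⁻ᵐ u(ξ+τ) dτ`, with `p = rot`. -/
noncomputable def jostIter (M : ℕ) : ℕ → ℂ → ℂ
  | 0 => fun _ => 1
  | n + 1 => fun ξ =>
      (tailIntegral 0 (fun ζ => (ζ⁻¹) ^ (M + 2) * jostIter M n ζ) ξ -
        tailIntegral (2 * rot) (fun ζ => (ζ⁻¹) ^ (M + 2) * jostIter M n ζ) ξ) / (2 * rot)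

/-- The derivatives of `jostIter`. -/
noncomputable def djostIter (M : ℕ) : ℕ → ℂ → ℂ
  | 0 => fun _ => 0
  | n + 1 => fun ξ => -tailIntegral (2 * rot) (fun ζ => (ζ⁻¹) ^ (M + 2) * jostIter M n ζ) ξ

/-- The source term of the `n`-th iterate. -/
noncomputable def jostSource (M : ℕ) : ℕ → ℂ → ℂ
  | 0 => fun _ => 0
  | n + 1 => fun ξ => (ξ⁻¹) ^ (M + 2) * jostIter M n ξ

/-- The constant governing the factorial decay of the iterates. -/
noncomputable def jostConst (M : ℕ) : ℝ := 64 * 2 ^ (M + 2)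

theorem jostConst_pos (M : ℕ) : 0 < jostConst M := by unfold jostConst; positivity

/-- The decay of the source term of the next iterate: multiplication by `ξ⁻ᵐ` gains `m` powers, of
which the Volterra integral uses up two. -/
theorem coneDecay_source {M n : ℕ} {A : ℝ} {f : ℂ → ℂ} (hf : DifferentiableOn ℂ f cone)
    (hb : ∀ ξ ∈ cone, ‖f ξ‖ ≤ A * ((coneGauge ξ)⁻¹) ^ (M * n)) :
    ConeDecay (2 ^ (M + 2) * A) (M * (n + 1) + 1) (fun ξ => (ξ⁻¹) ^ (M + 2) * f ξ) where
  diff := by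
    refine DifferentiableOn.mul ?_ hf
    exact (differentiableOn_id.inv fun ξ hξ => ne_zero_of_mem_cone hξ).pow _
  le ξ hξ := by
    have hN := coneGauge_pos hξ
    have h1 : ‖ξ⁻¹‖ ≤ 2 * (coneGauge ξ)⁻¹ := by
      have h0 : 0 < ‖ξ‖ := norm_pos_iff.2 (ne_zero_of_mem_cone hξ)
      rw [norm_inv, ← div_eq_mul_inv, inv_eq_one_div, div_le_div_iff₀ h0 hN]
      linarith [coneGauge_le ξ]
    rw [norm_mul, norm_pow]
    calc _ ≤ (2 * (coneGauge ξ)⁻¹) ^ (M + 2) * (A * ((coneGauge ξ)⁻¹) ^ (M * n)) := by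
          gcongr; exact hb ξ hξ
      _ = _ := by rw [mul_pow]; ring

/-- The iterates are holomorphic in the cone, and the integral of `τ` against the `n`-th source
produces the factor `1/(n+1)` in each step. -/
theorem jostIter_spec {M : ℕ} (hM : 1 ≤ M) (n : ℕ) :
    DifferentiableOn ℂ (jostIter M n) cone ∧ ∀ ξ ∈ cone,
      ‖jostIter M n ξ‖ ≤ jostConst M ^ n / n.factorial * ((coneGauge ξ)⁻¹) ^ (M * n) := by
  have hc := jostConst_pos M
  induction n with
  | zero => exact ⟨differentiableOn_const _, fun ξ _ => by simp [jostIter]⟩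
  | succ n ih =>
    have hg := coneDecay_source (n := n) ih.1 ih.2
    have h2p : 0 ≤ (2 * rot).re := by simp; linarith [rot_re_pos]
    have hk : 1 ≤ M * (n + 1) := Nat.mul_pos hM (Nat.succ_pos n)
    refine ⟨fun ξ hξ => ?_, fun ξ hξ => ?_⟩
    · have h0 := hg.hasDerivAt_tailIntegral (q := 0) (by omega) (by simp) hξ
      have h1 := hg.hasDerivAt_tailIntegral (q := 2 * rot) (by omega) h2p hξ
      exact ((h0.sub h1).div_const (2 * rot)).differentiableAt.differentiableWithinAt
    · refine (hg.norm_volterra_le hk rot_re_pos hξ).trans ?_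
      rw [← mul_assoc]
      have hN := coneGauge_pos hξ
      gcongr
      have h1 : (1 : ℝ) ≤ M := by exact_mod_cast hM
      have h2 : (64 : ℝ) / (M * (n + 1) : ℕ) ≤ 64 / (n + 1) := by
        gcongr; push_cast; nlinarith [(Nat.cast_nonneg n : (0 : ℝ) ≤ n)]
      calc _ ≤ 2 ^ (M + 2) * (jostConst M ^ n / n.factorial) * (64 / (n + 1)) := by gcongr
        _ = _ := by
          rw [Nat.factorial_succ, pow_succ (jostConst M), jostConst]; push_cast; field_simp

theorem jostIter_coneDecay {M : ℕ} (hM : 1 ≤ M) (n : ℕ) :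
    ConeDecay (2 ^ (M + 2) * (jostConst M ^ n / n.factorial)) (M * (n + 1) + 1)
      (fun ξ => (ξ⁻¹) ^ (M + 2) * jostIter M n ξ) := by
  exact coneDecay_source (jostIter_spec hM n).1 (jostIter_spec hM n).2

theorem hasDerivAt_jostIter {M : ℕ} (hM : 1 ≤ M) (n : ℕ) {ξ : ℂ} (hξ : ξ ∈ cone) :
    HasDerivAt (jostIter M n) (djostIter M n ξ) ξ := by
  cases n with
  | zero => exact hasDerivAt_const _ _
  | succ n =>
    have hg := jostIter_coneDecay hM n
    have h2p : 0 ≤ (2 * rot).re := by simp; linarith [rot_re_pos]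
    have h0 := hg.hasDerivAt_tailIntegral (q := 0) (by omega) (by simp) hξ
    have h1 := hg.hasDerivAt_tailIntegral (q := 2 * rot) (by omega) h2p hξ
    refine ((h0.sub h1).div_const (2 * rot)).congr_deriv ?_
    have := rot_ne_zero
    simp only [djostIter]
    field_simp
    ring

theorem hasDerivAt_djostIter {M : ℕ} (hM : 1 ≤ M) (n : ℕ) {ξ : ℂ} (hξ : ξ ∈ cone) :
    HasDerivAt (djostIter M n) (2 * rot * djostIter M n ξ + jostSource M n ξ) ξ := by
  cases n with
  | zero => simpa [djostIter, jostSource] using hasDerivAt_const ξ (0 : ℂ)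
  | succ n =>
    have hg := jostIter_coneDecay hM n
    have h2p : 0 ≤ (2 * rot).re := by simp; linarith [rot_re_pos]
    refine (hg.hasDerivAt_tailIntegral (q := 2 * rot) (by omega) h2p hξ).neg.congr_deriv ?_
    simp only [djostIter, jostSource]
    ring

theorem norm_djostIter_le {M : ℕ} (hM : 1 ≤ M) (n : ℕ) {ξ : ℂ} (hξ : ξ ∈ cone) :
    ‖djostIter M n ξ‖ ≤ jostConst M ^ n / n.factorial * ((coneGauge ξ)⁻¹) ^ (M * n + 1) := by
  have hc := jostConst_pos M
  have hN := coneGauge_pos hξ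
  cases n with
  | zero => simp [djostIter]; exact hN.le
  | succ n =>
    have hg := jostIter_coneDecay hM n
    have h2p : 0 ≤ (2 * rot).re := by simp; linarith [rot_re_pos]
    simp only [djostIter, norm_neg]
    refine (hg.norm_tailIntegral_le (by omega) h2p hξ).trans ?_
    rw [← mul_assoc]
    gcongr
    have h1 : (1 : ℝ) ≤ M := by exact_mod_cast hM
    have h2 : (8 : ℝ) / (M * (n + 1) + 1 : ℕ) ≤ 64 / (n + 1) := by
      gcongr
      · norm_num
      · push_cast; nlinarith [(Nat.cast_nonneg n : (0 : ℝ) ≤ n)]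
    calc _ ≤ 2 ^ (M + 2) * (jostConst M ^ n / n.factorial) * (64 / (n + 1)) := by gcongr
      _ = _ := by
        rw [Nat.factorial_succ, pow_succ (jostConst M), jostConst]; push_cast; field_simp

/-- Terms of the Jost series at position `x`; the `n`-th is `x^{-(m-2)n}` times a function of `xη`. -/
noncomputable def jostTerm (M n : ℕ) (x : ℝ) (η : ℂ) : ℂ := η ^ (M * n) * jostIter M n (x * η)

/-- The `x`-derivatives of `jostTerm`. -/
noncomputable def djostTerm (M n : ℕ) (x : ℝ) (η : ℂ) : ℂ :=
  η ^ (M * n) * (η * djostIter M n (x * η))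

/-- The expansion parameter of the Jost series, up to a constant. -/
noncomputable def jostRatio (M : ℕ) (x : ℝ) : ℝ := jostConst M * (8 / x) ^ M

theorem jostRatio_pos (M : ℕ) {x : ℝ} (hx : 0 < x) : 0 < jostRatio M x := by
  have := jostConst_pos M
  unfold jostRatio; positivity

section
variable {M : ℕ} {x : ℝ} {η : ℂ}

theorem norm_mul_gauge_inv_le (hx : 0 < x) (hη : η ∈ cone) :
    ‖η‖ * (coneGauge (x * η))⁻¹ ≤ 8 / x := by
  have h : ‖η‖ < 8 * coneGauge η := hη
  have hN := coneGauge_pos hη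
  rw [coneGauge_smul η hx, ← div_eq_mul_inv, div_le_div_iff₀ (by positivity) hx]
  nlinarith

theorem norm_jostTerm_le (hM : 1 ≤ M) (n : ℕ) (hx : 0 < x) (hη : η ∈ cone) :
    ‖jostTerm M n x η‖ ≤ 1 * (jostRatio M x ^ n / n.factorial) := by
  have hc := jostConst_pos M
  have hN := coneGauge_pos (smul_mem_cone hη hx)
  rw [jostTerm, norm_mul, norm_pow]
  calc _ ≤ ‖η‖ ^ (M * n) * (jostConst M ^ n / n.factorial *
        ((coneGauge (x * η))⁻¹) ^ (M * n)) := by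
        gcongr; exact (jostIter_spec hM n).2 _ (smul_mem_cone hη hx)
    _ = jostConst M ^ n / n.factorial * (‖η‖ * (coneGauge (x * η))⁻¹) ^ (M * n) := by
        rw [mul_pow]; ring
    _ ≤ jostConst M ^ n / n.factorial * (8 / x) ^ (M * n) := by
        gcongr; exact norm_mul_gauge_inv_le hx hη
    _ = _ := by rw [jostRatio, mul_pow, pow_mul]; ring

theorem norm_djostTerm_le (hM : 1 ≤ M) (n : ℕ) (hx : 0 < x) (hη : η ∈ cone) :
    ‖djostTerm M n x η‖ ≤ 8 / x * (jostRatio M x ^ n / n.factorial) := by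
  have hc := jostConst_pos M
  have hN := coneGauge_pos (smul_mem_cone hη hx)
  rw [djostTerm, norm_mul, norm_pow, norm_mul]
  calc _ ≤ ‖η‖ ^ (M * n) * (‖η‖ * (jostConst M ^ n / n.factorial *
        ((coneGauge (x * η))⁻¹) ^ (M * n + 1))) := by
        gcongr; exact norm_djostIter_le hM n (smul_mem_cone hη hx)
    _ = jostConst M ^ n / n.factorial * (‖η‖ * (coneGauge (x * η))⁻¹) ^ (M * n + 1) := by
        rw [mul_pow]; ring
    _ ≤ jostConst M ^ n / n.factorial * (8 / x) ^ (M * n + 1) := by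
        gcongr; exact norm_mul_gauge_inv_le hx hη
    _ = _ := by rw [jostRatio, mul_pow, pow_succ, pow_mul]; ring

/-- The Jost solution without its exponential factor. -/
noncomputable def jostSum (M : ℕ) (x : ℝ) (η : ℂ) : ℂ := ∑' n : ℕ, jostTerm M n x η

/-- The `x`-derivative of `jostSum`. -/
noncomputable def djostSum (M : ℕ) (x : ℝ) (η : ℂ) : ℂ := ∑' n : ℕ, djostTerm M n x η

theorem norm_jostSum_sub_one_le (hM : 1 ≤ M) (hx : 0 < x) (hη : η ∈ cone) :
    ‖jostSum M x η - 1‖ ≤ jostRatio M x * Real.exp (jostRatio M x) := by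
  have := norm_tsum_sub_le_of_exp_majorant zero_le_one (jostRatio_pos M hx).le 1
    (fun n => norm_jostTerm_le hM n hx hη)
  simpa [jostSum, jostTerm, jostIter] using this

theorem norm_djostSum_le (hM : 1 ≤ M) (hx : 0 < x) (hη : η ∈ cone) :
    ‖djostSum M x η‖ ≤ 8 / x * jostRatio M x * Real.exp (jostRatio M x) := by
  have := norm_tsum_sub_le_of_exp_majorant (by positivity) (jostRatio_pos M hx).le 1
    (fun n => norm_djostTerm_le hM n hx hη)
  simpa [djostSum, djostTerm, djostIter] using this

theorem hasDerivAt_jostTerm (hM : 1 ≤ M) (n : ℕ) (hx : 0 < x) (hη : η ∈ cone) :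
    HasDerivAt (fun x : ℝ => jostTerm M n x η) (djostTerm M n x η) x := by
  have h1 : HasDerivAt (fun z : ℂ => jostIter M n (z * η)) (djostIter M n (x * η) * η) (x : ℂ) :=
    HasDerivAt.comp (x : ℂ) (hasDerivAt_jostIter hM n (smul_mem_cone hη hx))
      (hasDerivAt_mul_const η)
  exact ((h1.const_mul (η ^ (M * n))).comp_ofReal).congr_deriv (by rw [djostTerm]; ring)

/-- The term preceding the `n`-th one, with `0` before the first. -/
noncomputable def prevJostTerm (M : ℕ) : ℕ → ℝ → ℂ → ℂ
  | 0 => fun _ _ => 0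
  | n + 1 => jostTerm M n

theorem hasDerivAt_djostTerm (hM : 1 ≤ M) (n : ℕ) (hx : 0 < x) (hη : η ∈ cone) :
    HasDerivAt (fun x : ℝ => djostTerm M n x η)
      (2 * rot * η * djostTerm M n x η + (1 / x ^ (M + 2) : ℝ) * prevJostTerm M n x η) x := by
  have h1 : HasDerivAt (fun z : ℂ => djostIter M n (z * η))
      ((2 * rot * djostIter M n (x * η) + jostSource M n (x * η)) * η) (x : ℂ) :=
    HasDerivAt.comp (x : ℂ) (hasDerivAt_djostIter hM n (smul_mem_cone hη hx))
      (hasDerivAt_mul_const η)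
  refine (((h1.const_mul η).const_mul (η ^ (M * n))).comp_ofReal).congr_deriv ?_
  rw [djostTerm]
  have hη0 := ne_zero_of_mem_cone hη
  have hx0 : (x : ℂ) ≠ 0 := by exact_mod_cast hx.ne'
  cases n with
  | zero => simp [jostSource, prevJostTerm]; ring
  | succ n =>
    simp only [jostSource, prevJostTerm, jostTerm]
    push_cast
    have e : η ^ (M * (n + 1)) * (η * (((x : ℂ) * η)⁻¹ ^ (M + 2) * η)) =
        1 / (x : ℂ) ^ (M + 2) * η ^ (M * n) := by
      rw [mul_inv, mul_pow, inv_pow, inv_pow]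
      field_simp
      ring
    linear_combination jostIter M n (x * η) * e

theorem summable_jostTerm (hM : 1 ≤ M) (hx : 0 < x) (hη : η ∈ cone) :
    Summable fun n => jostTerm M n x η :=
  summable_of_exp_majorant fun n => norm_jostTerm_le hM n hx hη

theorem summable_djostTerm (hM : 1 ≤ M) (hx : 0 < x) (hη : η ∈ cone) :
    Summable fun n => djostTerm M n x η :=
  summable_of_exp_majorant fun n => norm_djostTerm_le hM n hx hη

theorem jostRatio_anti (M : ℕ) {a x : ℝ} (ha : 0 < a) (hx : a ≤ x) :
    jostRatio M x ≤ jostRatio M a := by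
  have := jostConst_pos M
  have : 0 < x := ha.trans_le hx
  unfold jostRatio
  gcongr

theorem hasDerivAt_jostSum (hM : 1 ≤ M) (hx : 0 < x) (hη : η ∈ cone) :
    HasDerivAt (fun x => jostSum M x η) (djostSum M x η) x := by
  have hmem : x ∈ Ioi (x / 2) := by simp; linarith
  have hle : ∀ (n : ℕ) (y : ℝ), y ∈ Ioi (x / 2) →
      ‖djostTerm M n y η‖ ≤ 8 / (x / 2) * (jostRatio M (x / 2) ^ n / n.factorial) := by
    intro n y hy
    have hy0 : 0 < y := (half_pos hx).trans hy
    refine (norm_djostTerm_le hM n hy0 hη).trans ?_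
    have h1 := jostRatio_anti M (half_pos hx) (le_of_lt hy)
    have h2 := jostRatio_pos M hy0
    have h3 : x / 2 ≤ y := le_of_lt hy
    gcongr
  have hu := (hasSum_pow_div_factorial (jostRatio M (x / 2))).summable.mul_left (8 / (x / 2))
  have h := hasDerivAt_tsum_of_isPreconnected hu isOpen_Ioi isPreconnected_Ioi
    (g := fun n x => jostTerm M n x η) (g' := fun n x => djostTerm M n x η)
    (fun n y hy => hasDerivAt_jostTerm hM n ((half_pos hx).trans hy) hη)
    hle hmem (summable_jostTerm hM hx hη) hmem
  exact h

theorem hasDerivAt_djostSum (hM : 1 ≤ M) (hx : 0 < x) (hη : η ∈ cone) :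
    HasDerivAt (fun x => djostSum M x η)
      (2 * rot * η * djostSum M x η + (1 / x ^ (M + 2) : ℝ) * jostSum M x η) x := by
  have hmem : x ∈ Ioi (x / 2) := by simp; linarith
  have hx2 := half_pos hx
  have hs0 := (hasSum_pow_div_factorial (jostRatio M (x / 2))).summable
  have hs1 : Summable fun j : ℕ => jostRatio M (x / 2) ^ (j - 1) / ((j - 1).factorial : ℝ) :=
    (summable_nat_add_iff 1).1 (by simpa using hs0)
  set u : ℕ → ℝ := fun n =>
    ‖2 * rot * η‖ * (8 / (x / 2) * (jostRatio M (x / 2) ^ n / n.factorial)) +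
    1 / (x / 2) ^ (M + 2) * (jostRatio M (x / 2) ^ (n - 1) / (n - 1).factorial) with hu
  have husum : Summable u := ((hs0.mul_left _).mul_left _).add (hs1.mul_left _)
  have hprev : ∀ y : ℝ, 0 < y → ∀ n, ‖prevJostTerm M n y η‖ ≤
      jostRatio M y ^ (n - 1) / (n - 1).factorial := by
    intro y hy n
    have := jostRatio_pos M hy
    cases n with
    | zero => simp [prevJostTerm]
    | succ n => simpa [prevJostTerm] using norm_jostTerm_le hM n hy hη
  have h := hasDerivAt_tsum_of_isPreconnected (u := u) husum isOpen_Ioi isPreconnected_Ioi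
    (g := fun n x => djostTerm M n x η)
    (g' := fun n y =>
      2 * rot * η * djostTerm M n y η + (1 / y ^ (M + 2) : ℝ) * prevJostTerm M n y η)
    (fun n y hy => hasDerivAt_djostTerm hM n (hx2.trans hy) hη)
    (fun n y hy => ?_) hmem (summable_djostTerm hM hx hη) hmem
  · refine h.congr_deriv ?_
    have s1 := summable_djostTerm hM hx hη
    have s0 := summable_jostTerm hM hx hη
    have s2 : Summable fun n => prevJostTerm M n x η :=
      (summable_nat_add_iff 1).1 (by simpa only [prevJostTerm] using s0)
    rw [(s1.mul_left _).tsum_add (s2.mul_left _), tsum_mul_left, tsum_mul_left,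
      s2.tsum_eq_zero_add]
    simp only [prevJostTerm, zero_add]
    rfl
  · have hy0 : 0 < y := hx2.trans hy
    have h1 := jostRatio_anti M hx2 (le_of_lt hy)
    have h2 := jostRatio_pos M hy0
    have h3 : x / 2 ≤ y := le_of_lt hy
    refine (norm_add_le _ _).trans (add_le_add ?_ ?_)
    · rw [norm_mul]
      refine mul_le_mul_of_nonneg_left ((norm_djostTerm_le hM n hy0 hη).trans ?_) (norm_nonneg _)
      gcongr
    · rw [norm_mul, Complex.norm_real, Real.norm_of_nonneg (by positivity)]
      refine mul_le_mul ?_ ((hprev y hy0 n).trans ?_) (norm_nonneg _) (by positivity)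
      · gcongr
      · gcongr

/-- The Jost solution of `y'' = (x⁻ᵐ + ε²) y` with `ε = rot * η`, so that `e^{εx} y → 1` at
infinity; it continues the decaying solution beyond the half plane `Re ε > 0`. -/
noncomputable def jost (M : ℕ) (x : ℝ) (η : ℂ) : ℂ := Complex.exp (-(rot * η) * x) * jostSum M x η

/-- The `x`-derivative of `jost`. -/
noncomputable def djost (M : ℕ) (x : ℝ) (η : ℂ) : ℂ :=
  Complex.exp (-(rot * η) * x) * (djostSum M x η - rot * η * jostSum M x η)

theorem hasDerivAt_exp_neg_mul (e : ℂ) (x : ℝ) :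
    HasDerivAt (fun x : ℝ => Complex.exp (-e * x)) (Complex.exp (-e * x) * -e) x := by
  have h : HasDerivAt (fun z : ℂ => Complex.exp (-e * z)) (Complex.exp (-e * x) * -e) (x : ℂ) := by
    simpa using ((hasDerivAt_id (x : ℂ)).const_mul (-e)).cexp
  exact h.comp_ofReal

theorem hasDerivAt_jost (hM : 1 ≤ M) (hx : 0 < x) (hη : η ∈ cone) :
    HasDerivAt (fun x => jost M x η) (djost M x η) x := by
  refine ((hasDerivAt_exp_neg_mul (rot * η) x).mul (hasDerivAt_jostSum hM hx hη)).congr_deriv ?_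
  rw [djost]; ring

theorem hasDerivAt_djost (hM : 1 ≤ M) (hx : 0 < x) (hη : η ∈ cone) :
    HasDerivAt (fun x => djost M x η)
      (((1 / x ^ (M + 2) : ℝ) + (rot * η) ^ 2) * jost M x η) x := by
  refine ((hasDerivAt_exp_neg_mul (rot * η) x).mul ((hasDerivAt_djostSum hM hx hη).sub
    ((hasDerivAt_jostSum hM hx hη).const_mul (rot * η)))).congr_deriv ?_
  rw [jost]; simp only [Pi.sub_apply]; ring

theorem differentiableOn_jost (hM : 1 ≤ M) (hx : 0 < x) :
    DifferentiableOn ℂ (jost M x) cone := by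
  refine DifferentiableOn.mul (by fun_prop) ?_
  refine Complex.differentiableOn_tsum_of_summable_norm
    (u := fun n => 1 * (jostRatio M x ^ n / n.factorial))
    ((hasSum_pow_div_factorial _).summable.mul_left _) (fun n => ?_) isOpen_cone
    fun n η hη => norm_jostTerm_le hM n hx hη
  refine DifferentiableOn.mul (by fun_prop) ?_
  exact (jostIter_spec hM n).1.comp (by fun_prop) fun η hη => smul_mem_cone hη hx

theorem differentiableOn_djostSum (hM : 1 ≤ M) (hx : 0 < x) :
    DifferentiableOn ℂ (djostSum M x) cone := by
  refine Complex.differentiableOn_tsum_of_summable_norm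
    (u := fun n => 8 / x * (jostRatio M x ^ n / n.factorial))
    ((hasSum_pow_div_factorial _).summable.mul_left _) (fun n => ?_) isOpen_cone
    fun n η hη => norm_djostTerm_le hM n hx hη
  refine DifferentiableOn.mul (by fun_prop) (DifferentiableOn.mul (by fun_prop) ?_)
  have : DifferentiableOn ℂ (djostIter M n) cone := fun ξ hξ =>
    (hasDerivAt_djostIter hM n hξ).differentiableAt.differentiableWithinAt
  exact this.comp (by fun_prop) fun η hη => smul_mem_cone hη hx

theorem differentiableOn_djost (hM : 1 ≤ M) (hx : 0 < x) :
    DifferentiableOn ℂ (djost M x) cone := by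
  have h : DifferentiableOn ℂ (jostSum M x) cone := by
    have := (differentiableOn_jost hM hx).mul
      (by fun_prop : DifferentiableOn ℂ (fun η => Complex.exp (rot * η * x)) cone)
    refine this.congr fun η _ => ?_
    simp only [jost, Pi.mul_apply]
    rw [mul_right_comm, ← Complex.exp_add]; simp
  refine DifferentiableOn.mul (by fun_prop) ((differentiableOn_djostSum hM hx).sub
    (DifferentiableOn.mul (by fun_prop) h))

theorem tendsto_jostRatio (hM : 1 ≤ M) : Tendsto (jostRatio M) atTop (𝓝 0) := by
  have h1 : Tendsto (fun x : ℝ => 8 / x) atTop (𝓝 0) := tendsto_const_nhds.div_atTop tendsto_id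
  have := (h1.pow M).const_mul (jostConst M)
  rw [zero_pow (by omega), mul_zero] at this
  exact this

theorem tendsto_jostRatio_mul_exp (hM : 1 ≤ M) :
    Tendsto (fun x => jostRatio M x * Real.exp (jostRatio M x)) atTop (𝓝 0) := by
  have h := tendsto_jostRatio hM
  simpa using h.mul (Real.continuous_exp.continuousAt.tendsto.comp h)

theorem tendsto_jostSum (hM : 1 ≤ M) (hη : η ∈ cone) :
    Tendsto (fun x => jostSum M x η) atTop (𝓝 1) := by
  rw [tendsto_iff_norm_sub_tendsto_zero]
  refine squeeze_zero' (Eventually.of_forall fun _ => norm_nonneg _) ?_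
    (tendsto_jostRatio_mul_exp hM)
  filter_upwards [eventually_gt_atTop 0] with x hx using norm_jostSum_sub_one_le hM hx hη

theorem tendsto_djostSum (hM : 1 ≤ M) (hη : η ∈ cone) :
    Tendsto (fun x => djostSum M x η) atTop (𝓝 0) := by
  have h8 : Tendsto (fun x : ℝ => 8 / x) atTop (𝓝 0) := tendsto_const_nhds.div_atTop tendsto_id
  have := h8.mul (tendsto_jostRatio_mul_exp hM)
  rw [mul_zero] at this
  refine squeeze_zero_norm' ?_ this
  filter_upwards [eventually_gt_atTop 0] with x hx
  refine (norm_djostSum_le hM hx hη).trans (le_of_eq (by ring))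

end

/-! ### Wronskians and uniqueness of the decaying solution -/

/-- `f` solves `f'' = (x⁻ᵐ + E) f` on `(a, ∞)`, with derivative `f'`. -/
structure Solves (M : ℕ) (a : ℝ) (E : ℂ) (f f' : ℝ → ℂ) : Prop where
  deriv : ∀ x : ℝ, a < x → HasDerivAt f (f' x) x
  deriv2 : ∀ x : ℝ, a < x → HasDerivAt f' (((1 / x ^ (M + 2) : ℝ) + E) * f x) x

/-- The Wronskian of `f` and `g` with derivatives `f'` and `g'`. -/
def wronskian (f f' g g' : ℝ → ℂ) (x : ℝ) : ℂ := f x * g' x - f' x * g x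

section
variable {M : ℕ} {a : ℝ} {E : ℂ} {f f' g g' : ℝ → ℂ}

theorem Solves.mono (hf : Solves M a E f f') {b : ℝ} (h : a ≤ b) : Solves M b E f f' :=
  ⟨fun x hx => hf.deriv x (h.trans_lt hx), fun x hx => hf.deriv2 x (h.trans_lt hx)⟩

theorem Solves.sub (hf : Solves M a E f f') (hg : Solves M a E g g') :
    Solves M a E (fun x => f x - g x) (fun x => f' x - g' x) :=
  ⟨fun x hx => (hf.deriv x hx).sub (hg.deriv x hx), fun x hx =>
    ((hf.deriv2 x hx).sub (hg.deriv2 x hx)).congr_deriv (by ring)⟩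

theorem HasDerivAt.conj_real {f : ℝ → ℂ} {d : ℂ} {x : ℝ} (h : HasDerivAt f d x) :
    HasDerivAt (fun x => (starRingEnd ℂ) (f x)) ((starRingEnd ℂ) d) x :=
  (Complex.conjCLE.toContinuousLinearMap.hasFDerivAt.comp_hasDerivAt x h)

theorem Solves.conj (hf : Solves M a E f f') : Solves M a ((starRingEnd ℂ) E)
    (fun x => (starRingEnd ℂ) (f x)) (fun x => (starRingEnd ℂ) (f' x)) :=
  ⟨fun x hx => (hf.deriv x hx).conj_real, fun x hx =>
    (hf.deriv2 x hx).conj_real.congr_deriv (by simp)⟩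

theorem Solves.wronskian_eq (hf : Solves M a E f f') (hg : Solves M a E g g') {x y : ℝ}
    (hx : a < x) (hy : a < y) : wronskian f f' g g' x = wronskian f f' g g' y := by
  refine eq_of_hasDerivAt_zero (fun z hz => ?_) hx hy
  refine (((hf.deriv z hz).mul (hg.deriv2 z hz)).sub
    ((hf.deriv2 z hz).mul (hg.deriv z hz))).congr_deriv ?_
  ring

theorem Solves.wronskian_eq_of_tendsto (hf : Solves M a E f f') (hg : Solves M a E g g') {w : ℂ}
    (h : Tendsto (wronskian f f' g g') atTop (𝓝 w)) {x : ℝ} (hx : a < x) :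
    wronskian f f' g g' x = w := by
  refine tendsto_nhds_unique (Tendsto.congr' ?_ tendsto_const_nhds) h
  filter_upwards [eventually_gt_atTop a] with y hy using hf.wronskian_eq hg hx hy

/-- If a function and its second derivative tend to zero, so does the derivative. -/
theorem tendsto_deriv_zero {f f' f'' : ℝ → ℂ} {a : ℝ} (h : ∀ x, a < x → HasDerivAt f (f' x) x)
    (h' : ∀ x, a < x → HasDerivAt f' (f'' x) x) (hf : Tendsto f atTop (𝓝 0))
    (hf'' : Tendsto f'' atTop (𝓝 0)) : Tendsto f' atTop (𝓝 0) := by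
  rw [NormedAddCommGroup.tendsto_atTop] at hf hf'' ⊢
  intro e he
  obtain ⟨N, hN⟩ := hf (e / 4) (by positivity)
  obtain ⟨N', hN'⟩ := hf'' (e / 4) (by positivity)
  refine ⟨max (max N N') (a + 1), fun x hx => ?_⟩
  have hxN : N ≤ x := (le_max_left _ _).trans ((le_max_left _ _).trans hx)
  have hxN' : N' ≤ x := (le_max_right _ _).trans ((le_max_left _ _).trans hx)
  have hxa : a + 1 ≤ x := (le_max_right _ _).trans hx
  have hmem : x ∈ Icc x (x + 1) := ⟨le_rfl, by linarith⟩
  have h1 : ∀ s ∈ Icc x (x + 1), ‖f' s - f' x‖ ≤ e / 4 := by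
    intro s hs
    have := (convex_Icc x (x + 1)).norm_image_sub_le_of_norm_hasDerivWithin_le (C := e / 4)
      (fun z hz => (h' z (by linarith [hz.1])).hasDerivWithinAt)
      (fun z hz => by
        have := hN' z (by linarith [hz.1]); rw [sub_zero] at this; exact this.le) hmem hs
    refine this.trans ?_
    rw [Real.norm_eq_abs, abs_of_nonneg (by linarith [hs.1])]
    nlinarith [hs.2]
  have h2 := (convex_Icc x (x + 1)).norm_image_sub_le_of_norm_hasDerivWithin_le (C := e / 4)
      (f := fun s => f s - s * f' x)
      (fun z hz => ((h z (by linarith [hz.1])).sub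
        ((hasDerivAt_id z).ofReal_comp.mul_const (f' x))).hasDerivWithinAt)
      (fun z hz => by simpa using h1 z hz) hmem (y := x + 1) ⟨by linarith, le_rfl⟩
  have h3 := hN x hxN
  have h4 := hN (x + 1) (by linarith)
  rw [sub_zero] at h3 h4 ⊢
  have e1 : f' x = f (x + 1) - f x -
      (f (x + 1) - (x + 1 : ℝ) * f' x - (f x - x * f' x)) := by push_cast; ring
  rw [e1]
  refine (norm_sub_le _ _).trans_lt ?_
  have h5 := norm_sub_le (f (x + 1)) (f x)
  simp only [add_sub_cancel_left, norm_one, mul_one] at h2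
  linarith

end

section
variable {M : ℕ} {K : ℝ}

theorem solves_pert {i : ℕ} {Ψ dΨ : ℝ → ℝ} (hM : 1 ≤ M) (hK : ZeroEnergyBound M K)
    (hΨ : ZeroEnergySolution M i K Ψ dΨ) (ε : ℂ) :
    Solves M 1 (ε ^ 2) (fun x => pert M Ψ x ε) (fun x => dpert M Ψ dΨ x ε) :=
  ⟨fun _ hx => hasDerivAt_pert hM hK hΨ hx ε, fun _ hx => hasDerivAt_dpert hM hK hΨ hx ε⟩

theorem solves_jost (hM : 1 ≤ M) {η : ℂ} (hη : η ∈ cone) :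
    Solves M 0 ((rot * η) ^ 2) (fun x => jost M x η) (fun x => djost M x η) :=
  ⟨fun _ hx => hasDerivAt_jost hM hx hη, fun _ hx => hasDerivAt_djost hM hx hη⟩

theorem norm_exp_neg_mul_real (e : ℂ) (x : ℝ) :
    ‖Complex.exp (-e * x)‖ = Real.exp (-(e.re * x)) := by
  rw [Complex.norm_exp]; simp

theorem tendsto_exp_neg_mul_real {e : ℂ} (he : 0 < e.re) :
    Tendsto (fun x : ℝ => Complex.exp (-e * x)) atTop (𝓝 0) := by
  rw [tendsto_zero_iff_norm_tendsto_zero]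
  simp only [norm_exp_neg_mul_real]
  exact Real.tendsto_exp_neg_atTop_nhds_zero.comp (tendsto_id.const_mul_atTop he)

theorem tendsto_exp_mul_jost (hM : 1 ≤ M) {η : ℂ} (hη : η ∈ cone) :
    Tendsto (fun x : ℝ => Complex.exp (rot * η * x) * jost M x η) atTop (𝓝 1) := by
  refine (tendsto_jostSum hM hη).congr fun x => ?_
  rw [jost, ← mul_assoc, ← Complex.exp_add]; simp

/-- A solution small compared with `e^{-εx}` has, with its derivative, zero Wronskian with the Jost
solution and hence vanishes. -/
theorem Solves.eq_zero_of_tendsto (hM : 1 ≤ M) {η : ℂ} (hη : η ∈ cone) (hre : 0 < (rot * η).re)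
    {a : ℝ} (ha : 1 ≤ a) {d d' : ℝ → ℂ} (hd : Solves M a ((rot * η) ^ 2) d d')
    (hlim : Tendsto (fun x : ℝ => Complex.exp (rot * η * x) * d x) atTop (𝓝 0)) {x : ℝ}
    (hx : a < x) : d x = 0 ∧ d' x = 0 := by
  obtain ⟨K, hK1, hKb⟩ := zero_energy_bounds hM
  have hK : ZeroEnergyBound M K := ⟨hK1, fun x hx => (hKb x hx).1, fun x hx => (hKb x hx).2.1,
    fun x hx => (hKb x hx).2.2.1, fun x hx => (hKb x hx).2.2.2.1⟩
  set ε := rot * η with hε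
  have hexp := tendsto_exp_neg_mul_real hre
  have hJ := (solves_jost hM hη).mono (zero_le_one.trans ha)
  have hJ0 : Tendsto (fun x => jost M x η) atTop (𝓝 0) := by
    simpa [jost, ← hε] using hexp.mul (tendsto_jostSum hM hη)
  have hJ'0 : Tendsto (fun x => djost M x η) atTop (𝓝 0) := by
    have := hexp.mul ((tendsto_djostSum hM hη).sub ((tendsto_jostSum hM hη).const_mul ε))
    simpa [djost, ← hε] using this
  have hd0 : Tendsto d atTop (𝓝 0) := by
    have := hexp.mul hlim
    rw [zero_mul] at this
    refine this.congr fun x => ?_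
    rw [← mul_assoc, ← Complex.exp_add]; simp
  have hinv : Tendsto (fun x : ℝ => ((1 / x ^ (M + 2) : ℝ) : ℂ)) atTop (𝓝 0) := by
    have h1 : Tendsto (fun x : ℝ => 1 / x ^ (M + 2)) atTop (𝓝 0) :=
      tendsto_const_nhds.div_atTop (tendsto_pow_atTop (by omega))
    exact_mod_cast (Complex.continuous_ofReal.tendsto 0).comp h1
  have hd'0 : Tendsto d' atTop (𝓝 0) := by
    refine tendsto_deriv_zero hd.deriv hd.deriv2 hd0 ?_
    simpa using (hinv.add_const (ε ^ 2)).mul hd0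
  have hW : ∀ y, a < y → wronskian d d' (fun x => jost M x η) (fun x => djost M x η) y = 0 := by
    refine fun y hy => hd.wronskian_eq_of_tendsto hJ ?_ hy
    have := (hd0.mul hJ'0).sub (hd'0.mul hJ0)
    rw [mul_zero, sub_zero] at this
    exact this
  -- `W(d, φ) J = W(J, φ) d` for every solution `φ`; multiply by `e^{εx}` and let `x → ∞`
  have key : ∀ φ φ' : ℝ → ℂ, Solves M 1 (ε ^ 2) φ φ' → ∀ y, a < y → wronskian d d' φ φ' y = 0 := by
    intro φ φ' hφ y hy
    have hφ' := hφ.mono ha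
    set P := wronskian d d' φ φ' y
    set Q := wronskian (fun x => jost M x η) (fun x => djost M x η) φ φ' y
    have h1 : ∀ᶠ z : ℝ in atTop, P * (Complex.exp (ε * z) * jost M z η) =
        Q * (Complex.exp (ε * z) * d z) := by
      filter_upwards [eventually_gt_atTop a] with z hz
      have e1 : P = wronskian d d' φ φ' z := hd.wronskian_eq hφ' hy hz
      have e2 : Q = wronskian (fun x => jost M x η) (fun x => djost M x η) φ φ' z :=
        hJ.wronskian_eq hφ' hy hz
      have e3 := hW z hz
      rw [e1, e2]
      simp only [wronskian] at e3 ⊢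
      linear_combination Complex.exp (ε * z) * φ z * e3
    have h2 := ((tendsto_exp_mul_jost hM hη).const_mul P).congr' h1
    have h3 := tendsto_nhds_unique h2 (hlim.const_mul Q)
    simpa using h3
  have k1 := key _ _ (solves_pert hM hK (zeroEnergySolution_Phi1 hM hK) ε) x hx
  have k2 := key _ _ (solves_pert hM hK (zeroEnergySolution_Psi2 hM hK) ε) x hx
  have hw := wronskian_pert hM hK (ha.trans_lt hx) ε
  simp only [wronskian] at k1 k2
  constructor
  · linear_combination -d x * hw + pert M (Phi1 (M + 2)) x ε * k2 - pert M (Psi2 M) x ε * k1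
  · linear_combination -d' x * hw + dpert M (Phi1 (M + 2)) (dPhi1 M) x ε * k2 -
      dpert M (Psi2 M) (dPsi2 M) x ε * k1

/-- Uniqueness of the decaying solution. -/
theorem Solves.eq_jost (hM : 1 ≤ M) {η : ℂ} (hη : η ∈ cone) (hre : 0 < (rot * η).re)
    {a : ℝ} (ha : 1 ≤ a) {y y' : ℝ → ℂ} (hy : Solves M a ((rot * η) ^ 2) y y')
    (hlim : Tendsto (fun x : ℝ => Complex.exp (rot * η * x) * y x) atTop (𝓝 1)) {x : ℝ}
    (hx : a < x) : y x = jost M x η ∧ y' x = djost M x η := by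
  have h := (hy.sub ((solves_jost hM hη).mono (zero_le_one.trans ha))).eq_zero_of_tendsto
    hM hη hre ha (by simpa [mul_sub] using hlim.sub (tendsto_exp_mul_jost hM hη)) hx
  exact ⟨sub_eq_zero.1 h.1, sub_eq_zero.1 h.2⟩

theorem zeroEnergyBound_exists (hM : 1 ≤ M) : ∃ K, ZeroEnergyBound M K := by
  obtain ⟨K, hK1, hKb⟩ := zero_energy_bounds hM
  exact ⟨K, hK1, fun x hx => (hKb x hx).1, fun x hx => (hKb x hx).2.1,
    fun x hx => (hKb x hx).2.2.1, fun x hx => (hKb x hx).2.2.2.1⟩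

end

/-! ### The logarithmic coordinate -/

/-- The point `e^w / rot` lies in the cone when `w` lies in the strip `|Im w - π/4| ≤ 5π/6`. -/
theorem exp_div_rot_mem_cone {w : ℂ} (h : |w.im - Real.pi / 4| ≤ 5 * Real.pi / 6) :
    Complex.exp w / rot ∈ cone := by
  have e : Complex.exp w / rot = Complex.exp (w - Real.pi / 4 * Complex.I) := by
    rw [rot, ← Complex.exp_sub]
  have him : (w - Real.pi / 4 * Complex.I).im = w.im - Real.pi / 4 := by simp
  have hcos : -(√3 / 2) ≤ Real.cos (w.im - Real.pi / 4) := by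
    rw [← Real.cos_abs, ← Real.cos_pi_div_six, ← Real.cos_pi_sub]
    refine Real.cos_le_cos_of_nonneg_of_le_pi (abs_nonneg _) (by linarith [Real.pi_pos]) ?_
    linarith
  have h3 : √3 < 7 / 4 := by
    rw [Real.sqrt_lt' (by norm_num)]; norm_num
  rw [e, cone, mem_ofPred_eq, coneGauge]
  rw [Complex.norm_exp, Complex.exp_re, him]
  have := Real.exp_pos (w - Real.pi / 4 * Complex.I).re
  nlinarith

theorem div_rot_mem_cone {ε : ℂ} (h : 0 < ε.re) : ε / rot ∈ cone := by
  have h0 : ε ≠ 0 := by rintro rfl; simp at h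
  rw [← Complex.exp_log h0]
  apply exp_div_rot_mem_cone
  rw [Complex.log_im]
  have := Complex.abs_arg_lt_pi_div_two_iff.2 (Or.inl h)
  rw [abs_lt] at this
  rw [abs_le]
  constructor <;> linarith [Real.pi_pos]

theorem rot_mul_div (ε : ℂ) : rot * (ε / rot) = ε := mul_div_cancel₀ _ rot_ne_zero

section
variable {M : ℕ}

/-- The potential is real and the decaying solution unique, so conjugation of the solution amounts
to conjugation of `ε`. -/
theorem conj_jost (hM : 1 ≤ M) {ε : ℂ} (hε : 0 < ε.re) {x : ℝ} (hx : 1 < x) :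
    (starRingEnd ℂ) (jost M x (ε / rot)) = jost M x ((starRingEnd ℂ) ε / rot) ∧
    (starRingEnd ℂ) (djost M x (ε / rot)) = djost M x ((starRingEnd ℂ) ε / rot) := by
  have hc := div_rot_mem_cone hε
  have hre : 0 < ((starRingEnd ℂ) ε).re := by simpa using hε
  have hs := ((solves_jost hM hc).mono zero_le_one).conj
  have hlim := (Complex.continuous_conj.tendsto 1).comp (tendsto_exp_mul_jost hM hc)
  rw [rot_mul_div] at hs hlim
  refine Solves.eq_jost hM (div_rot_mem_cone hre) (by rwa [rot_mul_div]) le_rfl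
    (y := fun x => (starRingEnd ℂ) (jost M x (ε / rot)))
    (y' := fun x => (starRingEnd ℂ) (djost M x (ε / rot))) ?_ ?_ hx
  · rw [rot_mul_div, ← map_pow]; exact hs
  · rw [rot_mul_div]
    simpa [Function.comp_def, ← Complex.exp_conj] using hlim

/-- The Wronskian of two Jost solutions with opposite momenta. -/
theorem wronskian_jost_neg (hM : 1 ≤ M) {η : ℂ} (hη : η ∈ cone) (hη' : -η ∈ cone) {x : ℝ}
    (hx : 0 < x) : wronskian (fun x => jost M x η) (fun x => djost M x η)
      (fun x => jost M x (-η)) (fun x => djost M x (-η)) x = 2 * (rot * η) := by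
  have h2 := solves_jost hM hη'
  rw [mul_neg, neg_sq] at h2
  refine (solves_jost hM hη).wronskian_eq_of_tendsto h2 ?_ hx
  have hA := tendsto_jostSum hM hη
  have hB := tendsto_jostSum hM hη'
  have hA' := tendsto_djostSum hM hη
  have hB' := tendsto_djostSum hM hη'
  have h := (hA.mul (hB'.sub (hB.const_mul (rot * -η)))).sub ((hA'.sub (hA.const_mul (rot * η))).mul hB)
  have e : 1 * (0 - rot * -η * 1) - (0 - rot * η * 1) * 1 = 2 * (rot * η) := by ring
  rw [e] at h
  refine h.congr fun x => ?_
  have e1 : Complex.exp (-(rot * η) * x) * Complex.exp (-(rot * -η) * x) = 1 := by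
    rw [← Complex.exp_add]; simp
  simp only [wronskian, jost, djost]
  linear_combination -(jostSum M x η * (djostSum M x (-η) - rot * -η * jostSum M x (-η)) -
    (djostSum M x η - rot * η * jostSum M x η) * jostSum M x (-η)) * e1

end

/-! ### The connection coefficients on the logarithmic plane -/

/-- The Wronskian of the Jost solution at `ε = e^w` and the solution continuing `Ψ`, for `w` in the
strip `|Im w - π/4| ≤ 5π/6`. -/
noncomputable def coefPlus (M : ℕ) (Ψ dΨ : ℝ → ℝ) (w : ℂ) : ℂ :=
  wronskian (fun x => jost M x (Complex.exp w / rot)) (fun x => djost M x (Complex.exp w / rot))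
    (fun x => pert M Ψ x (Complex.exp w)) (fun x => dpert M Ψ dΨ x (Complex.exp w)) 2

/-- The continuation of `coefPlus` to a strip symmetric about the real axis. -/
noncomputable def coef (M : ℕ) (Ψ dΨ : ℝ → ℝ) (w : ℂ) : ℂ :=
  if 0 ≤ w.im then coefPlus M Ψ dΨ w
  else (starRingEnd ℂ) (coefPlus M Ψ dΨ ((starRingEnd ℂ) w))

section
variable {M i : ℕ} {K : ℝ} {Ψ dΨ : ℝ → ℝ}

theorem coefPlus_eq (hM : 1 ≤ M) (hK : ZeroEnergyBound M K) (hΨ : ZeroEnergySolution M i K Ψ dΨ)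
    {w : ℂ} (hw : Complex.exp w / rot ∈ cone) {x : ℝ} (hx : 1 < x) : coefPlus M Ψ dΨ w =
      wronskian (fun x => jost M x (Complex.exp w / rot)) (fun x => djost M x (Complex.exp w / rot))
        (fun x => pert M Ψ x (Complex.exp w)) (fun x => dpert M Ψ dΨ x (Complex.exp w)) x := by
  have h := (solves_jost hM hw).mono zero_le_one
  rw [rot_mul_div] at h
  exact h.wronskian_eq (solves_pert hM hK hΨ _) one_lt_two hx

theorem differentiableAt_coefPlus (hM : 1 ≤ M) (hK : ZeroEnergyBound M K)
    (hΨ : ZeroEnergySolution M i K Ψ dΨ) {w : ℂ} (hw : Complex.exp w / rot ∈ cone) :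
    DifferentiableAt ℂ (coefPlus M Ψ dΨ) w := by
  have hc : cone ∈ 𝓝 (Complex.exp w / rot) := isOpen_cone.mem_nhds hw
  have h1 : DifferentiableAt ℂ (fun w => jost M 2 (Complex.exp w / rot)) w :=
    ((differentiableOn_jost hM two_pos).differentiableAt hc).comp w
      (f := fun w => Complex.exp w / rot) (by fun_prop)
  have h2 : DifferentiableAt ℂ (fun w => djost M 2 (Complex.exp w / rot)) w :=
    ((differentiableOn_djost hM two_pos).differentiableAt hc).comp w
      (f := fun w => Complex.exp w / rot) (by fun_prop)
  have h3 : DifferentiableAt ℂ (fun w => pert M Ψ 2 (Complex.exp w)) w :=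
    (differentiable_pert hK hΨ one_le_two _).comp w (by fun_prop)
  have h4 : DifferentiableAt ℂ (fun w => dpert M Ψ dΨ 2 (Complex.exp w)) w :=
    (differentiable_dpert hK hΨ one_le_two _).comp w (by fun_prop)
  exact (h1.mul h4).sub (h2.mul h3)

theorem norm_exp_le_one {w : ℂ} (hre : w.re ≤ 0) : ‖Complex.exp w‖ ≤ 1 := by
  rw [Complex.norm_exp]; exact Real.exp_le_one_iff.2 hre

/-- The Wronskian is evaluated at `x = 2`, where both the Jost series and the continued solutions
are bounded uniformly in `|ε| ≤ 1`. -/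
theorem coefPlus_bounded (hM : 1 ≤ M) (hK : ZeroEnergyBound M K)
    (hΨ : ZeroEnergySolution M i K Ψ dΨ) :
    ∃ C : ℝ, ∀ w : ℂ, w.re ≤ 0 → Complex.exp w / rot ∈ cone → ‖coefPlus M Ψ dΨ w‖ ≤ C := by
  set q := jostRatio M 2
  set A := 1 + q * Real.exp q
  set B := 8 / 2 * q * Real.exp q
  set D := K * 2 ^ i * Real.exp (2 * K ^ 2 * 2 ^ 2 * 1 ^ 2)
  have hq : 0 < q := jostRatio_pos M two_pos
  have hK0 : 0 < K := by linarith [hK.one_le]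
  refine ⟨Real.exp 2 * A * D + Real.exp 2 * (B + 1 * A) * D, fun w hre hc => ?_⟩
  have hε := norm_exp_le_one hre
  have hS : ‖jostSum M 2 (Complex.exp w / rot)‖ ≤ A := by
    have h1 := norm_jostSum_sub_one_le hM two_pos hc
    have h2 := norm_sub_norm_le (jostSum M 2 (Complex.exp w / rot)) 1
    rw [norm_one] at h2
    simp only [A]; linarith
  have hdS := norm_djostSum_le hM two_pos hc
  have hE : ‖Complex.exp (-(Complex.exp w) * (2 : ℝ))‖ ≤ Real.exp 2 := by
    rw [Complex.norm_exp]
    refine Real.exp_le_exp.2 ((Complex.re_le_norm _).trans ?_)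
    rw [norm_mul, norm_neg, Complex.norm_real]
    norm_num; linarith
  have hexp : Real.exp (2 * K ^ 2 * 2 ^ 2 * ‖Complex.exp w‖ ^ 2) ≤
      Real.exp (2 * K ^ 2 * 2 ^ 2 * 1 ^ 2) := by gcongr
  have hp : ‖pert M Ψ 2 (Complex.exp w)‖ ≤ D :=
    (norm_pert_le hK hΨ one_le_two _).trans (mul_le_mul_of_nonneg_left hexp (by positivity))
  have hdp : ‖dpert M Ψ dΨ 2 (Complex.exp w)‖ ≤ D := by
    have h := (norm_mul_dpert_le hK hΨ one_le_two (Complex.exp w)).trans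
      (mul_le_mul_of_nonneg_left hexp (by positivity))
    rw [norm_mul, Complex.norm_real] at h
    norm_num at h
    have := norm_nonneg (dpert M Ψ dΨ 2 (Complex.exp w))
    simp only [D]
    norm_num
    linarith
  have hJ : ‖jost M 2 (Complex.exp w / rot)‖ ≤ Real.exp 2 * A := by
    rw [jost, rot_mul_div, norm_mul]
    gcongr
  have hdJ : ‖djost M 2 (Complex.exp w / rot)‖ ≤ Real.exp 2 * (B + 1 * A) := by
    rw [djost, rot_mul_div, norm_mul]
    refine mul_le_mul hE ((norm_sub_le _ _).trans (add_le_add hdS ?_)) (norm_nonneg _)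
      (by positivity)
    rw [norm_mul]; gcongr
  rw [coefPlus, wronskian]
  refine (norm_sub_le _ _).trans (add_le_add ?_ ?_)
  · rw [norm_mul]; gcongr
  · rw [norm_mul]; gcongr

theorem coefPlus_conj (hM : 1 ≤ M) {w : ℂ} (hw : |w.im| < Real.pi / 2) :
    coefPlus M Ψ dΨ ((starRingEnd ℂ) w) = (starRingEnd ℂ) (coefPlus M Ψ dΨ w) := by
  have hre : 0 < (Complex.exp w).re := by
    rw [Complex.exp_re]
    rw [abs_lt] at hw
    exact mul_pos (Real.exp_pos _) (Real.cos_pos_of_mem_Ioo ⟨by linarith, by linarith⟩)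
  have h := conj_jost hM hre one_lt_two
  rw [coefPlus, coefPlus, wronskian, wronskian, Complex.exp_conj, ← h.1, ← h.2, ← conj_pert,
    ← conj_dpert, map_sub, map_mul, map_mul]

/-- Reflection: `coefPlus` takes conjugate values at conjugate points of `|Im w| < π/2`, so the two
branches in the definition of `coef` agree there. -/
theorem coef_eq_coefPlus (hM : 1 ≤ M) {w : ℂ} (hw : -(Real.pi / 2) < w.im) :
    coef M Ψ dΨ w = coefPlus M Ψ dΨ w := by
  rw [coef]
  split_ifs with h
  · rfl
  · push Not at h
    rw [coefPlus_conj hM (by rw [abs_lt]; constructor <;> linarith [Real.pi_pos]),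
      Complex.conj_conj]

theorem coef_conj (hM : 1 ≤ M) (w : ℂ) :
    coef M Ψ dΨ ((starRingEnd ℂ) w) = (starRingEnd ℂ) (coef M Ψ dΨ w) := by
  rcases lt_trichotomy w.im 0 with h | h | h
  · have h1 : 0 ≤ ((starRingEnd ℂ) w).im := by rw [Complex.conj_im]; linarith
    rw [coef, if_pos h1, coef, if_neg (by linarith), Complex.conj_conj]
  · have h1 : (starRingEnd ℂ) w = w := Complex.conj_eq_iff_im.2 h
    have h2 := coefPlus_conj (Ψ := Ψ) (dΨ := dΨ) hM (w := w) (by rw [h]; simp [Real.pi_pos])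
    rw [h1] at h2 ⊢
    rwa [coef, if_pos h.ge]
  · have h1 : ¬ 0 ≤ ((starRingEnd ℂ) w).im := by rw [Complex.conj_im]; linarith
    rw [coef, if_neg h1, coef, if_pos h.le, Complex.conj_conj]

theorem exp_div_rot_mem_cone_of_lt {w : ℂ} (h1 : -(Real.pi / 2) < w.im)
    (h2 : w.im < 13 * Real.pi / 12) : Complex.exp w / rot ∈ cone := by
  apply exp_div_rot_mem_cone
  rw [abs_le]
  constructor <;> linarith [Real.pi_pos]

theorem differentiableAt_coef (hM : 1 ≤ M) (hK : ZeroEnergyBound M K)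
    (hΨ : ZeroEnergySolution M i K Ψ dΨ) {w : ℂ} (hw : |w.im| < 13 * Real.pi / 12) :
    DifferentiableAt ℂ (coef M Ψ dΨ) w := by
  have hup : ∀ w : ℂ, -(Real.pi / 2) < w.im → w.im < 13 * Real.pi / 12 →
      DifferentiableAt ℂ (coef M Ψ dΨ) w := by
    intro w h1 h2
    refine (differentiableAt_coefPlus hM hK hΨ
      (exp_div_rot_mem_cone_of_lt h1 h2)).congr_of_eventuallyEq ?_
    filter_upwards [(isOpen_lt continuous_const Complex.continuous_im).mem_nhds h1] with z hz
    exact coef_eq_coefPlus hM hz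
  rw [abs_lt] at hw
  by_cases h : -(Real.pi / 2) < w.im
  · exact hup w h hw.2
  · push Not at h
    have h1 := hup ((starRingEnd ℂ) w) (by rw [Complex.conj_im]; linarith [Real.pi_pos])
      (by rw [Complex.conj_im]; linarith [Real.pi_pos])
    have h2 := h1.conj_conj
    rw [Complex.conj_conj] at h2
    refine h2.congr_of_eventuallyEq (Eventually.of_forall fun z => ?_)
    simp only [Function.comp_apply]
    rw [coef_conj hM, Complex.conj_conj]

theorem coef_bounded (hM : 1 ≤ M) (hK : ZeroEnergyBound M K)
    (hΨ : ZeroEnergySolution M i K Ψ dΨ) :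
    ∃ C : ℝ, ∀ w : ℂ, w.re ≤ 0 → |w.im| < 13 * Real.pi / 12 → ‖coef M Ψ dΨ w‖ ≤ C := by
  obtain ⟨C, hC⟩ := coefPlus_bounded hM hK hΨ
  refine ⟨C, fun w hre him => ?_⟩
  rw [abs_lt] at him
  rw [coef]
  split_ifs with h
  · exact hC w hre (exp_div_rot_mem_cone_of_lt (by linarith [Real.pi_pos]) him.2)
  · push Not at h
    rw [Complex.norm_conj]
    exact hC _ (by simpa using hre) (exp_div_rot_mem_cone_of_lt
      (by rw [Complex.conj_im]; linarith [Real.pi_pos]) (by rw [Complex.conj_im]; linarith))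

/-- The Stokes factor: the Wronskian of the growing solutions continued to the two sides of the
negative `ε`-axis, normalised by that of one of them and the decaying one. -/
noncomputable def stokes (M : ℕ) (s : ℝ) : ℂ :=
  wronskian (fun x => jost M x (-(Real.exp s : ℂ) / rot)) (fun x => djost M x (-(Real.exp s : ℂ) / rot))
    (fun x => (starRingEnd ℂ) (jost M x (-(Real.exp s : ℂ) / rot)))
    (fun x => (starRingEnd ℂ) (djost M x (-(Real.exp s : ℂ) / rot))) (Real.exp (-s)) /
      (2 * Real.exp s)

theorem exp_add_pi_mul_I (s : ℝ) : Complex.exp (s + Real.pi * Complex.I) = -(Real.exp s : ℂ) := by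
  rw [Complex.exp_add, Complex.exp_pi_mul_I]; simp

theorem neg_exp_div_rot_mem_cone (s : ℝ) : -(Real.exp s : ℂ) / rot ∈ cone := by
  rw [← exp_add_pi_mul_I]
  apply exp_div_rot_mem_cone_of_lt <;> simp <;> linarith [Real.pi_pos]

/-- The jump of the connection coefficients across the negative `ε`-axis is the Stokes factor times
their value on the positive axis. -/
theorem coef_jump (hM : 1 ≤ M) (s : ℝ) :
    coef M Ψ dΨ (s + Real.pi * Complex.I) - coef M Ψ dΨ (s - Real.pi * Complex.I) =
      stokes M s * coef M Ψ dΨ s := by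
  set η : ℂ := (Real.exp s : ℂ) / rot with hη
  have hneg : -(Real.exp s : ℂ) / rot = -η := neg_div _ _
  have hc' : -η ∈ cone := hneg ▸ neg_exp_div_rot_mem_cone s
  have hpos : 0 < ((Real.exp s : ℂ)).re := by rw [Complex.ofReal_re]; exact Real.exp_pos s
  have hc : η ∈ cone := div_rot_mem_cone hpos
  have hrot : rot * η = Real.exp s := rot_mul_div _
  have hs1 : coef M Ψ dΨ (s - Real.pi * Complex.I) =
      (starRingEnd ℂ) (coef M Ψ dΨ (s + Real.pi * Complex.I)) := by
    rw [← coef_conj hM]; congr 1; simp [sub_eq_add_neg]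
  have hx : (1 : ℝ) < 2 := one_lt_two
  have hF : coef M Ψ dΨ (s + Real.pi * Complex.I) =
      jost M 2 (-η) * dpert M Ψ dΨ 2 (Real.exp s) - djost M 2 (-η) * pert M Ψ 2 (Real.exp s) := by
    rw [coef_eq_coefPlus hM (by simp; linarith [Real.pi_pos]), coefPlus, wronskian,
      exp_add_pi_mul_I, pert_neg, dpert_neg, hneg]
  have hF0 : coef M Ψ dΨ s =
      jost M 2 η * dpert M Ψ dΨ 2 (Real.exp s) - djost M 2 η * pert M Ψ 2 (Real.exp s) := by
    rw [coef_eq_coefPlus hM (by simp; linarith [Real.pi_pos]), coefPlus, wronskian,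
      ← Complex.ofReal_exp]
  have hreal := conj_jost hM hpos hx
  rw [Complex.conj_ofReal, ← hη] at hreal
  have hP := conj_pert (M := M) (Ψ := Ψ) 2 (Real.exp s)
  have hdP := conj_dpert (M := M) (Ψ := Ψ) (dΨ := dΨ) 2 (Real.exp s)
  rw [Complex.conj_ofReal] at hP hdP
  have hW := wronskian_jost_neg hM hc' (by rwa [neg_neg]) (two_pos (α := ℝ))
  rw [neg_neg, mul_neg, hrot] at hW
  have hW' := congrArg (starRingEnd ℂ) hW
  simp only [wronskian] at hW hW'
  simp only [map_mul, map_sub, map_neg, Complex.conj_ofReal, hreal.1, hreal.2, map_ofNat] at hW'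
  have hgs := solves_jost hM hc'
  rw [mul_neg, neg_sq, hrot] at hgs
  have hgs' := hgs.conj
  rw [map_pow, Complex.conj_ofReal] at hgs'
  have hS : stokes M s * (2 * Real.exp s) = jost M 2 (-η) * (starRingEnd ℂ) (djost M 2 (-η)) -
      djost M 2 (-η) * (starRingEnd ℂ) (jost M 2 (-η)) := by
    have h2 : (2 * (Real.exp s : ℂ)) ≠ 0 := by
      exact_mod_cast mul_ne_zero two_ne_zero (Real.exp_pos s).ne'
    rw [stokes, div_mul_cancel₀ _ h2, hneg]
    exact hgs.wronskian_eq hgs' (Real.exp_pos _) two_pos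
  have h2 : (2 * (Real.exp s : ℂ)) ≠ 0 := by
    exact_mod_cast mul_ne_zero two_ne_zero (Real.exp_pos s).ne'
  apply mul_left_cancel₀ h2
  rw [hs1, ← mul_assoc, mul_comm _ (stokes M s), hS, hF, hF0]
  simp only [map_mul, map_sub, hP, hdP]
  set g := jost M 2 (-η)
  set g' := djost M 2 (-η)
  set P := pert M Ψ 2 (Real.exp s)
  set P' := dpert M Ψ dΨ 2 (Real.exp s)
  -- the Plücker relation between the four solutions
  linear_combination (-((starRingEnd ℂ) g * P' - (starRingEnd ℂ) g' * P)) * hW +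
    (g * P' - g' * P) * hW'

end

/-! ### Expansion of the Stokes factor -/

/-- The point at which the Jost series is evaluated on the negative `ε`-axis. -/
noncomputable def stokesPoint : ℂ := -1 / rot

/-- First coefficient of the Stokes factor in powers of `t^{m-2}`, divided by `2πi`. -/
noncomputable def stokes₁ (M : ℕ) : ℝ :=
  -(Real.exp 1 ^ 2 * (djostTerm M 1 1 stokesPoint).im) / (2 * Real.pi)

/-- Second coefficient of the Stokes factor in powers of `t^{m-2}`, divided by `2πi`. -/
noncomputable def stokes₂ (M : ℕ) : ℝ :=
  -(Real.exp 1 ^ 2 * (djostTerm M 2 1 stokesPoint +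
    (starRingEnd ℂ) (jostTerm M 1 1 stokesPoint) * djostTerm M 1 1 stokesPoint).im) / (2 * Real.pi)

section
variable {M : ℕ}

theorem stokesPoint_mem_cone : stokesPoint ∈ cone := by
  have := neg_exp_div_rot_mem_cone 0
  simpa [stokesPoint] using this

theorem jostTerm_scaling (n : ℕ) {t : ℝ} (ht : 0 < t) (κ : ℂ) :
    jostTerm M n t⁻¹ (t * κ) = ((t ^ M : ℝ) : ℂ) ^ n * jostTerm M n 1 κ := by
  have : (t : ℂ) ≠ 0 := by exact_mod_cast ht.ne'
  have e : ((t⁻¹ : ℝ) : ℂ) * (t * κ) = ((1 : ℝ) : ℂ) * κ := by push_cast; field_simp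
  rw [jostTerm, jostTerm, e, mul_pow, pow_mul (t : ℂ)]
  push_cast
  ring

theorem djostTerm_scaling (n : ℕ) {t : ℝ} (ht : 0 < t) (κ : ℂ) :
    djostTerm M n t⁻¹ (t * κ) = t * (((t ^ M : ℝ) : ℂ) ^ n * djostTerm M n 1 κ) := by
  have : (t : ℂ) ≠ 0 := by exact_mod_cast ht.ne'
  have e : ((t⁻¹ : ℝ) : ℂ) * (t * κ) = ((1 : ℝ) : ℂ) * κ := by push_cast; field_simp
  rw [djostTerm, djostTerm, e, mul_pow, pow_mul (t : ℂ)]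
  push_cast
  ring

/-- At `x = 1/t` the Jost series for `ε = -t` depends on `t` only through powers of `t^{m-2}`. -/
theorem stokes_eq (s : ℝ) : stokes M s = Real.exp 1 ^ 2 / 2 *
    ((∑' n : ℕ, ((Real.exp s ^ M : ℝ) : ℂ) ^ n * jostTerm M n 1 stokesPoint) *
      (starRingEnd ℂ) (∑' n : ℕ, ((Real.exp s ^ M : ℝ) : ℂ) ^ n * djostTerm M n 1 stokesPoint) -
    (starRingEnd ℂ) (∑' n : ℕ, ((Real.exp s ^ M : ℝ) : ℂ) ^ n * jostTerm M n 1 stokesPoint) *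
      (∑' n : ℕ, ((Real.exp s ^ M : ℝ) : ℂ) ^ n * djostTerm M n 1 stokesPoint)) := by
  have ht := Real.exp_pos s
  set t := Real.exp s with ht'
  have ht0 : (t : ℂ) ≠ 0 := by exact_mod_cast ht.ne'
  have e1 : -(t : ℂ) / rot = t * stokesPoint := by rw [stokesPoint]; ring
  have e2 : Real.exp (-s) = t⁻¹ := Real.exp_neg s
  have e3 : Complex.exp (-(rot * (t * stokesPoint)) * (t⁻¹ : ℝ)) = (Real.exp 1 : ℝ) := by
    have : -(rot * (t * stokesPoint)) * (t⁻¹ : ℝ) = 1 := by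
      rw [stokesPoint]; push_cast; field_simp [rot_ne_zero]
    rw [this]; simp
  have e4 : rot * (t * stokesPoint) = -t := by rw [stokesPoint]; field_simp [rot_ne_zero]
  set a := ∑' n : ℕ, ((t ^ M : ℝ) : ℂ) ^ n * jostTerm M n 1 stokesPoint
  set b := ∑' n : ℕ, ((t ^ M : ℝ) : ℂ) ^ n * djostTerm M n 1 stokesPoint
  have ha : jostSum M t⁻¹ (t * stokesPoint) = a := by
    rw [jostSum]; exact tsum_congr fun n => jostTerm_scaling n ht _
  have hb : djostSum M t⁻¹ (t * stokesPoint) = t * b := by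
    rw [djostSum, ← tsum_mul_left]; exact tsum_congr fun n => djostTerm_scaling n ht _
  rw [stokes, wronskian, e1, e2]
  simp only [jost, djost, e3, ha, hb]
  simp only [map_mul, map_sub, Complex.conj_ofReal, e4, map_neg]
  field_simp
  ring

theorem norm_mul_pow_jostTerm_le (hM : 1 ≤ M) {l : ℝ} (hl : 0 ≤ l) (n : ℕ) :
    ‖(l : ℂ) ^ n * jostTerm M n 1 stokesPoint‖ ≤ 1 * ((l * jostRatio M 1) ^ n / n.factorial) := by
  rw [norm_mul, norm_pow, Complex.norm_of_nonneg hl, mul_pow, mul_div_assoc, ← mul_assoc, one_mul]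
  gcongr
  simpa using norm_jostTerm_le hM n one_pos stokesPoint_mem_cone

theorem norm_mul_pow_djostTerm_le (hM : 1 ≤ M) {l : ℝ} (hl : 0 ≤ l) (n : ℕ) :
    ‖(l : ℂ) ^ n * djostTerm M n 1 stokesPoint‖ ≤ 8 * ((l * jostRatio M 1) ^ n / n.factorial) := by
  rw [norm_mul, norm_pow, Complex.norm_of_nonneg hl, mul_pow, mul_div_assoc, mul_left_comm]
  gcongr
  simpa using norm_djostTerm_le hM n one_pos stokesPoint_mem_cone

theorem mul_pow_mul_exp_le {c q l : ℝ} (hc : 0 ≤ c) (hq : 0 ≤ q) (hl : 0 ≤ l) (hl1 : l ≤ 1) (N : ℕ) :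
    c * (l * q) ^ N * Real.exp (l * q) ≤ c * q ^ N * Real.exp q * l ^ N := by
  have : l * q ≤ q := by nlinarith
  calc _ ≤ c * (l * q) ^ N * Real.exp q := by gcongr
    _ = _ := by rw [mul_pow]; ring

theorem jostTerm_zero (x : ℝ) (η : ℂ) : jostTerm M 0 x η = 1 := by simp [jostTerm, jostIter]

theorem djostTerm_zero (x : ℝ) (η : ℂ) : djostTerm M 0 x η = 0 := by simp [djostTerm, djostIter]

/-- The Stokes factor up to an error of third order in `t^{m-2}`. Of the two series in `stokes_eq`,
that of `jostTerm` starts with `1` and that of `djostTerm` with a term of first order, and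
conjugation leaves the imaginary part of their product. -/
theorem stokes_expansion (hM : 1 ≤ M) : ∃ C : ℝ, ∀ s : ℝ, s ≤ 0 →
    ‖stokes M s - 2 * Real.pi * Complex.I *
      (stokes₁ M * Real.exp s ^ M + stokes₂ M * (Real.exp s ^ M) ^ 2)‖ ≤ C * (Real.exp s ^ M) ^ 3 := by
  set q := jostRatio M 1
  have hq : 0 < q := jostRatio_pos M one_pos
  set A := jostTerm M 1 1 stokesPoint with hA
  set B := djostTerm M 1 1 stokesPoint with hB
  set D := djostTerm M 2 1 stokesPoint with hD
  set ca := q ^ 2 * Real.exp q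
  set cb := 8 * q ^ 3 * Real.exp q
  set cc := 8 * q * Real.exp q
  refine ⟨Real.exp 1 ^ 2 / 2 * (2 * (cb + ‖A‖ * (‖D‖ + cb) + ca * cc)), fun s hs => ?_⟩
  have hl0 : 0 < Real.exp s ^ M := by positivity
  have hl1 : Real.exp s ^ M ≤ 1 := pow_le_one₀ (Real.exp_pos s).le (Real.exp_le_one_iff.2 hs)
  rw [stokes_eq]
  rw [show ((Real.exp s : ℂ) ^ M) = ((Real.exp s ^ M : ℝ) : ℂ) by push_cast; rfl]
  set l := Real.exp s ^ M
  set a := ∑' n : ℕ, (l : ℂ) ^ n * jostTerm M n 1 stokesPoint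
  set b := ∑' n : ℕ, (l : ℂ) ^ n * djostTerm M n 1 stokesPoint
  have ha : ‖a - (1 + l * A)‖ ≤ ca * l ^ 2 := by
    have := (norm_tsum_sub_le_of_exp_majorant zero_le_one (by positivity) 2
      (norm_mul_pow_jostTerm_le hM hl0.le)).trans (mul_pow_mul_exp_le zero_le_one hq.le hl0.le hl1 2)
    simpa only [Finset.sum_range_succ, Finset.sum_range_zero, jostTerm_zero, pow_zero, pow_one,
      zero_add, one_mul] using this
  have hb : ‖b - (l * B + l ^ 2 * D)‖ ≤ cb * l ^ 3 := by
    have := (norm_tsum_sub_le_of_exp_majorant (by norm_num) (by positivity) 3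
      (norm_mul_pow_djostTerm_le hM hl0.le)).trans
      (mul_pow_mul_exp_le (by norm_num) hq.le hl0.le hl1 3)
    simpa only [Finset.sum_range_succ, Finset.sum_range_zero, djostTerm_zero, pow_zero, pow_one,
      zero_add, mul_zero] using this
  have hb1 : ‖b‖ ≤ cc * l := by
    have := (norm_tsum_sub_le_of_exp_majorant (by norm_num) (by positivity) 1
      (norm_mul_pow_djostTerm_le hM hl0.le)).trans
      (mul_pow_mul_exp_le (by norm_num) hq.le hl0.le hl1 1)
    simpa only [Finset.sum_range_succ, Finset.sum_range_zero, djostTerm_zero, pow_zero, pow_one,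
      zero_add, mul_zero, sub_zero] using this
  set ra := a - (1 + l * A) with hra
  set rb := b - (l * B + l ^ 2 * D) with hrb
  set R := (starRingEnd ℂ) rb + l * A * (l ^ 2 * (starRingEnd ℂ) D + (starRingEnd ℂ) rb) +
    ra * (starRingEnd ℂ) b with hR
  have hRn : ‖R‖ ≤ (cb + ‖A‖ * (‖D‖ + cb) + ca * cc) * l ^ 3 := by
    have hln : ‖(l : ℂ)‖ = l := Complex.norm_of_nonneg hl0.le
    have h1 : ‖l * A * (l ^ 2 * (starRingEnd ℂ) D + (starRingEnd ℂ) rb)‖ ≤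
        (‖A‖ * (‖D‖ + cb)) * l ^ 3 := by
      rw [norm_mul, norm_mul, hln]
      have : ‖l ^ 2 * (starRingEnd ℂ) D + (starRingEnd ℂ) rb‖ ≤ (‖D‖ + cb) * l ^ 2 := by
        refine (norm_add_le _ _).trans ?_
        rw [norm_mul, norm_pow, hln, Complex.norm_conj, Complex.norm_conj]
        have : cb * l ^ 3 ≤ cb * l ^ 2 :=
          mul_le_mul_of_nonneg_left (pow_le_pow_of_le_one hl0.le hl1 (by norm_num)) (by positivity)
        linarith
      calc _ ≤ l * ‖A‖ * ((‖D‖ + cb) * l ^ 2) := by gcongr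
        _ = _ := by ring
    have h2 : ‖ra * (starRingEnd ℂ) b‖ ≤ ca * cc * l ^ 3 := by
      rw [norm_mul, Complex.norm_conj]
      calc _ ≤ ca * l ^ 2 * (cc * l) := by gcongr
        _ = _ := by ring
    refine (norm_add₃_le).trans ?_
    rw [Complex.norm_conj]
    linarith
  have him : ∀ z : ℂ, (starRingEnd ℂ) z - z = -(2 * z.im * Complex.I) := by
    intro z
    have := Complex.sub_conj z
    push_cast at this
    linear_combination -this
  have e : Real.exp 1 ^ 2 / 2 * (a * (starRingEnd ℂ) b - (starRingEnd ℂ) a * b) -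
      2 * Real.pi * Complex.I * (stokes₁ M * l + stokes₂ M * (l : ℂ) ^ 2) =
      Real.exp 1 ^ 2 / 2 * (R - (starRingEnd ℂ) R) := by
    have e1 := him B
    have e2 := him (D + (starRingEnd ℂ) A * B)
    have hpi : (Real.pi : ℂ) ≠ 0 := by exact_mod_cast Real.pi_ne_zero
    have hs1 : 2 * Real.pi * Complex.I * (stokes₁ M : ℂ) =
        Real.exp 1 ^ 2 / 2 * ((starRingEnd ℂ) B - B) := by
      rw [e1, stokes₁, ← hB]; push_cast; field_simp
    have hs2 : 2 * Real.pi * Complex.I * (stokes₂ M : ℂ) =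
        Real.exp 1 ^ 2 / 2 * ((starRingEnd ℂ) (D + (starRingEnd ℂ) A * B) -
          (D + (starRingEnd ℂ) A * B)) := by
      rw [e2, stokes₂, ← hA, ← hB, ← hD]; push_cast; field_simp
    rw [mul_add, ← mul_assoc, ← mul_assoc, hs1, hs2, hR, hra, hrb]
    simp only [map_add, map_sub, map_mul, map_pow, Complex.conj_ofReal, Complex.conj_conj, map_one]
    ring
  rw [e, norm_mul]
  have h1 : ‖((Real.exp 1 : ℝ) : ℂ) ^ 2 / 2‖ = Real.exp 1 ^ 2 / 2 := by
    rw [norm_div, norm_pow, Complex.norm_of_nonneg (Real.exp_pos 1).le]; simp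
  rw [h1, mul_assoc]
  refine mul_le_mul_of_nonneg_left ((norm_sub_le _ _).trans ?_) (by positivity)
  rw [Complex.norm_conj]
  linarith

/-- With its exponential factor, the source integral of the first iterate is a primitive of
`-e^{-2 rot ξ} ξ⁻ᵐ`. -/
theorem hasDerivAt_tailIntegral_source (hM : 1 ≤ M) {ξ : ℂ} (hξ : ξ ∈ cone) :
    HasDerivAt (fun ξ => Complex.exp (-(2 * rot * ξ)) *
      tailIntegral (2 * rot) (fun ζ => (ζ⁻¹) ^ (M + 2)) ξ)
      (-(Complex.exp (-(2 * rot * ξ)) * (ξ⁻¹) ^ (M + 2))) ξ := by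
  have hg := jostIter_coneDecay hM 0
  simp only [jostIter, mul_one] at hg
  have h2p : 0 ≤ (2 * rot).re := by simp; linarith [rot_re_pos]
  have h := hg.hasDerivAt_tailIntegral (q := 2 * rot) (by omega) h2p hξ
  have h1 : HasDerivAt (fun ξ => Complex.exp (-(2 * rot * ξ)))
      (Complex.exp (-(2 * rot * ξ)) * -(2 * rot * 1)) ξ :=
    (((hasDerivAt_id ξ).const_mul (2 * rot)).neg).cexp
  refine (h1.mul h).congr_deriv ?_
  ring

/-- The source integral of the first iterate along a ray; it is real there because its derivative is
real and it vanishes at infinity. -/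
theorem im_tailIntegral_source (hM : 1 ≤ M) :
    ((rot⁻¹) ^ (M + 1) * (Complex.exp (-(2 * rot * (1 / rot))) *
      tailIntegral (2 * rot) (fun ζ => (ζ⁻¹) ^ (M + 2)) (1 / rot))).im = 0 := by
  set k : ℝ → ℂ := fun r => (rot⁻¹) ^ (M + 1) * (Complex.exp (-(2 * rot * (r * rot⁻¹))) *
      tailIntegral (2 * rot) (fun ζ => (ζ⁻¹) ^ (M + 2)) (r * rot⁻¹)) with hk
  have hinv : rot⁻¹ ∈ cone := by
    have := div_rot_mem_cone (ε := 1) (by simp)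
    rwa [one_div] at this
  have hderiv : ∀ r : ℝ, 0 < r → HasDerivAt k (-((Real.exp (-(2 * r)) * (r⁻¹) ^ (M + 2) : ℝ) : ℂ)) r := by
    intro r hr
    have hr0 : (r : ℂ) ≠ 0 := by exact_mod_cast hr.ne'
    have h1 := HasDerivAt.comp (r : ℂ) (hasDerivAt_tailIntegral_source hM (smul_mem_cone hinv hr))
      (hasDerivAt_mul_const (rot⁻¹))
    refine ((h1.comp_ofReal).const_mul ((rot⁻¹) ^ (M + 1))).congr_deriv ?_
    have e1 : 2 * rot * (r * rot⁻¹) = 2 * r := by field_simp [rot_ne_zero]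
    rw [e1]
    push_cast
    have := rot_ne_zero
    rw [mul_inv, inv_inv, mul_pow, inv_pow, inv_pow]
    field_simp
    ring
  have hg := jostIter_coneDecay hM 0
  simp only [jostIter, mul_one] at hg
  have h2p : 0 ≤ (2 * rot).re := by simp; linarith [rot_re_pos]
  have hlim : Tendsto k atTop (𝓝 0) := by
    have hG := coneGauge_pos hinv
    set A : ℝ := 2 ^ (M + 2) * (jostConst M ^ 0 / Nat.factorial 0)
    have h0 : Tendsto (fun r : ℝ => A * (8 / (M * (0 + 1) + 1 : ℕ) * ((r * coneGauge rot⁻¹)⁻¹) ^ (M * (0 + 1) + 1)))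
        atTop (𝓝 0) := by
      have : Tendsto (fun r : ℝ => ((r * coneGauge rot⁻¹)⁻¹) ^ (M * (0 + 1) + 1)) atTop (𝓝 0) := by
        have := (tendsto_inv_atTop_zero.comp (tendsto_id.atTop_mul_const hG)).pow (M * (0 + 1) + 1)
        simpa using this
      simpa using (this.const_mul _).const_mul A
    refine squeeze_zero_norm' ?_ h0
    filter_upwards [eventually_gt_atTop 0] with r hr
    rw [hk]
    have e1 : 2 * rot * (r * rot⁻¹) = 2 * r := by field_simp [rot_ne_zero]
    simp only [norm_mul, norm_pow, norm_inv, norm_rot, e1]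
    have e2 : ‖Complex.exp (-(2 * (r : ℂ)))‖ ≤ 1 := norm_exp_le_one (by simp; linarith)
    have e3 := hg.norm_tailIntegral_le (q := 2 * rot) (by omega) h2p (smul_mem_cone hinv hr)
    rw [coneGauge_smul _ hr] at e3
    rw [inv_one, one_pow, one_mul]
    exact (mul_le_of_le_one_left (norm_nonneg _) e2).trans e3
  have him : ∀ r : ℝ, 0 < r → HasDerivAt (fun r => (k r).im) 0 r := by
    intro r hr
    have := Complex.imCLM.hasFDerivAt.comp_hasDerivAt r (hderiv r hr)
    simp only [Complex.imCLM_apply, Complex.neg_im, Complex.ofReal_im, neg_zero] at this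
    exact this
  have hlim' : Tendsto (fun r => (k r).im) atTop (𝓝 0) :=
    (Complex.continuous_im.tendsto 0).comp hlim
  have h1 : (k 1).im = 0 := by
    refine tendsto_nhds_unique (Tendsto.congr' ?_ tendsto_const_nhds) hlim'
    filter_upwards [eventually_gt_atTop 0] with r hr
      using eq_of_hasDerivAt_zero him one_pos hr
  simpa [hk, one_div] using h1

/-- The half-circle integral picks out one Taylor coefficient of `e^{-2z}`. -/
theorem re_integral_half_circle (n : ℕ) :
    (∫ θ in (0 : ℝ)..Real.pi, Complex.exp (-2 * Complex.exp (θ * Complex.I)) *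
      Complex.exp (-(n * (θ * Complex.I)))).re = Real.pi * ((-2) ^ n / n.factorial) := by
  set c : ℕ → ℂ := fun k => (-2) ^ k / k.factorial
  have hs : HasSum (fun k : ℕ => ∫ θ in (0 : ℝ)..Real.pi,
      c k * Complex.exp (((k : ℂ) - n) * Complex.I * θ))
      (∫ θ in (0 : ℝ)..Real.pi, Complex.exp (-2 * Complex.exp (θ * Complex.I)) *
      Complex.exp (-(n * (θ * Complex.I)))) := by
    refine intervalIntegral.hasSum_integral_of_dominated_convergence
      (fun k _ => 2 ^ k / k.factorial) (fun k => ?_) (fun k => ?_) ?_ ?_ ?_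
    · exact Continuous.aestronglyMeasurable (by fun_prop)
    · refine Eventually.of_forall fun θ _ => ?_
      have : ((k : ℂ) - n) * Complex.I * θ = (((k : ℝ) - n) * θ : ℝ) * Complex.I := by
        push_cast; ring
      rw [norm_mul, this, Complex.norm_exp_ofReal_mul_I]
      simp [c]
    · exact Eventually.of_forall fun θ _ => (hasSum_pow_div_factorial 2).summable
    · exact intervalIntegrable_const
    · refine Eventually.of_forall fun θ _ => ?_
      have h := NormedSpace.expSeries_div_hasSum_exp (-2 * Complex.exp (θ * Complex.I))
      rw [← Complex.exp_eq_exp_ℂ] at h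
      have h2 := h.mul_right (Complex.exp (-(n * (θ * Complex.I))))
      refine h2.congr_fun fun k => ?_
      have e : ((k : ℂ) - n) * Complex.I * θ = k * (θ * Complex.I) + -(n * (θ * Complex.I)) := by ring
      rw [e, Complex.exp_add, Complex.exp_nat_mul, mul_pow]
      simp only [c]
      ring
  have hre := Complex.hasSum_re hs
  have hterm : ∀ k : ℕ, k ≠ n → (∫ θ in (0 : ℝ)..Real.pi,
      c k * Complex.exp (((k : ℂ) - n) * Complex.I * θ)).re = 0 := by
    intro k hk
    have hkn : ((k : ℂ) - n) ≠ 0 := sub_ne_zero.2 (by exact_mod_cast hk)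
    have hc : (c k) = (((-2) ^ k / k.factorial : ℝ) : ℂ) := by simp [c]
    rw [intervalIntegral.integral_const_mul, integral_exp_mul_complex (mul_ne_zero hkn Complex.I_ne_zero)]
    have hp : Complex.exp (((k : ℂ) - n) * Complex.I * Real.pi) = (((-1) ^ k / (-1) ^ n : ℝ) : ℂ) := by
      have : ((k : ℂ) - n) * Complex.I * Real.pi =
          k * (Real.pi * Complex.I) - n * (Real.pi * Complex.I) := by ring
      rw [this, Complex.exp_sub, Complex.exp_nat_mul, Complex.exp_nat_mul, Complex.exp_pi_mul_I]
      push_cast; rfl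
    rw [hp, hc]
    have e : (((-2) ^ k / k.factorial : ℝ) : ℂ) * (((((-1) ^ k / (-1) ^ n : ℝ) : ℂ) -
        Complex.exp (((k : ℂ) - n) * Complex.I * (0 : ℝ))) / (((k : ℂ) - n) * Complex.I)) =
        ((-((-2) ^ k / k.factorial * (((-1) ^ k / (-1) ^ n - 1) / ((k : ℝ) - n))) : ℝ) : ℂ) *
          Complex.I := by
      push_cast
      rw [mul_zero, Complex.exp_zero]
      field_simp
      rw [Complex.I_sq]; ring
    rw [e, Complex.re_ofReal_mul, Complex.I_re, mul_zero]
  rw [hre.unique (hasSum_single n hterm)]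
  have hc : (c n) = (((-2) ^ n / n.factorial : ℝ) : ℂ) := by simp [c]
  rw [hc]
  simp only [sub_self, zero_mul, Complex.exp_zero, mul_one, intervalIntegral.integral_const, sub_zero]
  rw [Complex.smul_re, Complex.ofReal_re, smul_eq_mul]

/-- The leading Stokes coefficient does not vanish: up to nonzero real factors it is the imaginary
part of the source integral, continued along a half circle from the ray where it is real. -/
theorem stokes₁_ne_zero (hM : 1 ≤ M) : stokes₁ M ≠ 0 := by
  set T := tailIntegral (2 * rot) (fun ζ => (ζ⁻¹) ^ (M + 2)) with hT
  set h : ℝ → ℂ := fun θ => (rot⁻¹) ^ (M + 1) *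
    (Complex.exp (-(2 * rot * (Complex.exp (θ * Complex.I) / rot))) *
      T (Complex.exp (θ * Complex.I) / rot)) with hh
  set g : ℝ → ℂ := fun θ => Complex.exp (-2 * Complex.exp (θ * Complex.I)) *
      Complex.exp (-((M + 1 : ℕ) * (θ * Complex.I))) with hg
  -- `h` is the source integral at `ε = e^{iθ}`; it is real at `θ = 0`, and `θ = π` is the Stokes
  -- point.
  have hderiv : ∀ θ ∈ uIcc 0 Real.pi, HasDerivAt h (-Complex.I * g θ) θ := by
    intro θ hθ
    rw [uIcc_of_le Real.pi_pos.le] at hθ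
    have hc : Complex.exp (θ * Complex.I) / rot ∈ cone := by
      apply exp_div_rot_mem_cone_of_lt <;> simp <;> linarith [Real.pi_pos, hθ.1, hθ.2]
    have h1 : HasDerivAt (fun z : ℂ => Complex.exp (z * Complex.I) / rot)
        (Complex.exp (θ * Complex.I) * Complex.I / rot) (θ : ℂ) :=
      ((hasDerivAt_mul_const Complex.I).cexp).div_const rot
    have h2 := HasDerivAt.comp (θ : ℂ) (hasDerivAt_tailIntegral_source hM hc) h1
    refine ((h2.comp_ofReal).const_mul ((rot⁻¹) ^ (M + 1))).congr_deriv ?_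
    have e1 : 2 * rot * (Complex.exp (θ * Complex.I) / rot) = 2 * Complex.exp (θ * Complex.I) := by
      field_simp [rot_ne_zero]
    rw [e1, hg]
    simp only
    rw [Complex.exp_neg ((M + 1 : ℕ) * (θ * Complex.I)), Complex.exp_nat_mul, neg_mul, inv_div,
      div_pow, inv_pow]
    have := Complex.exp_ne_zero (θ * Complex.I)
    have := rot_ne_zero
    field_simp
    ring
  have hint := intervalIntegral.integral_eq_sub_of_hasDerivAt hderiv
    (Continuous.intervalIntegrable (by fun_prop) _ _)
  rw [intervalIntegral.integral_const_mul] at hint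
  have him := congrArg Complex.im hint
  have h0 : (h 0).im = 0 := by
    have := im_tailIntegral_source hM
    simpa [hh, hT] using this
  rw [Complex.sub_im, h0, sub_zero] at him
  have hre := re_integral_half_circle (M + 1)
  have him' : (h Real.pi).im = -(Real.pi * ((-2) ^ (M + 1) / (M + 1).factorial)) := by
    rw [← him, ← hre]; simp [hg]
  have hB : djostTerm M 1 1 stokesPoint =
      ((-(-1) ^ (M + 1) * Real.exp (-2) : ℝ) : ℂ) * h Real.pi := by
    have e0 : Complex.exp (Real.pi * Complex.I) / rot = stokesPoint := by
      rw [Complex.exp_pi_mul_I, stokesPoint]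
    have e1 : -(2 * rot * stokesPoint) = 2 := by rw [stokesPoint]; field_simp [rot_ne_zero]
    have e2 : Complex.exp (-2) * Complex.exp 2 = 1 := by rw [← Complex.exp_add]; simp
    simp only [hh, e0, e1, djostTerm, djostIter, jostIter, mul_one, ← hT]
    push_cast
    rw [one_mul]
    have e3 : stokesPoint ^ (M + 1) = (-1) ^ (M + 1) * (rot⁻¹) ^ (M + 1) := by
      rw [← mul_pow, stokesPoint, neg_one_mul, neg_div, one_div]
    rw [pow_succ] at e3
    linear_combination (-T stokesPoint) * e3 +
      ((-1) ^ (M + 1) * (rot⁻¹) ^ (M + 1) * T stokesPoint) * e2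
  rw [stokes₁, hB, Complex.im_ofReal_mul, him']
  have h1 := Real.pi_ne_zero
  have h2 : (((M + 1).factorial : ℕ) : ℝ) ≠ 0 := by exact_mod_cast Nat.factorial_ne_zero (M + 1)
  have h3 := (Real.exp_pos 1).ne'
  have h4 := (Real.exp_pos (-2)).ne'
  have h5 : ((-1 : ℝ)) ^ (M + 1) ≠ 0 := pow_ne_zero _ (by norm_num)
  have h6 : ((-2 : ℝ)) ^ (M + 1) ≠ 0 := pow_ne_zero _ (by norm_num)
  simp only [ne_eq, div_eq_zero_iff, neg_eq_zero, mul_eq_zero, h1, h2, h3,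
    h4, h5, h6, OfNat.ofNat_ne_zero, or_self, not_false_eq_true, pow_eq_zero_iff]

end

/-! ### Orders of vanishing up to logarithms -/

/-- `f w = O(e^{(n-δ) Re w})` for every `δ > 0`, on the part of `S` in the left half plane. In the
coordinate `ε = e^w` this says that `f` is `O(|ε|ⁿ)` up to a factor `|ε|^{-δ}`. -/
def SubO (S : Set ℂ) (n : ℕ) (f : ℂ → ℂ) : Prop :=
  ∀ δ : ℝ, 0 < δ → ∃ C : ℝ, ∀ w ∈ S, w.re ≤ 0 → ‖f w‖ ≤ C * Real.exp ((n - δ) * w.re)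

/-- The strip of half-width `b` around the real axis. -/
def strip (b : ℝ) : Set ℂ := {w | |w.im| ≤ b}

section
variable {S : Set ℂ} {n k : ℕ} {f g : ℂ → ℂ}

theorem mem_strip {b : ℝ} {w : ℂ} : w ∈ strip b ↔ |w.im| ≤ b := Iff.rfl

theorem strip_mono {b c : ℝ} (h : b ≤ c) : strip b ⊆ strip c := fun _ hw => le_trans hw h

theorem SubO.nonneg_const (h : SubO S n f) {δ : ℝ} (hδ : 0 < δ) :
    ∃ C : ℝ, 0 ≤ C ∧ ∀ w ∈ S, w.re ≤ 0 → ‖f w‖ ≤ C * Real.exp ((n - δ) * w.re) := by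
  obtain ⟨C, hC⟩ := h δ hδ
  exact ⟨max C 0, le_max_right _ _, fun w hw hre => (hC w hw hre).trans
    (mul_le_mul_of_nonneg_right (le_max_left _ _) (Real.exp_pos _).le)⟩

theorem SubO.subset (h : SubO S n f) {T : Set ℂ} (hT : T ⊆ S) : SubO T n f := fun δ hδ => by
  obtain ⟨C, hC⟩ := h δ hδ
  exact ⟨C, fun w hw => hC w (hT hw)⟩

theorem SubO.congr (h : SubO S n f) (hfg : ∀ w ∈ S, w.re ≤ 0 → f w = g w) : SubO S n g :=
  fun δ hδ => by
  obtain ⟨C, hC⟩ := h δ hδ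
  exact ⟨C, fun w hw hre => hfg w hw hre ▸ hC w hw hre⟩

theorem SubO.mono (h : SubO S n f) (hk : k ≤ n) : SubO S k f := fun δ hδ => by
  obtain ⟨C, hC0, hC⟩ := h.nonneg_const hδ
  refine ⟨C, fun w hw hre => (hC w hw hre).trans ?_⟩
  have : (k : ℝ) ≤ n := by exact_mod_cast hk
  refine mul_le_mul_of_nonneg_left (Real.exp_le_exp.2 ?_) hC0
  nlinarith

theorem SubO.add (hf : SubO S n f) (hg : SubO S n g) : SubO S n (fun w => f w + g w) :=
  fun δ hδ => by
  obtain ⟨C, hC⟩ := hf δ hδ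
  obtain ⟨D, hD⟩ := hg δ hδ
  refine ⟨C + D, fun w hw hre => (norm_add_le _ _).trans ?_⟩
  rw [add_mul]
  exact add_le_add (hC w hw hre) (hD w hw hre)

theorem SubO.const_mul (hf : SubO S n f) (c : ℂ) : SubO S n (fun w => c * f w) := fun δ hδ => by
  obtain ⟨C, hC⟩ := hf δ hδ
  refine ⟨‖c‖ * C, fun w hw hre => ?_⟩
  rw [norm_mul, mul_assoc]
  exact mul_le_mul_of_nonneg_left (hC w hw hre) (norm_nonneg _)

theorem SubO.sub (hf : SubO S n f) (hg : SubO S n g) : SubO S n (fun w => f w - g w) :=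
  (hf.add (hg.const_mul (-1))).congr fun w _ _ => by ring

theorem SubO.mul (hf : SubO S n f) (hg : SubO S k g) : SubO S (n + k) (fun w => f w * g w) :=
  fun δ hδ => by
  obtain ⟨C, hC0, hC⟩ := hf.nonneg_const (half_pos hδ)
  obtain ⟨D, hD0, hD⟩ := hg.nonneg_const (half_pos hδ)
  refine ⟨C * D, fun w hw hre => ?_⟩
  rw [norm_mul]
  calc _ ≤ (C * Real.exp ((n - δ / 2) * w.re)) * (D * Real.exp ((k - δ / 2) * w.re)) :=
        mul_le_mul (hC w hw hre) (hD w hw hre) (norm_nonneg _) (by positivity)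
    _ = C * D * (Real.exp ((n - δ / 2) * w.re) * Real.exp ((k - δ / 2) * w.re)) := by ring
    _ = _ := by rw [← Real.exp_add]; congr 2; push_cast; ring

theorem subO_zero_of_bounded {C : ℝ} (h : ∀ w ∈ S, w.re ≤ 0 → ‖f w‖ ≤ C) : SubO S 0 f :=
  fun δ hδ => by
  refine ⟨max C 0, fun w hw hre => (h w hw hre).trans ((le_max_left C 0).trans ?_)⟩
  refine le_mul_of_one_le_right (le_max_right _ _) (Real.one_le_exp ?_)
  push_cast; nlinarith

theorem subO_const (S : Set ℂ) (c : ℂ) : SubO S 0 (fun _ => c) :=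
  subO_zero_of_bounded (C := ‖c‖) fun _ _ _ => le_rfl

theorem subO_exp (S : Set ℂ) (k : ℕ) : SubO S k (fun w => Complex.exp (k * w)) := fun δ hδ => by
  refine ⟨1, fun w _ hre => ?_⟩
  rw [Complex.norm_exp, one_mul]
  refine Real.exp_le_exp.2 ?_
  have : ((k : ℂ) * w).re = k * w.re := by simp
  rw [this]
  nlinarith

theorem subO_id (b : ℝ) : SubO (strip b) 0 (fun w => w) := fun δ hδ => by
  refine ⟨1 / δ + |b|, fun w hw hre => ?_⟩
  have h1 := Complex.norm_le_abs_re_add_abs_im w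
  have h2 : |w.im| ≤ |b| := (mem_strip.1 hw).trans (le_abs_self b)
  have h3 : δ * (-w.re) ≤ Real.exp (δ * (-w.re)) := by linarith [Real.add_one_le_exp (δ * (-w.re))]
  have h4 : 1 ≤ Real.exp (δ * (-w.re)) := Real.one_le_exp (by nlinarith)
  have h5 : |w.re| ≤ 1 / δ * Real.exp (δ * (-w.re)) := by
    rw [abs_of_nonpos hre, one_div, ← div_eq_inv_mul, le_div_iff₀ hδ]; linarith
  have h6 : ((0 : ℕ) - δ) * w.re = δ * (-w.re) := by push_cast; ring
  rw [h6]
  nlinarith [abs_nonneg b]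

/-- A function that is small to all orders below `n` tends to zero against lower powers. -/
theorem SubO.tendsto_zero (h : SubO S n f) {k : ℕ} (hk : k < n) (hS : ∀ s : ℝ, (s : ℂ) ∈ S) :
    Tendsto (fun s : ℝ => f s * Complex.exp (-(k * s))) atBot (𝓝 0) := by
  obtain ⟨C, hC0, hC⟩ := h.nonneg_const (half_pos one_pos)
  have hlim : Tendsto (fun s : ℝ => C * Real.exp (1 / 2 * s)) atBot (𝓝 0) := by
    simpa using (Real.tendsto_exp_atBot.comp
      (tendsto_id.const_mul_atBot (by norm_num : (0 : ℝ) < 1 / 2))).const_mul C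
  refine squeeze_zero_norm' ?_ hlim
  filter_upwards [eventually_le_atBot 0] with s hs
  have h1 := hC s (hS s) (by simpa using hs)
  have h2 : ‖Complex.exp (-(k * s))‖ = Real.exp (-(k * s)) := by
    rw [Complex.norm_exp]; simp
  rw [norm_mul, h2]
  have hkn : (k : ℝ) + 1 ≤ n := by exact_mod_cast hk
  calc _ ≤ C * Real.exp ((n - 1 / 2) * s) * Real.exp (-(k * s)) := by
        gcongr; simpa using h1
    _ = C * Real.exp ((n - 1 / 2) * s + -(k * s)) := by rw [mul_assoc, Real.exp_add]
    _ ≤ _ := by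
      refine mul_le_mul_of_nonneg_left (Real.exp_le_exp.2 ?_) hC0
      nlinarith

end

/-! ### Functions with a small jump -/

/-- The difference of the values of `F` on the two sides of the negative `ε`-axis. -/
noncomputable def jump (F : ℂ → ℂ) (w : ℂ) : ℂ :=
  F (w + Real.pi * Complex.I) - F (w - Real.pi * Complex.I)

/-- In the strip `|Im w| ≤ 3π/4` the point `e^w` stays away from the negative axis, relative to its
size. -/
theorem half_max_le_norm_add {w : ℂ} (hw : w ∈ strip (3 * Real.pi / 4)) {t : ℝ} (ht : 0 ≤ t) :
    max t ‖Complex.exp w‖ / 2 ≤ ‖(t : ℂ) + Complex.exp w‖ := by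
  have hcos : -(√2 / 2) ≤ Real.cos w.im := by
    rw [← Real.cos_abs, ← Real.cos_pi_div_four, ← Real.cos_pi_sub]
    refine Real.cos_le_cos_of_nonneg_of_le_pi (abs_nonneg _) (by linarith [Real.pi_pos]) ?_
    have := mem_strip.1 hw
    linarith
  have h2 : √2 ≤ 3 / 2 := by
    rw [Real.sqrt_le_left (by norm_num)]; norm_num
  set r := Real.exp w.re with hr
  have hr0 : 0 < r := Real.exp_pos _
  have hn : ‖Complex.exp w‖ = r := Complex.norm_exp w
  have hsq : ‖(t : ℂ) + Complex.exp w‖ ^ 2 = t ^ 2 + 2 * t * (r * Real.cos w.im) + r ^ 2 := by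
    rw [← Complex.normSq_eq_norm_sq, Complex.normSq_apply]
    simp only [Complex.add_re, Complex.ofReal_re, Complex.add_im, Complex.ofReal_im, Complex.exp_re,
      Complex.exp_im]
    have := Real.sin_sq_add_cos_sq w.im
    linear_combination r ^ 2 * this
  have hlow : t ^ 2 + r ^ 2 - 3 / 2 * (t * r) ≤ ‖(t : ℂ) + Complex.exp w‖ ^ 2 := by
    rw [hsq]
    have : 0 ≤ t * r := by positivity
    nlinarith
  rw [hn]
  refine (pow_le_pow_iff_left₀ (by positivity) (norm_nonneg _) two_ne_zero).1 (le_trans ?_ hlow)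
  rcases max_choice t r with h | h <;> rw [h]
  · nlinarith [sq_nonneg (t * (3/4) - r)]
  · nlinarith [sq_nonneg (r * (3/4) - t)]

/-- The quotient of difference quotients is the Cauchy kernel in the variable `e^w`. -/
theorem dslope_mul_exp_div {F : ℂ → ℂ} {w₀ w : ℂ} (h : Complex.exp w ≠ Complex.exp w₀) :
    dslope F w₀ w * Complex.exp w / dslope Complex.exp w₀ w =
      (F w - F w₀) * (Complex.exp w / (Complex.exp w - Complex.exp w₀)) := by
  have hne : w ≠ w₀ := fun e => h (by rw [e])
  have h1 : w - w₀ ≠ 0 := sub_ne_zero.2 hne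
  have h2 : Complex.exp w - Complex.exp w₀ ≠ 0 := sub_ne_zero.2 h
  rw [dslope_of_ne _ hne, dslope_of_ne _ hne, slope_def_field, slope_def_field]
  field_simp

/-- The exponential is injective where one of the two points lies in the open strip of half-width
`π` and the other in the closed one, so its difference quotient has no zero. -/
theorem dslope_exp_ne_zero {w₀ w : ℂ} (h₀ : |w₀.im| < Real.pi) (h : |w.im| ≤ Real.pi) :
    dslope Complex.exp w₀ w ≠ 0 := by
  by_cases hw : w = w₀
  · rw [hw, dslope_same, Complex.deriv_exp]; exact Complex.exp_ne_zero _
  · rw [dslope_of_ne _ hw, slope_def_field]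
    refine div_ne_zero (sub_ne_zero.2 fun he => hw ?_) (sub_ne_zero.2 hw)
    obtain ⟨k, hk⟩ := Complex.exp_eq_exp_iff_exists_int.1 he
    have him := congrArg Complex.im hk
    have e : (w₀ + k * (2 * Real.pi * Complex.I)).im = w₀.im + k * (2 * Real.pi) := by simp
    rw [e] at him
    rw [abs_lt] at h₀
    rw [abs_le] at h
    have hp := Real.pi_pos
    have hk1 : (k : ℝ) < 1 := by nlinarith
    have hk2 : (-1 : ℝ) < k := by nlinarith
    have hk0 : k = 0 := by
      have : k < 1 := by exact_mod_cast hk1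
      have : -1 < k := by exact_mod_cast hk2
      omega
    rw [hk, hk0]; simp

/-- `F` is holomorphic in a strip larger than `|Im w| ≤ π` and, in the left half plane, bounded up
to factors `e^{-δ Re w}`. -/
structure LogHolomorphic (F : ℂ → ℂ) : Prop where
  diff : ∀ w : ℂ, |w.im| < 13 * Real.pi / 12 → DifferentiableAt ℂ F w
  subO : SubO (strip Real.pi) 0 F

/-- The Cauchy kernel on the lower and upper edges of the strip, where `e^w = -e^s`. -/
noncomputable def edgeKernel (w₀ : ℂ) (s : ℝ) : ℂ :=
  Real.exp s / (Real.exp s + Complex.exp w₀)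

/-- The Cauchy kernel on the imaginary axis. -/
noncomputable def circleKernel (w₀ : ℂ) (y : ℝ) : ℂ :=
  Complex.exp (y * Complex.I) / (Complex.exp (y * Complex.I) - Complex.exp w₀)

section
variable {F : ℂ → ℂ} {w₀ : ℂ}

theorem edge_ne_zero (hw : w₀ ∈ strip (3 * Real.pi / 4)) (s : ℝ) :
    (Real.exp s : ℂ) + Complex.exp w₀ ≠ 0 := by
  have h := half_max_le_norm_add hw (Real.exp_pos s).le
  have h1 := (Real.exp_pos s).trans_le (le_max_left (Real.exp s) ‖Complex.exp w₀‖)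
  exact norm_pos_iff.1 (by linarith)

theorem circle_ne_zero (hre : w₀.re < 0) (y : ℝ) :
    Complex.exp (y * Complex.I) - Complex.exp w₀ ≠ 0 := by
  intro h
  have h1 := congrArg norm (sub_eq_zero.1 h)
  rw [Complex.norm_exp_ofReal_mul_I, Complex.norm_exp] at h1
  linarith [(Real.exp_lt_one_iff.2 hre)]

theorem continuous_edgeKernel (hw : w₀ ∈ strip (3 * Real.pi / 4)) :
    Continuous (edgeKernel w₀) := by
  unfold edgeKernel
  exact Continuous.div (by fun_prop) (by fun_prop) (edge_ne_zero hw)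

theorem continuous_circleKernel (hre : w₀.re < 0) : Continuous (circleKernel w₀) := by
  unfold circleKernel
  exact Continuous.div (by fun_prop) (by fun_prop) (circle_ne_zero hre)

theorem LogHolomorphic.continuous_line (hF : LogHolomorphic F) {b : ℝ} (hb : |b| ≤ Real.pi) :
    Continuous fun x : ℝ => F (x + b * Complex.I) := by
  refine continuous_iff_continuousAt.2 fun x => ?_
  have h1 : |((x : ℂ) + b * Complex.I).im| < 13 * Real.pi / 12 := by
    simp; linarith [Real.pi_pos]
  exact (hF.diff _ h1).continuousAt.comp (f := fun x : ℝ => (x : ℂ) + b * Complex.I) (by fun_prop)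

theorem LogHolomorphic.continuous_jump (hF : LogHolomorphic F) :
    Continuous fun x : ℝ => jump F x := by
  have h1 := hF.continuous_line (b := Real.pi) (by rw [abs_of_pos Real.pi_pos])
  have h2 := hF.continuous_line (b := -Real.pi) (by rw [abs_neg, abs_of_pos Real.pi_pos])
  refine (h1.sub h2).congr fun x => ?_
  simp [jump, sub_eq_add_neg]

theorem LogHolomorphic.continuous_imag (hF : LogHolomorphic F) (a : ℝ) :
    ContinuousOn (fun y : ℝ => F (a + y * Complex.I)) (uIcc (-Real.pi) Real.pi) := by
  intro y hy
  rw [uIcc_of_le (by linarith [Real.pi_pos])] at hy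
  have h1 : |((a : ℂ) + y * Complex.I).im| < 13 * Real.pi / 12 := by
    have := abs_le.2 ⟨hy.1, hy.2⟩
    simp; linarith [Real.pi_pos]
  exact ((hF.diff _ h1).continuousAt.comp (f := fun y : ℝ => (a : ℂ) + y * Complex.I)
    (by fun_prop)).continuousWithinAt

/-- Cauchy's theorem on the rectangle `-L ≤ Re w ≤ 0`, `|Im w| ≤ π`. The kernel takes the same
values on the two horizontal edges, so that these combine to an integral of the jump. -/
theorem LogHolomorphic.rect_identity (hF : LogHolomorphic F)
    (hw : w₀ ∈ strip (3 * Real.pi / 4)) (hre : w₀.re < 0) {L : ℝ} (hL : -L < w₀.re) :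
    (∫ s in -L..0, jump F s * edgeKernel w₀ s) = Complex.I *
      (∫ y in -Real.pi..Real.pi, (F (y * Complex.I) - F w₀) * circleKernel w₀ y) -
      Complex.I * (∫ y in -Real.pi..Real.pi, (F (-L + y * Complex.I) - F w₀) *
        (Complex.exp (-L + y * Complex.I) /
          (Complex.exp (-L + y * Complex.I) - Complex.exp w₀))) := by
  have hpi := Real.pi_pos
  have h₀ : |w₀.im| < Real.pi := by have := mem_strip.1 hw; linarith
  set f : ℂ → ℂ := fun w => dslope F w₀ w * Complex.exp w / dslope Complex.exp w₀ w with hf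
  set U : Set ℂ := {w | |w.im| < 13 * Real.pi / 12}
  have hU : IsOpen U := isOpen_lt (by fun_prop) continuous_const
  have hfd : ∀ w : ℂ, |w.im| ≤ Real.pi → DifferentiableAt ℂ f w := by
    intro w hwi
    have hwU : U ∈ 𝓝 w := hU.mem_nhds (by change |w.im| < _; linarith)
    have hw₀U : U ∈ 𝓝 w₀ := hU.mem_nhds (by change |w₀.im| < _; linarith)
    have h1 : DifferentiableAt ℂ (dslope F w₀) w := ((Complex.differentiableOn_dslope hw₀U).2
      fun z hz => (hF.diff z hz).differentiableWithinAt).differentiableAt hwU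
    have h2 : DifferentiableAt ℂ (dslope Complex.exp w₀) w :=
      ((Complex.differentiableOn_dslope univ_mem).2
        Complex.differentiable_exp.differentiableOn).differentiableAt univ_mem
    exact (h1.mul Complex.differentiableAt_exp).div h2 (dslope_exp_ne_zero h₀ hwi)
  have hrect := Complex.integral_boundary_rect_eq_zero_of_differentiableOn f
    (-L + (-Real.pi : ℝ) * Complex.I) (Real.pi * Complex.I) (by
      intro w hw'
      refine (hfd w ?_).differentiableWithinAt
      have := hw'.2
      simp only [mem_preimage, Complex.add_im, Complex.neg_im, Complex.ofReal_im, neg_zero,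
        Complex.mul_im, Complex.ofReal_re, Complex.I_im, mul_one, Complex.I_re, mul_zero, add_zero,
        zero_add] at this
      rw [uIcc_of_le (by linarith)] at this
      exact abs_le.2 this)
  simp only [Complex.add_im, Complex.neg_im, Complex.ofReal_im, neg_zero, Complex.mul_im,
    Complex.ofReal_re, Complex.I_im, mul_one, Complex.I_re, mul_zero, add_zero, zero_add,
    Complex.add_re, Complex.neg_re, Complex.mul_re, sub_zero, Complex.ofReal_zero,
    smul_eq_mul, Complex.ofReal_neg] at hrect
  have hcont : ∀ b : ℝ, |b| ≤ Real.pi → Continuous fun x : ℝ => f (x + b * Complex.I) := by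
    intro b hb
    refine continuous_iff_continuousAt.2 fun x => ?_
    exact (hfd (x + b * Complex.I) (by simpa using hb)).continuousAt.comp
      (f := fun x : ℝ => (x : ℂ) + b * Complex.I) (by fun_prop)
  have hc1 := hcont (-Real.pi) (by rw [abs_neg, abs_of_pos hpi])
  have hc2 := hcont Real.pi (by rw [abs_of_pos hpi])
  simp only [Complex.ofReal_neg] at hc1
  rw [← intervalIntegral.integral_sub (hc1.intervalIntegrable _ _) (hc2.intervalIntegrable _ _)]
    at hrect
  have e1 : ∀ x : ℝ, f (x + -Real.pi * Complex.I) - f (x + Real.pi * Complex.I) =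
      -(jump F x * edgeKernel w₀ x) := by
    intro x
    have a1 : Complex.exp (x + -Real.pi * Complex.I) = -(Real.exp x : ℂ) := by
      rw [Complex.exp_add, neg_mul, Complex.exp_neg, Complex.exp_pi_mul_I]; simp
    have a2 : Complex.exp (x + Real.pi * Complex.I) = -(Real.exp x : ℂ) := exp_add_pi_mul_I x
    have hne : -(Real.exp x : ℂ) ≠ Complex.exp w₀ := fun h =>
      edge_ne_zero hw x (by rw [← h]; ring)
    have hne' := edge_ne_zero hw x
    have hne2 : -(Real.exp x : ℂ) - Complex.exp w₀ ≠ 0 := sub_ne_zero.2 hne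
    rw [hf]
    simp only
    rw [dslope_mul_exp_div (by rw [a1]; exact hne), dslope_mul_exp_div (by rw [a2]; exact hne), a1, a2]
    have e : -(Real.exp x : ℂ) / (-(Real.exp x : ℂ) - Complex.exp w₀) = edgeKernel w₀ x := by
      rw [edgeKernel, ← neg_add', neg_div_neg_eq]
    rw [e, jump, sub_eq_add_neg (x : ℂ), ← neg_mul]
    ring_nf
  have e2 : ∀ y : ℝ, f (y * Complex.I) = (F (y * Complex.I) - F w₀) * circleKernel w₀ y := by
    intro y
    rw [hf]
    exact dslope_mul_exp_div (sub_ne_zero.1 (circle_ne_zero hre y))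
  have e3 : ∀ y : ℝ, f (-L + y * Complex.I) = (F (-L + y * Complex.I) - F w₀) *
        (Complex.exp (-L + y * Complex.I) /
          (Complex.exp (-L + y * Complex.I) - Complex.exp w₀)) := by
    intro y
    rw [hf]
    refine dslope_mul_exp_div fun h => ?_
    have h1 := congrArg norm h
    rw [Complex.norm_exp, Complex.norm_exp, Real.exp_eq_exp] at h1
    simp at h1
    linarith
  simp only [e1, e2, e3, intervalIntegral.integral_neg] at hrect
  linear_combination -hrect

theorem integral_circleKernel (hre : w₀.re < 0) :
    ∫ y in -Real.pi..Real.pi, circleKernel w₀ y = 2 * Real.pi := by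
  have h := circleIntegral.integral_sub_inv_of_mem_ball (c := 0) (R := 1) (w := Complex.exp w₀)
    (by rw [mem_ball_zero_iff, Complex.norm_exp]; exact (Real.exp_lt_one_iff.2 hre))
  have hper : Function.Periodic (circleKernel w₀) (2 * Real.pi) := by
    intro y
    have : Complex.exp (((y + 2 * Real.pi : ℝ) : ℂ) * Complex.I) = Complex.exp (y * Complex.I) := by
      rw [← Complex.exp_periodic (y * Complex.I)]; congr 1; push_cast; ring
    rw [circleKernel, this, circleKernel]
  have h2 := hper.intervalIntegral_add_eq (-Real.pi) 0
  rw [show -Real.pi + 2 * Real.pi = Real.pi by ring, zero_add] at h2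
  rw [h2]
  have h3 : (∮ z in C(0, 1), (z - Complex.exp w₀)⁻¹) =
      Complex.I * ∫ y in 0..2 * Real.pi, circleKernel w₀ y := by
    rw [circleIntegral, ← intervalIntegral.integral_const_mul]
    refine intervalIntegral.integral_congr fun y _ => ?_
    simp only [deriv_circleMap, circleMap, circleKernel, Complex.ofReal_one, one_mul, zero_add,
      smul_eq_mul]
    ring
  rw [h3] at h
  apply mul_left_cancel₀ Complex.I_ne_zero
  rw [h]; ring

end

section
variable {F : ℂ → ℂ} {w₀ : ℂ} {N : ℕ}

/-- The kernel is bounded by `2 t / max(t, |ε|)`, where `t = e^s`, and hence by `2 (t/|ε|)^δ` for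
every `0 ≤ δ ≤ 1`. -/
theorem norm_edgeKernel_le (hw : w₀ ∈ strip (3 * Real.pi / 4)) {δ : ℝ} (hδ : 0 ≤ δ) (hδ1 : δ ≤ 1)
    (s : ℝ) : ‖edgeKernel w₀ s‖ ≤ 2 * Real.exp (δ * (s - w₀.re)) := by
  have h := half_max_le_norm_add hw (Real.exp_pos s).le
  rw [Complex.norm_exp] at h
  have hs := Real.exp_pos s
  have hn : 0 < ‖(Real.exp s : ℂ) + Complex.exp w₀‖ := norm_pos_iff.2 (edge_ne_zero hw s)
  rw [edgeKernel, norm_div, Complex.norm_of_nonneg hs.le, div_le_iff₀ hn]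
  have key : Real.exp s ≤ Real.exp (δ * (s - w₀.re)) * max (Real.exp s) (Real.exp w₀.re) := by
    rcases le_total s w₀.re with hle | hle
    · rw [max_eq_right (Real.exp_le_exp.2 hle), ← Real.exp_add, Real.exp_le_exp]
      nlinarith
    · rw [max_eq_left (Real.exp_le_exp.2 hle)]
      exact le_mul_of_one_le_left hs.le (Real.one_le_exp (mul_nonneg hδ (by linarith)))
  nlinarith [Real.exp_pos (δ * (s - w₀.re))]

theorem integrableOn_jump_mul (hF : LogHolomorphic F) (hJ : SubO (strip 0) N (jump F)) {g : ℝ → ℂ}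
    (hg : Continuous g) {k : ℕ} (hk : k < N) {D : ℝ}
    (hD : ∀ s : ℝ, s ≤ 0 → ‖g s‖ ≤ D * Real.exp (-(k * s))) :
    MeasureTheory.IntegrableOn (fun s : ℝ => jump F s * g s) (Iic 0) := by
  obtain ⟨C, hC0, hC⟩ := hJ.nonneg_const (half_pos one_pos)
  have hkN : (k : ℝ) + 1 ≤ N := by exact_mod_cast hk
  have hD0 : 0 ≤ D := by have := (norm_nonneg _).trans (hD 0 le_rfl); simpa using this
  refine MeasureTheory.Integrable.mono'
    ((integrableOn_exp_mul_Iic (half_pos one_pos) 0).const_mul (C * D))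
    (hF.continuous_jump.mul hg).aestronglyMeasurable ?_
  filter_upwards [MeasureTheory.ae_restrict_mem measurableSet_Iic] with s hs
  have hs : s ≤ 0 := hs
  have h1 := hC s (by simp [mem_strip]) (by simpa using hs)
  rw [Complex.ofReal_re] at h1
  rw [norm_mul]
  calc _ ≤ C * Real.exp ((N - 1 / 2) * s) * (D * Real.exp (-(k * s))) :=
        mul_le_mul h1 (hD s hs) (norm_nonneg _) (by positivity)
    _ = C * D * Real.exp ((N - 1 / 2) * s + -(k * s)) := by rw [Real.exp_add]; ring
    _ ≤ _ := by
      refine mul_le_mul_of_nonneg_left (Real.exp_le_exp.2 ?_) (by positivity)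
      nlinarith

/-- The left edge of the rectangle does not contribute in the limit. -/
theorem LogHolomorphic.tendsto_left_edge (hF : LogHolomorphic F) (w₀ : ℂ) :
    Tendsto (fun L : ℝ => ∫ y in -Real.pi..Real.pi, (F (-L + y * Complex.I) - F w₀) *
        (Complex.exp (-L + y * Complex.I) /
          (Complex.exp (-L + y * Complex.I) - Complex.exp w₀))) atTop (𝓝 0) := by
  have hpi := Real.pi_pos
  obtain ⟨C, hC0, hC⟩ := hF.subO.nonneg_const (half_pos one_pos)
  set e := ‖Complex.exp w₀‖ with he
  have he0 : 0 < e := norm_pos_iff.2 (Complex.exp_ne_zero _)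
  have hexp : ∀ a : ℝ, 0 < a → Tendsto (fun L : ℝ => Real.exp (-(a * L))) atTop (𝓝 0) := fun a ha =>
    Real.tendsto_exp_neg_atTop_nhds_zero.comp (tendsto_id.const_mul_atTop ha)
  have hlim : Tendsto (fun L : ℝ => (C * Real.exp (-(1 / 2 * L)) + ‖F w₀‖ * Real.exp (-(1 * L))) *
      (2 / e) * |Real.pi - -Real.pi|) atTop (𝓝 0) := by
    have := ((((hexp (1 / 2) (by norm_num)).const_mul C).add
      ((hexp 1 one_pos).const_mul ‖F w₀‖)).mul_const (2 / e)).mul_const |Real.pi - -Real.pi|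
    simpa using this
  refine squeeze_zero_norm' ?_ hlim
  have hsmall : ∀ᶠ L : ℝ in atTop, Real.exp (-(1 * L)) < e / 2 :=
    (hexp 1 one_pos).eventually_lt_const (by positivity)
  filter_upwards [hsmall, eventually_ge_atTop 0] with L hL hL0
  refine intervalIntegral.norm_integral_le_of_norm_le_const fun y hy => ?_
  rw [uIoc_of_le (by linarith)] at hy
  have hre : ((-L : ℂ) + y * Complex.I).re = -L := by simp
  have him : ((-L : ℂ) + y * Complex.I).im = y := by simp
  have h1 := hC (-L + y * Complex.I) (by rw [mem_strip, him, abs_le]; exact ⟨hy.1.le, hy.2⟩)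
    (by rw [hre]; linarith)
  rw [hre] at h1
  have hn : ‖Complex.exp (-L + y * Complex.I)‖ = Real.exp (-(1 * L)) := by
    rw [Complex.norm_exp, hre, one_mul]
  have h2 : e / 2 ≤ ‖Complex.exp (-L + y * Complex.I) - Complex.exp w₀‖ := by
    have := norm_sub_norm_le (Complex.exp w₀) (Complex.exp (-L + y * Complex.I))
    rw [norm_sub_rev, hn, ← he] at this
    linarith
  have h3 : ‖Complex.exp (-L + y * Complex.I) /
      (Complex.exp (-L + y * Complex.I) - Complex.exp w₀)‖ ≤ Real.exp (-(1 * L)) * (2 / e) := by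
    rw [norm_div, hn, div_eq_mul_inv, ← inv_div e 2]
    gcongr
  rw [norm_mul]
  calc _ ≤ (C * Real.exp (((0 : ℕ) - 1 / 2) * -L) + ‖F w₀‖) * (Real.exp (-(1 * L)) * (2 / e)) :=
        mul_le_mul ((norm_sub_le _ _).trans (by linarith)) h3 (norm_nonneg _) (by positivity)
    _ = (C * (Real.exp (((0 : ℕ) - 1 / 2) * -L) * Real.exp (-(1 * L))) +
          ‖F w₀‖ * Real.exp (-(1 * L))) * (2 / e) := by ring
    _ = _ := by rw [← Real.exp_add]; congr 5; push_cast; ring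

/-- Cauchy's formula in the variable `e^w`, on the slit disc. -/
theorem LogHolomorphic.cauchy_formula (hF : LogHolomorphic F) (hN : 1 ≤ N)
    (hJ : SubO (strip 0) N (jump F)) (hw : w₀ ∈ strip (3 * Real.pi / 4)) (hre : w₀.re < 0) :
    2 * Real.pi * F w₀ = (∫ y in -Real.pi..Real.pi, F (y * Complex.I) * circleKernel w₀ y) +
      Complex.I * ∫ s in Iic (0 : ℝ), jump F s * edgeKernel w₀ s := by
  have hint : MeasureTheory.IntegrableOn (fun s : ℝ => jump F s * edgeKernel w₀ s) (Iic 0) := by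
    refine integrableOn_jump_mul hF hJ (continuous_edgeKernel hw) (k := 0) (by omega) (D := 2)
      fun s _ => ?_
    simpa using norm_edgeKernel_le hw le_rfl zero_le_one s
  have h1 := MeasureTheory.intervalIntegral_tendsto_integral_Iic 0 hint tendsto_neg_atTop_atBot
  have hc0 : ContinuousOn (fun y : ℝ => F (y * Complex.I)) (uIcc (-Real.pi) Real.pi) := by
    simpa using hF.continuous_imag 0
  have hck := (continuous_circleKernel hre).continuousOn (s := uIcc (-Real.pi) Real.pi)
  have hsplit : (∫ y in -Real.pi..Real.pi, (F (y * Complex.I) - F w₀) * circleKernel w₀ y) =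
      (∫ y in -Real.pi..Real.pi, F (y * Complex.I) * circleKernel w₀ y) - F w₀ * (2 * Real.pi) := by
    have := intervalIntegral.integral_sub (μ := MeasureTheory.volume)
      (hc0.mul hck).intervalIntegrable (continuousOn_const (c := F w₀) |>.mul hck).intervalIntegrable
    simp only [Pi.mul_apply] at this
    rw [← integral_circleKernel hre, ← intervalIntegral.integral_const_mul, ← this]
    simp only [sub_mul]
  have h2 : Tendsto (fun L : ℝ => ∫ s in -L..0, jump F s * edgeKernel w₀ s) atTop
      (𝓝 (Complex.I * ((∫ y in -Real.pi..Real.pi, F (y * Complex.I) * circleKernel w₀ y) -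
        F w₀ * (2 * Real.pi)) - Complex.I * 0)) := by
    refine Tendsto.congr' ?_ (tendsto_const_nhds.sub ((hF.tendsto_left_edge w₀).const_mul Complex.I))
    filter_upwards [eventually_gt_atTop (-w₀.re)] with L hL
    rw [hF.rect_identity hw hre (by linarith), hsplit]
  rw [tendsto_nhds_unique h1 h2, mul_zero, sub_zero, ← mul_assoc, Complex.I_mul_I]
  ring

/-- The finite geometric expansion of the Cauchy kernel. -/
theorem cauchy_kernel_expansion {z ε : ℂ} (hz : z ≠ 0) (h : z - ε ≠ 0) (N : ℕ) :
    z / (z - ε) = ∑ k ∈ Finset.range N, ε ^ k * (z⁻¹) ^ k +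
      ε ^ N * ((z⁻¹) ^ N * (z / (z - ε))) := by
  induction N with
  | zero => simp
  | succ N ih =>
    have e : z / (z - ε) = 1 + ε * z⁻¹ * (z / (z - ε)) := by field_simp; ring
    rw [Finset.sum_range_succ]
    conv_lhs => rw [ih]
    have e2 : ε ^ N * ((z⁻¹) ^ N * (z / (z - ε))) =
        ε ^ N * (z⁻¹) ^ N + ε ^ (N + 1) * ((z⁻¹) ^ (N + 1) * (z / (z - ε))) := by
      conv_lhs => rw [e]
      ring
    rw [e2, add_assoc]

/-- The Taylor coefficients, up to the factor `2π`, of a function with small jump. -/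
noncomputable def logTaylor (F : ℂ → ℂ) (k : ℕ) : ℂ :=
  (∫ y in -Real.pi..Real.pi, F (y * Complex.I) * ((Complex.exp (y * Complex.I))⁻¹) ^ k) +
    Complex.I * ∫ s in Iic (0 : ℝ), jump F s * ((-(Real.exp s : ℂ))⁻¹) ^ k

/-- The finite geometric expansion of the kernel, inserted in Cauchy's formula. The integrals in
`logTaylor` converge at the slit because the jump vanishes to order `N`. -/
theorem LogHolomorphic.taylor_remainder (hF : LogHolomorphic F) (hN : 1 ≤ N)
    (hJ : SubO (strip 0) N (jump F)) (hw : w₀ ∈ strip (3 * Real.pi / 4)) (hre : w₀.re < 0) :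
    2 * Real.pi * F w₀ - ∑ k ∈ Finset.range N, Complex.exp w₀ ^ k * logTaylor F k =
      Complex.exp w₀ ^ N * ((∫ y in -Real.pi..Real.pi, F (y * Complex.I) *
        (((Complex.exp (y * Complex.I))⁻¹) ^ N * circleKernel w₀ y)) +
      Complex.I * ∫ s in Iic (0 : ℝ), jump F s *
        (((-(Real.exp s : ℂ))⁻¹) ^ N * edgeKernel w₀ s)) := by
  set ε := Complex.exp w₀ with hε
  have hc0 : ContinuousOn (fun y : ℝ => F (y * Complex.I)) (uIcc (-Real.pi) Real.pi) := by
    simpa using hF.continuous_imag 0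
  have hck := (continuous_circleKernel hre).continuousOn (s := uIcc (-Real.pi) Real.pi)
  have hek := continuous_edgeKernel hw
  have hcinv : ∀ k : ℕ, Continuous fun y : ℝ => ((Complex.exp (y * Complex.I))⁻¹) ^ k := fun k =>
    (Continuous.inv₀ (by fun_prop) fun y => Complex.exp_ne_zero _).pow k
  have hsinv : ∀ k : ℕ, Continuous fun s : ℝ => ((-(Real.exp s : ℂ))⁻¹) ^ k := fun k =>
    (Continuous.inv₀ (by fun_prop) fun s =>
      neg_ne_zero.2 (by exact_mod_cast (Real.exp_pos s).ne')).pow k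
  have hsn : ∀ (k : ℕ) (s : ℝ), ‖((-(Real.exp s : ℂ))⁻¹) ^ k‖ = Real.exp (-(k * s)) := by
    intro k s
    rw [norm_pow, norm_inv, norm_neg, Complex.norm_of_nonneg (Real.exp_pos s).le, ← Real.exp_neg,
      ← Real.exp_nat_mul]
    congr 1; ring
  have hI1 : ∀ k : ℕ, k < N → MeasureTheory.IntegrableOn
      (fun s : ℝ => jump F s * ((-(Real.exp s : ℂ))⁻¹) ^ k) (Iic 0) := fun k hk =>
    integrableOn_jump_mul hF hJ (hsinv k) hk (D := 1) fun s _ => by rw [hsn, one_mul]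
  have hI2 : MeasureTheory.IntegrableOn
      (fun s : ℝ => jump F s * (((-(Real.exp s : ℂ))⁻¹) ^ N * edgeKernel w₀ s)) (Iic 0) := by
    refine integrableOn_jump_mul hF hJ ((hsinv N).mul hek) (k := N - 1) (by omega)
      (D := 2 * Real.exp (-w₀.re)) fun s _ => ?_
    rw [norm_mul, hsn]
    calc _ ≤ Real.exp (-(N * s)) * (2 * Real.exp (1 * (s - w₀.re))) := by
          gcongr; exact norm_edgeKernel_le hw zero_le_one le_rfl s
      _ = 2 * Real.exp (-(N * s) + 1 * (s - w₀.re)) := by rw [Real.exp_add]; ring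
      _ = 2 * Real.exp (-w₀.re + -((N - 1 : ℕ) * s)) := by
          congr 2; rw [Nat.cast_sub hN]; push_cast; ring
      _ ≤ _ := by rw [Real.exp_add, mul_assoc]
  have e1 : (∫ y in -Real.pi..Real.pi, F (y * Complex.I) * circleKernel w₀ y) =
      ∑ k ∈ Finset.range N, ε ^ k *
        (∫ y in -Real.pi..Real.pi, F (y * Complex.I) * ((Complex.exp (y * Complex.I))⁻¹) ^ k) +
      ε ^ N * ∫ y in -Real.pi..Real.pi, F (y * Complex.I) *
        (((Complex.exp (y * Complex.I))⁻¹) ^ N * circleKernel w₀ y) := by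
    simp only [← intervalIntegral.integral_const_mul]
    rw [← intervalIntegral.integral_finsetSum, ← intervalIntegral.integral_add]
    · refine intervalIntegral.integral_congr fun y _ => ?_
      conv_lhs => rw [circleKernel,
        cauchy_kernel_expansion (Complex.exp_ne_zero _) (circle_ne_zero hre y) N, ← hε]
      rw [mul_add, Finset.mul_sum]
      congr 1
      · exact Finset.sum_congr rfl fun k _ => by ring
      · rw [circleKernel]; ring
    · refine ContinuousOn.intervalIntegrable (continuousOn_finsetSum _ fun k _ => ?_)
      exact continuousOn_const.mul (hc0.mul (hcinv k).continuousOn)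
    · exact (continuousOn_const.mul
        (hc0.mul ((hcinv N).continuousOn.mul hck))).intervalIntegrable
    · intro k _
      exact (continuousOn_const.mul (hc0.mul (hcinv k).continuousOn)).intervalIntegrable
  have e2 : (∫ s in Iic (0 : ℝ), jump F s * edgeKernel w₀ s) =
      ∑ k ∈ Finset.range N, ε ^ k *
        (∫ s in Iic (0 : ℝ), jump F s * ((-(Real.exp s : ℂ))⁻¹) ^ k) +
      ε ^ N * ∫ s in Iic (0 : ℝ), jump F s *
        (((-(Real.exp s : ℂ))⁻¹) ^ N * edgeKernel w₀ s) := by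
    simp only [← MeasureTheory.integral_const_mul]
    rw [← MeasureTheory.integral_finsetSum, ← MeasureTheory.integral_add]
    · refine MeasureTheory.integral_congr_ae (Eventually.of_forall fun s => ?_)
      have hs0 : -(Real.exp s : ℂ) ≠ 0 := neg_ne_zero.2 (by exact_mod_cast (Real.exp_pos s).ne')
      have hs1 : -(Real.exp s : ℂ) - ε ≠ 0 := fun h => edge_ne_zero hw s (by
        rw [← hε]; linear_combination -h)
      have ek : edgeKernel w₀ s = -(Real.exp s : ℂ) / (-(Real.exp s : ℂ) - ε) := by
        rw [edgeKernel, ← neg_add', neg_div_neg_eq]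
      simp only
      rw [ek]
      conv_lhs => rw [cauchy_kernel_expansion hs0 hs1 N]
      rw [mul_add, Finset.mul_sum]
      congr 1
      · exact Finset.sum_congr rfl fun k _ => by ring
      · ring
    · exact MeasureTheory.integrable_finsetSum _ fun k hk =>
        (hI1 k (Finset.mem_range.1 hk)).const_mul _
    · exact hI2.const_mul _
    · exact fun k hk => (hI1 k (Finset.mem_range.1 hk)).const_mul _
  rw [hF.cauchy_formula hN hJ hw hre, e1, e2]
  simp only [logTaylor, mul_add, Finset.sum_add_distrib, Finset.mul_sum]
  have e3 : ∑ k ∈ Finset.range N, Complex.I * (ε ^ k *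
      ∫ s in Iic (0 : ℝ), jump F s * ((-(Real.exp s : ℂ))⁻¹) ^ k) =
      ∑ k ∈ Finset.range N, ε ^ k * (Complex.I *
        ∫ s in Iic (0 : ℝ), jump F s * ((-(Real.exp s : ℂ))⁻¹) ^ k) :=
    Finset.sum_congr rfl fun k _ => by ring
  rw [e3]
  ring

/-- A holomorphic function on the logarithmic strip whose jump is small to order `N` is, to the same
order, a polynomial in `ε = e^w`. -/
theorem LogHolomorphic.exists_polynomial (hF : LogHolomorphic F) (hN : 1 ≤ N)
    (hJ : SubO (strip 0) N (jump F)) : ∃ P : Polynomial ℂ,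
      SubO (strip (3 * Real.pi / 4)) N (fun w => F w - P.eval (Complex.exp w)) := by
  have hpi := Real.pi_pos
  set P : Polynomial ℂ := ∑ k ∈ Finset.range N,
    Polynomial.C (logTaylor F k / (2 * Real.pi)) * Polynomial.X ^ k with hP
  have h2pi : (2 * Real.pi : ℂ) ≠ 0 := by exact_mod_cast (by positivity : (2 * Real.pi : ℝ) ≠ 0)
  have hPe : ∀ w : ℂ, 2 * Real.pi * P.eval (Complex.exp w) =
      ∑ k ∈ Finset.range N, Complex.exp w ^ k * logTaylor F k := by
    intro w
    simp only [hP, Polynomial.eval_finsetSum, Polynomial.eval_mul, Polynomial.eval_C,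
      Polynomial.eval_pow, Polynomial.eval_X, Finset.mul_sum]
    refine Finset.sum_congr rfl fun k _ => ?_
    field_simp
  refine ⟨P, fun δ hδ => ?_⟩
  -- an exponent at most `1/2` is enough near `ε = 0`
  set d := min δ 1 / 2 with hd
  have hd0 : 0 < d := by have := lt_min hδ one_pos; positivity
  have hdδ : 2 * d ≤ δ := by have := min_le_left δ 1; linarith
  have hd1 : 2 * d ≤ 1 := by have := min_le_right δ 1; linarith
  obtain ⟨C, hC0, hC⟩ := hJ.nonneg_const hd0
  obtain ⟨B, hB0, hB⟩ := hF.subO.nonneg_const one_pos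
  set D := ∫ s in Iic (0 : ℝ), C * (2 * Real.exp (d * s)) with hD
  have hD0 : 0 ≤ D := MeasureTheory.integral_nonneg fun s => by positivity
  obtain ⟨Q, hQ0, hQ⟩ := ((hF.subO.subset (strip_mono (by linarith : 3 * Real.pi / 4 ≤ Real.pi))).sub
    (subO_zero_of_bounded (S := strip (3 * Real.pi / 4)) (f := fun w => P.eval (Complex.exp w))
      (C := ∑ i ∈ P.support, ‖P.coeff i‖) fun w _ hre => by
        rw [Polynomial.eval_eq_sum, Polynomial.sum]
        refine norm_sum_le_of_le _ fun i _ => ?_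
        rw [norm_mul, norm_pow]
        exact mul_le_of_le_one_right (norm_nonneg _)
          (pow_le_one₀ (norm_nonneg _) (norm_exp_le_one hre)))).nonneg_const one_pos
  have hnear : ∀ w ∈ strip (3 * Real.pi / 4), w.re ≤ -1 → ‖F w - P.eval (Complex.exp w)‖ ≤
      (B * 2 * |Real.pi - -Real.pi| + D) * Real.exp ((N - δ) * w.re) := by
    intro w hw hre
    have hre0 : w.re < 0 := by linarith
    have hrem := hF.taylor_remainder hN hJ hw hre0
    rw [← hPe, ← mul_sub] at hrem
    have hε : ‖Complex.exp w‖ = Real.exp w.re := Complex.norm_exp w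
    have hhalf : Real.exp w.re ≤ 1 / 2 := by
      have h1 := Real.exp_le_exp.2 hre
      have h2 := Real.exp_one_gt_d9
      rw [Real.exp_neg] at h1
      refine h1.trans ?_
      rw [inv_eq_one_div]
      exact one_div_le_one_div_of_le two_pos (by linarith)
    have hT1 : ‖∫ y in -Real.pi..Real.pi, F (y * Complex.I) *
        (((Complex.exp (y * Complex.I))⁻¹) ^ N * circleKernel w y)‖ ≤
        B * 2 * |Real.pi - -Real.pi| := by
      refine intervalIntegral.norm_integral_le_of_norm_le_const fun y hy => ?_
      rw [uIoc_of_le (by linarith)] at hy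
      have h1 := hB (y * Complex.I) (by rw [mem_strip]; simpa using abs_le.2 ⟨hy.1.le, hy.2⟩)
        (by simp)
      have h2 : (1 : ℝ) / 2 ≤ ‖Complex.exp (y * Complex.I) - Complex.exp w‖ := by
        have := norm_sub_norm_le (Complex.exp (y * Complex.I)) (Complex.exp w)
        rw [Complex.norm_exp_ofReal_mul_I, hε] at this
        linarith
      have h3 : ‖circleKernel w y‖ ≤ 2 := by
        rw [circleKernel, norm_div, Complex.norm_exp_ofReal_mul_I]
        calc _ ≤ 1 / (1 / 2 : ℝ) := one_div_le_one_div_of_le (by norm_num) h2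
          _ = 2 := by norm_num
      rw [norm_mul, norm_mul, norm_pow, norm_inv, Complex.norm_exp_ofReal_mul_I, inv_one, one_pow,
        one_mul]
      refine mul_le_mul ?_ h3 (norm_nonneg _) hB0
      simpa using h1
    have hT2 : ‖∫ s in Iic (0 : ℝ), jump F s *
        (((-(Real.exp s : ℂ))⁻¹) ^ N * edgeKernel w s)‖ ≤ D * Real.exp (-(2 * d * w.re)) := by
      rw [hD, ← MeasureTheory.integral_mul_const]
      refine MeasureTheory.norm_integral_le_of_norm_le (((integrableOn_exp_mul_Iic hd0 0).const_mul
        2).const_mul C |>.mul_const _) ?_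
      filter_upwards [MeasureTheory.ae_restrict_mem measurableSet_Iic] with s hs
      have h1 := hC s (by simp [mem_strip]) (by simpa using hs)
      rw [Complex.ofReal_re] at h1
      have h2 : ‖((-(Real.exp s : ℂ))⁻¹) ^ N‖ = Real.exp (-(N * s)) := by
        rw [norm_pow, norm_inv, norm_neg, Complex.norm_of_nonneg (Real.exp_pos s).le,
          ← Real.exp_neg, ← Real.exp_nat_mul]
        congr 1; ring
      rw [norm_mul, norm_mul, h2]
      calc _ ≤ C * Real.exp ((N - d) * s) * (Real.exp (-(N * s)) *
            (2 * Real.exp (2 * d * (s - w.re)))) := by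
            gcongr; exact norm_edgeKernel_le hw (by positivity) hd1 s
        _ = C * (2 * (Real.exp ((N - d) * s) * Real.exp (-(N * s)) *
            Real.exp (2 * d * (s - w.re)))) := by ring
        _ = C * (2 * (Real.exp (d * s) * Real.exp (-(2 * d * w.re)))) := by
            rw [← Real.exp_add, ← Real.exp_add, ← Real.exp_add]; congr 3; ring
        _ = _ := by ring
    have h1 : (1 : ℝ) ≤ Real.exp (-(2 * d * w.re)) := Real.one_le_exp (by nlinarith)
    have h2 : 2 * Real.pi * ‖F w - P.eval (Complex.exp w)‖ ≤ Real.exp w.re ^ N *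
        ((B * 2 * |Real.pi - -Real.pi| + D) * Real.exp (-(2 * d * w.re))) := by
      have e := congrArg norm hrem
      rw [norm_mul, norm_mul (Complex.exp w ^ N), norm_pow, hε] at e
      have e' : ‖(2 * Real.pi : ℂ)‖ = 2 * Real.pi := by
        rw [norm_mul, Complex.norm_of_nonneg hpi.le]; simp
      rw [e'] at e
      rw [e]
      refine mul_le_mul_of_nonneg_left ((norm_add_le _ _).trans ?_) (by positivity)
      rw [norm_mul, Complex.norm_I, one_mul, add_mul]
      refine add_le_add (hT1.trans (le_mul_of_one_le_right (by positivity) h1)) hT2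
    have h3 : ‖F w - P.eval (Complex.exp w)‖ ≤ 2 * Real.pi * ‖F w - P.eval (Complex.exp w)‖ :=
      le_mul_of_one_le_left (norm_nonneg _) (by linarith [Real.pi_gt_three])
    refine h3.trans (h2.trans ?_)
    rw [mul_left_comm, ← Real.exp_nat_mul, ← Real.exp_add]
    refine mul_le_mul_of_nonneg_left (Real.exp_le_exp.2 ?_) (by positivity)
    nlinarith
  -- away from `ε = 0` all powers are comparable
  refine ⟨(B * 2 * |Real.pi - -Real.pi| + D) + Q * Real.exp 1 * Real.exp |N - δ|,
    fun w hw hre => ?_⟩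
  rw [add_mul]
  rcases le_total w.re (-1) with h | h
  · exact (hnear w hw h).trans (le_add_of_nonneg_right (by positivity))
  · refine (hQ w hw hre).trans (le_trans ?_ (le_add_of_nonneg_left (by positivity)))
    rw [mul_assoc, mul_assoc, ← Real.exp_add, ← Real.exp_add]
    refine mul_le_mul_of_nonneg_left (Real.exp_le_exp.2 ?_) hQ0
    have := neg_abs_le ((N : ℝ) - δ)
    have := le_abs_self ((N : ℝ) - δ)
    push_cast
    nlinarith [abs_nonneg ((N : ℝ) - δ)]

end

/-! ### Expansion of functions with a Stokes jump -/

section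
variable {S : Set ℂ} {F G : ℂ → ℂ} {M : ℕ}

theorem subO_polynomial (S : Set ℂ) (P : Polynomial ℂ) :
    SubO S 0 (fun w => P.eval (Complex.exp w)) :=
  subO_zero_of_bounded (C := ∑ i ∈ P.support, ‖P.coeff i‖) fun w _ hre => by
    rw [Polynomial.eval_eq_sum, Polynomial.sum]
    refine norm_sum_le_of_le _ fun i _ => ?_
    rw [norm_mul, norm_pow]
    exact mul_le_of_le_one_right (norm_nonneg _) (pow_le_one₀ (norm_nonneg _) (norm_exp_le_one hre))

theorem eval_eq_coeff_add (P : Polynomial ℂ) (z : ℂ) :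
    P.eval z = P.coeff 0 + z * P.divX.eval z := by
  conv_lhs => rw [← P.divX_mul_X_add]
  simp; ring

theorem subO_polynomial_sub_coeff (S : Set ℂ) (P : Polynomial ℂ) :
    SubO S 1 (fun w => P.eval (Complex.exp w) - P.coeff 0) := by
  have h1 := (subO_exp S 1).mul (subO_polynomial S P.divX)
  refine h1.congr fun w _ _ => ?_
  rw [eval_eq_coeff_add P]
  push_cast
  ring_nf

theorem subO_polynomial_sub_coeff₂ (S : Set ℂ) (P : Polynomial ℂ) :
    SubO S 2 (fun w => P.eval (Complex.exp w) - (P.coeff 0 + P.coeff 1 * Complex.exp w)) := by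
  have h1 := (subO_exp S 1).mul (subO_polynomial_sub_coeff S P.divX)
  refine h1.congr fun w _ _ => ?_
  rw [eval_eq_coeff_add P, Polynomial.coeff_divX]
  push_cast
  ring_nf

theorem subO_id_mul_exp (b : ℝ) (k : ℕ) : SubO (strip b) k (fun w => w * Complex.exp (k * w)) :=
  ((subO_id b).mul (subO_exp _ k)).mono (by omega)

theorem subO_sq_mul_exp (b : ℝ) (k : ℕ) :
    SubO (strip b) k (fun w => w ^ 2 * Complex.exp (k * w)) :=
  (((subO_id b).mul (subO_id_mul_exp b k)).mono (by omega)).congr fun w _ _ => by ring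

theorem LogHolomorphic.sub (hF : LogHolomorphic F) (hG : LogHolomorphic G) :
    LogHolomorphic (fun w => F w - G w) :=
  ⟨fun w hw => (hF.diff w hw).sub (hG.diff w hw), hF.subO.sub hG.subO⟩

theorem LogHolomorphic.add (hF : LogHolomorphic F) (hG : LogHolomorphic G) :
    LogHolomorphic (fun w => F w + G w) :=
  ⟨fun w hw => (hF.diff w hw).add (hG.diff w hw), hF.subO.add hG.subO⟩

theorem LogHolomorphic.const_mul (hF : LogHolomorphic F) (c : ℂ) :
    LogHolomorphic (fun w => c * F w) :=
  ⟨fun w hw => (hF.diff w hw).const_mul c, hF.subO.const_mul c⟩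

theorem logHolomorphic_id_mul_exp (k : ℕ) : LogHolomorphic (fun w => w * Complex.exp (k * w)) :=
  ⟨fun w _ => by fun_prop, (subO_id_mul_exp _ k).mono (by omega)⟩

theorem logHolomorphic_sq_mul_exp (k : ℕ) :
    LogHolomorphic (fun w => w ^ 2 * Complex.exp (k * w)) :=
  ⟨fun w _ => by fun_prop, (subO_sq_mul_exp _ k).mono (by omega)⟩

theorem jump_sub (F G : ℂ → ℂ) (w : ℂ) :
    jump (fun w => F w - G w) w = jump F w - jump G w := by simp only [jump]; ring

theorem jump_add (F G : ℂ → ℂ) (w : ℂ) :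
    jump (fun w => F w + G w) w = jump F w + jump G w := by simp only [jump]; ring

theorem jump_const_mul (c : ℂ) (F : ℂ → ℂ) (w : ℂ) :
    jump (fun w => c * F w) w = c * jump F w := by simp only [jump]; ring

theorem exp_mul_add_pi (k : ℕ) (w : ℂ) :
    Complex.exp (k * (w + Real.pi * Complex.I)) = (-1) ^ k * Complex.exp (k * w) := by
  rw [mul_add, Complex.exp_add, Complex.exp_nat_mul (Real.pi * Complex.I), Complex.exp_pi_mul_I]; ring

theorem exp_mul_sub_pi (k : ℕ) (w : ℂ) :
    Complex.exp (k * (w - Real.pi * Complex.I)) = (-1) ^ k * Complex.exp (k * w) := by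
  rw [mul_sub, Complex.exp_sub, Complex.exp_nat_mul (Real.pi * Complex.I), Complex.exp_pi_mul_I,
    div_eq_iff (pow_ne_zero _ (by norm_num)), mul_right_comm, ← mul_pow]
  simp

theorem jump_id_mul_exp (k : ℕ) (w : ℂ) : jump (fun w => w * Complex.exp (k * w)) w =
    2 * Real.pi * Complex.I * ((-1) ^ k * Complex.exp (k * w)) := by
  simp only [jump, exp_mul_add_pi, exp_mul_sub_pi]; ring

theorem jump_sq_mul_exp (k : ℕ) (w : ℂ) : jump (fun w => w ^ 2 * Complex.exp (k * w)) w =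
    4 * Real.pi * Complex.I * w * ((-1) ^ k * Complex.exp (k * w)) := by
  simp only [jump, exp_mul_add_pi, exp_mul_sub_pi]; ring

theorem ofReal_mem_strip {b : ℝ} (hb : 0 ≤ b) (s : ℝ) : (s : ℂ) ∈ strip b := by
  simpa [mem_strip] using hb

/-- A constant plus a multiple of `ε` that is small to second order vanishes. -/
theorem eq_zero_of_subO {a b : ℂ} (h : SubO (strip 0) 2 (fun w => a + b * Complex.exp w)) :
    a = 0 ∧ b = 0 := by
  have hexp : Tendsto (fun s : ℝ => Complex.exp s) atBot (𝓝 0) := by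
    have := (Complex.continuous_ofReal.tendsto 0).comp Real.tendsto_exp_atBot
    simpa [Function.comp_def] using this
  have h0 := h.tendsto_zero (k := 0) (by norm_num) (ofReal_mem_strip le_rfl)
  have h0' : Tendsto (fun s : ℝ => a + b * Complex.exp s) atBot (𝓝 (a + b * 0)) :=
    (hexp.const_mul b).const_add a
  have ha : a = 0 := by
    have := tendsto_nhds_unique h0' (by simpa using h0)
    simpa using this
  refine ⟨ha, ?_⟩
  have h1 := h.tendsto_zero (k := 1) (by norm_num) (ofReal_mem_strip le_rfl)
  refine tendsto_nhds_unique (Tendsto.congr (fun s => ?_) tendsto_const_nhds) h1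
  rw [ha, zero_add, mul_assoc, ← Complex.exp_add]
  simp

/-- The coefficient of `ε^{m-2} ln ε`. -/
noncomputable def logCoeff (M : ℕ) : ℝ := (-1) ^ M * stokes₁ M

theorem logCoeff_mul_sign (M : ℕ) : (logCoeff M : ℂ) * (-1) ^ M = stokes₁ M := by
  rw [logCoeff]; push_cast
  rw [mul_right_comm, ← mul_pow]; simp

theorem subO_stokes_sub (hM : 1 ≤ M) : SubO (strip 0) (3 * M) (fun w => stokes M w.re -
    2 * Real.pi * Complex.I * (stokes₁ M * Complex.exp (M * w) +
      stokes₂ M * Complex.exp ((2 * M : ℕ) * w))) := by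
  obtain ⟨C, hC⟩ := stokes_expansion hM
  intro δ hδ
  refine ⟨max C 0, fun w hw hre => ?_⟩
  have him : w.im = 0 := abs_nonpos_iff.1 hw
  obtain ⟨s, rfl⟩ : ∃ s : ℝ, w = s := ⟨w.re, Complex.ext (by simp) (by simp [him])⟩
  beta_reduce
  rw [Complex.ofReal_re] at hre ⊢
  have e1 : Complex.exp (M * s) = (Real.exp s : ℂ) ^ M := by
    rw [Complex.exp_nat_mul, Complex.ofReal_exp]
  have e2 : Complex.exp ((2 * M : ℕ) * s) = ((Real.exp s : ℂ) ^ M) ^ 2 := by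
    rw [Complex.exp_nat_mul, Complex.ofReal_exp, ← pow_mul, mul_comm]
  rw [e1, e2]
  refine (hC s hre).trans ?_
  rw [← pow_mul, ← Real.exp_nat_mul]
  refine mul_le_mul (le_max_left _ _) (Real.exp_le_exp.2 ?_) (Real.exp_pos _).le (le_max_right _ _)
  push_cast
  nlinarith

/-- The shape of the expansion: a polynomial in `ε` and logarithmic terms determined by its first
two coefficients, up to order `m = M + 2`. -/
noncomputable def stokesExpansion (M : ℕ) (P : Polynomial ℂ) (w : ℂ) : ℂ :=
  P.eval (Complex.exp w) + logCoeff M * P.coeff 0 * (w * Complex.exp (M * w)) -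
    logCoeff M * P.coeff 1 * (w * Complex.exp ((M + 1 : ℕ) * w)) +
    logCoeff M * stokes₁ M / 2 * P.coeff 0 * (w ^ 2 * Complex.exp ((2 * M : ℕ) * w)) +
    stokes₂ M * P.coeff 0 * (w * Complex.exp ((2 * M : ℕ) * w))

/-- Bootstrapping: the jump of `F` is known from `F` itself to an order higher by `M`, hence `F` is
known to that order. -/
theorem LogHolomorphic.exists_stokesExpansion (hM : 1 ≤ M) (hF : LogHolomorphic F)
    (hj : ∀ s : ℝ, jump F s = stokes M s * F s) : ∃ P : Polynomial ℂ,
      SubO (strip (3 * Real.pi / 4)) (M + 2) (fun w => F w - stokesExpansion M P w) := by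
  have hpi := Real.pi_pos
  have hj' : ∀ w ∈ strip 0, jump F w = stokes M w.re * F w := by
    intro w hw
    have him : w.im = 0 := abs_nonpos_iff.1 hw
    have := hj w.re
    rwa [show ((w.re : ℝ) : ℂ) = w from Complex.ext (by simp) (by simp [him])] at this
  have hsub : strip 0 ⊆ strip (3 * Real.pi / 4) := strip_mono (by positivity)
  have hF0 : SubO (strip 0) 0 F := hF.subO.subset (strip_mono hpi.le)
  have hS := subO_stokes_sub hM
  have hE : ∀ k : ℕ, SubO (strip 0) k (fun w => Complex.exp (k * w)) := subO_exp _
  have hS1 : SubO (strip 0) (2 * M) (fun w => stokes M w.re -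
      2 * Real.pi * Complex.I * (stokes₁ M * Complex.exp (M * w))) :=
    ((hS.mono (by omega : 2 * M ≤ 3 * M)).add
      ((hE (2 * M)).const_mul (2 * Real.pi * Complex.I * stokes₂ M))).congr fun w _ _ => by ring
  have hS0 : SubO (strip 0) M (fun w => stokes M w.re) :=
    ((hS1.mono (by omega : M ≤ 2 * M)).add
      ((hE M).const_mul (2 * Real.pi * Complex.I * stokes₁ M))).congr fun w _ _ => by ring
  -- zeroth approximation
  obtain ⟨P₀, hP₀⟩ := hF.exists_polynomial hM
    (((hS0.mul hF0).mono (by omega)).congr fun w hw _ => (hj' w hw).symm)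
  set c₀ := P₀.coeff 0
  have hA0 : SubO (strip 0) 1 (fun w => F w - c₀) :=
    (((hP₀.subset hsub).mono hM).add (subO_polynomial_sub_coeff _ P₀)).congr fun w _ _ => by ring
  -- first approximation
  have hG := hF.sub ((logHolomorphic_id_mul_exp M).const_mul (logCoeff M * c₀))
  obtain ⟨P₁, hP₁⟩ := hG.exists_polynomial (N := M + 1) (by omega)
    ((((hS1.mul hF0).mono (by omega : M + 1 ≤ 2 * M + 0)).add
      (((hE M).mul hA0).const_mul (2 * Real.pi * Complex.I * stokes₁ M))).congr fun w hw _ => by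
        rw [jump_sub, jump_const_mul, jump_id_mul_exp, hj' w hw]
        linear_combination (2 * Real.pi * Complex.I * c₀ * Complex.exp (M * w)) * logCoeff_mul_sign M)
  set c₁ := P₁.coeff 1
  have hcoef0 : P₁.coeff 0 = c₀ := by
    have h1 : SubO (strip 0) 1 (fun _ => P₁.coeff 0 - c₀) := by
      refine ((hA0.sub ((hP₁.subset hsub).mono (by omega))).sub
        ((((subO_id_mul_exp 0 M).mono hM).const_mul (logCoeff M * c₀)).add
          (subO_polynomial_sub_coeff _ P₁))).congr fun w _ _ => ?_
      ring
    have h2 := h1.tendsto_zero (k := 0) (by norm_num) (ofReal_mem_strip le_rfl)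
    have h3 : P₁.coeff 0 - c₀ = 0 := by simpa using h2
    exact sub_eq_zero.1 h3
  have hA1 : SubO (strip 0) 2 (fun w => F w - (c₀ + c₁ * Complex.exp w +
      logCoeff M * c₀ * (w * Complex.exp (M * w)))) :=
    (((hP₁.subset hsub).mono (by omega)).add (subO_polynomial_sub_coeff₂ _ P₁)).congr fun w _ _ => by
      rw [hcoef0]; ring
  -- second approximation
  have hH := hF.sub ((((logHolomorphic_id_mul_exp M).const_mul (logCoeff M * c₀)).sub
    ((logHolomorphic_id_mul_exp (M + 1)).const_mul (logCoeff M * c₁))).add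
    (((logHolomorphic_sq_mul_exp (2 * M)).const_mul (logCoeff M * stokes₁ M / 2 * c₀)).add
      ((logHolomorphic_id_mul_exp (2 * M)).const_mul (stokes₂ M * c₀))))
  have hEadd : ∀ w : ℂ, Complex.exp ((M + 1 : ℕ) * w) = Complex.exp (M * w) * Complex.exp w := by
    intro w; rw [← Complex.exp_add]; congr 1; push_cast; ring
  have hEdouble : ∀ w : ℂ, Complex.exp ((2 * M : ℕ) * w) =
      Complex.exp (M * w) * Complex.exp (M * w) := by
    intro w; rw [← Complex.exp_add]; congr 1; push_cast; ring
  obtain ⟨P, hP⟩ := hH.exists_polynomial (N := M + 2) (by omega)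
    ((((hS.mul hF0).mono (by omega : M + 2 ≤ 3 * M + 0)).add
      ((((hE M).mul hA1).const_mul (2 * Real.pi * Complex.I * stokes₁ M)).add
      ((((hE (2 * M)).mul hA0).const_mul (2 * Real.pi * Complex.I * stokes₂ M)).mono
        (by omega)))).congr fun w hw _ => by
        rw [jump_sub, jump_add, jump_sub, jump_add, jump_const_mul, jump_const_mul, jump_const_mul,
          jump_const_mul, jump_id_mul_exp, jump_id_mul_exp, jump_id_mul_exp, jump_sq_mul_exp,
          hj' w hw, pow_succ (-1 : ℂ) M, (even_two_mul M).neg_one_pow, hEadd, hEdouble]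
        linear_combination (2 * Real.pi * Complex.I * (c₀ * Complex.exp (M * w) +
          c₁ * Complex.exp (M * w) * Complex.exp w)) * logCoeff_mul_sign M)
  have hcoef := eq_zero_of_subO (a := P.coeff 0 - c₀) (b := P.coeff 1 - c₁)
    (((hA1.sub ((hP.subset hsub).mono (by omega))).sub
      (((((subO_sq_mul_exp 0 (2 * M)).mono (by omega : 2 ≤ 2 * M)).const_mul
        (logCoeff M * stokes₁ M / 2 * c₀)).add
      (((subO_id_mul_exp 0 (2 * M)).mono (by omega : 2 ≤ 2 * M)).const_mul (stokes₂ M * c₀))).sub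
      (((subO_id_mul_exp 0 (M + 1)).mono (by omega : 2 ≤ M + 1)).const_mul
        (logCoeff M * c₁)) |>.add (subO_polynomial_sub_coeff₂ _ P))).congr fun w _ _ => by ring)
  refine ⟨P, hP.congr fun w _ _ => ?_⟩
  rw [stokesExpansion, sub_eq_zero.1 hcoef.1, sub_eq_zero.1 hcoef.2]
  ring

end

/-! ### The connection coefficients at small energy -/

section
variable {M i : ℕ} {K : ℝ} {Ψ dΨ : ℝ → ℝ}

theorem logHolomorphic_coef (hM : 1 ≤ M) (hK : ZeroEnergyBound M K)
    (hΨ : ZeroEnergySolution M i K Ψ dΨ) : LogHolomorphic (coef M Ψ dΨ) := by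
  obtain ⟨C, hC⟩ := coef_bounded hM hK hΨ
  refine ⟨fun w hw => differentiableAt_coef hM hK hΨ hw, subO_zero_of_bounded fun w hw hre =>
    hC w hre ?_⟩
  have := mem_strip.1 hw
  linarith [Real.pi_pos]

theorem coef_ofReal_im (hM : 1 ≤ M) (s : ℝ) : (coef M Ψ dΨ s).im = 0 := by
  have := coef_conj (Ψ := Ψ) (dΨ := dΨ) hM s
  rw [Complex.conj_ofReal] at this
  exact Complex.conj_eq_iff_im.1 this.symm

/-- Bounds at `x = u⁻²` for `ε = u³`, that is, at `x = ε^{-2/3}`, which lies in the overlap of the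
regions where the Jost solution is close to `e^{-εx}` and the zero-energy solutions are good
approximations. Here `U` and `dU` stand for the Jost series and its derivative, `φ₁` and `φ₂` for
the continuations of `Phi1` and `Psi2`. -/
structure OverlapBounds (M : ℕ) (D : ℝ) (x u : ℝ) (U dU φ₁ dφ₁ φ₂ dφ₂ : ℂ) : Prop where
  U_sub : ‖U - 1‖ ≤ D * u
  dU_le : ‖dU‖ ≤ D * u ^ 4
  φ₁_sub : ‖φ₁ - Phi1 (M + 2) x‖ ≤ D * u
  dφ₁_le : ‖dφ₁‖ ≤ D * u ^ 4
  φ₂_le : ‖φ₂‖ * u ^ 2 ≤ D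
  dφ₂_sub : ‖dφ₂ - 1‖ ≤ D * u

/-- At `x = u⁻²`, `ε = u³` both expansion parameters are small: `x^{-(m-2)} ≤ u²` for the Jost
series and `(εx)² = u²` for the continued solutions. -/
theorem overlapBounds_exists (hM : 1 ≤ M) : ∃ D : ℝ, 0 ≤ D ∧ ∀ u : ℝ, 0 < u → u < 1 →
    ∀ η ∈ cone, OverlapBounds M D (u ^ 2)⁻¹ u (jostSum M (u ^ 2)⁻¹ η) (djostSum M (u ^ 2)⁻¹ η)
      (pert M (Phi1 (M + 2)) (u ^ 2)⁻¹ (u ^ 3 : ℝ))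
      (dpert M (Phi1 (M + 2)) (dPhi1 M) (u ^ 2)⁻¹ (u ^ 3 : ℝ))
      (pert M (Psi2 M) (u ^ 2)⁻¹ (u ^ 3 : ℝ))
      (dpert M (Psi2 M) (dPsi2 M) (u ^ 2)⁻¹ (u ^ 3 : ℝ)) := by
  obtain ⟨K, hK1, hKb⟩ := zero_energy_bounds hM
  have hK : ZeroEnergyBound M K := ⟨hK1, fun x hx => (hKb x hx).1, fun x hx => (hKb x hx).2.1,
    fun x hx => (hKb x hx).2.2.1, fun x hx => (hKb x hx).2.2.2.1⟩
  have hK0 : 0 < K := by linarith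
  have hs1 := zeroEnergySolution_Phi1 hM hK
  have hs2 := zeroEnergySolution_Psi2 hM hK
  set e₀ := Real.exp (2 * K ^ 2)
  set R := jostConst M * 8 ^ M * Real.exp (jostRatio M 1)
  have hR : 0 < R := by have := jostConst_pos M; positivity
  set A := K * (2 * K ^ 2) * e₀
  have hA : 0 < A := by positivity
  refine ⟨8 * R + A + K + K * e₀, by positivity, fun u hu hu1 η hη => ?_⟩
  set x := (u ^ 2)⁻¹ with hx
  have hx1 : 1 ≤ x := (one_le_inv₀ (by positivity)).2 (pow_le_one₀ hu.le hu1.le)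
  have hx0 : 0 < x := by linarith
  have hu2 : u ^ 2 ≤ u := by nlinarith
  have hu4 : u ^ 4 ≤ u ^ 2 := pow_le_pow_of_le_one hu.le hu1.le (by norm_num)
  have hxinv : x⁻¹ = u ^ 2 := inv_inv _
  have hxu : x ^ 2 * ‖((u ^ 3 : ℝ) : ℂ)‖ ^ 2 = u ^ 2 := by
    rw [Complex.norm_of_nonneg (by positivity), hx]; field_simp
  have hexp : Real.exp (2 * K ^ 2 * x ^ 2 * ‖((u ^ 3 : ℝ) : ℂ)‖ ^ 2) ≤ e₀ := by
    refine Real.exp_le_exp.2 ?_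
    rw [mul_assoc, hxu]
    nlinarith [sq_nonneg K]
  have hratio : jostRatio M x * Real.exp (jostRatio M x) ≤ R * u ^ 2 := by
    have hc := jostConst_pos M
    have h1 : jostRatio M x ≤ jostConst M * 8 ^ M * u ^ 2 := by
      have h2 : (u ^ 2) ^ M ≤ (u ^ 2) ^ 1 :=
        pow_le_pow_of_le_one (by positivity) (by nlinarith) hM
      rw [jostRatio, div_eq_mul_inv, hxinv, mul_pow, pow_one] at *
      rw [← mul_assoc]
      gcongr
    have h3 := Real.exp_le_exp.2 (jostRatio_anti M one_pos hx1)
    have h4 := jostRatio_pos M hx0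
    calc _ ≤ jostConst M * 8 ^ M * u ^ 2 * Real.exp (jostRatio M 1) := by gcongr
      _ = _ := by ring
  have hpoly : 2 * K ^ 2 * x ^ 2 * ‖((u ^ 3 : ℝ) : ℂ)‖ ^ 2 = 2 * K ^ 2 * u ^ 2 := by
    rw [mul_assoc, hxu]
  have hp1 := norm_pert_sub_le hK hs1 hx1 ((u ^ 3 : ℝ) : ℂ)
  have hdp1 := norm_mul_dpert_sub_le hK hs1 hx1 ((u ^ 3 : ℝ) : ℂ)
  have hp2 := norm_pert_le hK hs2 hx1 ((u ^ 3 : ℝ) : ℂ)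
  have hdp2 := norm_mul_dpert_sub_le hK hs2 hx1 ((u ^ 3 : ℝ) : ℂ)
  have hb1 : K * x ^ 0 * (2 * K ^ 2 * x ^ 2 * ‖((u ^ 3 : ℝ) : ℂ)‖ ^ 2) *
      Real.exp (2 * K ^ 2 * x ^ 2 * ‖((u ^ 3 : ℝ) : ℂ)‖ ^ 2) ≤ A * u ^ 2 := by
    rw [hpoly] at hexp ⊢
    calc _ ≤ K * x ^ 0 * (2 * K ^ 2 * u ^ 2) * e₀ := by gcongr
      _ = _ := by simp only [A]; ring
  have hb2 : K * x ^ 1 * (2 * K ^ 2 * x ^ 2 * ‖((u ^ 3 : ℝ) : ℂ)‖ ^ 2) *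
      Real.exp (2 * K ^ 2 * x ^ 2 * ‖((u ^ 3 : ℝ) : ℂ)‖ ^ 2) ≤ x * (A * u ^ 2) := by
    rw [hpoly] at hexp ⊢
    calc _ ≤ K * x ^ 1 * (2 * K ^ 2 * u ^ 2) * e₀ := by gcongr
      _ = _ := by simp only [A]; ring
  have hmulx : ∀ (z : ℂ) (B : ℝ), ‖(x : ℂ) * z‖ ≤ B → ‖z‖ ≤ u ^ 2 * B := by
    intro z B h
    rw [norm_mul, Complex.norm_of_nonneg hx0.le] at h
    rw [← hxinv]
    rw [← div_eq_inv_mul, le_div_iff₀ hx0]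
    linarith
  refine ⟨?_, ?_, ?_, ?_, ?_, ?_⟩
  · refine (norm_jostSum_sub_one_le hM hx0 hη).trans (hratio.trans ?_)
    nlinarith [mul_pos hK0 (Real.exp_pos (2 * K ^ 2))]
  · refine (norm_djostSum_le hM hx0 hη).trans ?_
    rw [mul_assoc, div_eq_mul_inv, hxinv]
    calc _ ≤ 8 * u ^ 2 * (R * u ^ 2) := by gcongr
      _ = 8 * R * u ^ 4 := by ring
      _ ≤ _ := by gcongr; linarith [mul_pos hK0 (Real.exp_pos (2 * K ^ 2))]
  · refine (hp1.trans hb1).trans ?_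
    nlinarith [mul_pos hK0 (Real.exp_pos (2 * K ^ 2))]
  · have h1 := hmulx (dpert M (Phi1 (M + 2)) (dPhi1 M) x (u ^ 3 : ℝ) - dPhi1 M x) (A * u ^ 2)
      (by rw [mul_sub]; exact hdp1.trans hb1)
    have h2 : ‖(dPhi1 M x : ℂ)‖ ≤ K * u ^ 4 := by
      rw [Complex.norm_real, Real.norm_eq_abs]
      refine (hK.dPhi1_le x hx1).trans (le_of_eq ?_)
      rw [hxinv]; ring
    have h3 := norm_add_le (dpert M (Phi1 (M + 2)) (dPhi1 M) x (u ^ 3 : ℝ) - dPhi1 M x)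
      (dPhi1 M x : ℂ)
    rw [sub_add_cancel] at h3
    have : 0 < u ^ 4 := by positivity
    nlinarith [mul_pos hK0 (Real.exp_pos (2 * K ^ 2))]
  · have h1 : ‖pert M (Psi2 M) x (u ^ 3 : ℝ)‖ ≤ K * x ^ 1 * e₀ := hp2.trans (by gcongr)
    calc _ ≤ K * x ^ 1 * e₀ * u ^ 2 := by gcongr
      _ = K * e₀ * (x * x⁻¹) := by rw [hxinv]; ring
      _ = K * e₀ := by rw [mul_inv_cancel₀ hx0.ne', mul_one]
      _ ≤ _ := by linarith
  · have h1 := hmulx (dpert M (Psi2 M) (dPsi2 M) x (u ^ 3 : ℝ) - dPsi2 M x) (x * (A * u ^ 2))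
      (by rw [mul_sub]; exact hdp2.trans hb2)
    have h2 : ‖(dPsi2 M x : ℂ) - 1‖ ≤ K * u ^ 2 := by
      rw [← Complex.ofReal_one, ← Complex.ofReal_sub, Complex.norm_real, Real.norm_eq_abs, ← hxinv]
      exact (hKb x hx1).2.2.2.2.2
    have h3 := norm_add_le (dpert M (Psi2 M) (dPsi2 M) x (u ^ 3 : ℝ) - dPsi2 M x)
      ((dPsi2 M x : ℂ) - 1)
    rw [sub_add_sub_cancel] at h3
    have h4 : u ^ 2 * (x * (A * u ^ 2)) = A * u ^ 2 := by
      rw [← hxinv]; field_simp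
    rw [h4] at h1
    nlinarith [mul_pos hK0 (Real.exp_pos (2 * K ^ 2))]

/-- The Wronskian defining `coef`, evaluated at `x = u⁻²` for `ε = u³ = e^s`. -/
theorem coef_overlap (hM : 1 ≤ M) (hK : ZeroEnergyBound M K) (hΨ : ZeroEnergySolution M i K Ψ dΨ)
    {s : ℝ} (hs : s < 0) {u : ℝ} (hu : u = Real.exp (s / 3)) :
    ((u ^ 3 : ℝ) : ℂ) / rot ∈ cone ∧ coef M Ψ dΨ s = Complex.exp (-u) *
      (jostSum M (u ^ 2)⁻¹ ((u ^ 3 : ℝ) / rot) * dpert M Ψ dΨ (u ^ 2)⁻¹ (u ^ 3 : ℝ) -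
      (djostSum M (u ^ 2)⁻¹ ((u ^ 3 : ℝ) / rot) - u ^ 3 * jostSum M (u ^ 2)⁻¹ ((u ^ 3 : ℝ) / rot)) *
        pert M Ψ (u ^ 2)⁻¹ (u ^ 3 : ℝ)) := by
  have hu0 : 0 < u := hu ▸ Real.exp_pos _
  have hu1 : u < 1 := hu ▸ Real.exp_lt_one_iff.2 (by linarith)
  have hu3 : Complex.exp s = ((u ^ 3 : ℝ) : ℂ) := by
    rw [hu, ← Real.exp_nat_mul, ← Complex.ofReal_exp]; congr 2; push_cast; ring
  have hc : ((u ^ 3 : ℝ) : ℂ) / rot ∈ cone :=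
    div_rot_mem_cone (by rw [Complex.ofReal_re]; positivity)
  have hx : 1 < (u ^ 2)⁻¹ := (one_lt_inv₀ (by positivity)).2 (pow_lt_one₀ hu0.le hu1 two_ne_zero)
  refine ⟨hc, ?_⟩
  rw [coef_eq_coefPlus hM (by simp; linarith [Real.pi_pos]), coefPlus_eq hM hK hΨ
    (by rw [hu3]; exact hc) hx, wronskian, hu3]
  have he : -((u ^ 3 : ℝ) : ℂ) * ((u ^ 2)⁻¹ : ℝ) = -u := by
    have : (u : ℂ) ≠ 0 := by exact_mod_cast hu0.ne'
    push_cast; field_simp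
  simp only [jost, djost, rot_mul_div, he]
  push_cast
  ring

theorem tendsto_of_norm_sub_le {f : ℝ → ℂ} {c : ℂ} {C : ℝ}
    (h : ∀ s : ℝ, s < 0 → ‖f s - c‖ ≤ C * Real.exp (s / 3)) : Tendsto f atBot (𝓝 c) := by
  rw [tendsto_iff_norm_sub_tendsto_zero]
  have h1 : Tendsto (fun s : ℝ => C * Real.exp (s / 3)) atBot (𝓝 0) := by
    simpa using (Real.tendsto_exp_atBot.comp
      (tendsto_id.atBot_div_const (by norm_num : (0 : ℝ) < 3))).const_mul C
  refine squeeze_zero' (Eventually.of_forall fun _ => norm_nonneg _) ?_ h1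
  filter_upwards [eventually_lt_atBot 0] with s hs using h s hs

theorem tendsto_exp_neg_overlap :
    Tendsto (fun s : ℝ => Complex.exp (-(Real.exp (s / 3) : ℝ))) atBot (𝓝 1) := by
  have h1 : Tendsto (fun s : ℝ => ((Real.exp (s / 3) : ℝ) : ℂ)) atBot (𝓝 0) :=
    tendsto_of_norm_sub_le (C := 1) fun s _ => by
      rw [sub_zero, one_mul, Complex.norm_of_nonneg (Real.exp_pos _).le]
  have h2 := (Complex.continuous_exp.tendsto (-0)).comp h1.neg
  simpa [Function.comp_def] using h2

/-- At the matching point the Jost solution tends to `1` and the derivative of the solution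
continuing `Psi2` to `1`, while the other product in the Wronskian is `O(u)`. -/
theorem tendsto_coef_Psi2 (hM : 1 ≤ M) :
    Tendsto (fun s : ℝ => coef M (Psi2 M) (dPsi2 M) s) atBot (𝓝 1) := by
  obtain ⟨K, hK⟩ := zeroEnergyBound_exists hM
  obtain ⟨D, hD0, hD⟩ := overlapBounds_exists hM
  set v : ℝ → ℝ := fun s => Real.exp (s / 3) with hv
  set T : ℝ → ℂ := fun s => jostSum M (v s ^ 2)⁻¹ ((v s ^ 3 : ℝ) / rot) *
        dpert M (Psi2 M) (dPsi2 M) (v s ^ 2)⁻¹ (v s ^ 3 : ℝ) -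
      (djostSum M (v s ^ 2)⁻¹ ((v s ^ 3 : ℝ) / rot) -
        v s ^ 3 * jostSum M (v s ^ 2)⁻¹ ((v s ^ 3 : ℝ) / rot)) *
        pert M (Psi2 M) (v s ^ 2)⁻¹ (v s ^ 3 : ℝ) with hT
  have hTlim : Tendsto T atBot (𝓝 1) := by
    refine tendsto_of_norm_sub_le (C := (D + 1) * D + D + (D + (D + 1)) * D) fun s hs => ?_
    have hu0 : 0 < v s := Real.exp_pos _
    have hu1 : v s < 1 := Real.exp_lt_one_iff.2 (by linarith)
    have hb := hD (v s) hu0 hu1 _ (coef_overlap hM hK (zeroEnergySolution_Psi2 hM hK) hs rfl).1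
    rw [hT]
    change _ ≤ _ * v s
    simp only
    set u := v s
    set U := jostSum M (u ^ 2)⁻¹ ((u ^ 3 : ℝ) / rot)
    set dU := djostSum M (u ^ 2)⁻¹ ((u ^ 3 : ℝ) / rot)
    set φ := pert M (Psi2 M) (u ^ 2)⁻¹ (u ^ 3 : ℝ)
    set dφ := dpert M (Psi2 M) (dPsi2 M) (u ^ 2)⁻¹ (u ^ 3 : ℝ)
    have hU : ‖U‖ ≤ D + 1 := by
      have := norm_sub_norm_le U 1
      rw [norm_one] at this
      nlinarith [hb.U_sub]
    have e : U * dφ - (dU - u ^ 3 * U) * φ - 1 = U * (dφ - 1) + (U - 1) - (dU - u ^ 3 * U) * φ := by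
      ring
    have hun : ‖(u : ℂ)‖ = u := Complex.norm_of_nonneg hu0.le
    have h3 : ‖(dU - u ^ 3 * U) * φ‖ ≤ (D + (D + 1)) * D * u := by
      have h4 : ‖dU - u ^ 3 * U‖ ≤ (D + (D + 1)) * u ^ 3 := by
        refine (norm_sub_le _ _).trans ?_
        rw [norm_mul, norm_pow, hun, add_mul]
        have h5 : u ^ 4 ≤ u ^ 3 := pow_le_pow_of_le_one hu0.le hu1.le (by norm_num)
        refine add_le_add (hb.dU_le.trans (by gcongr)) ?_
        rw [mul_comm]; gcongr
      rw [norm_mul]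
      calc _ ≤ (D + (D + 1)) * u ^ 3 * ‖φ‖ := by gcongr
        _ = (D + (D + 1)) * (‖φ‖ * u ^ 2) * u := by ring
        _ ≤ _ := by gcongr; exact hb.φ₂_le
    rw [e]
    have h5 : ‖U * (dφ - 1)‖ ≤ (D + 1) * D * u := by
      rw [norm_mul, mul_assoc]
      gcongr
      exact hb.dφ₂_sub
    have h6 := norm_sub_le (U * (dφ - 1) + (U - 1)) ((dU - u ^ 3 * U) * φ)
    have h7 := norm_add_le (U * (dφ - 1)) (U - 1)
    linarith [hb.U_sub]
  have h := tendsto_exp_neg_overlap.mul hTlim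
  rw [one_mul] at h
  refine h.congr' ?_
  filter_upwards [eventually_lt_atBot 0] with s hs
  exact ((coef_overlap hM hK (zeroEnergySolution_Psi2 hM hK) hs rfl).2).symm

/-- Here the Wronskian is `ε` to leading order: it is the term with the derivative `-ε` of the
exponential factor of the Jost solution against the value `1` of `Phi1` at infinity. -/
theorem tendsto_coef_Phi1 (hM : 1 ≤ M) : Tendsto (fun s : ℝ =>
    coef M (Phi1 (M + 2)) (dPhi1 M) s * Complex.exp (-s)) atBot (𝓝 1) := by
  obtain ⟨K, hK⟩ := zeroEnergyBound_exists hM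
  obtain ⟨D, hD0, hD⟩ := overlapBounds_exists hM
  set v : ℝ → ℝ := fun s => Real.exp (s / 3) with hv
  have hc := fun (s : ℝ) (hs : s < 0) =>
    coef_overlap hM hK (zeroEnergySolution_Phi1 hM hK) hs (u := v s) rfl
  have hv0 : ∀ s, 0 < v s := fun s => Real.exp_pos _
  have hv1 : ∀ s, s < 0 → v s < 1 := fun s hs => Real.exp_lt_one_iff.2 (by linarith)
  have hx : Tendsto (fun s => (v s ^ 2)⁻¹) atBot atTop := by
    have e : ∀ s, (v s ^ 2)⁻¹ = Real.exp (-s * (2 / 3)) := fun s => by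
      rw [hv, ← Real.exp_nat_mul, ← Real.exp_neg]; congr 1; push_cast; ring
    simp only [e]
    exact Real.tendsto_exp_atTop.comp
      (tendsto_neg_atBot_atTop.atTop_mul_const (by norm_num))
  have hU : Tendsto (fun s => jostSum M (v s ^ 2)⁻¹ ((v s ^ 3 : ℝ) / rot)) atBot (𝓝 1) :=
    tendsto_of_norm_sub_le fun s hs => (hD _ (hv0 s) (hv1 s hs) _ (hc s hs).1).U_sub
  have hφ : Tendsto (fun s => pert M (Phi1 (M + 2)) (v s ^ 2)⁻¹ (v s ^ 3 : ℝ)) atBot (𝓝 1) := by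
    have h1 : Tendsto (fun s => pert M (Phi1 (M + 2)) (v s ^ 2)⁻¹ (v s ^ 3 : ℝ) -
        Phi1 (M + 2) (v s ^ 2)⁻¹) atBot (𝓝 0) := tendsto_of_norm_sub_le fun s hs => by
      rw [sub_zero]; exact (hD _ (hv0 s) (hv1 s hs) _ (hc s hs).1).φ₁_sub
    have h2 : Tendsto (fun s => ((Phi1 (M + 2) (v s ^ 2)⁻¹ : ℝ) : ℂ)) atBot (𝓝 (1 : ℝ)) :=
      (Complex.continuous_ofReal.tendsto 1).comp ((tendsto_Phi1_atTop hM).comp hx)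
    simpa using h1.add h2
  have hsmall : ∀ {f : ℝ → ℂ}, (∀ s, s < 0 → ‖f s‖ ≤ D * v s ^ 4) →
      Tendsto (fun s => f s * (((v s ^ 3)⁻¹ : ℝ) : ℂ)) atBot (𝓝 0) := by
    intro f hf
    refine tendsto_of_norm_sub_le (C := D) fun s hs => ?_
    have := hv0 s
    rw [sub_zero, norm_mul, Complex.norm_of_nonneg (by positivity)]
    calc _ ≤ D * v s ^ 4 * (v s ^ 3)⁻¹ := by gcongr; exact hf s hs
      _ = D * v s := by field_simp
  have hdU := hsmall fun s hs => (hD _ (hv0 s) (hv1 s hs) _ (hc s hs).1).dU_le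
  have hdφ := hsmall fun s hs => (hD _ (hv0 s) (hv1 s hs) _ (hc s hs).1).dφ₁_le
  have hE : Tendsto (fun s : ℝ => Complex.exp (-(v s : ℝ))) atBot (𝓝 1) := tendsto_exp_neg_overlap
  have h := hE.mul ((hU.mul hdφ).sub ((hdU.sub hU).mul hφ))
  have e0 : (1 : ℂ) * (1 * 0 - (0 - 1) * 1) = 1 := by ring
  rw [e0] at h
  refine h.congr' ?_
  filter_upwards [eventually_lt_atBot 0] with s hs
  have hu3 : Complex.exp (-s) = (((v s ^ 3)⁻¹ : ℝ) : ℂ) := by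
    rw [hv, ← Real.exp_nat_mul, ← Real.exp_neg, ← Complex.ofReal_neg, ← Complex.ofReal_exp]
    congr 2; push_cast; ring
  rw [(hc s hs).2, hu3]
  have h3 : (v s : ℂ) ^ 3 * (((v s ^ 3)⁻¹ : ℝ) : ℂ) = 1 := by
    have hne : (v s : ℂ) ≠ 0 := by exact_mod_cast (hv0 s).ne'
    push_cast
    exact mul_inv_cancel₀ (pow_ne_zero 3 hne)
  linear_combination (-(Complex.exp (-(v s : ℝ)) * jostSum M (v s ^ 2)⁻¹ ((v s ^ 3 : ℝ) / rot) *
    pert M (Phi1 (M + 2)) (v s ^ 2)⁻¹ (v s ^ 3 : ℝ))) * h3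

end

section
variable {M : ℕ} {F : ℂ → ℂ} {P : Polynomial ℂ}

theorem subO_sub_of_stokesExpansion (hM : 1 ≤ M)
    (h : SubO (strip (3 * Real.pi / 4)) (M + 2) (fun w => F w - stokesExpansion M P w)) :
    SubO (strip 0) 2 (fun w => F w - (P.coeff 0 + P.coeff 1 * Complex.exp w +
      logCoeff M * P.coeff 0 * (w * Complex.exp (M * w)))) := by
  have hpi := Real.pi_pos
  refine ((((h.subset (strip_mono (by positivity))).mono (by omega : 2 ≤ M + 2)).add
    (subO_polynomial_sub_coeff₂ _ P)).sub
    ((((subO_id_mul_exp 0 (M + 1)).mono (by omega : 2 ≤ M + 1)).const_mul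
      (logCoeff M * P.coeff 1)).sub
    ((((subO_sq_mul_exp 0 (2 * M)).mono (by omega : 2 ≤ 2 * M)).const_mul
      (logCoeff M * stokes₁ M / 2 * P.coeff 0)).add
    (((subO_id_mul_exp 0 (2 * M)).mono (by omega : 2 ≤ 2 * M)).const_mul
      (stokes₂ M * P.coeff 0))))).congr fun w _ _ => ?_
  rw [stokesExpansion]
  ring

theorem tendsto_exp_ofReal_atBot : Tendsto (fun s : ℝ => Complex.exp s) atBot (𝓝 0) := by
  have := (Complex.continuous_ofReal.tendsto 0).comp Real.tendsto_exp_atBot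
  simpa [Function.comp_def] using this

/-- The constant term of the polynomial in a Stokes expansion is the limit at `ε = 0`. -/
theorem coeff_zero_of_tendsto (hM : 1 ≤ M)
    (h : SubO (strip (3 * Real.pi / 4)) (M + 2) (fun w => F w - stokesExpansion M P w)) {l : ℂ}
    (hl : Tendsto (fun s : ℝ => F s) atBot (𝓝 l)) : P.coeff 0 = l := by
  have h1 : SubO (strip 0) 1 (fun w => F w - P.coeff 0) :=
    (((subO_sub_of_stokesExpansion hM h).mono (by omega : 1 ≤ 2)).add
      ((((subO_exp (strip 0) 1).const_mul (P.coeff 1)).add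
        (((subO_id_mul_exp 0 M).mono hM).const_mul (logCoeff M * P.coeff 0))))).congr
      fun w _ _ => by push_cast; ring_nf
  have h2 := h1.tendsto_zero (k := 0) (by norm_num) (ofReal_mem_strip le_rfl)
  have h3 := hl.sub_const (P.coeff 0)
  have h4 := tendsto_nhds_unique h3 (by simpa using h2)
  exact (sub_eq_zero.1 h4).symm

/-- The coefficient of `ε` in a Stokes expansion as a limit. The term `ε^{m-2} ln ε` has to be
subtracted first, since for `m = 3` it dominates `ε`. -/
theorem tendsto_coeff_one (hM : 1 ≤ M)
    (h : SubO (strip (3 * Real.pi / 4)) (M + 2) (fun w => F w - stokesExpansion M P w)) :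
    Tendsto (fun s : ℝ => (F s - P.coeff 0 - logCoeff M * P.coeff 0 * (s * Complex.exp (M * s))) *
      Complex.exp (-s)) atBot (𝓝 (P.coeff 1)) := by
  have h2 := (subO_sub_of_stokesExpansion hM h).tendsto_zero (k := 1) (by norm_num)
    (ofReal_mem_strip le_rfl)
  have h3 := h2.add_const (P.coeff 1)
  rw [zero_add] at h3
  refine h3.congr fun s => ?_
  have e : Complex.exp s * Complex.exp (-s) = 1 := by rw [← Complex.exp_add]; simp
  simp only [Nat.cast_one, one_mul]
  linear_combination (-P.coeff 1) * e

/-- Expansion of the coefficient of `pert Phi1` in the Jost solution. -/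
theorem exists_expansion_coef_Psi2 (hM : 1 ≤ M) : ∃ (P : Polynomial ℂ) (p : ℝ),
    P.coeff 0 = 1 ∧ P.coeff 1 = p ∧ SubO (strip (3 * Real.pi / 4)) (M + 2)
      (fun w => coef M (Psi2 M) (dPsi2 M) w - stokesExpansion M P w) := by
  obtain ⟨K, hK⟩ := zeroEnergyBound_exists hM
  obtain ⟨P, hP⟩ := (logHolomorphic_coef hM hK (zeroEnergySolution_Psi2 hM hK)).exists_stokesExpansion
    hM (fun s => coef_jump hM s)
  have h0 : P.coeff 0 = 1 := coeff_zero_of_tendsto hM hP (tendsto_coef_Psi2 hM)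
  refine ⟨P, (P.coeff 1).re, h0, ?_, hP⟩
  have h1 := (Complex.continuous_im.tendsto _).comp (tendsto_coeff_one hM hP)
  have him : (P.coeff 1).im = 0 := by
    refine tendsto_nhds_unique (h1.congr fun s => ?_) tendsto_const_nhds
    have e1 : Complex.exp (-s) = (Real.exp (-s) : ℂ) := by push_cast; rfl
    have e2 : Complex.exp (M * s) = (Real.exp (M * s) : ℂ) := by push_cast; rfl
    simp only [Function.comp_apply, h0, e1, e2, Complex.mul_im, Complex.sub_im, Complex.ofReal_im,
      Complex.one_im, coef_ofReal_im hM s, mul_zero, zero_mul, add_zero, sub_zero, mul_one]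
  exact Complex.ext (by simp) (by simp [him])

/-- Expansion of the coefficient of `pert Psi2`, up to its sign. -/
theorem exists_expansion_coef_Phi1 (hM : 1 ≤ M) : ∃ P : Polynomial ℂ,
    P.coeff 0 = 0 ∧ P.coeff 1 = 1 ∧ SubO (strip (3 * Real.pi / 4)) (M + 2)
      (fun w => coef M (Phi1 (M + 2)) (dPhi1 M) w - stokesExpansion M P w) := by
  obtain ⟨K, hK⟩ := zeroEnergyBound_exists hM
  obtain ⟨P, hP⟩ := (logHolomorphic_coef hM hK (zeroEnergySolution_Phi1 hM hK)).exists_stokesExpansion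
    hM (fun s => coef_jump hM s)
  have h0 : P.coeff 0 = 0 := by
    refine coeff_zero_of_tendsto hM hP ?_
    have := (tendsto_coef_Phi1 hM).mul tendsto_exp_ofReal_atBot
    rw [mul_zero] at this
    refine this.congr fun s => ?_
    rw [mul_assoc, ← Complex.exp_add]; simp
  have h1 := tendsto_coeff_one hM hP
  simp only [h0, mul_zero, zero_mul, sub_zero] at h1
  exact ⟨P, h0, tendsto_nhds_unique h1 (tendsto_coef_Phi1 hM), hP⟩

end

/-! ### Division by the factor `r` -/

/-- The coefficient of `ε^{2m-4} (ln ε)²`. -/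
noncomputable def logSqCoeff (M : ℕ) : ℝ := logCoeff M * stokes₁ M / 2

/-- The factor `r` in the coordinate `w = ln ε`. -/
noncomputable def rLog (M : ℕ) (c : ℝ) (w : ℂ) : ℂ :=
  1 + c * Complex.exp w + logCoeff M * (w * Complex.exp (M * w)) +
    logSqCoeff M * (w ^ 2 * Complex.exp ((2 * M : ℕ) * w))

/-- The coefficient of `ε^{m-1} ln ε` after division by `r` of an expansion with leading
coefficients `p₀`, `p₁`. The term with `stokes₂` has this order only for `m = 3`. -/
noncomputable def quotientCoeff (M : ℕ) (c p₀ p₁ : ℝ) : ℝ :=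
  -(logCoeff M * (2 * p₁ - c * p₀)) + if M = 1 then stokes₂ M * p₀ else 0

section
variable {M : ℕ}

theorem subO_rLog_sub_one (hM : 1 ≤ M) (b : ℝ) (c : ℝ) :
    SubO (strip b) 1 (fun w => rLog M c w - 1) :=
  (((subO_exp (strip b) 1).const_mul c).add ((((subO_id_mul_exp b M).mono hM).const_mul
    (logCoeff M)).add (((subO_sq_mul_exp b (2 * M)).mono (by omega : 1 ≤ 2 * M)).const_mul
    (logSqCoeff M)))).congr fun w _ _ => by rw [rLog]; push_cast; ring_nf

/-- To order `m`, a Stokes expansion is `r` times a polynomial plus one logarithmic term. -/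
theorem stokesExpansion_eq_rLog_mul (hM : 1 ≤ M) (b : ℝ) (c : ℝ) {P : Polynomial ℂ} {p₀ p₁ : ℝ}
    (h0 : P.coeff 0 = p₀) (h1 : P.coeff 1 = p₁) : ∃ Q : Polynomial ℂ, Q.coeff 0 = p₀ ∧
      SubO (strip b) (M + 2) (fun w => stokesExpansion M P w - rLog M c w *
        (Q.eval (Complex.exp w) +
          quotientCoeff M c p₀ p₁ * (w * Complex.exp ((M + 1 : ℕ) * w)))) := by
  set D : Polynomial ℂ := P.divX - Polynomial.C ((c : ℂ) * p₀) with hD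
  -- the inverse of `1 + c ε` to order `M + 1`
  set R : Polynomial ℂ := ∑ k ∈ Finset.range (M + 1), (Polynomial.C (-(c : ℂ)) * Polynomial.X) ^ k
    with hR
  have hRz : ∀ z : ℂ, (1 + c * z) * R.eval z = 1 - (-c * z) ^ (M + 1) := by
    intro z
    have : R.eval z = ∑ k ∈ Finset.range (M + 1), (-c * z) ^ k := by
      simp [hR, Polynomial.eval_finsetSum]
    rw [this]
    have := mul_neg_geom_sum (-(c : ℂ) * z) (M + 1)
    rw [← this]; ring
  have hR0 : R.coeff 0 = 1 := by
    have := hRz 0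
    rw [Polynomial.coeff_zero_eq_eval_zero]
    simpa using this
  set Q : Polynomial ℂ := Polynomial.C (p₀ : ℂ) + Polynomial.X * (D * R) with hQ
  have hQ0 : Q.coeff 0 = p₀ := by simp [hQ]
  have hD0 : (D * R).coeff 0 = p₁ - c * p₀ := by
    rw [Polynomial.mul_coeff_zero, hR0, hD, Polynomial.coeff_sub, Polynomial.coeff_divX,
      Polynomial.coeff_C_zero, zero_add, h1, mul_one]
  refine ⟨Q, hQ0, ?_⟩
  set q := quotientCoeff M c p₀ p₁
  have hEadd : ∀ w : ℂ, Complex.exp ((M + 1 : ℕ) * w) = Complex.exp (M * w) * Complex.exp w := by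
    intro w; rw [← Complex.exp_add]; congr 1; push_cast; ring
  -- the terms of order at least `m` in the difference: the error of the approximate inverse; the
  -- logarithm in `r` times the polynomial beyond its constant term; the squared logarithm in `r`;
  -- the logarithmic term times `r - 1`; and the term `ε^{2m-4} ln ε`, which for `m = 3` alone is
  -- not small and contributes to `q`
  have t1 : SubO (strip b) (M + 2) (fun w => (D.eval (Complex.exp w) * Complex.exp w) *
      ((-c) ^ (M + 1) * Complex.exp ((M + 1 : ℕ) * w))) := by
    have h := ((subO_polynomial (strip b) D).mul (subO_exp (strip b) 1)).mul
      ((subO_exp (strip b) (M + 1)).const_mul ((-(c : ℂ)) ^ (M + 1)))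
    exact (h.mono (by omega)).congr fun w _ _ => by push_cast; ring_nf
  have t2 : SubO (strip b) (M + 2) (fun w =>
      ((D * R).eval (Complex.exp w) - (D * R).coeff 0) * (w * Complex.exp ((M + 1 : ℕ) * w))) :=
    ((subO_polynomial_sub_coeff (strip b) (D * R)).mul (subO_id_mul_exp b (M + 1))).mono (by omega)
  have t3 : SubO (strip b) (M + 2) (fun w =>
      ((D * R).eval (Complex.exp w) * Complex.exp w) * (w ^ 2 * Complex.exp ((2 * M : ℕ) * w))) := by
    have h := ((subO_polynomial (strip b) (D * R)).mul (subO_exp (strip b) 1)).mul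
      (subO_sq_mul_exp b (2 * M))
    exact (h.mono (by omega)).congr fun w _ _ => by push_cast; ring_nf
  have t4 : SubO (strip b) (M + 2) (fun w =>
      (rLog M c w - 1) * (w * Complex.exp ((M + 1 : ℕ) * w))) :=
    ((subO_rLog_sub_one hM b c).mul (subO_id_mul_exp b (M + 1))).mono (by omega)
  have t5 : SubO (strip b) (M + 2) (fun w => stokes₂ M * p₀ *
      (w * Complex.exp ((2 * M : ℕ) * w)) -
      (if M = 1 then stokes₂ M * p₀ else 0 : ℝ) * (w * Complex.exp ((M + 1 : ℕ) * w))) := by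
    by_cases hM1 : M = 1
    · subst hM1
      refine ((subO_const (strip b) 0).mul (subO_exp (strip b) (1 + 2))).mono (by omega) |>.congr
        fun w _ _ => ?_
      rw [if_pos rfl]; push_cast; ring_nf
    · refine (((subO_id_mul_exp b (2 * M)).mono (by omega : M + 2 ≤ 2 * M)).const_mul
        (stokes₂ M * p₀)).congr fun w _ _ => ?_
      rw [if_neg hM1]; push_cast; ring
  refine ((((t1.sub (t2.const_mul (logCoeff M))).sub (t3.const_mul (logSqCoeff M))).sub
    (t4.const_mul q)).add t5).congr fun w _ _ => ?_
  have eP : P.eval (Complex.exp w) = p₀ + Complex.exp w * (D.eval (Complex.exp w) + c * p₀) := by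
    rw [eval_eq_coeff_add, h0, hD]; simp
  have eQ : Q.eval (Complex.exp w) = p₀ + Complex.exp w * (D.eval (Complex.exp w) *
      R.eval (Complex.exp w)) := by simp [hQ]
  have eR := hRz (Complex.exp w)
  rw [mul_pow, ← Complex.exp_nat_mul w (M + 1)] at eR
  have eq : (q : ℂ) = -(logCoeff M * (2 * p₁ - c * p₀)) +
      ((if M = 1 then stokes₂ M * p₀ else 0 : ℝ) : ℂ) := by
    simp only [q, quotientCoeff]; push_cast; ring
  rw [stokesExpansion, eP, eQ, h0, h1, hD0, Polynomial.eval_mul]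
  have es : (logSqCoeff M : ℂ) = logCoeff M * stokes₁ M / 2 := by
    rw [logSqCoeff]; push_cast; ring
  rw [← es]
  rw [show ((if M = 1 then stokes₂ M * p₀ else 0 : ℝ) : ℂ) =
    q + logCoeff M * (2 * p₁ - c * p₀) by rw [eq]; ring]
  rw [rLog]
  rw [hEadd] at eR ⊢
  linear_combination (Complex.exp w * D.eval (Complex.exp w)) * eR

/-- The coefficient of `pert Phi1` in the Jost solution is, to order `m`, the product of `r` with
the sum of a polynomial and a multiple of `ε^{m-1} ln ε`. -/
theorem exists_quotient_coef_Psi2 (hM : 1 ≤ M) (c : ℝ) : ∃ (Q : Polynomial ℂ) (q : ℝ),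
    Q.coeff 0 = 1 ∧ SubO (strip (3 * Real.pi / 4)) (M + 2) (fun w =>
      coef M (Psi2 M) (dPsi2 M) w - rLog M c w *
        (Q.eval (Complex.exp w) + q * (w * Complex.exp ((M + 1 : ℕ) * w)))) := by
  obtain ⟨P, p, h0, h1, hP⟩ := exists_expansion_coef_Psi2 hM
  obtain ⟨Q, hQ0, hQ⟩ := stokesExpansion_eq_rLog_mul hM (3 * Real.pi / 4) c (p₀ := 1)
    (by rw [h0]; simp) h1
  exact ⟨Q, _, by rw [hQ0]; simp, (hP.add hQ).congr fun w _ _ => by ring⟩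

/-- The same for the coefficient of `pert Psi2`, up to its sign. Here the polynomial has no constant
term, and the multiple of the logarithm does not depend on the constant `c` in `r`. -/
theorem exists_quotient_coef_Phi1 (hM : 1 ≤ M) (c : ℝ) : ∃ Q : Polynomial ℂ,
    Q.coeff 0 = 0 ∧ SubO (strip (3 * Real.pi / 4)) (M + 2) (fun w =>
      coef M (Phi1 (M + 2)) (dPhi1 M) w - rLog M c w * (Q.eval (Complex.exp w) +
        (-(2 * logCoeff M) : ℝ) * (w * Complex.exp ((M + 1 : ℕ) * w)))) := by
  obtain ⟨P, h0, h1, hP⟩ := exists_expansion_coef_Phi1 hM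
  obtain ⟨Q, hQ0, hQ⟩ := stokesExpansion_eq_rLog_mul hM (3 * Real.pi / 4) c (p₀ := 0) (p₁ := 1)
    (by rw [h0]; simp) (by rw [h1]; simp)
  have e : quotientCoeff M c 0 1 = -(2 * logCoeff M) := by
    rw [quotientCoeff]; split_ifs <;> ring
  rw [e] at hQ
  exact ⟨Q, by rw [hQ0]; simp, (hP.add hQ).congr fun w _ _ => by ring⟩

end

/-! ### Bounds on derivatives in `ε` from Cauchy's estimate -/

/-- The points within relative distance `θ` of the half disc `Re ε > 0`, `|ε| ≤ 1/x`. -/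
def enlargedHalfDisc (θ x : ℝ) : Set ℂ :=
  {z | ∃ ε : ℂ, 0 < ε.re ∧ ‖ε‖ ≤ 1 / x ∧ ‖z - ε‖ < θ * ‖ε‖}

section
variable {θ x : ℝ} {z ε : ℂ}

theorem norm_pos_of_re_pos (hε : 0 < ε.re) : 0 < ‖ε‖ := hε.trans_le (Complex.re_le_norm ε)

theorem isOpen_enlargedHalfDisc (θ x : ℝ) : IsOpen (enlargedHalfDisc θ x) := by
  have : enlargedHalfDisc θ x = ⋃ ε ∈ {ε : ℂ | 0 < ε.re ∧ ‖ε‖ ≤ 1 / x},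
      Metric.ball ε (θ * ‖ε‖) := by
    ext z
    simp [enlargedHalfDisc, dist_eq_norm, and_assoc]
  rw [this]
  exact isOpen_biUnion fun _ _ => Metric.isOpen_ball

theorem closedBall_subset_enlargedHalfDisc (hθ : 0 < θ) (hε : 0 < ε.re) (hx : ‖ε‖ ≤ 1 / x) :
    Metric.closedBall ε (θ / 2 * ‖ε‖) ⊆ enlargedHalfDisc θ x := by
  intro z hz
  rw [mem_closedBall_iff_norm] at hz
  have := norm_pos_of_re_pos hε
  exact ⟨ε, hε, hx, by nlinarith⟩

/-- Cauchy's estimate for the `k`-th derivative at the centre of a closed disc. -/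
theorem norm_iteratedDeriv_le_of_closedBall {F : ℂ → ℂ} {k : ℕ} {R C : ℝ} (hR : 0 < R)
    (hF : ∀ z ∈ Metric.closedBall ε R, DifferentiableAt ℂ F z)
    (hC : ∀ z ∈ Metric.closedBall ε R, ‖F z‖ ≤ C) :
    ‖iteratedDeriv k F ε‖ ≤ k.factorial * C / R ^ k := by
  refine Complex.norm_iteratedDeriv_le_of_forall_mem_sphere_norm_le k hR ?_ fun z hz =>
    hC z (Metric.sphere_subset_closedBall hz)
  refine DifferentiableOn.diffContOnCl fun z hz => ?_
  rw [closure_ball _ hR.ne'] at hz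
  exact (hF z hz).differentiableWithinAt

/-- A function that splits into an entire part, `O(|ε| x)` for `|ε| ≤ 2/x`, and a part that is
`O(|ε|^{m-δ} x²)` near the half disc, satisfies the required bounds. -/
theorem epsDerivBounds_of_split {m : ℕ} (hm : 3 ≤ m) {x₀ : ℝ} (hx₀ : 1 < x₀) (hθ : 0 < θ)
    (hθ1 : θ ≤ 1) {f reg sing : ℝ → ℂ → ℂ}
    (hf : ∀ x : ℝ, x₀ ≤ x → ∀ ε : ℂ, 0 < ε.re → ‖ε‖ ≤ 1 / x →
      f x =ᶠ[𝓝 ε] fun z => reg x z + sing x z)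
    (hreg : ∀ x : ℝ, x₀ ≤ x → Differentiable ℂ (reg x))
    (hregb : ∃ C : ℝ, ∀ x : ℝ, x₀ ≤ x → ∀ ε : ℂ, ‖ε‖ ≤ 2 / x → ‖reg x ε‖ ≤ C * (‖ε‖ * x))
    (hsing : ∀ x : ℝ, x₀ ≤ x → DifferentiableOn ℂ (sing x) (enlargedHalfDisc θ x))
    (hsingb : ∀ δ : ℝ, 0 < δ → ∃ C : ℝ, ∀ x : ℝ, x₀ ≤ x → ∀ ε ∈ enlargedHalfDisc θ x,
      ‖sing x ε‖ ≤ C * ‖ε‖ ^ ((m : ℝ) - δ) * x ^ 2) :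
    (∃ C : ℝ, ∀ x : ℝ, x₀ ≤ x → ∀ ε : ℂ, 0 < ε.re → ‖ε‖ ≤ 1 / x → ‖f x ε‖ ≤ C * ‖ε * (x : ℂ)‖) ∧
      EpsDerivBounds m x₀ f := by
  obtain ⟨A, hA⟩ := hregb
  have hmem : ∀ x : ℝ, x₀ ≤ x → ∀ ε : ℂ, 0 < ε.re → ‖ε‖ ≤ 1 / x → ε ∈ enlargedHalfDisc θ x :=
    fun x _ ε hε hb => ⟨ε, hε, hb, by simpa using mul_pos hθ (norm_pos_of_re_pos hε)⟩
  have hregc : ∀ x : ℝ, x₀ ≤ x → ∀ (ε : ℂ) (n : ℕ∞), ContDiffAt ℂ n (reg x) ε := fun x hx ε n =>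
    ((hreg x hx).analyticAt ε).contDiffAt
  have hsingc : ∀ x : ℝ, x₀ ≤ x → ∀ ε : ℂ, 0 < ε.re → ‖ε‖ ≤ 1 / x → ∀ n : ℕ∞,
      ContDiffAt ℂ n (sing x) ε := fun x hx ε hε hb n =>
    ((hsing x hx).analyticAt ((isOpen_enlargedHalfDisc θ x).mem_nhds (hmem x hx ε hε hb))).contDiffAt
  have hA0 : 0 ≤ max A 0 := le_max_right _ _
  -- the entire part is bounded on the disc of radius `1/x` around `ε`
  have hregd : ∀ k : ℕ, ∀ x : ℝ, x₀ ≤ x → ∀ ε : ℂ, ‖ε‖ ≤ 1 / x →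
      ‖iteratedDeriv k (reg x) ε‖ ≤ k.factorial * (2 * max A 0) * x ^ k := by
    intro k x hx ε hb
    have hx0 : 0 < x := by linarith
    refine (norm_iteratedDeriv_le_of_closedBall (R := 1 / x) (C := 2 * max A 0) (by positivity)
      (fun z _ => hreg x hx z) fun z hz => ?_).trans (le_of_eq ?_)
    · have hz2 : ‖z‖ ≤ 2 / x := by
        rw [mem_closedBall_iff_norm] at hz
        have h1 := norm_add_le ε (z - ε)
        rw [add_sub_cancel] at h1
        have : 2 / x = 1 / x + 1 / x := by ring
        linarith
      have h2 : ‖z‖ * x ≤ 2 := by rwa [le_div_iff₀ hx0] at hz2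
      calc _ ≤ A * (‖z‖ * x) := hA x hx z hz2
        _ ≤ max A 0 * 2 := mul_le_mul (le_max_left _ _) h2 (by positivity) hA0
        _ = _ := mul_comm _ _
    · rw [one_div, inv_pow, div_inv_eq_mul]
  have hθ2 : 1 ≤ 2 / θ := by rw [le_div_iff₀ hθ]; linarith
  -- the singular part is bounded on a disc of radius proportional to `|ε|`, which avoids the slit
  have hsingd : ∀ δ : ℝ, 0 < δ → δ ≤ 1 → ∃ C : ℝ, 0 ≤ C ∧ ∀ k : ℕ, k ≤ m + 1 → ∀ x : ℝ, x₀ ≤ x →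
      ∀ ε : ℂ, 0 < ε.re → ‖ε‖ ≤ 1 / x →
        ‖iteratedDeriv k (sing x) ε‖ ≤ C * ‖ε‖ ^ ((m : ℝ) - δ - k) * x ^ 2 := by
    intro δ hδ hδ1
    obtain ⟨C, hC⟩ := hsingb δ hδ
    refine ⟨(m + 1).factorial * (max C 0 * 2 ^ ((m : ℝ) - δ)) * (2 / θ) ^ (m + 1), by positivity,
      fun k hk x hx ε hε hb => ?_⟩
    have hx0 : 0 < x := by linarith
    have hn := norm_pos_of_re_pos hε
    have hsub := closedBall_subset_enlargedHalfDisc hθ hε hb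
    have hm3 : (3 : ℝ) ≤ m := by exact_mod_cast hm
    refine (norm_iteratedDeriv_le_of_closedBall (k := k) (R := θ / 2 * ‖ε‖)
      (C := max C 0 * 2 ^ ((m : ℝ) - δ) * ‖ε‖ ^ ((m : ℝ) - δ) * x ^ 2) (by positivity)
      (fun z hz => (hsing x hx).differentiableAt
        ((isOpen_enlargedHalfDisc θ x).mem_nhds (hsub hz))) fun z hz => ?_).trans ?_
    · refine (hC x hx z (hsub hz)).trans ?_
      rw [mem_closedBall_iff_norm] at hz
      have h1 := norm_add_le ε (z - ε)
      rw [add_sub_cancel] at h1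
      have h2 : ‖z‖ ≤ 2 * ‖ε‖ := by nlinarith
      have h3 : ‖z‖ ^ ((m : ℝ) - δ) ≤ 2 ^ ((m : ℝ) - δ) * ‖ε‖ ^ ((m : ℝ) - δ) := by
        rw [← Real.mul_rpow (by norm_num) hn.le]
        exact Real.rpow_le_rpow (norm_nonneg _) h2 (by linarith)
      rw [mul_assoc (max C 0)]
      have : 0 ≤ ‖z‖ ^ ((m : ℝ) - δ) := by positivity
      gcongr
      exact le_max_left _ _
    · rw [mul_pow, Real.rpow_sub hn _ (k : ℝ), Real.rpow_natCast]
      have e : (k.factorial : ℝ) * (max C 0 * 2 ^ ((m : ℝ) - δ) * ‖ε‖ ^ ((m : ℝ) - δ) * x ^ 2) /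
          ((θ / 2) ^ k * ‖ε‖ ^ k) = k.factorial * (max C 0 * 2 ^ ((m : ℝ) - δ)) * (2 / θ) ^ k *
            (‖ε‖ ^ ((m : ℝ) - δ) / ‖ε‖ ^ k) * x ^ 2 := by
        rw [div_pow, div_pow]; field_simp
      rw [e]
      gcongr
  have hsplit : ∀ x : ℝ, x₀ ≤ x → ∀ ε : ℂ, 0 < ε.re → ‖ε‖ ≤ 1 / x → ∀ k : ℕ,
      ‖iteratedDeriv k (f x) ε‖ ≤ ‖iteratedDeriv k (reg x) ε‖ + ‖iteratedDeriv k (sing x) ε‖ := by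
    intro x hx ε hε hb k
    rw [(hf x hx ε hε hb).iteratedDeriv_eq k]
    have := iteratedDeriv_fun_add (n := k) (hregc x hx ε k) (hsingc x hx ε hε hb k)
    rw [this]
    exact norm_add_le _ _
  obtain ⟨C₁, hC₁0, hC₁⟩ := hsingd 1 one_pos le_rfl
  have hm3 : (3 : ℝ) ≤ m := by exact_mod_cast hm
  -- with `δ = 1` the exponents are natural numbers
  have hint : ∀ k : ℕ, k ≤ m - 1 → ∀ r : ℝ, r ^ ((m : ℝ) - 1 - k) = r ^ (m - 1 - k) := by
    intro k hk r
    rw [← Real.rpow_natCast, Nat.cast_sub hk, Nat.cast_sub (by omega)]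
    push_cast; rfl
  refine ⟨⟨max A 0 + C₁, fun x hx ε hε hb => ?_⟩, fun x hx ε hε hb => ?_,
    ⟨m.factorial * (2 * max A 0) + C₁, fun k hk1 hk x hx ε hε hb => ?_⟩, fun δ hδ => ?_⟩
  · have hx0 : 0 < x := by linarith
    have hn := norm_pos_of_re_pos hε
    have hbx : ‖ε‖ * x ≤ 1 := by rwa [le_div_iff₀ hx0] at hb
    have h2 := hC₁ 0 (by omega) x hx ε hε hb
    rw [hint 0 (by omega), iteratedDeriv_zero] at h2
    have h3 := hA x hx ε (hb.trans (by gcongr; norm_num))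
    rw [(hf x hx ε hε hb).eq_of_nhds, norm_mul, Complex.norm_of_nonneg hx0.le, add_mul]
    have hle1 : ‖ε‖ ≤ 1 := hb.trans (by rw [div_le_one hx0]; linarith)
    refine (norm_add_le _ _).trans (add_le_add (h3.trans ?_) (h2.trans ?_))
    · gcongr; exact le_max_left _ _
    · calc C₁ * ‖ε‖ ^ (m - 1 - 0) * x ^ 2 ≤ C₁ * ‖ε‖ ^ 2 * x ^ 2 := by
            gcongr C₁ * ?_ * x ^ 2
            exact pow_le_pow_of_le_one hn.le hle1 (by omega)
        _ = C₁ * ((‖ε‖ * x) * (‖ε‖ * x)) := by ring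
        _ ≤ C₁ * (1 * (‖ε‖ * x)) := by gcongr
        _ = _ := by ring
  · have h := ((hregc x hx ε (m + 1)).add (hsingc x hx ε hε hb (m + 1))).congr_of_eventuallyEq
      (hf x hx ε hε hb)
    exact_mod_cast h
  · have hx0 : 0 < x := by linarith
    have hx1 : 1 ≤ x := by linarith
    have hn := norm_pos_of_re_pos hε
    have hbx : ‖ε‖ * x ≤ 1 := by rwa [le_div_iff₀ hx0] at hb
    have hle1 : ‖ε‖ ≤ 1 := hb.trans (by rw [div_le_one hx0]; linarith)
    refine (hsplit x hx ε hε hb k).trans ?_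
    rw [add_mul]
    refine add_le_add ((hregd k x hx ε hb).trans ?_)
      ((hC₁ k (by omega) x hx ε hε hb).trans ?_)
    · gcongr
      omega
    · rw [hint k hk, mul_assoc]
      refine mul_le_mul_of_nonneg_left ?_ hC₁0
      rcases Nat.lt_or_ge 1 k with h | h
      · calc _ ≤ 1 * x ^ 2 := by gcongr; exact pow_le_one₀ hn.le hle1
          _ ≤ x ^ k := by rw [one_mul]; exact pow_le_pow_right₀ hx1 h
      · have hk' : k = 1 := by omega
        subst hk'
        calc _ ≤ ‖ε‖ ^ 1 * x ^ 2 := by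
              gcongr ?_ * x ^ 2
              exact pow_le_pow_of_le_one hn.le hle1 (by omega)
          _ = (‖ε‖ * x) * x := by ring
          _ ≤ 1 * x := by gcongr
          _ = x ^ 1 := by ring
  · obtain ⟨C, hC0, hC⟩ := hsingd (min δ 1) (lt_min hδ one_pos) (min_le_right _ _)
    refine ⟨(m + 1).factorial * (2 * max A 0) + C, fun k hk1 hk x hx ε hε hb => ?_⟩
    have hx0 : 0 < x := by linarith
    have hx1 : 1 ≤ x := by linarith
    have hn := norm_pos_of_re_pos hε
    have hbx : ‖ε‖ * x ≤ 1 := by rwa [le_div_iff₀ hx0] at hb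
    have hle1 : ‖ε‖ ≤ 1 := hb.trans (by rw [div_le_one hx0]; linarith)
    refine (hsplit x hx ε hε hb k).trans ?_
    rw [add_mul, add_mul]
    refine add_le_add ((hregd k x hx ε hb).trans ?_) ((hC k hk x hx ε hε hb).trans ?_)
    · have h1 : x ^ k ≤ ‖ε‖ ^ ((m : ℝ) - k - δ) * x ^ m := by
        have h2 : x ^ (k - m) ≤ ‖ε‖ ^ ((m : ℝ) - k) := by
          have e : (m : ℝ) - k = -((k - m : ℕ) : ℝ) := by rw [Nat.cast_sub hk1]; ring
          rw [e, Real.rpow_neg hn.le, Real.rpow_natCast, ← inv_pow]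
          gcongr
          rwa [← one_div, le_div_iff₀ hn, mul_comm]
        have h3 : ‖ε‖ ^ ((m : ℝ) - k) ≤ ‖ε‖ ^ ((m : ℝ) - k - δ) :=
          Real.rpow_le_rpow_of_exponent_ge hn hle1 (by linarith)
        calc x ^ k = x ^ (k - m) * x ^ m := by rw [← pow_add]; congr 1; omega
          _ ≤ _ := by gcongr; exact h2.trans h3
      have : (k.factorial : ℝ) ≤ (m + 1).factorial := by exact_mod_cast Nat.factorial_le hk
      calc _ ≤ (m + 1).factorial * (2 * max A 0) * (‖ε‖ ^ ((m : ℝ) - k - δ) * x ^ m) := by gcongr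
        _ = _ := by ring
    · have h3 : ‖ε‖ ^ ((m : ℝ) - min δ 1 - k) ≤ ‖ε‖ ^ ((m : ℝ) - k - δ) :=
        Real.rpow_le_rpow_of_exponent_ge hn hle1 (by linarith [min_le_left δ 1])
      have h4 : x ^ 2 ≤ x ^ m := pow_le_pow_right₀ hx1 (by omega)
      gcongr

end

/-! ### The factor `r` near the half disc -/

section
variable {M : ℕ} {b c x θ : ℝ} {ε z : ℂ}

/-- The factor `r` with the constants `a₀ = logSqCoeff M` and `a₁ = logCoeff M` is `rLog` at
`w = ln ε`. -/
theorem rFactor_eq_rLog (M : ℕ) (c : ℝ) (hε : ε ≠ 0) :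
    rFactor (M + 2) (logSqCoeff M) (logCoeff M) c ε = rLog M c (Complex.log ε) := by
  have e : 2 * (M + 2) - 4 = 2 * M := by omega
  rw [rFactor, rLog, e, Complex.exp_nat_mul, Complex.exp_nat_mul, Complex.exp_log hε,
    Nat.add_sub_cancel]
  ring

theorem rFactor_zero (M : ℕ) (a₀ a₁ c : ℝ) : rFactor (M + 2) a₀ a₁ c 0 = 1 := by
  simp [rFactor]

/-- An order of vanishing in the logarithmic coordinate, read off in the coordinate `ε`. -/
theorem SubO.comp_log {n : ℕ} {f : ℂ → ℂ} (h : SubO (strip b) n f) {δ : ℝ} (hδ : 0 < δ) :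
    ∃ C : ℝ, 0 ≤ C ∧ ∀ ε : ℂ, ε ≠ 0 → ‖ε‖ ≤ 1 → |ε.arg| ≤ b →
      ‖f (Complex.log ε)‖ ≤ C * ‖ε‖ ^ ((n : ℝ) - δ) := by
  obtain ⟨C, hC0, hC⟩ := h.nonneg_const hδ
  refine ⟨C, hC0, fun ε hε h1 hb => ?_⟩
  have hn : 0 < ‖ε‖ := norm_pos_iff.2 hε
  have h2 := hC (Complex.log ε) (mem_strip.2 (by rwa [Complex.log_im]))
    (by rw [Complex.log_re]; exact Real.log_nonpos hn.le h1)
  rwa [Complex.log_re, mul_comm _ (Real.log ‖ε‖), ← Real.rpow_def_of_pos hn] at h2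

theorem norm_rFactor_sub_one_le (hM : 1 ≤ M) (c : ℝ) : ∃ C : ℝ, 0 ≤ C ∧ ∀ ε : ℂ, ‖ε‖ ≤ 1 →
    ‖rFactor (M + 2) (logSqCoeff M) (logCoeff M) c ε - 1‖ ≤ C * √‖ε‖ := by
  obtain ⟨C, hC0, hC⟩ := (subO_rLog_sub_one hM Real.pi c).comp_log (δ := 1 / 2) (by norm_num)
  refine ⟨C, hC0, fun ε h1 => ?_⟩
  rcases eq_or_ne ε 0 with rfl | hε
  · simp [rFactor_zero M]
  · have := hC ε hε h1 (Complex.abs_arg_le_pi ε)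
    rw [rFactor_eq_rLog M c hε, Real.sqrt_eq_rpow]
    norm_num at this
    exact this

theorem mem_slitPlane_of_re_nonneg (h : 0 ≤ ε.re) (hε : ε ≠ 0) : ε ∈ Complex.slitPlane := by
  rw [Complex.mem_slitPlane_iff]
  rcases h.lt_or_eq with h | h
  · exact Or.inl h
  · refine Or.inr fun hi => hε (Complex.ext ?_ ?_) <;> simp [← h, hi]

theorem differentiableAt_rFactor {m : ℕ} {a₀ a₁ : ℝ} (h : ε ∈ Complex.slitPlane) :
    DifferentiableAt ℂ (rFactor m a₀ a₁ c) ε := by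
  unfold rFactor
  have := Complex.differentiableAt_log h
  fun_prop

theorem continuousAt_rFactor (hM : 1 ≤ M) (h : 0 ≤ ε.re) :
    ContinuousAt (rFactor (M + 2) (logSqCoeff M) (logCoeff M) c) ε := by
  rcases eq_or_ne ε 0 with rfl | hε
  · obtain ⟨C, hC0, hC⟩ := norm_rFactor_sub_one_le hM c
    rw [ContinuousAt, rFactor_zero M, tendsto_iff_norm_sub_tendsto_zero]
    have h0 : Tendsto (fun ε : ℂ => C * √‖ε‖) (𝓝 0) (𝓝 0) := by
      have : Continuous fun ε : ℂ => C * √‖ε‖ := by fun_prop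
      simpa using this.tendsto 0
    refine squeeze_zero' (Eventually.of_forall fun _ => norm_nonneg _) ?_ h0
    filter_upwards [Metric.closedBall_mem_nhds (0 : ℂ) one_pos] with z hz
    exact hC z (by simpa using hz)
  · exact (differentiableAt_rFactor (mem_slitPlane_of_re_nonneg h hε)).continuousAt

/-- For large `c` the linear term keeps `r` away from zero in the right half plane: `|1 + cε|` is at
least `1` and at least `c|ε|`, whereas the logarithmic terms are `O(|ε|^{1/2})`. -/
theorem exists_noZeroHalfDisc (hM : 1 ≤ M) {x₀ : ℝ} (hx₀ : 1 < x₀) :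
    ∃ c : ℝ, NoZeroHalfDisc (rFactor (M + 2) (logSqCoeff M) (logCoeff M) c) x₀ := by
  obtain ⟨C, hC0, hC⟩ := norm_rFactor_sub_one_le hM 0
  refine ⟨C ^ 2 + 1, fun ε hre hle h0 => ?_⟩
  set c : ℝ := C ^ 2 + 1 with hc
  have h1 : ‖ε‖ ≤ 1 := hle.trans (by rw [div_le_one (by linarith)]; linarith)
  have h2 : ‖1 + (c : ℂ) * ε‖ ≤ C * √‖ε‖ := by
    have e : 1 + (c : ℂ) * ε = -(rFactor (M + 2) (logSqCoeff M) (logCoeff M) 0 ε - 1) := by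
      rw [rFactor, Nat.add_sub_cancel] at h0 ⊢
      push_cast
      linear_combination h0
    rw [e, norm_neg]
    exact hC ε h1
  have h3 : ‖1 + (c : ℂ) * ε‖ ^ 2 = 1 + 2 * c * ε.re + (c * ‖ε‖) ^ 2 := by
    rw [mul_pow, ← Complex.normSq_eq_norm_sq, ← Complex.normSq_eq_norm_sq, Complex.normSq_apply,
      Complex.normSq_apply]
    simp
    ring
  have hc0 : 0 < c := by positivity
  have h4 : 1 ≤ ‖1 + (c : ℂ) * ε‖ := by
    refine le_of_sq_le_sq ?_ (norm_nonneg _)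
    rw [h3]
    have : 0 ≤ 2 * c * ε.re := by positivity
    nlinarith [sq_nonneg (c * ‖ε‖)]
  have h5 : c * ‖ε‖ ≤ ‖1 + (c : ℂ) * ε‖ := by
    refine le_of_sq_le_sq ?_ (norm_nonneg _)
    rw [h3]
    have : 0 ≤ 2 * c * ε.re := by positivity
    linarith
  set s := √‖ε‖ with hs
  have hs0 : 0 ≤ s := Real.sqrt_nonneg _
  have hs2 : ‖ε‖ = s * s := (Real.mul_self_sqrt (norm_nonneg _)).symm
  have h6 : 1 ≤ C * s := h4.trans h2
  have hs1 : 0 < s := by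
    rcases hs0.lt_or_eq with h | h
    · exact h
    · rw [← h] at h6; norm_num at h6
  have h7 : c * s ≤ C := by
    have h8 := h5.trans h2
    rw [hs2, ← mul_assoc] at h8
    exact le_of_mul_le_mul_right h8 hs1
  have h9 : c * 1 ≤ c * (C * s) := by gcongr
  have h10 : C * (c * s) ≤ C * C := by gcongr
  nlinarith

theorem enlargedHalfDisc_mono {x₀ : ℝ} (hx₀ : 0 < x₀) (hx : x₀ ≤ x) :
    enlargedHalfDisc θ x ⊆ enlargedHalfDisc θ x₀ := fun _ ⟨ε, h1, h2, h3⟩ =>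
  ⟨ε, h1, h2.trans (by gcongr), h3⟩

theorem norm_le_two_div_of_mem (hθ : θ ≤ 1) (hz : z ∈ enlargedHalfDisc θ x) :
    ‖z‖ ≤ 2 / x := by
  obtain ⟨ε, h1, h2, h3⟩ := hz
  have h4 := norm_add_le ε (z - ε)
  rw [add_sub_cancel] at h4
  have : 2 / x = 1 / x + 1 / x := by ring
  nlinarith [norm_pos_of_re_pos h1]

theorem norm_le_one_of_mem (hθ0 : 0 ≤ θ) (hθ : θ ≤ x - 1) (hz : z ∈ enlargedHalfDisc θ x) :
    ‖z‖ ≤ 1 := by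
  obtain ⟨ε, h1, h2, h3⟩ := hz
  have h4 := norm_add_le ε (z - ε)
  rw [add_sub_cancel] at h4
  have hx : 0 < x := by linarith
  rw [le_div_iff₀ hx] at h2
  nlinarith [norm_pos_of_re_pos h1]

theorem ne_zero_of_mem (hθ : θ ≤ 1) (hz : z ∈ enlargedHalfDisc θ x) : z ≠ 0 := by
  obtain ⟨ε, h1, h2, h3⟩ := hz
  rintro rfl
  rw [zero_sub, norm_neg] at h3
  nlinarith [norm_pos_of_re_pos h1]

/-- A point at distance less than `|ε|/4` from a point `ε` of the half plane has argument at most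
`3π/4` in absolute value. -/
theorem abs_arg_le_of_mem (hθ : θ ≤ 1 / 4) (hz : z ∈ enlargedHalfDisc θ x) :
    |z.arg| ≤ 3 * Real.pi / 4 := by
  have hz0 : z ≠ 0 := ne_zero_of_mem (by linarith) hz
  obtain ⟨ε, h1, h2, h3⟩ := hz
  have hn := norm_pos_of_re_pos h1
  have hzn : 0 < ‖z‖ := norm_pos_iff.2 hz0
  have h4 : ‖ε‖ ≤ ‖z‖ + 1 / 4 * ‖ε‖ := by
    have := norm_sub_norm_le ε z
    rw [norm_sub_rev] at this
    nlinarith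
  have h5 : -(1 / 4 * ‖ε‖) ≤ z.re := by
    have h6 := (abs_le.1 (Complex.abs_re_le_norm (z - ε))).1
    rw [Complex.sub_re] at h6
    nlinarith
  by_contra! h
  have hcos := Real.cos_lt_cos_of_nonneg_of_le_pi (by positivity) (Complex.abs_arg_le_pi z) h
  rw [Real.cos_abs, Complex.cos_arg hz0, div_lt_iff₀ hzn,
    show 3 * Real.pi / 4 = Real.pi - Real.pi / 4 by ring, Real.cos_pi_sub, Real.cos_pi_div_four]
    at hcos
  have h7 : (1 : ℝ) ≤ √2 := Real.one_le_sqrt.2 (by norm_num)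
  nlinarith

theorem mem_slitPlane_of_mem (hθ : θ ≤ 1 / 4) (hz : z ∈ enlargedHalfDisc θ x) :
    z ∈ Complex.slitPlane := by
  rw [Complex.mem_slitPlane_iff_arg]
  refine ⟨fun h => ?_, ne_zero_of_mem (by linarith) hz⟩
  have := abs_arg_le_of_mem hθ hz
  rw [h, abs_of_pos Real.pi_pos] at this
  linarith [Real.pi_pos]

/-- If `r` has no zero in the closed half disc, then by compactness it is bounded away from zero on a
neighbourhood of it. -/
theorem exists_le_norm_rFactor (hM : 1 ≤ M) {x₀ : ℝ} (hx₀ : 1 < x₀)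
    (h : NoZeroHalfDisc (rFactor (M + 2) (logSqCoeff M) (logCoeff M) c) x₀) :
    ∃ θ ρ : ℝ, 0 < θ ∧ θ ≤ 1 / 4 ∧ θ ≤ x₀ - 1 ∧ 0 < ρ ∧ ∀ z ∈ enlargedHalfDisc θ x₀,
      ρ ≤ ‖rFactor (M + 2) (logSqCoeff M) (logCoeff M) c z‖ := by
  set r := rFactor (M + 2) (logSqCoeff M) (logCoeff M) c with hr
  set K : Set ℂ := {ε | 0 ≤ ε.re} ∩ Metric.closedBall 0 (1 / x₀) with hK
  have hKc : IsCompact K := (isCompact_closedBall _ _).inter_left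
    (isClosed_le continuous_const Complex.continuous_re)
  have hKn : ∀ ε ∈ K, r ε ≠ 0 := fun ε hε => h ε hε.1 (by simpa using hε.2)
  have hcont : ∀ ε ∈ K, ContinuousAt (fun z => ‖r z‖) ε := fun ε hε =>
    (continuousAt_rFactor hM hε.1).norm
  obtain ⟨ε₀, hε₀, hmin⟩ := hKc.exists_isMinOn ⟨0, le_refl (0 : ℂ).re, by simp; linarith⟩
    (fun ε hε => (hcont ε hε).continuousWithinAt)
  have hρ : 0 < ‖r ε₀‖ := norm_pos_iff.2 (hKn ε₀ hε₀)
  have hsub : K ⊆ interior {z | ‖r ε₀‖ / 2 < ‖r z‖} := fun ε hε => by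
    rw [mem_interior_iff_mem_nhds]
    exact (hcont ε hε).eventually_const_lt (by have : ‖r ε₀‖ ≤ ‖r ε‖ := hmin hε; linarith)
  obtain ⟨δ, hδ, hthick⟩ := hKc.exists_thickening_subset_open isOpen_interior hsub
  refine ⟨min (min (1 / 4) (x₀ - 1)) δ, ‖r ε₀‖ / 2,
    lt_min (lt_min (by norm_num) (by linarith)) hδ, (min_le_left _ _).trans (min_le_left _ _),
    (min_le_left _ _).trans (min_le_right _ _), by linarith, fun z hz => ?_⟩
  obtain ⟨ε, h1, h2, h3⟩ := hz
  have hmem : z ∈ Metric.thickening δ K := by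
    rw [Metric.mem_thickening_iff]
    refine ⟨ε, ⟨h1.le, by simpa using h2⟩, ?_⟩
    rw [dist_eq_norm]
    have h4 : ‖ε‖ ≤ 1 := h2.trans (by rw [div_le_one (by linarith)]; linarith)
    calc _ < _ := h3
      _ ≤ δ * 1 := mul_le_mul (min_le_right _ _) h4 (norm_nonneg _) hδ.le
      _ = δ := mul_one _
  have h5 : ‖r ε₀‖ / 2 < ‖r z‖ := interior_subset (s := {z | ‖r ε₀‖ / 2 < ‖r z‖}) (hthick hmem)
  exact h5.le

end

/-! ### Splitting the solution into a regular and a small singular part -/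

/-- `p x` is entire in `ε`, of size `xⁱ` and within `xⁱ (|ε| x)²` of `P x` for `|ε| ≤ 2/x`. -/
structure EntirePerturbation (i : ℕ) (A : ℝ) (p : ℝ → ℂ → ℂ) (P : ℝ → ℂ) : Prop where
  differentiable : ∀ x : ℝ, 1 < x → Differentiable ℂ (p x)
  le : ∀ x : ℝ, 1 < x → ∀ ε : ℂ, ‖ε‖ ≤ 2 / x → ‖p x ε‖ ≤ A * x ^ i
  sub_le : ∀ x : ℝ, 1 < x → ∀ ε : ℂ, ‖ε‖ ≤ 2 / x → ‖p x ε - P x‖ ≤ A * x ^ i * (‖ε‖ * x) ^ 2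

/-- What is left of a coefficient, given in the coordinate `w = ln ε`, after subtraction of `r` times
a polynomial and a multiple of `ε^{m-1} ln ε`. -/
noncomputable def coefRemainder (M : ℕ) (c : ℝ) (F : ℂ → ℂ) (Q : Polynomial ℂ) (q : ℝ) (ε : ℂ) : ℂ :=
  F (Complex.log ε) - rFactor (M + 2) (logSqCoeff M) (logCoeff M) c ε *
    (Q.eval ε + q * (ε ^ (M + 1) * Complex.log ε))

section
variable {M i : ℕ} {c K A θ q : ℝ} {F : ℂ → ℂ} {Q : Polynomial ℂ} {Ψ dΨ : ℝ → ℝ} {p : ℝ → ℂ → ℂ}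
  {P : ℝ → ℂ}

theorem exp_le_of_norm_le (K : ℝ) {x : ℝ} (hx : 1 < x) {ε : ℂ} (hε : ‖ε‖ ≤ 2 / x) :
    Real.exp (2 * K ^ 2 * x ^ 2 * ‖ε‖ ^ 2) ≤ Real.exp (8 * K ^ 2) := by
  rw [le_div_iff₀ (by linarith)] at hε
  refine Real.exp_le_exp.2 ?_
  have h : (‖ε‖ * x) ^ 2 ≤ 2 ^ 2 := by
    have : 0 < x := by linarith
    gcongr
  nlinarith [sq_nonneg K]

theorem entirePerturbation_of_bounds (hK : 1 ≤ K) (hd : ∀ x : ℝ, 1 < x → Differentiable ℂ (p x))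
    (hle : ∀ x : ℝ, 1 < x → ∀ ε : ℂ, ‖p x ε‖ ≤ K * x ^ i * Real.exp (2 * K ^ 2 * x ^ 2 * ‖ε‖ ^ 2))
    (hsub : ∀ x : ℝ, 1 < x → ∀ ε : ℂ, ‖p x ε - P x‖ ≤ K * x ^ i * (2 * K ^ 2 * x ^ 2 * ‖ε‖ ^ 2) *
      Real.exp (2 * K ^ 2 * x ^ 2 * ‖ε‖ ^ 2)) :
    EntirePerturbation i (2 * K ^ 3 * Real.exp (8 * K ^ 2)) p P where
  differentiable := hd
  le x hx ε hε := by
    have hx0 : 0 < x := by linarith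
    have hK3 : K ≤ 2 * K ^ 3 := by nlinarith [sq_nonneg (K - 1)]
    calc _ ≤ _ := hle x hx ε
      _ ≤ 2 * K ^ 3 * x ^ i * Real.exp (8 * K ^ 2) := by
        gcongr ?_ * x ^ i * ?_
        exact exp_le_of_norm_le K hx hε
      _ = _ := by ring
  sub_le x hx ε hε := by
    have hx0 : 0 < x := by linarith
    calc _ ≤ _ := hsub x hx ε
      _ ≤ K * x ^ i * (2 * K ^ 2 * x ^ 2 * ‖ε‖ ^ 2) * Real.exp (8 * K ^ 2) :=
        mul_le_mul_of_nonneg_left (exp_le_of_norm_le K hx hε) (by positivity)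
      _ = _ := by ring

theorem entirePerturbation_pert (hK : ZeroEnergyBound M K) (hΨ : ZeroEnergySolution M i K Ψ dΨ) :
    EntirePerturbation i (2 * K ^ 3 * Real.exp (8 * K ^ 2)) (pert M Ψ) (fun x => Ψ x) :=
  entirePerturbation_of_bounds hK.one_le (fun _ hx => differentiable_pert hK hΨ hx.le)
    (fun _ hx => norm_pert_le hK hΨ hx.le) (fun _ hx => norm_pert_sub_le hK hΨ hx.le)

theorem entirePerturbation_mul_dpert (hK : ZeroEnergyBound M K)
    (hΨ : ZeroEnergySolution M i K Ψ dΨ) :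
    EntirePerturbation i (2 * K ^ 3 * Real.exp (8 * K ^ 2)) (fun x ε => x * dpert M Ψ dΨ x ε)
      (fun x => x * dΨ x) :=
  entirePerturbation_of_bounds hK.one_le
    (fun _ hx => (differentiable_dpert hK hΨ hx.le).const_mul _)
    (fun _ hx => norm_mul_dpert_le hK hΨ hx.le) (fun _ hx => norm_mul_dpert_sub_le hK hΨ hx.le)

/-- Near the half disc the remainder of a coefficient is `O(|ε|^{m-δ})`: there `ln ε` stays in the
strip on which the expansion holds. -/
theorem norm_coefRemainder_le {x₀ : ℝ} (hθ0 : 0 ≤ θ) (hθ : θ ≤ 1 / 4) (hθ1 : θ ≤ x₀ - 1)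
    (hF : SubO (strip (3 * Real.pi / 4)) (M + 2) (fun w => F w - rLog M c w *
      (Q.eval (Complex.exp w) + q * (w * Complex.exp ((M + 1 : ℕ) * w))))) {δ : ℝ} (hδ : 0 < δ) :
    ∃ C : ℝ, 0 ≤ C ∧ ∀ z ∈ enlargedHalfDisc θ x₀,
      ‖coefRemainder M c F Q q z‖ ≤ C * ‖z‖ ^ (((M + 2 : ℕ) : ℝ) - δ) := by
  obtain ⟨C, hC0, hC⟩ := hF.comp_log hδ
  refine ⟨C, hC0, fun z hz => ?_⟩
  have hz0 : z ≠ 0 := ne_zero_of_mem (by linarith) hz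
  have := hC z hz0 (norm_le_one_of_mem hθ0 hθ1 hz) (abs_arg_le_of_mem hθ hz)
  rwa [Complex.exp_nat_mul, Complex.exp_log hz0, mul_comm (Complex.log z), ← rFactor_eq_rLog M c hz0]
    at this

theorem differentiableOn_coefRemainder {x₀ : ℝ} (hθ : θ ≤ 1 / 4)
    (hF : ∀ w : ℂ, |w.im| < 13 * Real.pi / 12 → DifferentiableAt ℂ F w) :
    DifferentiableOn ℂ (coefRemainder M c F Q q) (enlargedHalfDisc θ x₀) := fun z hz => by
  have hs := mem_slitPlane_of_mem hθ hz
  have hl := Complex.differentiableAt_log hs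
  have h1 : DifferentiableAt ℂ F (Complex.log z) := hF _ (by
    rw [Complex.log_im]
    have := abs_arg_le_of_mem hθ hz
    linarith [Real.pi_pos])
  have h2 : DifferentiableAt ℂ (fun ε => F (Complex.log ε)) z := h1.comp z hl
  have h3 := differentiableAt_rFactor (m := M + 2) (c := c) (a₀ := logSqCoeff M)
    (a₁ := logCoeff M) hs
  have h4 : DifferentiableAt ℂ (fun ε => Q.eval ε) z := Q.differentiable z
  unfold coefRemainder
  exact (h2.sub (h3.mul (h4.add
    (((differentiableAt_id.pow _).mul hl).const_mul _)))).differentiableWithinAt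

/-- The bounds for `(α p₁ - γ p₂)/r - P₁ - B ε^{m-1} ln ε`, where `α` and `γ` are `r` times a
polynomial and a multiple of `ε^{m-1} ln ε`, up to `O(|ε|^{m-δ})`, and `B` collects the logarithmic
terms. -/
theorem epsDerivBounds_of_coef (hM : 1 ≤ M) {x₀ : ℝ} (hx₀ : 1 < x₀)
    (hr : NoZeroHalfDisc (rFactor (M + 2) (logSqCoeff M) (logCoeff M) c) x₀) {α γ : ℂ → ℂ}
    {Qα Qγ : Polynomial ℂ} {qα qγ : ℝ} (hQα : Qα.coeff 0 = 1) (hQγ : Qγ.coeff 0 = 0)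
    (hα : SubO (strip (3 * Real.pi / 4)) (M + 2) (fun w => α w - rLog M c w *
      (Qα.eval (Complex.exp w) + qα * (w * Complex.exp ((M + 1 : ℕ) * w)))))
    (hγ : SubO (strip (3 * Real.pi / 4)) (M + 2) (fun w => γ w - rLog M c w *
      (Qγ.eval (Complex.exp w) + qγ * (w * Complex.exp ((M + 1 : ℕ) * w)))))
    (hdα : ∀ w : ℂ, |w.im| < 13 * Real.pi / 12 → DifferentiableAt ℂ α w)
    (hdγ : ∀ w : ℂ, |w.im| < 13 * Real.pi / 12 → DifferentiableAt ℂ γ w)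
    {p₁ p₂ f : ℝ → ℂ → ℂ} {P₁ P₂ : ℝ → ℂ} (hA : 0 ≤ A) (hp₁ : EntirePerturbation 0 A p₁ P₁)
    (hp₂ : EntirePerturbation 1 A p₂ P₂)
    (hf : ∀ x : ℝ, x₀ ≤ x → ∀ ε : ℂ, 0 < ε.re →
      rFactor (M + 2) (logSqCoeff M) (logCoeff M) c ε ≠ 0 → f x ε =
        (α (Complex.log ε) * p₁ x ε - γ (Complex.log ε) * p₂ x ε) /
          rFactor (M + 2) (logSqCoeff M) (logCoeff M) c ε - P₁ x -
          (qα * P₁ x - qγ * P₂ x) * (ε ^ (M + 1) * Complex.log ε)) :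
    (∃ C : ℝ, ∀ x : ℝ, x₀ ≤ x → ∀ ε : ℂ, 0 < ε.re → ‖ε‖ ≤ 1 / x → ‖f x ε‖ ≤ C * ‖ε * (x : ℂ)‖) ∧
      EpsDerivBounds (M + 2) x₀ f := by
  obtain ⟨θ, ρ, hθ0, hθ, hθ1, hρ, hrρ⟩ := exists_le_norm_rFactor hM hx₀ hr
  set r := rFactor (M + 2) (logSqCoeff M) (logCoeff M) c with hrdef
  have hsub : ∀ x : ℝ, x₀ ≤ x → enlargedHalfDisc θ x ⊆ enlargedHalfDisc θ x₀ := fun x hx =>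
    enlargedHalfDisc_mono (by linarith) hx
  refine epsDerivBounds_of_split (by omega) hx₀ hθ0 (by linarith)
    (reg := fun x z => p₁ x z * Qα.eval z - P₁ x - p₂ x z * Qγ.eval z)
    (sing := fun x z => (p₁ x z - P₁ x) * (qα * (z ^ (M + 1) * Complex.log z)) -
      (p₂ x z - P₂ x) * (qγ * (z ^ (M + 1) * Complex.log z)) +
      (p₁ x z * coefRemainder M c α Qα qα z - p₂ x z * coefRemainder M c γ Qγ qγ z) / r z)
    (fun x hx ε hε hb => ?_) (fun x hx => ?_) ?_ (fun x hx z hz => ?_) fun δ hδ => ?_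
  · have hmem : ε ∈ enlargedHalfDisc θ x :=
      ⟨ε, hε, hb, by simpa using mul_pos hθ0 (norm_pos_of_re_pos hε)⟩
    filter_upwards [(isOpen_enlargedHalfDisc θ x).mem_nhds hmem,
      (isOpen_lt continuous_const Complex.continuous_re).mem_nhds hε] with z hz hzre
    have hz0 : r z ≠ 0 := norm_pos_iff.1 (hρ.trans_le (hrρ z (hsub x hx hz)))
    rw [hf x hx z hzre hz0, coefRemainder, coefRemainder, ← hrdef]
    field_simp
    ring
  · exact (((hp₁.differentiable x (by linarith)).mul Qα.differentiable).sub_const _).sub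
      ((hp₂.differentiable x (by linarith)).mul Qγ.differentiable)
  · have hbdd : ∀ Q : Polynomial ℂ, ∃ D : ℝ, 0 ≤ D ∧ ∀ z : ℂ, ‖z‖ ≤ 2 → ‖Q.eval z‖ ≤ D := fun Q => by
      obtain ⟨D, hD⟩ := (isCompact_closedBall (0 : ℂ) 2).exists_bound_of_continuousOn
        Q.continuous.continuousOn
      exact ⟨max D 0, le_max_right _ _, fun z hz => (hD z (by simpa using hz)).trans (le_max_left _ _)⟩
    obtain ⟨D₁, hD₁0, hD₁⟩ := hbdd Qα.divX
    obtain ⟨D₂, hD₂0, hD₂⟩ := hbdd Qγ.divX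
    refine ⟨A * (2 + D₁ + D₂), fun x hx z hz => ?_⟩
    have hx1 : 1 < x := by linarith
    have hzx : ‖z‖ * x ≤ 2 := by rwa [le_div_iff₀ (by linarith)] at hz
    have hz2 : ‖z‖ ≤ 2 := by nlinarith [norm_nonneg z]
    have e : p₁ x z * Qα.eval z - P₁ x - p₂ x z * Qγ.eval z = (p₁ x z - P₁ x) +
        z * (p₁ x z * Qα.divX.eval z) - z * (p₂ x z * Qγ.divX.eval z) := by
      rw [eval_eq_coeff_add Qα, eval_eq_coeff_add Qγ, hQα, hQγ]; ring
    have h1 : ‖p₁ x z - P₁ x‖ ≤ A * (2 * (‖z‖ * x)) := by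
      calc _ ≤ _ := hp₁.sub_le x hx1 z hz
        _ = A * ((‖z‖ * x) * (‖z‖ * x)) := by ring
        _ ≤ _ := by gcongr
    have h2 : ‖z * (p₁ x z * Qα.divX.eval z)‖ ≤ ‖z‖ * (A * x * D₁) := by
      rw [norm_mul, norm_mul]
      gcongr
      · calc _ ≤ _ := hp₁.le x hx1 z hz
          _ ≤ A * x := by rw [pow_zero]; gcongr
      · exact hD₁ z hz2
    have h3 : ‖z * (p₂ x z * Qγ.divX.eval z)‖ ≤ ‖z‖ * (A * x * D₂) := by
      rw [norm_mul, norm_mul]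
      gcongr
      · simpa using hp₂.le x hx1 z hz
      · exact hD₂ z hz2
    simp only [e]
    calc _ ≤ ‖p₁ x z - P₁ x‖ + ‖z * (p₁ x z * Qα.divX.eval z)‖ + ‖z * (p₂ x z * Qγ.divX.eval z)‖ :=
          (norm_sub_le _ _).trans (by gcongr; exact norm_add_le _ _)
      _ ≤ A * (2 * (‖z‖ * x)) + ‖z‖ * (A * x * D₁) + ‖z‖ * (A * x * D₂) := by gcongr
      _ = _ := by ring
  · have hs := mem_slitPlane_of_mem hθ hz
    have hl := Complex.differentiableAt_log hs
    have hL : DifferentiableAt ℂ (fun z : ℂ => z ^ (M + 1) * Complex.log z) z :=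
      (differentiableAt_id.pow _).mul hl
    have h1 := hp₁.differentiable x (by linarith) z
    have h2 := hp₂.differentiable x (by linarith) z
    have hn := (isOpen_enlargedHalfDisc θ x₀).mem_nhds (hsub x hx hz)
    have h3 := (differentiableOn_coefRemainder (M := M) (c := c) (Q := Qα) (q := qα) (x₀ := x₀) hθ
      hdα).differentiableAt hn
    have h4 := (differentiableOn_coefRemainder (M := M) (c := c) (Q := Qγ) (q := qγ) (x₀ := x₀) hθ
      hdγ).differentiableAt hn
    exact ((((h1.sub_const _).mul (hL.const_mul _)).sub ((h2.sub_const _).mul (hL.const_mul _))).add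
      (((h1.mul h3).sub (h2.mul h4)).div (differentiableAt_rFactor hs)
        (norm_pos_iff.1 (hρ.trans_le (hrρ z (hsub x hx hz)))))).differentiableWithinAt
  · obtain ⟨CL, hCL0, hCL⟩ := (subO_id_mul_exp (3 * Real.pi / 4) (M + 1)).comp_log hδ
    obtain ⟨C₁, hC₁0, hC₁⟩ := norm_coefRemainder_le hθ0.le hθ hθ1 hα hδ
    obtain ⟨C₂, hC₂0, hC₂⟩ := norm_coefRemainder_le hθ0.le hθ hθ1 hγ hδ
    refine ⟨2 * A * CL * (|qα| + |qγ|) + A * (C₁ + C₂) / ρ, fun x hx z hz => ?_⟩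
    have hx1 : 1 < x := by linarith
    have hzb := norm_le_two_div_of_mem (by linarith) hz
    have hzx : ‖z‖ * x ≤ 2 := by rwa [le_div_iff₀ (by linarith)] at hzb
    have hz0 : z ≠ 0 := ne_zero_of_mem (by linarith) hz
    have hzn : 0 < ‖z‖ := norm_pos_iff.2 hz0
    have hL : ‖z ^ (M + 1) * Complex.log z‖ ≤ CL * ‖z‖ ^ (((M + 1 : ℕ) : ℝ) - δ) := by
      have := hCL z hz0 (norm_le_one_of_mem hθ0.le hθ1 (hsub x hx hz)) (abs_arg_le_of_mem hθ hz)
      rwa [Complex.exp_nat_mul, Complex.exp_log hz0, mul_comm (Complex.log z)] at this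
    set T := ‖z‖ ^ (((M + 2 : ℕ) : ℝ) - δ) with hT
    have hT0 : 0 ≤ T := by positivity
    have hTL : ‖z‖ * ‖z‖ ^ (((M + 1 : ℕ) : ℝ) - δ) = T := by
      rw [hT, show ((M + 2 : ℕ) : ℝ) - δ = 1 + (((M + 1 : ℕ) : ℝ) - δ) by push_cast; ring,
        Real.rpow_add hzn, Real.rpow_one]
    -- two of the three surplus powers of `x` are left, the third one is paid for by `|z| x ≤ 2`
    have hlog : ∀ (i : ℕ) (p P : ℂ) (q : ℝ), i ≤ 1 → ‖p - P‖ ≤ A * x ^ i * (‖z‖ * x) ^ 2 →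
        ‖(p - P) * (q * (z ^ (M + 1) * Complex.log z))‖ ≤ 2 * A * CL * |q| * (T * x ^ 2) := by
      intro i p P q hi hpP
      have hxi : x ^ i * ‖z‖ ≤ 2 := by
        have : x ^ i ≤ x ^ 1 := pow_le_pow_right₀ hx1.le hi
        rw [pow_one] at this
        nlinarith
      rw [norm_mul, norm_mul, Complex.norm_real, Real.norm_eq_abs]
      calc _ ≤ A * x ^ i * (‖z‖ * x) ^ 2 * (|q| * (CL * ‖z‖ ^ (((M + 1 : ℕ) : ℝ) - δ))) := by gcongr
        _ = (x ^ i * ‖z‖) * (A * CL * |q| * (‖z‖ * ‖z‖ ^ (((M + 1 : ℕ) : ℝ) - δ)) * x ^ 2) := by ring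
        _ = (x ^ i * ‖z‖) * (A * CL * |q| * T * x ^ 2) := by rw [hTL]
        _ ≤ 2 * (A * CL * |q| * T * x ^ 2) := by gcongr
        _ = _ := by ring
    have hrem : ∀ (i : ℕ) (p t : ℂ) (C : ℝ), i ≤ 1 → 0 ≤ C → ‖p‖ ≤ A * x ^ i → ‖t‖ ≤ C * T →
        ‖p * t‖ ≤ A * C * (T * x ^ 2) := by
      intro i p t C hi hC hp ht
      rw [norm_mul]
      calc _ ≤ A * x ^ i * (C * T) := by gcongr
        _ ≤ A * x ^ 2 * (C * T) := by gcongr 2; exact pow_le_pow_right₀ hx1.le (by omega)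
        _ = _ := by ring
    have h1 := hlog 0 _ _ qα zero_le_one (hp₁.sub_le x hx1 z hzb)
    have h2 := hlog 1 _ _ qγ le_rfl (hp₂.sub_le x hx1 z hzb)
    have h3 := hrem 0 _ _ _ zero_le_one hC₁0 (hp₁.le x hx1 z hzb) (hC₁ z (hsub x hx hz))
    have h4 := hrem 1 _ _ _ le_rfl hC₂0 (hp₂.le x hx1 z hzb) (hC₂ z (hsub x hx hz))
    have h5 : ‖(p₁ x z * coefRemainder M c α Qα qα z - p₂ x z * coefRemainder M c γ Qγ qγ z) / r z‖ ≤
        (A * C₁ * (T * x ^ 2) + A * C₂ * (T * x ^ 2)) / ρ := by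
      rw [norm_div]
      gcongr
      · exact (norm_sub_le _ _).trans (add_le_add h3 h4)
      · exact hrρ z (hsub x hx hz)
    calc _ ≤ _ := (norm_add_le _ _).trans (add_le_add ((norm_sub_le _ _).trans (add_le_add h1 h2)) h5)
      _ = _ := by ring

end

/-! ### The expansion of the decaying solution -/

section
variable {M : ℕ} {K x x₀ : ℝ} {ε : ℂ}

/-- The decaying solution in the basis of the two entire solutions. -/
theorem jost_eq_coef (hM : 1 ≤ M) (hK : ZeroEnergyBound M K) (hε : 0 < ε.re) (hx : 1 < x) :
    jost M x (ε / rot) = coef M (Psi2 M) (dPsi2 M) (Complex.log ε) * pert M (Phi1 (M + 2)) x ε -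
        coef M (Phi1 (M + 2)) (dPhi1 M) (Complex.log ε) * pert M (Psi2 M) x ε ∧
      djost M x (ε / rot) =
        coef M (Psi2 M) (dPsi2 M) (Complex.log ε) * dpert M (Phi1 (M + 2)) (dPhi1 M) x ε -
          coef M (Phi1 (M + 2)) (dPhi1 M) (Complex.log ε) * dpert M (Psi2 M) (dPsi2 M) x ε := by
  have h0 : ε ≠ 0 := by rintro rfl; simp at hε
  have him : -(Real.pi / 2) < (Complex.log ε).im := by
    rw [Complex.log_im]
    exact (abs_lt.1 (Complex.abs_arg_lt_pi_div_two_iff.2 (Or.inl hε))).1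
  have hc : Complex.exp (Complex.log ε) / rot ∈ cone := by
    rw [Complex.exp_log h0]; exact div_rot_mem_cone hε
  have hW := wronskian_pert hM hK hx ε
  rw [coef_eq_coefPlus hM him, coef_eq_coefPlus hM him,
    coefPlus_eq hM hK (zeroEnergySolution_Psi2 hM hK) hc hx,
    coefPlus_eq hM hK (zeroEnergySolution_Phi1 hM hK) hc hx]
  simp only [Complex.exp_log h0, wronskian]
  constructor
  · linear_combination (-jost M x (ε / rot)) * hW
  · linear_combination (-djost M x (ε / rot)) * hW

/-- Uniqueness of the decaying solution, first for `x > x₀` and then at `x₀` by continuity. -/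
theorem IsDecayingSolution.eq_jost (hM : 1 ≤ M) (hx₀ : 1 < x₀) {V : ℝ → ℝ}
    (hV : ∀ x : ℝ, x₀ ≤ x → V x = 1 / x ^ (M + 2)) (hε : 0 < ε.re) {y : ℝ → ℂ}
    (hy : IsDecayingSolution V x₀ ε y) (hx : x₀ ≤ x) : y x = jost M x (ε / rot) := by
  obtain ⟨⟨y', hy'⟩, hlim⟩ := hy
  have hcone := div_rot_mem_cone hε
  have hs : Solves M x₀ ((rot * (ε / rot)) ^ 2) y y' := by
    rw [rot_mul_div]
    refine ⟨fun x hx => (hy' x hx.le).1.hasDerivAt (Ici_mem_nhds hx), fun x hx => ?_⟩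
    rw [← hV x hx.le]
    exact (hy' x hx.le).2.hasDerivAt (Ici_mem_nhds hx)
  have hgt : ∀ x : ℝ, x₀ < x → y x = jost M x (ε / rot) := fun x hx =>
    (hs.eq_jost hM hcone (by rwa [rot_mul_div]) hx₀.le (by rwa [rot_mul_div]) hx).1
  rcases hx.lt_or_eq with h | rfl
  · exact hgt x h
  · have h1 : Tendsto y (𝓝[>] x₀) (𝓝 (y x₀)) :=
      ((hy' x₀ self_mem_Ici).1.continuousWithinAt.mono Ioi_subset_Ici_self)
    have h2 : Tendsto (fun x => jost M x (ε / rot)) (𝓝[>] x₀) (𝓝 (jost M x₀ (ε / rot))) :=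
      (((solves_jost hM hcone).deriv x₀ (by linarith)).continuousAt.tendsto).mono_left
        nhdsWithin_le_nhds
    refine tendsto_nhds_unique (h1.congr' ?_) h2
    filter_upwards [self_mem_nhdsWithin] with x hx using hgt x hx

theorem isEquivalent_linear_combination (hM : 1 ≤ M) (q : ℝ) {κ : ℝ} (hκ : κ ≠ 0) :
    (fun x => q * Phi1 (M + 2) x + κ * Psi2 M x) ~[atTop] fun x : ℝ => κ * x := by
  refine isEquivalent_of_tendsto_one ?_
  have h1 := ((tendsto_Phi1_atTop hM).mul tendsto_inv_atTop_zero).const_mul (q / κ)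
  have h2 := h1.add (Psi2_isEquivalent hM)
  rw [one_mul, mul_zero, zero_add] at h2
  refine h2.congr' ?_
  filter_upwards [eventually_gt_atTop 0] with x hx
  simp only [Pi.div_apply]
  field_simp

end

theorem mainTheorem3 (m : ℕ) (hm : 3 ≤ m) :
    ∃ a₀ a₁ κ : ℝ, κ ≠ 0 ∧ ∀ x₀ : ℝ, 1 < x₀ →
      -- some linear correction makes `r` zero-free
      (∃ c : ℝ, NoZeroHalfDisc (rFactor m a₀ a₁ c) x₀) ∧
      -- the expansion holds with every such `r` (with `c = 0` if that one is zero-free)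
      ∀ c : ℝ, NoZeroHalfDisc (rFactor m a₀ a₁ c) x₀ →
        ∃ (b₁ b₂ : ℝ) (B₁ : ℝ → ℝ),
          (∀ x : ℝ, B₁ x = b₁ * Phi1 m x + b₂ * Phi2 m x) ∧
          B₁ ~[atTop] (fun x : ℝ => κ * x) ∧
          ∀ V : ℝ → ℝ, (∀ x : ℝ, x₀ ≤ x → V x = 1 / x ^ m) →
          ∀ y : ℝ → ℂ → ℂ,
            (∀ ε : ℂ, 0 < ε.re → IsDecayingSolution V x₀ ε (fun x => y x ε)) →
            ∃ f : ℝ → ℂ → ℂ,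
              -- by the choice of `c` this covers all `ε` with `|ε| ≤ 1 / x`, and it fixes `f`
              -- near every such `ε`
              (∀ x : ℝ, x₀ ≤ x → ∀ ε : ℂ, 0 < ε.re → rFactor m a₀ a₁ c ε ≠ 0 →
                y x ε = rFactor m a₀ a₁ c ε *
                  ((Phi1 m x : ℂ) + (B₁ x : ℂ) * ε ^ (m - 1) * Complex.log ε + f x ε)) ∧
              (∃ C : ℝ, ∀ x : ℝ, x₀ ≤ x → ∀ ε : ℂ, 0 < ε.re → ‖ε‖ ≤ 1 / x →
                ‖f x ε‖ ≤ C * ‖ε * (x : ℂ)‖) ∧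
              EpsDerivBounds m x₀ f ∧
              -- the expansion may be differentiated in `x`
              (∀ x : ℝ, x₀ ≤ x → ∀ ε : ℂ, 0 < ε.re → ‖ε‖ ≤ 1 / x →
                DifferentiableWithinAt ℝ (fun s : ℝ => f s ε) (Ici x₀) x) ∧
              EpsDerivBounds m x₀
                (fun x ε => (x : ℂ) * derivWithin (fun s : ℝ => f s ε) (Ici x₀) x) := by
  obtain ⟨M, rfl⟩ : ∃ M, m = M + 2 := ⟨m - 2, by omega⟩
  have hM : 1 ≤ M := by omega
  obtain ⟨K, hK⟩ := zeroEnergyBound_exists hM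
  have hK0 : 0 < K := by linarith [hK.one_le]
  have hlog : logCoeff M ≠ 0 :=
    mul_ne_zero (pow_ne_zero _ (by norm_num)) (stokes₁_ne_zero hM)
  refine ⟨logSqCoeff M, logCoeff M, 2 * logCoeff M, mul_ne_zero two_ne_zero hlog, fun x₀ hx₀ =>
    ⟨exists_noZeroHalfDisc hM hx₀, fun c hc => ?_⟩⟩
  have h₁ := zeroEnergySolution_Phi1 hM hK
  have h₂ := zeroEnergySolution_Psi2 hM hK
  obtain ⟨Qα, qα, hQα, hα⟩ := exists_quotient_coef_Psi2 hM c
  obtain ⟨Qγ, hQγ, hγ⟩ := exists_quotient_coef_Phi1 hM c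
  refine ⟨qα, 2 * logCoeff M / wronskianPhi M,
    fun x => qα * Phi1 (M + 2) x + 2 * logCoeff M * Psi2 M x, fun x => by simp only [Psi2]; ring,
    isEquivalent_linear_combination hM qα (mul_ne_zero two_ne_zero hlog), fun V hV y hy => ?_⟩
  set r := rFactor (M + 2) (logSqCoeff M) (logCoeff M) c with hr
  set α := coef M (Psi2 M) (dPsi2 M) with hαdef
  set γ := coef M (Phi1 (M + 2)) (dPhi1 M) with hγdef
  set f : ℝ → ℂ → ℂ := fun x ε => y x ε / r ε - Phi1 (M + 2) x -
    ((qα * Phi1 (M + 2) x + 2 * logCoeff M * Psi2 M x : ℝ) : ℂ) * ε ^ (M + 1) * Complex.log ε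
    with hf
  -- the expansion of `f` holds also where `r ε = 0`, the quotient by zero being `0` on both sides
  have hfeq : ∀ ε : ℂ, 0 < ε.re → ∀ x : ℝ, x₀ ≤ x → f x ε =
      (α (Complex.log ε) * pert M (Phi1 (M + 2)) x ε - γ (Complex.log ε) * pert M (Psi2 M) x ε) /
        r ε - Phi1 (M + 2) x - (qα * Phi1 (M + 2) x - (-(2 * logCoeff M) : ℝ) * Psi2 M x) *
          (ε ^ (M + 1) * Complex.log ε) := by
    intro ε hε x hx
    rw [hf]
    simp only
    rw [(hy ε hε).eq_jost hM hx₀ hV hε hx, (jost_eq_coef hM hK hε (hx₀.trans_le hx)).1]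
    push_cast
    ring
  have hfderiv : ∀ ε : ℂ, 0 < ε.re → ∀ x : ℝ, x₀ ≤ x → HasDerivWithinAt (fun s => f s ε)
      ((α (Complex.log ε) * dpert M (Phi1 (M + 2)) (dPhi1 M) x ε -
          γ (Complex.log ε) * dpert M (Psi2 M) (dPsi2 M) x ε) / r ε - dPhi1 M x -
        (qα * dPhi1 M x - (-(2 * logCoeff M) : ℝ) * dPsi2 M x) *
          (ε ^ (M + 1) * Complex.log ε)) (Ici x₀) x := by
    intro ε hε x hx
    have hx1 := hx₀.trans_le hx
    have hx0 : 0 < x := by linarith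
    have d1 := (hasDerivAt_pert hM hK h₁ hx1 ε).const_mul (α (Complex.log ε))
    have d2 := (hasDerivAt_pert hM hK h₂ hx1 ε).const_mul (γ (Complex.log ε))
    have d3 := (hasDerivAt_Phi1 hM hx0).ofReal_comp
    have d4 := (hasDerivAt_Psi2 hM hx0).ofReal_comp
    have d := (((d1.sub d2).div_const (r ε)).sub d3).sub
      (((d3.const_mul (qα : ℂ)).sub (d4.const_mul ((-(2 * logCoeff M) : ℝ) : ℂ))).mul_const
        (ε ^ (M + 1) * Complex.log ε))
    exact d.hasDerivWithinAt.congr (fun s hs => hfeq ε hε s hs) (hfeq ε hε x hx)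
  have hdα := fun w => differentiableAt_coef (w := w) hM hK h₂
  have hdγ := fun w => differentiableAt_coef (w := w) hM hK h₁
  have hA : 0 ≤ 2 * K ^ 3 * Real.exp (8 * K ^ 2) := by positivity
  have hb := epsDerivBounds_of_coef hM hx₀ hc hQα hQγ hα hγ hdα hdγ hA
    (entirePerturbation_pert hK h₁) (entirePerturbation_pert hK h₂) (f := f)
    fun x hx ε hε _ => hfeq ε hε x hx
  refine ⟨f, fun x _ ε _ hrε => ?_, hb.1, hb.2, fun x hx ε hε _ =>
    (hfderiv ε hε x hx).differentiableWithinAt, ?_⟩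
  · rw [hf, Nat.add_sub_assoc one_le_two]
    field_simp
    ring
  · refine (epsDerivBounds_of_coef hM hx₀ hc hQα hQγ hα hγ hdα hdγ hA
      (entirePerturbation_mul_dpert hK h₁) (entirePerturbation_mul_dpert hK h₂)
      fun x hx ε hε _ => ?_).2
    rw [(hfderiv ε hε x hx).derivWithin (uniqueDiffOn_Ici x₀ x hx)]
    ring
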